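/- All digraphs are finite, without loops and without parallel arcs. An \emph{out-tree} of a digraph $D$ is a subdigraph $T$ that is an oriented tree with exactly one vertex $r$ of in-degree zero, its root; its \emph{leaves} are its vertices of out-degree zero; it is an \emph{out-branching} of $D$ if $V(T)=V(D)$. An instance is a triple $(D,r,k)$ with $r\in V(D)$ and parameter $k\in\mathbb N$. \textsc{Rooted $k$-Leaf Out-Branching} (respectively \textsc{Rooted $k$-Leaf Out-Tree}) asks whether $D$ has an out-branching (respectively an out-tree, not necessarily spanning) with root $r$ and at least $k$ leaves. An arc (a vertex set) \emph{disconnects} a vertex $w$ from $r$ if every path from $r$ to $w$ contains it (contains one of its vertices). Consider the following reduction rules; $k$ never changes. 1. (Reachability) If some vertex is not reachable from $r$, answer \textsc{No}. (For out-trees: delete such a vertex instead.) The other rules are applied only when all vertices are reachable from $r$. 2. (Useless arc) If the vertex $u$ disconnects $v$ from $r$ and $vu$ is an arc, delete $vu$. 3. (Bridge) If an arc $uv$ disconnects at least two vertices from $r$, contract $uv$ (if $u=r$, the new vertex is the root). 4. (Avoidable arc) If a vertex set $S$ with $|S|\le 2$ and $v\notin S$ disconnects $v$ from $r$, and $vw$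 as well as $xw$ for all $x\in S$ are arcs, delete $vw$. 5. (Two directional path) Suppose that there is a path $P=p_1p_2\cdots p_l$ with $l\in\{7,8\}$ and $r\notin V(P)$, and there are $p_{in}\in\{p_{l-1},p_l\}$ and $p_{out}\in\{p_1,p_2\}$, such that $p_1$ and $p_{in}$ are exactly the vertices of $P$ with in-arcs from outside $P$; $p_l$ and $p_{out}$ are exactly the vertices of $P$ with out-arcs to outside $P$; $P$ is the unique out-branching of $D[V(P)]$ with root $p_1$; there is a path $Q$ from $p_{in}$ to $p_{out}$ that is the unique out-branching of $D[V(P)]$ with root $p_{in}$; and the vertex after $p_{out}$ on $P$ is not the vertex after $p_l$ on $Q$. Then delete all vertices of $P$ other than $p_1,p_{in},p_{out},p_l$, and add two new vertices $u,v$ and the arcs $p_{out}u,\ uv,\ vp_{in},\ p_lv,\ vu,\ up_1$. An instance is \emph{reduced} if no rule applies to it. \textbf{Theorem.} For each of the two problems there is a polynomial-time algorithm that maps every instance $(D,r,k)$ to an instance $(D',r',k')$ of the same problem such that $(D,r,k)$ is a yes-instance if and only if $(D',r',k')$ is, $k'\le k$, and $|V(D')|\le\max(2,1540k^3)$; in particular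 $|V(D')|\le 1540k^3=O(k^3)$ for $k\ge1$. Moreover, the algorithm can be taken as follows: apply Rules 1--5 exhaustively; for out-branchings, answer \textsc{No} if Rule 1 applies; if the resulting reduced instance has more than $1540k^3$ vertices, answer \textsc{Yes}; otherwise output that reduced instance. Here \textsc{Yes} is output as the instance with one vertex and parameter $0$, and \textsc{No} as the instance with two vertices, no arc and parameter $0$. -/

import Mathlib

/-! ## Digraphs, out-trees, out-branchings -/

namespace Digraph

variable {V : Type}

/-- `p` lists the vertices of a (simple) directed path of `D` from `a` to `b`. -/
def IsPath (D : Digraph V) (p : List V) (a b : V) : Prop :=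
  p.IsChain D.Adj ∧ p.Nodup ∧ p.head? = some a ∧ p.getLast? = some b

/-- The subdigraph of `D` induced on a set of vertices. -/
def inducedOn (D : Digraph V) (s : Set V) : Digraph s where
  Adj a b := D.Adj a b

/-- The digraph on `s` whose arcs are the pairs of consecutive entries of the list `p`. -/
def pathOn (s : Set V) (p : List V) : Digraph s where
  Adj a b := [(a : V), (b : V)] <:+: p

/-- `T` is an out-tree with root `r` and with vertex set the whole type: an oriented tree in which
`r` is the only vertex of in-degree zero. -/
structure IsOutTree (T : Digraph V) (r : V) : Prop where
  oriented : ∀ a b, T.Adj a b → ¬ T.Adj b a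
  isTree : T.toSimpleGraphInclusive.IsTree
  inDegree_zero_iff : ∀ b, (∀ a, ¬ T.Adj a b) ↔ b = r

/-- The leaves: the vertices of out-degree zero. -/
def leaves (T : Digraph V) : Set V := {a | ∀ b, ¬ T.Adj a b}

/-- `T` is an out-branching of `D` with root `r` (a spanning out-tree). -/
def IsOutBranching (D : Digraph V) (r : V) (T : Digraph V) : Prop :=
  T ≤ D ∧ T.IsOutTree r

/-- Every path from the root `r` to `w` contains a vertex of `S`. -/
def SetDisconnects (D : Digraph V) (r : V) (S : Set V) (w : V) : Prop :=
  ∀ p, D.IsPath p r w → ∃ x ∈ S, x ∈ p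

/-- Every path from the root `r` to `w` contains the arc `uv`. -/
def ArcDisconnects (D : Digraph V) (r u v w : V) : Prop :=
  ∀ p, D.IsPath p r w → [u, v] <:+: p

/-- There is a path from `r` to `w`. -/
def Reaches (D : Digraph V) (r w : V) : Prop := ∃ p, D.IsPath p r w

/-- Removal of the arc `ab`. -/
def deleteArc (D : Digraph V) (a b : V) : Digraph V where
  Adj x y := D.Adj x y ∧ ¬ (x = a ∧ y = b)

/-- Contraction of the arc `uv`; the vertex that replaces `u` and `v` keeps the name `u`. -/
def contract (D : Digraph V) (u v : V) : Digraph {x : V // x ≠ v} where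
  Adj a b := a ≠ b ∧
    (D.Adj a b ∨ ((a : V) = u ∧ D.Adj v b) ∨ ((b : V) = u ∧ D.Adj a v))

/-- The situation of the two directional path rule: `P` runs from `p₁` to `pl`, `Q` runs from `pin`
to `pout` on the same vertices. -/
structure TwoDirectionalPath (D : Digraph V) (r : V) (P Q : List V) (p₁ pin pout pl : V) :
    Prop where
  path : D.IsPath P p₁ pl
  length : P.length = 7 ∨ P.length = 8
  /-- `pin` is one of the last two vertices of `P`. -/
  pin_mem : pin = pl ∨ [pin, pl] <:+ P
  /-- `pout` is one of the first two vertices of `P`. -/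
  pout_mem : pout = p₁ ∨ [p₁, pout] <+: P
  root_notMem : r ∉ P
  in_arcs : ∀ b ∈ P, (∃ a, a ∉ P ∧ D.Adj a b) ↔ (b = p₁ ∨ b = pin)
  out_arcs : ∀ a ∈ P, (∃ b, b ∉ P ∧ D.Adj a b) ↔ (a = pl ∨ a = pout)
  /-- `P` is the unique out-branching with root `p₁` of the subdigraph induced on `P`. -/
  unique_P : ∀ T : Digraph {x | x ∈ P},
    (∃ h : p₁ ∈ P, (D.inducedOn {x | x ∈ P}).IsOutBranching ⟨p₁, h⟩ T) ↔ T = pathOn {x | x ∈ P} P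
  path_Q : D.IsPath Q pin pout
  /-- `Q` is the unique out-branching with root `pin` of the subdigraph induced on `P`. -/
  unique_Q : ∀ T : Digraph {x | x ∈ P},
    (∃ h : pin ∈ P, (D.inducedOn {x | x ∈ P}).IsOutBranching ⟨pin, h⟩ T) ↔
      T = pathOn {x | x ∈ P} Q
  /-- The vertex after `pout` on `P` is not the vertex after `pl` on `Q`. -/
  next_ne : ∀ x, [pout, x] <:+: P → ¬ [pl, x] <:+: Q

/-- The vertices that the two directional path rule keeps. -/
def Kept (P : List V) (p₁ pin pout pl x : V) : Prop :=
  x ∈ P → x = p₁ ∨ x = pin ∨ x = pout ∨ x = pl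

/-- The digraph that the two directional path rule produces; the new vertices `u` and `v` are
`Sum.inr false` and `Sum.inr true`. -/
def replacePath (D : Digraph V) (P : List V) (p₁ pin pout pl : V) :
    Digraph ({x : V // Kept P p₁ pin pout pl x} ⊕ Bool) where
  Adj
    | .inl a, .inl b => D.Adj a b
    | .inl a, .inr false => (a : V) = pout
    | .inl a, .inr true => (a : V) = pl
    | .inr false, .inl b => (b : V) = p₁
    | .inr true, .inl b => (b : V) = pin
    | .inr i, .inr j => i ≠ j

end Digraph

/-! ## The two parameterized problems -/

namespace LeafKernel

/-- An instance: a finite digraph without loops, a root, and the parameter. -/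
structure Instance where
  n : ℕ
  D : Digraph (Fin n)
  loopless : ∀ a, ¬ D.Adj a a
  root : Fin n
  k : ℕ

/-- Is there an out-branching with the given root and at least `k` leaves? -/
def RootedLeafOutBranching (I : Instance) : Prop :=
  ∃ T : Digraph (Fin I.n), I.D.IsOutBranching I.root T ∧ I.k ≤ T.leaves.ncard

/-- Is there an out-tree (not necessarily spanning) with the given root and at least `k` leaves? -/
def RootedLeafOutTree (I : Instance) : Prop :=
  ∃ (s : Set (Fin I.n)) (h : I.root ∈ s) (T : Digraph s),
    T ≤ I.D.inducedOn s ∧ T.IsOutTree ⟨I.root, h⟩ ∧ I.k ≤ T.leaves.ncard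

/-! ## The reduction rules -/

/-- `J` is `(D, r, k)` up to the names of the vertices. -/
def Instance.IsCopyOf {V : Type} (J : Instance) (D : Digraph V) (r : V) (k : ℕ) : Prop :=
  J.k = k ∧ ∃ e : V ≃ Fin J.n, (∀ a b, D.Adj a b ↔ J.D.Adj (e a) (e b)) ∧ e r = J.root

/-- Every vertex is reachable from the root: the reachability rule does not apply. -/
def AllReachable (I : Instance) : Prop := ∀ u, I.D.Reaches I.root u

/-- Reachability rule for out-trees: delete a vertex that is disconnected from the root. -/
def UnreachableVertexRule (I J : Instance) : Prop :=
  ∃ (u : Fin I.n) (h : I.root ≠ u), ¬ I.D.Reaches I.root u ∧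
    J.IsCopyOf (I.D.inducedOn {x | x ≠ u}) ⟨I.root, h⟩ I.k

def UselessArcRule (I J : Instance) : Prop :=
  ∃ u v, I.D.SetDisconnects I.root {u} v ∧ I.D.Adj v u ∧
    J.IsCopyOf (I.D.deleteArc v u) I.root I.k

def BridgeRule (I J : Instance) : Prop :=
  ∃ (u v w₁ w₂ : Fin I.n) (h : I.root ≠ v), I.D.Adj u v ∧ w₁ ≠ w₂ ∧
    I.D.ArcDisconnects I.root u v w₁ ∧ I.D.ArcDisconnects I.root u v w₂ ∧
    J.IsCopyOf (I.D.contract u v) ⟨I.root, h⟩ I.k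

def AvoidableArcRule (I J : Instance) : Prop :=
  ∃ (S : Finset (Fin I.n)) (v w : Fin I.n), S.card ≤ 2 ∧ v ∉ S ∧
    I.D.SetDisconnects I.root S v ∧ I.D.Adj v w ∧ (∀ x ∈ S, I.D.Adj x w) ∧
    J.IsCopyOf (I.D.deleteArc v w) I.root I.k

def TwoDirectionalPathRule (I J : Instance) : Prop :=
  ∃ (P Q : List (Fin I.n)) (p₁ pin pout pl : Fin I.n)
    (h : I.D.TwoDirectionalPath I.root P Q p₁ pin pout pl),
    J.IsCopyOf (I.D.replacePath P p₁ pin pout pl)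
      (.inl ⟨I.root, fun hP => absurd hP h.root_notMem⟩) I.k

/-- One application of a rule other than the reachability rule. -/
def RuleStep (I J : Instance) : Prop :=
  UselessArcRule I J ∨ BridgeRule I J ∨ AvoidableArcRule I J ∨ TwoDirectionalPathRule I J

/-- One step on an instance of the out-branching problem to which the reachability rule does not
apply. -/
def BranchingStep (I J : Instance) : Prop := AllReachable I ∧ RuleStep I J

/-- One step on an instance of the out-tree problem; the reachability rule comes first. -/
def TreeStep (I J : Instance) : Prop :=
  UnreachableVertexRule I J ∨ (AllReachable I ∧ RuleStep I J)

/-- No rule can be applied. -/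
def IsReduced (I : Instance) : Prop := AllReachable I ∧ ∀ J, ¬ RuleStep I J

/-- The answer "yes", as an instance: one vertex, parameter 0. -/
def yesInstance : Instance where
  n := 1
  D := ⊥
  loopless := fun _ h => h
  root := 0
  k := 0

/-- The answer "no" (for out-branchings), as an instance: two vertices, no arc, parameter 0. -/
def noInstance : Instance where
  n := 2
  D := ⊥
  loopless := fun _ h => h
  root := 0
  k := 0

/-- `J` is an outcome of the kernelization procedure for out-branchings on input `I`. -/
inductive BranchingRun (I : Instance) : Instance → Prop
  | unreachable (J : Instance) : Relation.ReflTransGen BranchingStep I J → ¬ AllReachable J →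
      BranchingRun I noInstance
  | large (J : Instance) : Relation.ReflTransGen BranchingStep I J → IsReduced J →
      1540 * I.k ^ 3 < J.n → BranchingRun I yesInstance
  | small (J : Instance) : Relation.ReflTransGen BranchingStep I J → IsReduced J →
      J.n ≤ 1540 * I.k ^ 3 → BranchingRun I J

/-- `J` is an outcome of the kernelization procedure for out-trees on input `I`. -/
inductive TreeRun (I : Instance) : Instance → Prop
  | large (J : Instance) : Relation.ReflTransGen TreeStep I J → IsReduced J →
      1540 * I.k ^ 3 < J.n → TreeRun I yesInstance
  | small (J : Instance) : Relation.ReflTransGen TreeStep I J → IsReduced J →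
      J.n ≤ 1540 * I.k ^ 3 → TreeRun I J

/-! ## Polynomial time

The machine model is the random access machine with structured programs: registers and an
unbounded memory holding natural numbers, indirect addressing, addition and truncated subtraction
(no multiplication), unit cost. -/

/-- A configuration of the machine. -/
structure State where
  reg : ℕ → ℕ
  mem : ℕ → ℕ

/-- Expressions: constants, registers, memory contents at a computed address, sums, differences. -/
inductive Expr
  | lit (c : ℕ)
  | reg (i : ℕ)
  | load (a : Expr)
  | plus (a b : Expr)
  | minus (a b : Expr)

def Expr.val (s : State) : Expr → ℕ
  | .lit c => c
  | .reg i => s.reg i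
  | .load a => s.mem (a.val s)
  | .plus a b => a.val s + b.val s
  | .minus a b => a.val s - b.val s

/-- Programs; a condition holds if the value of the expression is not zero. -/
inductive Prog
  | assign (i : ℕ) (e : Expr)
  | store (a e : Expr)
  | seq (c d : Prog)
  | ite (e : Expr) (c d : Prog)
  | loop (e : Expr) (c : Prog)

/-- `Exec c s s' t`: started in `s`, the program `c` halts in `s'` after `t` steps. -/
inductive Exec : Prog → State → State → ℕ → Prop
  | assign (i : ℕ) (e : Expr) (s : State) :
      Exec (.assign i e) s ⟨Function.update s.reg i (e.val s), s.mem⟩ 1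
  | store (a e : Expr) (s : State) :
      Exec (.store a e) s ⟨s.reg, Function.update s.mem (a.val s) (e.val s)⟩ 1
  | seq (c d : Prog) (s s' s'' : State) (t t' : ℕ) :
      Exec c s s' t → Exec d s' s'' t' → Exec (.seq c d) s s'' (t + t')
  | ite_true (e : Expr) (c d : Prog) (s s' : State) (t : ℕ) :
      e.val s ≠ 0 → Exec c s s' t → Exec (.ite e c d) s s' (t + 1)
  | ite_false (e : Expr) (c d : Prog) (s s' : State) (t : ℕ) :
      e.val s = 0 → Exec d s s' t → Exec (.ite e c d) s s' (t + 1)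
  | loop_true (e : Expr) (c : Prog) (s s' s'' : State) (t t' : ℕ) :
      e.val s ≠ 0 → Exec c s s' t → Exec (.loop e c) s' s'' t' →
      Exec (.loop e c) s s'' (t + t' + 1)
  | loop_false (e : Expr) (c : Prog) (s : State) :
      e.val s = 0 → Exec (.loop e c) s s 1

/-- The initial configuration: the input in the memory, its length in register `0`. -/
def initial (l : List ℕ) : State where
  reg i := if i = 0 then l.length else 0
  mem i := l.getD i 0

/-- The output of a configuration is `l`: its entries in the memory, its length in register `0`. -/
def State.Outputs (s : State) (l : List ℕ) : Prop :=
  s.reg 0 = l.length ∧ ∀ i < l.length, s.mem i = l.getD i 0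

/-- The number of bits of an input (one extra bit per entry as a separator). -/
def bitSize (l : List ℕ) : ℕ := (l.map fun a => a.size + 1).sum

open Classical in
/-- An instance as a list of numbers: number of vertices, root, parameter, adjacency matrix. -/
noncomputable def Instance.encode (I : Instance) : List ℕ :=
  [I.n, (I.root : ℕ), I.k] ++
    (List.finRange I.n).flatMap fun a => (List.finRange I.n).map fun b => if I.D.Adj a b then 1 else 0

/-- `f` is computed by a program in time polynomial in the number of bits of its input. -/
def PolyTime (f : Instance → Instance) : Prop :=
  ∃ (c : Prog) (p : Polynomial ℕ), ∀ I : Instance, ∃ (s : State) (t : ℕ),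
    Exec c (initial I.encode) s t ∧ t ≤ p.eval (bitSize I.encode) ∧ s.Outputs (f I).encode

/-- `f` is a kernelization of the problem `L` in which the number of vertices of the kernel is at
most `size k`, and in which the parameter does not grow. -/
structure IsKernelization (L : Instance → Prop) (size : ℕ → ℕ) (f : Instance → Instance) :
    Prop where
  polyTime : PolyTime f
  equivalent : ∀ I, L I ↔ L (f I)
  card_le : ∀ I, (f I).n ≤ size I.k
  param_le : ∀ I, (f I).k ≤ I.k

end LeafKernel

namespace LeafKernel

open Relation

/-! ### Walks, separation and domination as reachability -/

section Relations

variable {V : Type*}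

/-- `w` is reached from `r` by a walk of `n` arcs. -/
def WalkN (B : V → V → Prop) (r : V) : ℕ → V → Prop
  | 0, w => w = r
  | n + 1, w => ∃ x, WalkN B r n x ∧ B x w

theorem reflTransGen_iff_walkN {B : V → V → Prop} {r w : V} :
    ReflTransGen B r w ↔ ∃ n, WalkN B r n w := by
  constructor
  · intro h
    induction h with
    | refl => exact ⟨0, rfl⟩
    | tail _ h ih => obtain ⟨n, hn⟩ := ih; exact ⟨n + 1, _, hn, h⟩
  · rintro ⟨n, hn⟩
    induction n generalizing w with
    | zero => cases hn; exact .refl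
    | succ n ih => obtain ⟨x, hx, hB⟩ := hn; exact (ih hx).tail hB

/-- A breadth-first search tree. -/
theorem exists_bfs_parent (B : V → V → Prop) (r : V) :
    ∃ (g : V → V) (d : V → ℕ), ∀ w, ReflTransGen B r w → w ≠ r →
      B (g w) w ∧ ReflTransGen B r (g w) ∧ d (g w) < d w := by
  classical
  let d : V → ℕ := fun w => sInf {n | WalkN B r n w}
  have key : ∀ w, ReflTransGen B r w → w ≠ r →
      ∃ x, B x w ∧ ReflTransGen B r x ∧ d x < d w := by
    intro w hw hr
    have hne : {n | WalkN B r n w}.Nonempty := reflTransGen_iff_walkN.1 hw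
    have hm : WalkN B r (d w) w := Nat.sInf_mem hne
    rcases h : d w with _ | n
    · rw [h] at hm; exact absurd hm hr
    · rw [h] at hm
      obtain ⟨x, hx, hB⟩ := hm
      exact ⟨x, hB, reflTransGen_iff_walkN.2 ⟨n, hx⟩, Nat.lt_succ_of_le (Nat.sInf_le hx)⟩
  choose! g hg using key
  exact ⟨g, d, fun w hw hr => hg w hw hr⟩

/-- The arcs of `A` whose tail is not in `L`. -/
def Arcs (A : V → V → Prop) (L : Set V) (a b : V) : Prop := A a b ∧ a ∉ L

/-- The arcs of `A` that avoid the set `S`. -/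
def Avoid (A : V → V → Prop) (S : Set V) (a b : V) : Prop := A a b ∧ a ∉ S ∧ b ∉ S

/-- Every vertex can be reached without passing through `L`. -/
def Spans (A : V → V → Prop) (r : V) (L : Set V) : Prop := ∀ w, ReflTransGen (Arcs A L) r w

/-- `z` dominates `w`: every walk from `r` to `w` meets `z`. -/
def Dom (A : V → V → Prop) (r z w : V) : Prop :=
  z = r ∨ ¬ ReflTransGen (Avoid A {z}) r w

/-- A walk in a smaller digraph to a vertex separated by `S` meets `S`. -/
theorem exists_mem_of_separates {A B : V → V → Prop} {S : Set V} {r v : V} (hBA : ∀ a b, B a b → A a b)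
    (hS : r ∈ S ∨ ¬ ReflTransGen (Avoid A S) r v) (hv : ReflTransGen B r v) :
    ∃ x ∈ S, ReflTransGen B r x ∧ ReflTransGen B x v := by
  by_contra hcon
  push Not at hcon
  have key : ∀ w, ReflTransGen B w v → ReflTransGen B r w → ReflTransGen (Avoid A S) w v := by
    intro w hw
    induction hw using ReflTransGen.head_induction_on with
    | refl => exact fun _ => .refl
    | head h h' ih =>
      intro hr
      refine .head ⟨hBA _ _ h, ?_, ?_⟩ (ih (hr.tail h))
      · exact fun hm => hcon _ hm hr (.head h h')
      · exact fun hm => hcon _ hm (hr.tail h) h'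
  rcases hS with h | h
  · exact hcon _ h .refl hv
  · exact h (key r hv .refl)

end Relations

/-! ### Path lists versus reachability -/

section Paths

variable {V : Type}

theorem IsPath.reflTransGen_of {B : V → V → Prop} : ∀ {p : List V} {a b : V},
    p.IsChain B → p.head? = some a → p.getLast? = some b → ReflTransGen B a b
  | [], _, _, _, h, _ => by simp at h
  | [x], a, b, _, h, h' => by
    simp at h h'; subst h; subst h'; exact .refl
  | x :: y :: l, a, b, hc, h, h' => by
    simp only [List.head?_cons, Option.some.injEq] at h
    subst h
    rw [List.isChain_cons_cons] at hc
    rw [List.getLast?_cons_cons] at h'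
    exact .head hc.1 (IsPath.reflTransGen_of hc.2 (by simp) h')

/-- A walk contains a path. -/
theorem exists_path_of_reflTransGen {B : V → V → Prop} {a b : V} (h : ReflTransGen B a b) :
    ∃ p : List V, p.IsChain B ∧ p.Nodup ∧ p.head? = some a ∧ p.getLast? = some b := by
  induction h using ReflTransGen.head_induction_on with
  | refl => exact ⟨[b], by simp⟩
  | @head a c h _ ih =>
    obtain ⟨p, hc, hn, hh, hl⟩ := ih
    by_cases ha : a ∈ p
    · obtain ⟨s, t, rfl⟩ := List.append_of_mem ha
      refine ⟨a :: t, ?_, ?_, by simp, ?_⟩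
      · exact (List.isChain_append.1 hc).2.1
      · exact (List.nodup_append.1 hn).2.1
      · simpa [List.getLast?_append] using hl
    · rcases p with _ | ⟨x, p⟩
      · simp at hh
      · simp only [List.head?_cons, Option.some.injEq] at hh
        subst hh
        exact ⟨a :: x :: p, List.isChain_cons_cons.2 ⟨h, hc⟩, List.nodup_cons.2 ⟨ha, hn⟩, by simp,
          by rw [List.getLast?_cons_cons]; exact hl⟩

theorem reaches_iff {D : Digraph V} {r w : V} : D.Reaches r w ↔ ReflTransGen D.Adj r w :=
  ⟨fun ⟨_, h⟩ => IsPath.reflTransGen_of h.1 h.2.2.1 h.2.2.2,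
    fun h => (exists_path_of_reflTransGen h).imp fun _ h => h⟩

/-- The case `r ∈ S` is separate because the trivial walk at `r` has no arc and so cannot violate
`Avoid`. -/
theorem setDisconnects_iff {D : Digraph V} {r w : V} {S : Set V} :
    D.SetDisconnects r S w ↔ r ∈ S ∨ ¬ ReflTransGen (Avoid D.Adj S) r w := by
  constructor
  · intro h
    by_contra hcon
    push Not at hcon
    obtain ⟨p, hc, hn, hh, hl⟩ := exists_path_of_reflTransGen hcon.2
    obtain ⟨x, hx, hxp⟩ := h p ⟨hc.imp fun _ _ h => h.1, hn, hh, hl⟩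
    obtain ⟨s, t, rfl⟩ := List.append_of_mem hxp
    rcases List.eq_nil_or_concat s with rfl | ⟨s, y, rfl⟩
    · simp at hh; subst hh; exact hcon.1 hx
    · rw [List.isChain_append] at hc
      exact (hc.2.2 y (by simp) x (by simp)).2.2 hx
  · intro h p hp
    by_contra hcon
    push Not at hcon
    have hr : r ∈ p := List.mem_of_mem_head? (by rw [hp.2.2.1]; simp)
    rcases h with h | h
    · exact hcon r h hr
    · apply h
      refine IsPath.reflTransGen_of (p := p) ?_ hp.2.2.1 hp.2.2.2
      have := hp.1
      rw [List.isChain_iff_getElem] at this ⊢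
      intro i hi
      exact ⟨this i hi, fun h => hcon _ h (List.getElem_mem _),
        fun h => hcon _ h (List.getElem_mem _)⟩

theorem infix_pair_iff {p : List V} {u v : V} :
    [u, v] <:+: p ↔ ∃ i, ∃ h : i + 1 < p.length, p[i] = u ∧ p[i + 1] = v := by
  constructor
  · rintro ⟨s, t, rfl⟩
    exact ⟨s.length, by simp, by simp, by simp⟩
  · rintro ⟨i, h, rfl, rfl⟩
    refine ⟨p.take i, p.drop (i + 2), ?_⟩
    have h1 : p.drop i = p[i] :: p[i+1] :: p.drop (i + 2) := by
      rw [List.drop_eq_getElem_cons (by omega), List.drop_eq_getElem_cons (by omega)]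
    calc _ = p.take i ++ p.drop i := by rw [h1]; simp
      _ = p := List.take_append_drop _ _

theorem arcDisconnects_iff {D : Digraph V} {r u v w : V} :
    D.ArcDisconnects r u v w ↔ ¬ ReflTransGen (fun a b => D.Adj a b ∧ ¬ (a = u ∧ b = v)) r w := by
  constructor
  · intro h hcon
    obtain ⟨p, hc, hn, hh, hl⟩ := exists_path_of_reflTransGen hcon
    obtain ⟨i, hi, h1, h2⟩ := infix_pair_iff.1 (h p ⟨hc.imp fun _ _ h => h.1, hn, hh, hl⟩)
    exact (List.isChain_iff_getElem.1 hc i hi).2 ⟨h1, h2⟩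
  · intro h p hp
    by_contra hcon
    apply h
    refine IsPath.reflTransGen_of (p := p) ?_ hp.2.2.1 hp.2.2.2
    have := hp.1
    rw [List.isChain_iff_getElem] at this ⊢
    intro i hi
    exact ⟨this i hi, fun hh => hcon (infix_pair_iff.2 ⟨i, hi, hh.1, hh.2⟩)⟩

end Paths

/-! ### Out-trees as digraphs with unique parents -/

section OutTrees

variable {V : Type}

/-- No arc enters a set that is closed under in-neighbours. This excludes directed cycles and,
later, competing branchings. -/
theorem not_reflTransGen_of_parents {T : V → V → Prop} {r : V} {C : Set V} (hr : r ∉ C)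
    (h : ∀ a b, T a b → b ∈ C → a ∈ C) {w : V} (hw : w ∈ C) : ¬ ReflTransGen T r w := by
  intro hrw
  induction hrw with
  | refl => exact hr hw
  | tail _ hab ih => exact ih (h _ _ hab hw)

/-- Sending each vertex other than the root to the edge from a chosen parent is injective by
orientedness. A tree has exactly as many edges as there are such vertices, so every arc is a chosen
one and parents are unique. Conversely, unique parents and reachability give connectedness and the
right number of edges. -/
theorem isOutTree_iff [Finite V] {T : Digraph V} {r : V} :
    T.IsOutTree r ↔ (∀ a, ¬ T.Adj a r) ∧ (∀ b, b ≠ r → ∃ a, T.Adj a b) ∧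
      (∀ a a' b, T.Adj a b → T.Adj a' b → a = a') ∧ ∀ b, ReflTransGen T.Adj r b := by
  classical
  have hcard : Nat.card {b : V // b ≠ r} + 1 = Nat.card V := by
    have := Fintype.ofFinite V
    rw [Nat.card_eq_fintype_card, Nat.card_eq_fintype_card, Fintype.card_subtype_compl]
    simp only [Fintype.card_unique]
    have : 0 < Fintype.card V := Fintype.card_pos_iff.2 ⟨r⟩
    omega
  constructor
  · intro h
    have h0 : ∀ a, ¬ T.Adj a r := (h.inDegree_zero_iff r).2 rfl
    have h1 : ∀ b, b ≠ r → ∃ a, T.Adj a b := by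
      intro b hb
      by_contra hcon
      push Not at hcon
      exact hb ((h.inDegree_zero_iff b).1 hcon)
    choose! p hp using h1
    have hne : ∀ b, b ≠ r → p b ≠ b := fun b hb he => by
      have := hp b hb
      rw [he] at this
      exact h.oriented _ _ this this
    let F : {b : V // b ≠ r} → T.toSimpleGraphInclusive.edgeSet := fun b =>
      ⟨s(p b, b), by
        rw [SimpleGraph.mem_edgeSet, Digraph.toSimpleGraphInclusive, SimpleGraph.fromRel_adj]
        exact ⟨hne b b.2, .inl (hp b b.2)⟩⟩
    have hinj : Function.Injective F := by
      rintro ⟨b, hb⟩ ⟨b', hb'⟩ he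
      simp only [F, Subtype.mk.injEq, Sym2.eq_iff] at he
      rcases he with he | he
      · exact Subtype.ext he.2
      · exact absurd (he.1 ▸ hp b hb) (h.oriented _ _ (by have := hp b' hb'; rwa [← he.2] at this))
    have hbij : Function.Bijective F := by
      rw [Nat.bijective_iff_injective_and_card]
      refine ⟨hinj, ?_⟩
      have := (SimpleGraph.isTree_iff_connected_and_card.1 h.isTree).2
      omega
    have h2 : ∀ a b, T.Adj a b → a = p b := by
      intro a b hab
      have hab' : a ≠ b := fun he => h.oriented _ _ hab (by subst he; exact hab)
      obtain ⟨⟨c, hc⟩, hce⟩ := hbij.2 ⟨s(a, b), by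
        rw [SimpleGraph.mem_edgeSet, Digraph.toSimpleGraphInclusive, SimpleGraph.fromRel_adj]
        exact ⟨hab', .inl hab⟩⟩
      simp only [F, Subtype.mk.injEq, Sym2.eq_iff] at hce
      rcases hce with he | he
      · rw [← he.1, he.2]
      · exact absurd hab (h.oriented _ _ (by have := hp c hc; rwa [he.1, he.2] at this))
    refine ⟨h0, fun b hb => ⟨_, hp b hb⟩, fun a a' b hab hab' => (h2 a b hab).trans (h2 a' b hab').symm,
      fun b => ?_⟩
    have hreach := h.isTree.connected.preconnected r b
    rw [SimpleGraph.reachable_iff_reflTransGen] at hreach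
    induction hreach with
    | refl => exact .refl
    | @tail x y _ hxy ih =>
      rw [Digraph.toSimpleGraphInclusive, SimpleGraph.fromRel_adj] at hxy
      rcases hxy.2 with hxy | hxy
      · exact ih.tail hxy
      -- An edge traversed against its direction leads to the unique parent, through which the
      -- directed walk has already come.
      · rcases ReflTransGen.cases_tail ih with rfl | ⟨z, hz, hzx⟩
        · exact absurd hxy (h0 _)
        · rw [h2 _ _ hxy, ← h2 _ _ hzx]; exact hz
  · rintro ⟨h0, h1, h2, h3⟩
    choose! p hp using h1
    have hor : ∀ a b, T.Adj a b → ¬ T.Adj b a := by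
      intro a b hab hba
      refine not_reflTransGen_of_parents (T := T.Adj) (r := r) (C := {a, b}) ?_ ?_ (w := a) (by simp) (h3 a)
      · rintro (rfl | rfl)
        · exact h0 _ hba
        · exact h0 _ hab
      · rintro x y hxy (rfl | rfl)
        · exact .inr (h2 _ _ _ hxy hba)
        · exact .inl (h2 _ _ _ hxy hab)
    have hne : ∀ a b, T.Adj a b → a ≠ b := fun a b hab he => hor a b hab (by subst he; exact hab)
    have hadj : ∀ a b, T.toSimpleGraphInclusive.Adj a b ↔ T.Adj a b ∨ T.Adj b a := by
      intro a b
      rw [Digraph.toSimpleGraphInclusive, SimpleGraph.fromRel_adj]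
      refine ⟨fun h => h.2, fun h => ⟨?_, h⟩⟩
      rcases h with h | h
      · exact hne _ _ h
      · exact (hne _ _ h).symm
    have hreach : ∀ b, T.toSimpleGraphInclusive.Reachable r b := by
      intro b
      rw [SimpleGraph.reachable_iff_reflTransGen]
      exact ReflTransGen.mono (fun a b h => (hadj a b).2 (.inl h)) _ _ (h3 b)
    refine ⟨hor, ?_, fun b => ⟨fun h => by_contra fun hb => h _ (hp b hb), fun h => h ▸ h0⟩⟩
    rw [SimpleGraph.isTree_iff_connected_and_card]
    have : Nonempty V := ⟨r⟩
    refine ⟨⟨fun a b => (hreach a).symm.trans (hreach b)⟩, ?_⟩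
    rw [← hcard]
    congr 1
    symm
    have hmem : ∀ b, b ≠ r → s(p b, b) ∈ T.toSimpleGraphInclusive.edgeSet := fun b hb =>
      (SimpleGraph.mem_edgeSet _).2 ((hadj _ _).2 (.inl (hp b hb)))
    let F : {b : V // b ≠ r} → T.toSimpleGraphInclusive.edgeSet := fun b => ⟨s(p b, b), hmem b b.2⟩
    refine Nat.card_eq_of_bijective F ⟨?_, ?_⟩
    · rintro ⟨b, hb⟩ ⟨b', hb'⟩ he
      simp only [F, Subtype.mk.injEq, Sym2.eq_iff] at he
      rcases he with he | he
      · exact Subtype.ext he.2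
      · exact absurd (he.1 ▸ hp b hb) (hor _ _ (by have := hp b' hb'; rwa [← he.2] at this))
    · rintro ⟨e, he⟩
      induction e with
      | _ a b =>
        have hb : ∀ a b, T.Adj a b → b ≠ r := fun a b h hr => h0 a (hr ▸ h)
        rcases (hadj a b).1 he with h | h
        · refine ⟨⟨b, hb _ _ h⟩, Subtype.ext ?_⟩
          simp only [F, h2 _ _ _ (hp b (hb _ _ h)) h]
        · refine ⟨⟨a, hb _ _ h⟩, Subtype.ext ?_⟩
          simp only [F, h2 _ _ _ (hp a (hb _ _ h)) h, Sym2.eq_swap]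

end OutTrees

end LeafKernel

namespace LeafKernel

open Relation

/-! ### Leaf sets in place of trees -/

section Characterization

theorem rtg_mono {V : Type*} {B B' : V → V → Prop} (h : ∀ a b, B a b → B' a b) {a b : V}
    (hab : ReflTransGen B a b) : ReflTransGen B' a b := ReflTransGen.mono h _ _ hab

theorem rtg_map {V W : Type*} {B : V → V → Prop} {B' : W → W → Prop} (f : V → W)
    (h : ∀ a b, B a b → B' (f a) (f b)) {a b : V} (hab : ReflTransGen B a b) :
    ReflTransGen B' (f a) (f b) := ReflTransGen.lift f h _ _ hab

/-- There is a set of `k` vertices without which every vertex can be reached. -/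
def BrYes {V : Type*} (A : V → V → Prop) (r : V) (k : ℕ) : Prop :=
  ∃ L : Set V, k ≤ L.ncard ∧ Spans A r L

/-- There is a set of `k` vertices all of which can be reached without passing through them. -/
def TrYes {V : Type*} (A : V → V → Prop) (r : V) (k : ℕ) : Prop :=
  ∃ L : Set V, k ≤ L.ncard ∧ ∀ w ∈ L, ReflTransGen (Arcs A L) r w

variable {V : Type}

theorem exists_isOutTree [Finite V] {B : V → V → Prop} {r : V} (h : ∀ w, ReflTransGen B r w) :
    ∃ T : Digraph V, (∀ a b, T.Adj a b → B a b) ∧ T.IsOutTree r := by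
  obtain ⟨g, d, hg⟩ := exists_bfs_parent B r
  refine ⟨⟨fun a b => b ≠ r ∧ g b = a⟩, ?_, isOutTree_iff.2 ⟨?_, ?_, ?_, ?_⟩⟩
  · rintro a b ⟨hb, rfl⟩; exact (hg b (h b) hb).1
  · rintro a ⟨h, _⟩; exact h rfl
  · exact fun b hb => ⟨g b, hb, rfl⟩
  · rintro a a' b ⟨_, rfl⟩ ⟨_, rfl⟩; rfl
  · intro b
    induction hn : d b using Nat.strong_induction_on generalizing b with
    | _ n ih =>
      by_cases hb : b = r
      · rw [hb]
      · exact (ih (d (g b)) (hn ▸ (hg b (h b) hb).2.2) _ rfl).tail ⟨hb, rfl⟩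

theorem reflTransGen_leaves {T : Digraph V} {r : V} {b : V} (h : ReflTransGen T.Adj r b)
    {A : V → V → Prop} (hA : ∀ a b, T.Adj a b → A a b) {L : Set V} (hL : L ⊆ T.leaves) :
    ReflTransGen (Arcs A L) r b :=
  rtg_mono (fun _ _ hab => ⟨hA _ _ hab, fun hm => hL hm _ hab⟩) h

/-- Walks in the tree never leave a leaf. Conversely, a tree built only from arcs with tails outside
`L` has all of `L` among its leaves. -/
theorem isOutBranching_iff_brYes [Finite V] {D : Digraph V} {r : V} {k : ℕ} :
    (∃ T, D.IsOutBranching r T ∧ k ≤ T.leaves.ncard) ↔ BrYes D.Adj r k := by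
  constructor
  · rintro ⟨T, ⟨hle, hT⟩, hk⟩
    exact ⟨T.leaves, hk, fun w =>
      reflTransGen_leaves ((isOutTree_iff.1 hT).2.2.2 w) (fun _ _ h => hle h) le_rfl⟩
  · rintro ⟨L, hk, hL⟩
    obtain ⟨T, hTB, hT⟩ := exists_isOutTree hL
    exact ⟨T, ⟨fun a b h => (hTB a b h).1, hT⟩,
      hk.trans (Set.ncard_le_ncard (fun a ha b hab => (hTB a b hab).2 ha))⟩

theorem isOutTree_iff_trYes [Finite V] {D : Digraph V} {r : V} {k : ℕ} :
    (∃ (s : Set V) (h : r ∈ s) (T : Digraph s),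
      T ≤ D.inducedOn s ∧ T.IsOutTree ⟨r, h⟩ ∧ k ≤ T.leaves.ncard) ↔ TrYes D.Adj r k := by
  constructor
  · rintro ⟨s, h, T, hle, hT, hk⟩
    refine ⟨(↑) '' T.leaves, by rwa [Set.ncard_image_of_injective _ Subtype.val_injective], ?_⟩
    rintro _ ⟨w, hw, rfl⟩
    refine rtg_map (fun x : s => (x : V)) ?_ ((isOutTree_iff.1 hT).2.2.2 w)
    rintro a b hab
    refine ⟨hle hab, ?_⟩
    rintro ⟨a', ha', he⟩
    exact ha' b (by rwa [Subtype.ext he])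
  · rintro ⟨L, hk, hL⟩
    let s : Set V := {w | ReflTransGen (Arcs D.Adj L) r w}
    have hr : r ∈ s := ReflTransGen.refl
    have hs : ∀ w (hw : w ∈ s), ReflTransGen (fun a b : s => Arcs D.Adj L a b) ⟨r, hr⟩ ⟨w, hw⟩ := by
      intro w hw
      have hw' : ReflTransGen (Arcs D.Adj L) r w := hw
      induction hw' with
      | refl => exact .refl
      | tail h1 h2 ih => exact (ih h1).tail h2
    obtain ⟨T, hTB, hT⟩ := exists_isOutTree (fun w : s => hs w.1 w.2)
    refine ⟨s, hr, T, fun a b h => (hTB a b h).1, hT, ?_⟩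
    have : L ⊆ (↑) '' T.leaves := fun w hw =>
      ⟨⟨w, hL w hw⟩, fun b hab => (hTB _ b hab).2 hw, rfl⟩
    exact (hk.trans (Set.ncard_le_ncard this)).trans
      (Set.ncard_image_of_injective _ Subtype.val_injective).le

theorem BrYes.trYes {A : V → V → Prop} {r : V} {k : ℕ} : BrYes A r k → TrYes A r k :=
  fun ⟨L, hk, hL⟩ => ⟨L, hk, fun w _ => hL w⟩

/-- An arc `ab` that leaves the reached part must have its tail in `L`. Exchanging the leaf `a` for
`b` keeps the number of leaves, keeps everything reached, and reaches `b` in addition. -/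
theorem TrYes.brYes [Finite V] {A : V → V → Prop} {r : V} {k : ℕ} (hA : ∀ w, ReflTransGen A r w)
    (h : TrYes A r k) : BrYes A r k := by
  classical
  obtain ⟨L, hk, hL⟩ := h
  induction hm : {w | ¬ ReflTransGen (Arcs A L) r w}.ncard using Nat.strong_induction_on
    generalizing L with
  | _ m ih =>
    by_cases hall : Spans A r L
    · exact ⟨L, hk, hall⟩
    · simp only [Spans, not_forall] at hall
      obtain ⟨w, hw⟩ := hall
      have : ∃ a b, ReflTransGen (Arcs A L) r a ∧ ¬ ReflTransGen (Arcs A L) r b ∧ A a b := by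
        by_contra hcon
        push Not at hcon
        refine hw ?_
        have := hA w
        induction this with
        | refl => exact .refl
        | tail _ hab ih' => exact by_contra fun hb => hcon _ _ (by_contra fun ha => hb (absurd (ih' ha) ha)) hb hab
      obtain ⟨a, b, ha, hb, hab⟩ := this
      have haL : a ∈ L := by_contra fun h => hb (ha.tail ⟨hab, h⟩)
      have hbL : b ∉ L := fun h => hb (hL b h)
      have key : ∀ x, ReflTransGen (Arcs A L) r x → ReflTransGen (Arcs A (insert b (L \ {a}))) r x := by
        intro x hx
        induction hx with
        | refl => exact .refl
        | tail h1 h2 ih' =>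
          refine ih'.tail ⟨h2.1, ?_⟩
          rintro (rfl | h)
          · exact hb h1
          · exact h2.2 h.1
      have hb' : ReflTransGen (Arcs A (insert b (L \ {a}))) r b :=
        (key a ha).tail ⟨hab, by rintro (rfl | h); exacts [hb ha, h.2 rfl]⟩
      -- The induction is on the number of unreached vertices, which drops because `b` is now
      -- reached.
      refine ih _ ?_ (insert b (L \ {a})) ?_ ?_ rfl
      · rw [← hm]
        refine Set.ncard_lt_ncard ⟨fun x hx hx' => hx (key x hx'), fun hsub => ?_⟩
        exact hsub (show b ∈ _ from hb) hb'
      · rw [Set.ncard_insert_of_notMem (fun h => hbL h.1), Set.ncard_sdiff_singleton_add_one haL]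
        exact hk
      · rintro x (rfl | h)
        · exact hb'
        · exact key x (hL x h.1)

theorem brYes_zero_iff {A : V → V → Prop} {r : V} : BrYes A r 0 ↔ ∀ w, ReflTransGen A r w := by
  constructor
  · rintro ⟨L, _, hL⟩ w
    exact rtg_mono (fun _ _ h => h.1) (hL w)
  · exact fun h => ⟨∅, Nat.zero_le _, fun w => rtg_mono (fun _ _ h => ⟨h, by simp⟩) (h w)⟩

theorem BrYes.equiv {W : Type} {A : V → V → Prop} {B : W → W → Prop} (e : V ≃ W)
    (h : ∀ a b, A a b → B (e a) (e b)) {r : V} {k : ℕ} (hA : BrYes A r k) : BrYes B (e r) k := by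
  obtain ⟨L, hk, hL⟩ := hA
  refine ⟨e '' L, by rwa [Set.ncard_image_of_injective _ e.injective], fun w => ?_⟩
  have := rtg_map e (B' := Arcs B (e '' L)) (fun a b hab => ⟨h a b hab.1, fun hm => hab.2 (by
    simpa using hm)⟩) (hL (e.symm w))
  simpa using this

theorem TrYes.equiv {W : Type} {A : V → V → Prop} {B : W → W → Prop} (e : V ≃ W)
    (h : ∀ a b, A a b → B (e a) (e b)) {r : V} {k : ℕ} (hA : TrYes A r k) : TrYes B (e r) k := by
  obtain ⟨L, hk, hL⟩ := hA
  refine ⟨e '' L, by rwa [Set.ncard_image_of_injective _ e.injective], ?_⟩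
  rintro _ ⟨w, hw, rfl⟩
  exact rtg_map e (B' := Arcs B (e '' L)) (fun a b hab => ⟨h a b hab.1, fun hm => hab.2 (by
    simpa using hm)⟩) (hL w hw)

end Characterization

/-! ### Instances and their isomorphic copies -/

section Instances

theorem rootedLeafOutBranching_iff {I : Instance} :
    RootedLeafOutBranching I ↔ BrYes I.D.Adj I.root I.k := isOutBranching_iff_brYes

theorem rootedLeafOutTree_iff {I : Instance} :
    RootedLeafOutTree I ↔ TrYes I.D.Adj I.root I.k := isOutTree_iff_trYes

theorem allReachable_iff {I : Instance} :
    AllReachable I ↔ ∀ w, ReflTransGen I.D.Adj I.root w := by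
  simp only [AllReachable, reaches_iff]

variable {V : Type} {J : Instance} {D : Digraph V} {r : V} {k : ℕ}

theorem Instance.IsCopyOf.brYes_iff (h : J.IsCopyOf D r k) (k' : ℕ) :
    BrYes J.D.Adj J.root k' ↔ BrYes D.Adj r k' := by
  obtain ⟨_, e, he, hr⟩ := h
  constructor
  · intro hJ
    have := hJ.equiv (B := D.Adj) e.symm (fun a b hab => (he _ _).2 (by simpa using hab))
    rwa [← hr, Equiv.symm_apply_apply] at this
  · intro hD
    exact hr ▸ hD.equiv e (fun a b => (he a b).1)

theorem Instance.IsCopyOf.trYes_iff (h : J.IsCopyOf D r k) (k' : ℕ) :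
    TrYes J.D.Adj J.root k' ↔ TrYes D.Adj r k' := by
  obtain ⟨_, e, he, hr⟩ := h
  constructor
  · intro hJ
    have := hJ.equiv (B := D.Adj) e.symm (fun a b hab => (he _ _).2 (by simpa using hab))
    rwa [← hr, Equiv.symm_apply_apply] at this
  · intro hD
    exact hr ▸ hD.equiv e (fun a b => (he a b).1)

theorem exists_isCopyOf [Finite V] (D : Digraph V) (hD : ∀ a, ¬ D.Adj a a) (r : V) (k : ℕ) :
    ∃ J : Instance, J.IsCopyOf D r k := by
  obtain ⟨n, ⟨e⟩⟩ := Finite.exists_equiv_fin V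
  exact ⟨⟨n, ⟨fun a b => D.Adj (e.symm a) (e.symm b)⟩, fun a => hD _, e r, k⟩, rfl, e,
    by simp, rfl⟩

end Instances

/-! ### Soundness of arc deletion, contraction and vertex deletion -/

section Soundness

variable {V : Type} {A : V → V → Prop} {r : V}

/-- Removal of an arc that is never needed. -/
theorem Spans.deleteArc {L : Set V} {v w : V} {S : Set V} (hL : Spans A r L)
    (hS : r ∈ S ∨ ¬ ReflTransGen (Avoid A S) r v) (hvS : v ∉ S)
    (hw : ∀ x ∈ S, x = w ∨ A x w) : Spans (fun a b => A a b ∧ ¬ (a = v ∧ b = w)) r L := by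
  intro y
  induction hL y with
  | refl => exact .refl
  | @tail a b _ hab ih =>
    by_cases he : a = v ∧ b = w
    · obtain ⟨rfl, rfl⟩ := he
      -- The walk to `v` has met some `x` of `S`, and `w` is `x` itself or is reached by the arc
      -- from `x` to `w`. This arc may be used because the walk goes on from `x` to `v`, so `x` is
      -- not in `L`.
      obtain ⟨x, hx, h1, h2⟩ := exists_mem_of_separates (fun a b h => h.1.1) hS ih
      rcases hw x hx with rfl | hxw
      · exact h1
      · refine h1.tail ⟨⟨hxw, fun h => hvS (h.1 ▸ hx)⟩, ?_⟩
        rcases ReflTransGen.cases_head h2 with rfl | ⟨z, hz, _⟩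
        · exact absurd hx hvS
        · exact hz.2
    · exact ih.tail ⟨⟨hab.1, he⟩, hab.2⟩

/-- The alternative `x = w ∨ A x w` treats two rules at once: the useless arc rule has `S = {w}`,
the avoidable arc rule has arcs from all of `S` to `w`. -/
theorem brYes_deleteArc_iff {v w : V} {S : Set V} {k : ℕ}
    (hS : r ∈ S ∨ ¬ ReflTransGen (Avoid A S) r v) (hvS : v ∉ S) (hw : ∀ x ∈ S, x = w ∨ A x w) :
    BrYes (fun a b => A a b ∧ ¬ (a = v ∧ b = w)) r k ↔ BrYes A r k :=
  ⟨fun ⟨L, hk, hL⟩ => ⟨L, hk, fun w => rtg_mono (fun _ _ h => ⟨h.1.1, h.2⟩) (hL w)⟩,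
    fun ⟨L, hk, hL⟩ => ⟨L, hk, hL.deleteArc hS hvS hw⟩⟩

/-- A reachable vertex that is separated by the arc `uv` is reached through `u` and `v`. -/
theorem reflTransGen_of_arc_separates {B : V → V → Prop} (hBA : ∀ a b, B a b → A a b) {u v w : V}
    (h : ¬ ReflTransGen (fun a b => A a b ∧ ¬ (a = u ∧ b = v)) r w) (hw : ReflTransGen B r w) :
    ReflTransGen B r u ∧ B u v ∧ ReflTransGen B v w := by
  by_contra hcon
  have key : ∀ y, ReflTransGen B r y → ReflTransGen B y w →
      ReflTransGen (fun a b => A a b ∧ ¬ (a = u ∧ b = v)) r y := by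
    intro y hy
    induction hy with
    | refl => exact fun _ => .refl
    | tail h1 h2 ih =>
      intro h3
      refine (ih (.head h2 h3)).tail ⟨hBA _ _ h2, ?_⟩
      rintro ⟨rfl, rfl⟩
      exact hcon ⟨h1, h2, h3⟩
  exact h (key w hw .refl)

/-- The bridge is used by every spanning set of walks, so neither of its ends is a leaf in `D`, and
a leaf set survives contraction. In the other direction a leaf at the merged vertex is moved to `v`.
-/
theorem brYes_contract_iff {D : Digraph V} [Finite V] {u v w₁ w₂ : V} (hr : r ≠ v) (huv : D.Adj u v)
    (hloop : ∀ a, ¬ D.Adj a a) (hall : ∀ w, ReflTransGen D.Adj r w)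
    (hne : w₁ ≠ w₂) (h1 : D.ArcDisconnects r u v w₁) (h2 : D.ArcDisconnects r u v w₂) {k : ℕ} :
    BrYes (D.contract u v).Adj ⟨r, hr⟩ k ↔ BrYes D.Adj r k := by
  classical
  rw [arcDisconnects_iff] at h1 h2
  have huv' : u ≠ v := fun h => hloop u (h ▸ huv)
  -- If `v` could be reached without the bridge, so could everything behind `v`, in particular `w₁`.
  have hv : ¬ ReflTransGen (fun a b => D.Adj a b ∧ ¬ (a = u ∧ b = v)) r v := by
    intro hv
    obtain ⟨-, -, h⟩ := reflTransGen_of_arc_separates (fun _ _ h => h) h1 (hall w₁)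
    obtain ⟨s, hs⟩ := reflTransGen_iff_walkN.1 h
    have key : ∀ n x, WalkN D.Adj v n x →
        ReflTransGen (fun a b => D.Adj a b ∧ ¬ (a = u ∧ b = v)) r x := by
      intro n
      induction n with
      | zero => rintro x rfl; exact hv
      | succ n ih =>
        rintro x ⟨y, hy, hyx⟩
        by_cases he : y = u ∧ x = v
        · rw [he.2]; exact hv
        · exact (ih y hy).tail ⟨hyx, he⟩
    exact h1 (key s w₁ hs)
  -- This is where two separated vertices are needed: one of them differs from `v`, which forces `v`
  -- to have an out-arc in use.
  have hw : ∃ w, w ≠ v ∧ ¬ ReflTransGen (fun a b => D.Adj a b ∧ ¬ (a = u ∧ b = v)) r w := by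
    by_cases h : w₁ = v
    · exact ⟨w₂, fun h' => hne (h.trans h'.symm), h2⟩
    · exact ⟨w₁, h, h1⟩
  obtain ⟨w, hwv, hw⟩ := hw
  have hloopc : ∀ a b : {x // x ≠ v}, (a = b ∨ (D.contract u v).Adj a b) ↔ (a = b ∨
      (D.Adj a b ∨ ((a : V) = u ∧ D.Adj v b) ∨ ((b : V) = u ∧ D.Adj a v))) := by
    intro a b
    by_cases h : a = b
    · simp [h]
    · simp [Digraph.contract, h]
  constructor
  · rintro ⟨L, hk, hL⟩
    let u' : {x // x ≠ v} := ⟨u, huv'⟩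
    -- everything that is reached in the contracted digraph is reached in `D`
    have key : ∀ M : Set V, (∀ a : {x // x ≠ v}, a ≠ u' → a ∉ L → (a : V) ∉ M) → u ∉ M →
        (u' ∉ L → v ∉ M) → Spans D.Adj r M := by
      intro M hM huM hvM
      have hu : ReflTransGen (Arcs D.Adj M) r u := by
        have : ∀ x, ReflTransGen (Arcs (D.contract u v).Adj L) ⟨r, hr⟩ x →
            ReflTransGen (Arcs D.Adj M) r x ∨ ReflTransGen (Arcs D.Adj M) r u := by
          intro x hx
          induction hx with
          | refl => exact .inl .refl
          | @tail a b _ hab ih =>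
            rcases ih with ih | ih
            · by_cases hau : (a : V) = u
              · exact .inr (hau ▸ ih)
              · have haM := hM a (fun h => hau (h ▸ rfl)) hab.2
                rcases hab.1.2 with h | h | h
                · exact .inl (ih.tail ⟨h, haM⟩)
                · exact absurd h.1 hau
                · have := reflTransGen_of_arc_separates (fun _ _ h => h.1) hv (ih.tail ⟨h.2, haM⟩)
                  exact .inr this.1
            · exact .inr ih
        exact (this u' (hL u')).elim id id
      have hv' : ReflTransGen (Arcs D.Adj M) r v := hu.tail ⟨huv, huM⟩
      intro x
      by_cases hxv : x = v
      · rw [hxv]; exact hv'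
      · have := hL ⟨x, hxv⟩
        suffices h : ∀ x, ReflTransGen (Arcs (D.contract u v).Adj L) ⟨r, hr⟩ x →
          ReflTransGen (Arcs D.Adj M) r x from h _ this
        intro x hx
        induction hx with
        | refl => exact .refl
        | @tail a b _ hab ih =>
          have haM : (a : V) ∉ M := by
            by_cases hau : a = u'
            · exact hau ▸ huM
            · exact hM a hau hab.2
          rcases hab.1.2 with h | h | h
          · exact ih.tail ⟨h, haM⟩
          · exact hv'.tail ⟨h.2, hvM (fun hm => hab.2 (by rwa [show a = u' from Subtype.ext h.1]))⟩
          · rw [h.1]; exact hu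
    -- If the merged vertex is a leaf, it is replaced by `v`, since `u` has to pass on to `v`.
    by_cases hu : u' ∈ L
    · refine ⟨insert v ((↑) '' (L \ {u'})), ?_, key _ ?_ ?_ ?_⟩
      · rw [Set.ncard_insert_of_notMem (by simp), Set.ncard_image_of_injective _
          Subtype.val_injective, Set.ncard_sdiff_singleton_add_one hu]
        exact hk
      · rintro a hau haL (h | ⟨b, hb, h⟩)
        · exact a.2 h
        · exact haL (Subtype.ext h ▸ hb.1)
      · rintro (h | ⟨b, hb, h⟩)
        · exact huv' h
        · exact hb.2 (Subtype.ext h)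
      · exact fun h => absurd hu h
    · refine ⟨(↑) '' L, ?_, key _ ?_ ?_ ?_⟩
      · rwa [Set.ncard_image_of_injective _ Subtype.val_injective]
      · rintro a hau haL ⟨b, hb, h⟩
        exact haL (Subtype.ext h ▸ hb)
      · rintro ⟨b, hb, h⟩
        exact hu ((Subtype.ext h : b = u') ▸ hb)
      · rintro - ⟨b, hb, h⟩
        exact b.2 h
  · rintro ⟨L, hk, hL⟩
    -- Reaching `w` uses the arc `uv` and then an arc out of `v`, so neither end of the bridge lies
    -- in `L`.
    obtain ⟨-, huL, hvw⟩ := reflTransGen_of_arc_separates (fun _ _ h => h.1) hw (hL w)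
    have hvL : v ∉ L := by
      rcases ReflTransGen.cases_head hvw with h | ⟨z, hz, _⟩
      · exact absurd h.symm hwv
      · exact hz.2
    refine ⟨Subtype.val ⁻¹' L, ?_, ?_⟩
    · rw [← Set.ncard_image_of_injective _ Subtype.val_injective]
      refine hk.trans (Set.ncard_le_ncard fun x hx => ?_)
      exact ⟨⟨x, fun h => hvL (h ▸ hx)⟩, hx, rfl⟩
    · let c : V → {x // x ≠ v} := fun x => if h : x = v then ⟨u, huv'⟩ else ⟨x, h⟩
      have hstep : ∀ a b, Arcs D.Adj L a b → ReflTransGen (Arcs (D.contract u v).Adj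
          (Subtype.val ⁻¹' L)) (c a) (c b) := by
        intro a b hab
        have hc : (c a : V) ∉ L := by
          simp only [c]
          split_ifs with h
          · exact huL.2
          · exact hab.2
        rcases (hloopc (c a) (c b)).2 (by
          simp only [c]
          split_ifs with h h' h'
          · simp
          · simp only [Subtype.mk.injEq]; subst h; simp [hab.1]
          · subst h'; simp [hab.1]
          · simp [hab.1]) with h | h
        · rw [h]
        · exact .single ⟨h, hc⟩
      intro x
      have hcr : c r = ⟨r, hr⟩ := by simp [c, hr]
      have hcx : c x = x := by simp [c, x.2]
      rw [← hcr, ← hcx]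
      have := hL x
      generalize (x : V) = y at this
      induction this with
      | refl => exact .refl
      | tail _ h ih => exact ih.trans (hstep _ _ h)

theorem trYes_inducedOn_iff {D : Digraph V} {u : V} (h : r ≠ u)
    (hu : ¬ ReflTransGen D.Adj r u) {k : ℕ} :
    TrYes (D.inducedOn {x | x ≠ u}).Adj ⟨r, h⟩ k ↔ TrYes D.Adj r k := by
  constructor
  · rintro ⟨L, hk, hL⟩
    refine ⟨(↑) '' L, by rwa [Set.ncard_image_of_injective _ Subtype.val_injective], ?_⟩
    rintro _ ⟨w, hw, rfl⟩
    refine rtg_map (fun x : {x | x ≠ u} => (x : V)) ?_ (hL w hw)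
    rintro a b hab
    refine ⟨hab.1, ?_⟩
    rintro ⟨a', ha', he⟩
    exact hab.2 (Subtype.ext he ▸ ha')
  · rintro ⟨L, hk, hL⟩
    have huL : u ∉ L := fun hm => hu (rtg_mono (fun _ _ h => h.1) (hL u hm))
    refine ⟨Subtype.val ⁻¹' L, ?_, ?_⟩
    · rw [← Set.ncard_image_of_injective _ Subtype.val_injective]
      suffices h : L = Subtype.val '' (Subtype.val ⁻¹' L : Set {x | x ≠ u}) by rwa [← h]
      ext x
      constructor
      · exact fun hx => ⟨⟨x, fun h => huL (h ▸ hx)⟩, hx, rfl⟩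
      · rintro ⟨y, hy, rfl⟩; exact hy
    · have key : ∀ x, ReflTransGen (Arcs D.Adj L) r x → ∀ hx : x ≠ u,
          ReflTransGen (Arcs (D.inducedOn {x | x ≠ u}).Adj (Subtype.val ⁻¹' L)) ⟨r, h⟩ ⟨x, hx⟩ := by
        intro x hx
        induction hx with
        | refl => exact fun _ => .refl
        | @tail a b h1 h2 ih =>
          intro hb
          have ha : a ≠ u := fun h => hu (h ▸ rtg_mono (fun _ _ h => h.1) h1)
          exact (ih ha).tail ⟨h2.1, h2.2⟩
      rintro ⟨w, hw'⟩ hw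
      exact key w (hL w hw) hw'

end Soundness

end LeafKernel

namespace LeafKernel

open Relation

/-! ### Unique out-branchings as paths without forward chords -/

section TwoDirectional

variable {V : Type}

/-- No arc of `A` leads from an entry of the list to a later entry other than the next one. -/
def NoSkip (A : V → V → Prop) : List V → Prop
  | [] => True
  | a :: l => (∀ x ∈ l.tail, ¬ A a x) ∧ NoSkip A l

theorem noSkip_iff {A : V → V → Prop} : ∀ {l : List V}, NoSkip A l ↔
    ∀ i j (hi : i < l.length) (hj : j < l.length), A l[i] l[j] → j ≤ i + 1
  | [] => by simp [NoSkip]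
  | a :: l => by
    rw [NoSkip, noSkip_iff]
    constructor
    · rintro ⟨h1, h2⟩ i j hi hj hA
      rcases i with _ | i <;> rcases j with _ | j
      · omega
      · by_contra hcon
        refine h1 (l[j]'(by simpa using hj)) ?_ (by simpa using hA)
        rw [List.mem_iff_getElem]
        simp only [List.length_cons] at hj
        exact ⟨j - 1, by simp; omega, by simp [show j - 1 + 1 = j by omega]⟩
      · omega
      · have := h2 i j (by simpa using hi) (by simpa using hj) (by simpa using hA)
        omega
    · refine fun h => ⟨fun x hx hA => ?_, fun i j hi hj hA => ?_⟩
      · obtain ⟨i, hi, rfl⟩ := List.mem_iff_getElem.1 hx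
        simp only [List.length_tail] at hi
        have := h 0 (i + 2) (by simp) (by simp; omega) (by simpa using hA)
        omega
      · have := h (i + 1) (j + 1) (by simpa using hi) (by simpa using hj) (by simpa using hA)
        omega

theorem nodup_infix_pair {p : List V} (hp : p.Nodup) {i j : ℕ} (hi : i < p.length) (hj : j < p.length) :
    [p[i], p[j]] <:+: p ↔ j = i + 1 := by
  rw [infix_pair_iff]
  constructor
  · rintro ⟨m, hm, h1, h2⟩
    rw [hp.getElem_inj_iff] at h1 h2
    omega
  · rintro rfl
    exact ⟨i, hj, rfl, rfl⟩

theorem pathOn_isOutTree {s : Set V} {L : List V} (hn : L.Nodup) (hs : ∀ x, x ∈ s ↔ x ∈ L)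
    (h0 : 0 < L.length) [Finite V] :
    (Digraph.pathOn s L).IsOutTree ⟨L[0], (hs _).2 (List.getElem_mem _)⟩ := by
  rw [isOutTree_iff]
  refine ⟨?_, ?_, ?_, ?_⟩
  · rintro ⟨a, ha⟩ h
    obtain ⟨i, hi, rfl⟩ := List.mem_iff_getElem.1 ((hs a).1 ha)
    have := (nodup_infix_pair hn hi h0).1 h
    omega
  · rintro ⟨b, hb⟩ hne
    obtain ⟨j, hj, rfl⟩ := List.mem_iff_getElem.1 ((hs b).1 hb)
    have hj0 : j ≠ 0 := by rintro rfl; exact hne rfl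
    exact ⟨⟨L[j - 1], (hs _).2 (List.getElem_mem _)⟩,
      (nodup_infix_pair hn (by omega) hj).2 (by omega)⟩
  · rintro ⟨a, ha⟩ ⟨a', ha'⟩ ⟨b, hb⟩ h h'
    obtain ⟨i, hi, rfl⟩ := List.mem_iff_getElem.1 ((hs a).1 ha)
    obtain ⟨i', hi', rfl⟩ := List.mem_iff_getElem.1 ((hs a').1 ha')
    obtain ⟨j, hj, rfl⟩ := List.mem_iff_getElem.1 ((hs b).1 hb)
    have h1 := (nodup_infix_pair hn hi hj).1 h
    have h2 := (nodup_infix_pair hn hi' hj).1 h'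
    have : i = i' := by omega
    subst this; rfl
  · rintro ⟨b, hb⟩
    obtain ⟨j, hj, rfl⟩ := List.mem_iff_getElem.1 ((hs b).1 hb)
    induction j with
    | zero => exact .refl
    | succ j ih =>
      exact (ih (by omega) ((hs _).2 (List.getElem_mem _))).tail
        ((nodup_infix_pair hn (by omega) hj).2 rfl)

/-- A path is the only out-branching with its root exactly if it covers everything and
no arc skips vertices of it. -/
theorem unique_outBranching_iff [Finite V] {D : Digraph V} {L : List V} {a b : V} {s : Set V}
    (hL : D.IsPath L a b) (ha : a ∈ s) (hb : b ∈ s) :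
    (∀ T : Digraph s, (∃ h : a ∈ s, (D.inducedOn s).IsOutBranching ⟨a, h⟩ T) ↔
      T = Digraph.pathOn s L) ↔ (∀ x, x ∈ s ↔ x ∈ L) ∧ NoSkip D.Adj L := by
  classical
  obtain ⟨hc, hn, hh, hl⟩ := hL
  have h0 : 0 < L.length := by
    rcases L with _ | ⟨x, L⟩
    · simp at hh
    · simp
  have ha0 : L[0] = a := by
    rw [List.head?_eq_getElem?, List.getElem?_eq_getElem h0] at hh
    simpa using hh
  have hbl : L[L.length - 1] = b := by
    rw [List.getLast?_eq_getElem?, List.getElem?_eq_getElem (by omega)] at hl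
    simpa using hl
  constructor
  · intro H
    obtain ⟨h, hle, hT⟩ := (H _).2 rfl
    have hT' := isOutTree_iff.1 hT
    have hs : ∀ x, x ∈ s ↔ x ∈ L := by
      intro x
      constructor
      · intro hx
        by_cases hxa : x = a
        · rw [hxa, ← ha0]; exact List.getElem_mem _
        · obtain ⟨y, hy⟩ := hT'.2.1 ⟨x, hx⟩ (fun h => hxa (congrArg Subtype.val h))
          have hy' : [(y : V), x] <:+: L := hy
          exact hy'.subset (by simp)
      · intro hx
        obtain ⟨i, hi, rfl⟩ := List.mem_iff_getElem.1 hx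
        -- Membership in `s` spreads backwards from the end `b`: a vertex of `s` other than `a` has
        -- a parent in `s`, and in `pathOn s L` this can only be its predecessor on `L`.
        have : ∀ m i (hi : i < L.length), i + m = L.length - 1 → L[i] ∈ s := by
          intro m
          induction m with
          | zero => intro i hi he; simp only [show i = L.length - 1 by omega, hbl, hb]
          | succ m ih =>
            intro i hi he
            have hi1 := ih (i + 1) (by omega) (by omega)
            obtain ⟨y, hy⟩ := hT'.2.1 ⟨L[i + 1], hi1⟩ (fun h => by
              have := congrArg Subtype.val h
              simp only [← ha0, hn.getElem_inj_iff] at this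
              omega)
            obtain ⟨j, hj, h1, h2⟩ := infix_pair_iff.1 (show [(y : V), L[i + 1]] <:+: L from hy)
            rw [hn.getElem_inj_iff] at h2
            have : j = i := by omega
            subst this
            rw [h1]; exact y.2
        exact this (L.length - 1 - i) i hi (by omega)
    refine ⟨hs, noSkip_iff.2 fun i j hi hj hA => ?_⟩
    by_contra hcon
    have mem : ∀ i (hi : i < L.length), L[i] ∈ s := fun i hi => (hs _).2 (List.getElem_mem _)
    -- A forward chord from `L[i]` to `L[j]` allows `L[j]` to be hung below `L[i]`, which gives a
    -- second out-branching.
    let T : Digraph s := ⟨fun x y => if (y : V) = L[j] then (x : V) = L[i] else [(x : V), (y : V)] <:+: L⟩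
    have hTb : (D.inducedOn s).IsOutBranching ⟨a, ha⟩ T := by
      refine ⟨?_, isOutTree_iff.2 ⟨?_, ?_, ?_, ?_⟩⟩
      · intro x y hxy
        simp only [T] at hxy
        split_ifs at hxy with hy
        · show D.Adj x y
          rw [hxy, hy]; exact hA
        · exact hle hxy
      · intro x hx
        simp only [T] at hx
        split_ifs at hx with hy
        · rw [← ha0, hn.getElem_inj_iff] at hy; omega
        · exact hT'.1 x hx
      · intro y hy
        by_cases hyj : (y : V) = L[j]
        · exact ⟨⟨L[i], mem i hi⟩, by simp [T, hyj]⟩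
        · obtain ⟨x, hx⟩ := hT'.2.1 y hy
          exact ⟨x, by simp only [T, hyj, if_false]; exact hx⟩
      · intro x x' y hx hx'
        simp only [T] at hx hx'
        split_ifs at hx hx' with hy
        · exact Subtype.ext (hx.trans hx'.symm)
        · exact hT'.2.2.1 x x' y hx hx'
      · have key : ∀ m (hm : m < L.length), ReflTransGen T.Adj ⟨a, ha⟩ ⟨L[m], mem m hm⟩ := by
          intro m
          induction m using Nat.strong_induction_on with
          | _ m ih =>
            intro hm
            rcases m with _ | m
            · simp only [ha0]; exact .refl
            · by_cases hmj : m + 1 = j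
              · exact (ih i (by omega) hi).tail (by simp [T, hmj])
              · refine (ih m (by omega) (by omega)).tail ?_
                simp only [T, hn.getElem_inj_iff, hmj, if_false]
                exact (nodup_infix_pair hn _ _).2 rfl
        rintro ⟨y, hy⟩
        obtain ⟨m, hm, rfl⟩ := List.mem_iff_getElem.1 ((hs y).1 hy)
        exact key m hm
    have hTe := (H T).1 ⟨ha, hTb⟩
    have h1 : T.Adj ⟨L[i], mem i hi⟩ ⟨L[j], mem j hj⟩ := by simp [T]
    rw [hTe] at h1
    have := (nodup_infix_pair hn hi hj).1 h1
    omega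
  · rintro ⟨hs, hskip⟩ T
    rw [noSkip_iff] at hskip
    have hroot : (⟨L[0], (hs _).2 (List.getElem_mem _)⟩ : s) = ⟨a, ha⟩ := Subtype.ext ha0
    constructor
    · rintro ⟨_, hle, hT⟩
      have hT' := isOutTree_iff.1 hT
      have mem : ∀ i (hi : i < L.length), L[i] ∈ s := fun i hi => (hs _).2 (List.getElem_mem _)
      have key : ∀ j (hj : j + 1 < L.length), T.Adj ⟨L[j], mem j (by omega)⟩ ⟨L[j + 1], mem _ hj⟩ := by
        intro j hj
        by_contra hcon
        -- Without chords, only the arc from `L[j]` to `L[j + 1]` enters the final segment of the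
        -- path that starts at `L[j + 1]`, so every out-branching contains it.
        refine not_reflTransGen_of_parents (T := T.Adj) (r := ⟨a, ha⟩)
          (C := {x | ∃ m, ∃ hm : m < L.length, j + 1 ≤ m ∧ L[m] = (x : V)}) ?_ ?_
          (w := ⟨L[j + 1], mem _ hj⟩) ⟨j + 1, hj, le_rfl, rfl⟩ (hT'.2.2.2 _)
        · rintro ⟨m, hm, hjm, h⟩
          simp only [← ha0, hn.getElem_inj_iff] at h
          omega
        · rintro ⟨x, hx⟩ ⟨y, hy⟩ hxy ⟨m, hm, hjm, h⟩
          obtain ⟨i, hi, rfl⟩ := List.mem_iff_getElem.1 ((hs x).1 hx)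
          obtain rfl : L[m] = y := h
          by_contra hcon2
          have hlt : ¬ j + 1 ≤ i := fun hh => hcon2 ⟨i, hi, hh, rfl⟩
          have := hskip i m hi hm (hle hxy)
          have e1 : i = j := by omega
          have e2 : m = j + 1 := by omega
          subst e1 e2
          exact hcon hxy
      ext ⟨x, hx⟩ ⟨y, hy⟩
      obtain ⟨i, hi, rfl⟩ := List.mem_iff_getElem.1 ((hs x).1 hx)
      obtain ⟨m, hm, rfl⟩ := List.mem_iff_getElem.1 ((hs y).1 hy)
      show _ ↔ [L[i], L[m]] <:+: L
      rw [nodup_infix_pair hn hi hm]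
      constructor
      · intro h
        rcases m with _ | m
        · exact absurd h (by simp only [ha0]; exact hT'.1 _)
        · have := hT'.2.2.1 _ _ _ h (key m hm)
          simp only [Subtype.mk.injEq, hn.getElem_inj_iff] at this
          omega
      · rintro rfl
        exact key i hm
    · rintro rfl
      refine ⟨ha, ?_, hroot ▸ pathOn_isOutTree hn hs h0⟩
      rintro ⟨x, hx⟩ ⟨y, hy⟩ hxy
      obtain ⟨i, hi, h1, h2⟩ := infix_pair_iff.1 (show [x, y] <:+: L from hxy)
      show D.Adj x y
      rw [← h1, ← h2]
      exact List.isChain_iff_getElem.1 hc i hi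

/-- The situation of the two directional path rule, in terms of arcs only. -/
structure TwoPath (D : Digraph V) (r : V) (P Q : List V) (p₁ pin pout pl : V) : Prop where
  path : D.IsPath P p₁ pl
  length : P.length = 7 ∨ P.length = 8
  pin_mem : pin = pl ∨ [pin, pl] <:+ P
  pout_mem : pout = p₁ ∨ [p₁, pout] <+: P
  root_notMem : r ∉ P
  in_arcs : ∀ b ∈ P, (∃ a, a ∉ P ∧ D.Adj a b) ↔ (b = p₁ ∨ b = pin)
  out_arcs : ∀ a ∈ P, (∃ b, b ∉ P ∧ D.Adj a b) ↔ (a = pl ∨ a = pout)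
  noSkip_P : NoSkip D.Adj P
  path_Q : D.IsPath Q pin pout
  mem_Q : ∀ x, x ∈ P ↔ x ∈ Q
  noSkip_Q : NoSkip D.Adj Q
  next_ne : ∀ x, [pout, x] <:+: P → ¬ [pl, x] <:+: Q

theorem twoDirectionalPath_iff [Finite V] {D : Digraph V} {r : V} {P Q : List V} {p₁ pin pout pl : V} :
    D.TwoDirectionalPath r P Q p₁ pin pout pl ↔ TwoPath D r P Q p₁ pin pout pl := by
  have mem : D.IsPath P p₁ pl → (pin = pl ∨ [pin, pl] <:+ P) → (pout = p₁ ∨ [p₁, pout] <+: P) →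
      p₁ ∈ P ∧ pl ∈ P ∧ pin ∈ P ∧ pout ∈ P := by
    rintro ⟨-, -, h1, h2⟩ h3 h4
    have e1 : p₁ ∈ P := List.mem_of_mem_head? (by rw [h1]; simp)
    have e2 : pl ∈ P := List.mem_of_mem_getLast? (by rw [h2]; simp)
    refine ⟨e1, e2, ?_, ?_⟩
    · rcases h3 with rfl | h3
      · exact e2
      · exact h3.subset (by simp)
    · rcases h4 with rfl | h4
      · exact e1
      · exact h4.subset (by simp)
  constructor
  · intro h
    obtain ⟨m1, m2, m3, m4⟩ := mem h.path h.pin_mem h.pout_mem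
    have hP := (unique_outBranching_iff (s := {x | x ∈ P}) h.path m1 m2).1 h.unique_P
    have hQ := (unique_outBranching_iff (s := {x | x ∈ P}) h.path_Q m3 m4).1 h.unique_Q
    exact ⟨h.path, h.length, h.pin_mem, h.pout_mem, h.root_notMem, h.in_arcs, h.out_arcs, hP.2,
      h.path_Q, hQ.1, hQ.2, h.next_ne⟩
  · intro h
    obtain ⟨m1, m2, m3, m4⟩ := mem h.path h.pin_mem h.pout_mem
    exact ⟨h.path, h.length, h.pin_mem, h.pout_mem, h.root_notMem, h.in_arcs, h.out_arcs,
      (unique_outBranching_iff (s := {x | x ∈ P}) h.path m1 m2).2 ⟨fun _ => Iff.rfl, h.noSkip_P⟩,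
      h.path_Q, (unique_outBranching_iff (s := {x | x ∈ P}) h.path_Q m3 m4).2 ⟨h.mem_Q, h.noSkip_Q⟩,
      h.next_ne⟩

end TwoDirectional

end LeafKernel

namespace LeafKernel

open Relation

/-! ### Exchanging one two-way passage for another -/

section TwoWay

theorem rtg_along_list {V : Type} {A : V → V → Prop} {M : Set V} {l : List V} (hc : l.IsChain A) {i j : ℕ}
    (hij : i ≤ j) (hj : j < l.length) (hM : ∀ m (hm : m < l.length), i ≤ m → m < j → l[m] ∉ M) :
    ReflTransGen (fun a b => A a b ∧ a ∉ M ∧ a ∈ l) l[i] l[j] := by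
  induction j with
  | zero => obtain rfl : i = 0 := by omega
            exact .refl
  | succ j ih =>
    by_cases h : i = j + 1
    · subst h; exact .refl
    · exact (ih (by omega) (by omega) (fun m hm h1 h2 => hM m hm h1 (by omega))).tail
        ⟨List.isChain_iff_getElem.1 hc j hj, hM j (by omega) (by omega) (by omega), List.getElem_mem _⟩

/-- The vertices of `P` can be traversed along the path `P` from `p₁` to `pl` and along the path `Q`
from `pin` to `pout`, there are no other ways in or out, and without `x` and `y` one still gets from
`p₁` to `pout` and from `pin` to `pl`. -/
structure TwoWay {V : Type} (A : V → V → Prop) (P Q : List V) (p₁ pin pout pl : V) : Prop where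
  chain_P : P.IsChain A
  nodup_P : P.Nodup
  head_P : P.head? = some p₁
  last_P : P.getLast? = some pl
  noSkip_P : NoSkip A P
  chain_Q : Q.IsChain A
  nodup_Q : Q.Nodup
  head_Q : Q.head? = some pin
  last_Q : Q.getLast? = some pout
  noSkip_Q : NoSkip A Q
  mem_Q : ∀ x, x ∈ P ↔ x ∈ Q
  ne : pout ≠ pl
  entry : ∀ a b, a ∉ P → b ∈ P → A a b → b = p₁ ∨ b = pin
  exit : ∀ a b, a ∈ P → b ∉ P → A a b → a = pl ∨ a = pout
  split : ∃ x y, x ∈ P ∧ y ∈ P ∧ x ≠ y ∧ pl ≠ x ∧ pl ≠ y ∧ pout ≠ x ∧ pout ≠ y ∧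
    ReflTransGen (fun a b => A a b ∧ a ∉ ({x, y} : Set V) ∧ a ∈ P) p₁ pout ∧
    ReflTransGen (fun a b => A a b ∧ a ∉ ({x, y} : Set V) ∧ a ∈ P) pin pl ∧
    ∀ b ∈ P, ReflTransGen (fun a b => A a b ∧ a ∉ ({x, y} : Set V) ∧ a ∈ P) p₁ b ∨
      ReflTransGen (fun a b => A a b ∧ a ∉ ({x, y} : Set V) ∧ a ∈ P) pin b

/-- The entries of the list up to the first one in `L`. -/
def Initial {V : Type} (P : List V) (L : Set V) (x : V) : Prop :=
  ∃ i, ∃ hi : i < P.length, P[i] = x ∧ ∀ j (hj : j < P.length), j < i → P[j] ∉ L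

variable {V : Type} {A : V → V → Prop} {P Q : List V} {p₁ pin pout pl : V} {L : Set V}

/-- As no arc skips forward, a walk inside the passage either falls back into the segment traversed
so far or extends it by one vertex, which requires that the current vertex is not a leaf. -/
theorem Initial.step (hn : P.Nodup) (hs : NoSkip A P) {x y : V} (hx : Initial P L x) (hxL : x ∉ L) (hA : A x y)
    (hy : y ∈ P) : Initial P L y := by
  obtain ⟨i, hi, rfl, h⟩ := hx
  obtain ⟨j, hj, rfl⟩ := List.mem_iff_getElem.1 hy
  have := noSkip_iff.1 hs i j hi hj hA
  refine ⟨j, hj, rfl, fun m hm hmj => ?_⟩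
  by_cases hmi : m = i
  · subst hmi; exact hxL
  · exact h m hm (by omega)

theorem initial_head (h : P.head? = some p₁) : Initial P L p₁ := by
  rcases P with _ | ⟨a, l⟩
  · simp at h
  · exact ⟨0, by simp, by simpa using h, by omega⟩

/-- A traversal ends at its first leaf, so each of the two traversals accounts for at most one leaf.
-/
theorem Initial.eq_of_mem (hn : P.Nodup) {x y : V} (hx : Initial P L x) (hy : Initial P L y)
    (hxL : x ∈ L) (hyL : y ∈ L) : x = y := by
  obtain ⟨i, hi, rfl, h⟩ := hx
  obtain ⟨j, hj, rfl, h'⟩ := hy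
  rcases lt_trichotomy i j with hij | hij | hij
  · exact absurd hxL (h' i hi hij)
  · subst hij; rfl
  · exact absurd hyL (h j hj hij)

theorem not_initial_last (hn : P.Nodup) (h : P.getLast? = some pl) {c : V} (hc : c ∈ P) (hcL : c ∈ L)
    (hne : c ≠ pl) : ¬ Initial P L pl := by
  rintro ⟨i, hi, he, hL⟩
  rw [List.getLast?_eq_getElem?, List.getElem?_eq_getElem (by omega), Option.some_inj, ← he,
    hn.getElem_inj_iff] at h
  obtain ⟨j, hj, rfl⟩ := List.mem_iff_getElem.1 hc
  refine hL j hj ?_ hcL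
  have : j ≠ i := by rintro rfl; exact hne he
  omega

theorem TwoWay.swap (h : TwoWay A P Q p₁ pin pout pl) : TwoWay A Q P pin p₁ pl pout where
  chain_P := h.chain_Q
  nodup_P := h.nodup_Q
  head_P := h.head_Q
  last_P := h.last_Q
  noSkip_P := h.noSkip_Q
  chain_Q := h.chain_P
  nodup_Q := h.nodup_P
  head_Q := h.head_P
  last_Q := h.last_P
  noSkip_Q := h.noSkip_P
  mem_Q x := (h.mem_Q x).symm
  ne := h.ne.symm
  entry a b ha hb hab := (h.entry a b (by rwa [h.mem_Q]) (by rwa [h.mem_Q]) hab).symm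
  exit a b ha hb hab := (h.exit a b (by rwa [h.mem_Q]) (by rwa [h.mem_Q]) hab).symm
  split := by
    obtain ⟨x, y, h1, h2, h3, h4, h5, h6, h7, h8, h9, h10⟩ := h.split
    simp only [h.mem_Q] at h1 h2 h8 h9 h10
    exact ⟨x, y, h1, h2, h3, h6, h7, h4, h5, h9, h8, fun b hb => (h10 b hb).symm⟩

theorem TwoWay.rtg_P (h : TwoWay A P Q p₁ pin pout pl) {M : Set V} (hM : M ⊆ {pl}) {b : V} (hb : b ∈ P) :
    ReflTransGen (fun a b => A a b ∧ a ∉ M ∧ a ∈ P) p₁ b := by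
  obtain ⟨j, hj, rfl⟩ := List.mem_iff_getElem.1 hb
  have h1 := h.head_P
  have h2 := h.last_P
  rw [List.head?_eq_getElem?, List.getElem?_eq_getElem (by omega), Option.some_inj] at h1
  rw [List.getLast?_eq_getElem?, List.getElem?_eq_getElem (by omega), Option.some_inj] at h2
  rw [← h1]
  refine rtg_along_list h.chain_P (Nat.zero_le _) hj fun m hm _ hmj hmM => ?_
  have := hM hmM
  rw [Set.mem_singleton_iff, ← h2, h.nodup_P.getElem_inj_iff] at this
  omega

variable {V' : Type} {A' : V' → V' → Prop} {P' Q' : List V'} {p₁' pin' pout' pl' : V'}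

/-- Two digraphs that agree outside two-way passages. -/
structure Agree (A : V → V → Prop) (P : List V) (p₁ pin pout pl : V) (A' : V' → V' → Prop)
    (P' : List V') (p₁' pin' pout' pl' : V') (e : {x // x ∉ P} ≃ {x // x ∉ P'}) : Prop where
  adj : ∀ x y, A (x : {x // x ∉ P}) (y : {x // x ∉ P}) ↔ A' (e x) (e y)
  adj_p₁ : ∀ x : {x // x ∉ P}, A x p₁ ↔ A' (e x) p₁'
  adj_pin : ∀ x : {x // x ∉ P}, A x pin ↔ A' (e x) pin'
  adj_pout : ∀ x : {x // x ∉ P}, A pout x ↔ A' pout' (e x)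
  adj_pl : ∀ x : {x // x ∉ P}, A pl x ↔ A' pl' (e x)

theorem Agree.symm {e : {x // x ∉ P} ≃ {x // x ∉ P'}} (h : Agree A P p₁ pin pout pl A' P' p₁' pin' pout' pl' e) :
    Agree A' P' p₁' pin' pout' pl' A P p₁ pin pout pl e.symm where
  adj x y := by simp [h.adj]
  adj_p₁ x := by simp [h.adj_p₁]
  adj_pin x := by simp [h.adj_pin]
  adj_pout x := by simp [h.adj_pout]
  adj_pl x := by simp [h.adj_pl]

/-- Leaves outside the passage are carried over by `e`, those inside are replaced by `M`. Inside the
passage a walk has traversed an initial segment of `P` after entering at `p₁`, or of `Q` after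
entering at `pin`. So it suffices that every crossing still possible with `L` is possible with `M`
(`hpl`, `hpout`) and that `P'` is covered from an entrance that is surely used (`hcov`): a vertex
that one traversal cannot reach certifies that the other entrance is used. -/
theorem spans_of_agree [Finite V] [Finite V'] (h : TwoWay A P Q p₁ pin pout pl)
    (h' : TwoWay A' P' Q' p₁' pin' pout' pl')
    {e : {x // x ∉ P} ≃ {x // x ∉ P'}} (he : Agree A P p₁ pin pout pl A' P' p₁' pin' pout' pl' e)
    {r : V} (hr : r ∉ P) (hL : Spans A r L) (M : Set V') (hMP : ∀ x ∈ M, x ∈ P')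
    (hcard : {x ∈ L | x ∈ P}.ncard ≤ M.ncard)
    (hpl : pl ∉ L → pl' ∉ M ∧
      (Initial P L pl → ReflTransGen (fun a b => A' a b ∧ a ∉ M ∧ a ∈ P') p₁' pl') ∧
      (Initial Q L pl → ReflTransGen (fun a b => A' a b ∧ a ∉ M ∧ a ∈ P') pin' pl'))
    (hpout : pout ∉ L → pout' ∉ M ∧
      (Initial P L pout → ReflTransGen (fun a b => A' a b ∧ a ∉ M ∧ a ∈ P') p₁' pout') ∧
      (Initial Q L pout → ReflTransGen (fun a b => A' a b ∧ a ∉ M ∧ a ∈ P') pin' pout'))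
    (hcov : ∀ b ∈ P',
      (ReflTransGen (fun a b => A' a b ∧ a ∉ M ∧ a ∈ P') p₁' b ∧ ∃ x ∈ P, ¬ Initial Q L x) ∨
      (ReflTransGen (fun a b => A' a b ∧ a ∉ M ∧ a ∈ P') pin' b ∧ ∃ x ∈ P, ¬ Initial P L x) ∨
      (ReflTransGen (fun a b => A' a b ∧ a ∉ M ∧ a ∈ P') p₁' b ∧
        ReflTransGen (fun a b => A' a b ∧ a ∉ M ∧ a ∈ P') pin' b)) :
    ∃ L' : Set V', L.ncard ≤ L'.ncard ∧ Spans A' (e ⟨r, hr⟩) L' := by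
  let N : Set V' := (fun x : {x // x ∉ P} => (e x : V')) '' {x | (x : V) ∈ L}
  have hNP : ∀ x ∈ N, x ∉ P' := by rintro _ ⟨x, _, rfl⟩; exact (e x).2
  have heN : ∀ x : {x // x ∉ P}, (e x : V') ∈ N ∪ M → (x : V) ∈ L := by
    rintro x (⟨y, hy, hxy⟩ | hx)
    · have : y = x := e.injective (Subtype.ext hxy)
      exact this ▸ hy
    · exact absurd (hMP _ hx) (e x).2
  have lift : ∀ a b, ReflTransGen (fun a b => A' a b ∧ a ∉ M ∧ a ∈ P') a b →
      ReflTransGen (Arcs A' (N ∪ M)) a b := fun a b => rtg_mono fun a b hab =>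
    ⟨hab.1, by rintro (h | h); exacts [hNP _ h hab.2.2, hab.2.1 h]⟩
  refine ⟨N ∪ M, ?_, ?_⟩
  · have h1 : L.ncard = {x ∈ L | x ∉ P}.ncard + {x ∈ L | x ∈ P}.ncard := by
      rw [← Set.ncard_union_eq]
      · congr 1; ext x; simp; tauto
      · rw [Set.disjoint_left]; rintro x hx hx'; exact hx.2 hx'.2
    have h2 : N.ncard = {x ∈ L | x ∉ P}.ncard := by
      rw [Set.ncard_image_of_injective _ (fun x y hxy => e.injective (Subtype.ext hxy)),
        ← Set.ncard_image_of_injective _ Subtype.val_injective]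
      congr 1
      ext x
      constructor
      · rintro ⟨y, hy, rfl⟩; exact ⟨hy, y.2⟩
      · rintro ⟨hx, hxP⟩; exact ⟨⟨x, hxP⟩, hx, rfl⟩
    rw [h1, Set.ncard_union_eq, h2]
    · omega
    · rw [Set.disjoint_left]; exact fun x hx hx' => hNP x hx (hMP x hx')
  have key : ∀ x, ReflTransGen (Arcs A L) r x →
      (∀ hx : x ∉ P, ReflTransGen (Arcs A' (N ∪ M)) (e ⟨r, hr⟩) (e ⟨x, hx⟩)) ∧
      (x ∈ P → (Initial P L x ∧ ReflTransGen (Arcs A' (N ∪ M)) (e ⟨r, hr⟩) p₁') ∨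
        (Initial Q L x ∧ ReflTransGen (Arcs A' (N ∪ M)) (e ⟨r, hr⟩) pin')) := by
    intro x hx
    induction hx with
    | refl => exact ⟨fun _ => .refl, fun h => absurd h hr⟩
    | @tail a b _ hab ih =>
      have haN : ∀ ha : a ∉ P, (e ⟨a, ha⟩ : V') ∉ N ∪ M := fun ha hm => hab.2 (heN _ hm)
      refine ⟨fun hb => ?_, fun hb => ?_⟩
      · by_cases ha : a ∈ P
        · rcases h.exit a b ha hb hab.1 with rfl | rfl
          · obtain ⟨g1, g2, g3⟩ := hpl hab.2
            have hAb := (he.adj_pl ⟨b, hb⟩).1 hab.1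
            have hm : a ∈ P → pl' ∉ N ∪ M := fun _ => by
              rintro (h1 | h1)
              · exact hNP _ h1 (List.mem_of_mem_getLast? (by rw [h'.last_P]; simp))
              · exact g1 h1
            rcases ih.2 ha with ⟨i1, i2⟩ | ⟨i1, i2⟩
            · exact (i2.trans (lift _ _ (g2 i1))).tail ⟨hAb, hm ha⟩
            · exact (i2.trans (lift _ _ (g3 i1))).tail ⟨hAb, hm ha⟩
          · obtain ⟨g1, g2, g3⟩ := hpout hab.2
            have hAb := (he.adj_pout ⟨b, hb⟩).1 hab.1
            have hm : a ∈ P → pout' ∉ N ∪ M := fun _ => by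
              rintro (h1 | h1)
              · exact hNP _ h1 ((h'.mem_Q _).2 (List.mem_of_mem_getLast? (by rw [h'.last_Q]; simp)))
              · exact g1 h1
            rcases ih.2 ha with ⟨i1, i2⟩ | ⟨i1, i2⟩
            · exact (i2.trans (lift _ _ (g2 i1))).tail ⟨hAb, hm ha⟩
            · exact (i2.trans (lift _ _ (g3 i1))).tail ⟨hAb, hm ha⟩
        · exact (ih.1 ha).tail ⟨(he.adj ⟨a, ha⟩ ⟨b, hb⟩).1 hab.1, haN ha⟩
      · by_cases ha : a ∈ P
        · rcases ih.2 ha with ⟨i1, i2⟩ | ⟨i1, i2⟩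
          · exact .inl ⟨i1.step h.nodup_P h.noSkip_P hab.2 hab.1 hb, i2⟩
          · exact .inr ⟨i1.step h.nodup_Q h.noSkip_Q hab.2 hab.1 ((h.mem_Q _).1 hb), i2⟩
        · rcases h.entry a b ha hb hab.1 with rfl | rfl
          · exact .inl ⟨initial_head h.head_P, (ih.1 ha).tail
              ⟨(he.adj_p₁ ⟨a, ha⟩).1 hab.1, haN ha⟩⟩
          · exact .inr ⟨initial_head h.head_Q, (ih.1 ha).tail
              ⟨(he.adj_pin ⟨a, ha⟩).1 hab.1, haN ha⟩⟩
  intro y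
  by_cases hy : y ∈ P'
  · have r1 : (∃ x ∈ P, ¬ Initial Q L x) → ReflTransGen (Arcs A' (N ∪ M)) (e ⟨r, hr⟩) p₁' := by
      rintro ⟨x, hx, hxi⟩
      rcases (key x (hL x)).2 hx with h1 | h1
      · exact h1.2
      · exact absurd h1.1 hxi
    have r2 : (∃ x ∈ P, ¬ Initial P L x) → ReflTransGen (Arcs A' (N ∪ M)) (e ⟨r, hr⟩) pin' := by
      rintro ⟨x, hx, hxi⟩
      rcases (key x (hL x)).2 hx with h1 | h1
      · exact absurd h1.1 hxi
      · exact h1.2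
    rcases hcov y hy with ⟨c1, c2⟩ | ⟨c1, c2⟩ | ⟨c1, c2⟩
    · exact (r1 c2).trans (lift _ _ c1)
    · exact (r2 c2).trans (lift _ _ c1)
    · have hp : p₁ ∈ P := List.mem_of_mem_head? (by rw [h.head_P]; simp)
      rcases (key p₁ (hL _)).2 hp with h1 | h1
      · exact h1.2.trans (lift _ _ c1)
      · exact h1.2.trans (lift _ _ c2)
  · have := (key (e.symm ⟨y, hy⟩) (hL _)).1 (e.symm ⟨y, hy⟩).2
    simpa using this

/-- There are four cases according to the leaves inside the passage. A leaf other than `pl` blocks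
the crossing from `p₁` to `pl`, a leaf other than `pout` blocks the one from `pin` to `pout`. If
both are blocked, there are at most two leaves, and the two vertices from `split` can serve. If only
one is blocked, the single leaf is `pout` or `pl` and its counterpart serves. Otherwise there is no
leaf inside. -/
theorem exists_spans_of_agree [Finite V] [Finite V'] (h : TwoWay A P Q p₁ pin pout pl)
    (h' : TwoWay A' P' Q' p₁' pin' pout' pl')
    {e : {x // x ∉ P} ≃ {x // x ∉ P'}} (he : Agree A P p₁ pin pout pl A' P' p₁' pin' pout' pl' e)
    {r : V} (hr : r ∉ P) (hL : Spans A r L) :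
    ∃ L' : Set V', L.ncard ≤ L'.ncard ∧ Spans A' (e ⟨r, hr⟩) L' := by
  have hplP : pl ∈ P := List.mem_of_mem_getLast? (by rw [h.last_P]; simp)
  have hplP' : pl' ∈ P' := List.mem_of_mem_getLast? (by rw [h'.last_P]; simp)
  have hpoutP : pout ∈ P := (h.mem_Q _).2 (List.mem_of_mem_getLast? (by rw [h.last_Q]; simp))
  have hpoutP' : pout' ∈ P' := (h'.mem_Q _).2 (List.mem_of_mem_getLast? (by rw [h'.last_Q]; simp))
  have toP : ∀ {M : Set V'} {a b}, ReflTransGen (fun a b => A' a b ∧ a ∉ M ∧ a ∈ Q') a b →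
      ReflTransGen (fun a b => A' a b ∧ a ∉ M ∧ a ∈ P') a b := fun hab =>
    rtg_mono (fun _ _ h => by rwa [h'.mem_Q]) hab
  by_cases c1 : ∃ c ∈ L, c ∈ P ∧ c ≠ pl
  · by_cases c2 : ∃ c ∈ L, c ∈ P ∧ c ≠ pout
    · obtain ⟨c, hcL, hcP, hc⟩ := c1
      obtain ⟨d, hdL, hdP, hd⟩ := c2
      have n1 := not_initial_last h.nodup_P h.last_P hcP hcL hc
      have n2 := not_initial_last h.nodup_Q h.last_Q ((h.mem_Q _).1 hdP) hdL hd
      obtain ⟨x, y, hx, hy, hxy, g1, g2, g3, g4, g5, g6, g7⟩ := h'.split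
      refine spans_of_agree h h' he hr hL {x, y} ?_ ?_ ?_ ?_ ?_
      · rintro z (rfl | rfl) <;> assumption
      · rw [Set.ncard_pair hxy]
        -- Every leaf is reached, hence ends one of the two traversals.
        have hsub : {z ∈ L | z ∈ P} ⊆ {z ∈ L | Initial P L z} ∪ {z ∈ L | Initial Q L z} := by
          rintro z ⟨hz, hzP⟩
          have : ∀ x, ReflTransGen (Arcs A L) r x → x ∈ P → Initial P L x ∨ Initial Q L x := by
            intro x hx
            induction hx with
            | refl => exact fun h => absurd h hr
            | @tail a b _ hab ih =>
              intro hb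
              by_cases ha : a ∈ P
              · rcases ih ha with i1 | i1
                · exact .inl (i1.step h.nodup_P h.noSkip_P hab.2 hab.1 hb)
                · exact .inr (i1.step h.nodup_Q h.noSkip_Q hab.2 hab.1 ((h.mem_Q _).1 hb))
              · rcases h.entry a b ha hb hab.1 with rfl | rfl
                · exact .inl (initial_head h.head_P)
                · exact .inr (initial_head h.head_Q)
          rcases this z (hL z) hzP with h1 | h1
          · exact .inl ⟨hz, h1⟩
          · exact .inr ⟨hz, h1⟩
        have l1 : {z ∈ L | Initial P L z}.ncard ≤ 1 := (Set.ncard_le_one_iff (Set.toFinite _)).2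
          fun ha hb => ha.2.eq_of_mem h.nodup_P hb.2 ha.1 hb.1
        have l2 : {z ∈ L | Initial Q L z}.ncard ≤ 1 := (Set.ncard_le_one_iff (Set.toFinite _)).2
          fun ha hb => ha.2.eq_of_mem h.nodup_Q hb.2 ha.1 hb.1
        exact (Set.ncard_le_ncard hsub).trans ((Set.ncard_union_le _ _).trans (by omega))
      · exact fun _ => ⟨by simp [g1, g2], fun h1 => absurd h1 n1, fun _ => g6⟩
      · exact fun _ => ⟨by simp [g3, g4], fun _ => g5, fun h1 => absurd h1 n2⟩
      · intro b hb
        rcases g7 b hb with h1 | h1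
        · exact .inl ⟨h1, pout, hpoutP, n2⟩
        · exact .inr (.inl ⟨h1, pl, hplP, n1⟩)
    · push Not at c2
      obtain ⟨c, hcL, hcP, hc⟩ := c1
      have hcp := c2 c hcL hcP
      subst hcp
      have n1 := not_initial_last h.nodup_P h.last_P hcP hcL hc
      refine spans_of_agree h h' he hr hL {pout'} (by simpa using hpoutP') ?_ ?_ ?_ ?_
      · rw [Set.ncard_singleton]
        exact (Set.ncard_le_one_iff (Set.toFinite _)).2 fun ha hb => (c2 _ ha.1 ha.2).trans (c2 _ hb.1 hb.2).symm
      · exact fun _ => ⟨by simpa using h'.ne.symm, fun h1 => absurd h1 n1,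
          fun _ => toP (h'.swap.rtg_P le_rfl ((h'.mem_Q _).1 hplP'))⟩
      · exact fun h => absurd hcL h
      · exact fun b hb => .inr (.inl ⟨toP (h'.swap.rtg_P le_rfl ((h'.mem_Q _).1 hb)), pl, hplP, n1⟩)
  · push Not at c1
    by_cases c2 : pl ∈ L
    · have n2 := not_initial_last h.nodup_Q h.last_Q ((h.mem_Q _).1 hplP) c2 h.ne.symm
      refine spans_of_agree h h' he hr hL {pl'} (by simpa using hplP') ?_ ?_ ?_ ?_
      · rw [Set.ncard_singleton]
        exact (Set.ncard_le_one_iff (Set.toFinite _)).2 fun ha hb => (c1 _ ha.1 ha.2).trans (c1 _ hb.1 hb.2).symm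
      · exact fun h => absurd c2 h
      · exact fun _ => ⟨by simpa using h'.ne, fun _ => h'.rtg_P le_rfl hpoutP', fun h1 => absurd h1 n2⟩
      · exact fun b hb => .inl ⟨h'.rtg_P le_rfl hb, pout, hpoutP, n2⟩
    · refine spans_of_agree h h' he hr hL ∅ (by simp) ?_ ?_ ?_ ?_
      · have : {x ∈ L | x ∈ P} = ∅ := by
          ext x
          simp only [Set.mem_ofPred_eq, Set.mem_empty_iff_false, iff_false, not_and]
          exact fun hx hxP => c2 (c1 x hx hxP ▸ hx)
        simp [this]
      · exact fun _ => ⟨by simp, fun _ => h'.rtg_P (by simp) hplP',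
          fun _ => toP (h'.swap.rtg_P (by simp) ((h'.mem_Q _).1 hplP'))⟩
      · exact fun _ => ⟨by simp, fun _ => h'.rtg_P (by simp) hpoutP',
          fun _ => toP (h'.swap.rtg_P (by simp) ((h'.mem_Q _).1 hpoutP'))⟩
      · exact fun b hb => .inr (.inr ⟨h'.rtg_P (by simp) hb,
          toP (h'.swap.rtg_P (by simp) ((h'.mem_Q _).1 hb))⟩)

end TwoWay

end LeafKernel

namespace LeafKernel

open Relation

set_option linter.unusedSimpArgs false

/-! ### The path of the rule and its replacement as two-way passages -/

section ReplacePath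

variable {V : Type} {D : Digraph V} {r : V} {P Q : List V} {p₁ pin pout pl : V}

/-- The positions of the four special vertices on the two paths. -/
structure TwoPath.Pos (P Q : List V) (p₁ pin pout pl : V) (ii io t s : ℕ) : Prop where
  len : P.length = 7 ∨ P.length = 8
  lenQ : Q.length = P.length
  ii_mem : ii + 1 = P.length ∨ ii + 2 = P.length
  io_mem : io = 0 ∨ io = 1
  t_le : t ≤ 1
  s_ge : P.length ≤ s + 2
  s_lt : s < P.length
  p₁_P : ∀ h : 0 < P.length, P[0] = p₁
  pl_P : ∀ h : P.length - 1 < P.length, P[P.length - 1] = pl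
  pin_P : ∀ h : ii < P.length, P[ii] = pin
  pout_P : ∀ h : io < P.length, P[io] = pout
  pin_Q : ∀ h : 0 < Q.length, Q[0] = pin
  pout_Q : ∀ h : P.length - 1 < Q.length, Q[P.length - 1] = pout
  pl_Q : ∀ h : t < Q.length, Q[t] = pl
  p₁_Q : ∀ h : s < Q.length, Q[s] = p₁
  t_eq : ii + 1 = P.length ∧ t = 0 ∨ ii + 2 = P.length ∧ t = 1

/-- If `pin` immediately precedes `pl` on `P`, the arc between them cannot be a forward chord of
`Q`, so `pl` comes second on `Q`. In the same way `p₁` is the last or the last but one vertex of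
`Q`. -/
theorem TwoPath.exists_pos (h : TwoPath D r P Q p₁ pin pout pl) :
    ∃ ii io t s, TwoPath.Pos P Q p₁ pin pout pl ii io t s := by
  obtain ⟨cP, nP, hP, lP⟩ := h.path
  obtain ⟨cQ, nQ, hQ, lQ⟩ := h.path_Q
  have hl := h.length
  have hlen : Q.length = P.length :=
    (((List.perm_ext_iff_of_nodup nP nQ).2 h.mem_Q).length_eq).symm
  rw [List.head?_eq_getElem?, List.getElem?_eq_getElem (by omega), Option.some_inj] at hP hQ
  rw [List.getLast?_eq_getElem?, List.getElem?_eq_getElem (by omega), Option.some_inj] at lP lQ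
  have skQ := noSkip_iff.1 h.noSkip_Q
  have arcP := List.isChain_iff_getElem.1 cP
  have lQ' : Q[P.length - 1] = pout := by simpa only [hlen] using lQ
  have e1 : ∃ ii, (ii + 1 = P.length ∨ ii + 2 = P.length) ∧ ∃ hi : ii < P.length, P[ii] = pin := by
    rcases h.pin_mem with rfl | ⟨l, hl'⟩
    · exact ⟨P.length - 1, by omega, by omega, lP⟩
    · subst hl'
      exact ⟨l.length, by simp, by simp, by simp⟩
  have e2 : ∃ io, (io = 0 ∨ io = 1) ∧ ∃ hi : io < P.length, P[io] = pout := by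
    rcases h.pout_mem with rfl | ⟨l, hl'⟩
    · exact ⟨0, by omega, by omega, hP⟩
    · subst hl'
      exact ⟨1, by simp, by simp, by simp⟩
  obtain ⟨ii, hii, hii', hpin⟩ := e1
  obtain ⟨io, hio, hio', hpout⟩ := e2
  have e3 : ∃ t, ∃ ht : t < Q.length, Q[t] = pl ∧ t ≤ 1 ∧
      (ii + 1 = P.length ∧ t = 0 ∨ ii + 2 = P.length ∧ t = 1) := by
    rcases hii with hi | hi
    · refine ⟨0, by omega, ?_, by omega, by omega⟩
      rw [hQ, ← hpin, ← lP]
      congr 1; omega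
    · have hm : pl ∈ Q := (h.mem_Q _).1 (lP ▸ List.getElem_mem _)
      obtain ⟨t, ht, htq⟩ := List.mem_iff_getElem.1 hm
      have hA := arcP ii (by omega)
      have : P[ii + 1] = Q[t] := by
        rw [htq, ← lP]; congr 1; omega
      rw [this, hpin, ← hQ] at hA
      have h1 := skQ 0 t (by omega) ht hA
      have h2 : t ≠ 0 := by
        rintro rfl
        have : P[ii] = P[P.length - 1] := by rw [hpin, lP, ← htq, hQ]
        rw [nP.getElem_inj_iff] at this
        omega
      exact ⟨t, ht, htq, by omega, by omega⟩
  have e4 : ∃ s, ∃ hs : s < Q.length, Q[s] = p₁ ∧ P.length ≤ s + 2 := by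
    rcases hio with rfl | rfl
    · exact ⟨P.length - 1, by omega, by rw [lQ', ← hpout, hP], by omega⟩
    · have hm : p₁ ∈ Q := (h.mem_Q _).1 (hP ▸ List.getElem_mem _)
      obtain ⟨s, hs, hsq⟩ := List.mem_iff_getElem.1 hm
      have hA := arcP 0 (by omega)
      simp only [zero_add] at hA
      rw [hpout, hP, ← hsq, ← lQ'] at hA
      have := skQ s _ hs (by omega) hA
      exact ⟨s, hs, hsq, by omega⟩
  obtain ⟨t, ht, htq, ht1, hteq⟩ := e3
  obtain ⟨s, hs, hsq, hs1⟩ := e4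
  exact ⟨ii, io, t, s, hl, hlen, hii, hio, ht1, hs1, by omega, fun _ => hP, fun _ => lP, fun _ => hpin,
    fun _ => hpout, fun _ => hQ, fun _ => lQ', fun _ => htq, fun _ => hsq, hteq⟩

theorem TwoPath.pout_ne_pl (h : TwoPath D r P Q p₁ pin pout pl) : pout ≠ pl := by
  obtain ⟨ii, io, t, s, H⟩ := h.exists_pos
  have hl := H.len
  have := H.io_mem
  intro he
  rw [← H.pout_P (by omega), ← H.pl_P (by omega), h.path.2.1.getElem_inj_iff] at he
  omega

/-- Let `z` be the vertex after `pl` on `Q`. The two simultaneous leaves are the predecessors on `P`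
of `z` and of `pin`. From `p₁` one runs along `P` up to the first leaf; from `pin` one proceeds to
`pl`, jumps to `z` and runs along `P` up to the second. The condition `next_ne` ensures that `pout`
is not the predecessor of `z`. -/
theorem TwoPath.twoWay (h : TwoPath D r P Q p₁ pin pout pl) : TwoWay D.Adj P Q p₁ pin pout pl := by
  obtain ⟨ii, io, t, s, H⟩ := h.exists_pos
  obtain ⟨cP, nP, hP, lP⟩ := h.path
  obtain ⟨cQ, nQ, hQ, lQ⟩ := h.path_Q
  have hl := H.len
  have hlQ := H.lenQ
  have b1 := H.ii_mem
  have b2 := H.io_mem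
  have b3 := H.t_le
  have b4 := H.s_ge
  have b5 := H.s_lt
  have b6 := H.t_eq
  have arcP := List.isChain_iff_getElem.1 cP
  have arcQ := List.isChain_iff_getElem.1 cQ
  refine ⟨cP, nP, hP, lP, h.noSkip_P, cQ, nQ, hQ, lQ, h.noSkip_Q, h.mem_Q, h.pout_ne_pl,
    fun a b ha hb hab => (h.in_arcs b hb).1 ⟨a, ha, hab⟩,
    fun a b ha hb hab => (h.out_arcs a ha).1 ⟨b, hb, hab⟩, ?_⟩
  have hz : Q[t + 1] ∈ P := (h.mem_Q _).2 (List.getElem_mem _)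
  obtain ⟨iz, hiz, hzP⟩ := List.mem_iff_getElem.1 hz
  have hne : ∀ i (hi : i < P.length) j (hj : j < Q.length), P[i] = Q[j] → j ≠ t + 1 → iz ≠ i := by
    rintro i hi j hj he hjt rfl
    rw [hzP, nQ.getElem_inj_iff] at he
    omega
  -- The vertex at position `iz` of `P` is third or second on `Q`, hence different from the four end
  -- vertices, which sit at the extremes of `Q`. Together with `n5` this places it strictly between
  -- the successor of `pout` and `pin`.
  have n1 : iz ≠ io := hne _ (by omega) (P.length - 1) (by omega)
    (by rw [H.pout_P, H.pout_Q]) (by omega)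
  have n2 : iz ≠ 0 := hne _ (by omega) s (by omega) (by rw [H.p₁_P, H.p₁_Q]) (by omega)
  have n3 : iz ≠ ii := hne _ (by omega) 0 (by omega) (by rw [H.pin_P, H.pin_Q]) (by omega)
  have n4 : iz ≠ P.length - 1 := hne _ (by omega) t (by omega) (by rw [H.pl_P, H.pl_Q]) (by omega)
  have n5 : iz ≠ io + 1 := by
    rintro rfl
    refine h.next_ne P[io + 1] ?_ ?_
    · rw [← H.pout_P (by omega)]
      exact (nodup_infix_pair nP _ _).2 rfl
    · rw [← H.pl_Q (by omega), hzP]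
      exact (nodup_infix_pair nQ _ _).2 rfl
  have c1 : io + 2 ≤ iz := by omega
  have c2 : iz < ii := by omega
  have hne' : ∀ i j (hi : i < P.length) (hj : j < P.length), i ≠ j → P[i] ≠ P[j] :=
    fun i j hi hj hij he => hij (nP.getElem_inj_iff.1 he)
  have hM : ∀ m (hm : m < P.length), m ≠ iz - 1 → m ≠ ii - 1 → P[m] ∉ ({P[iz - 1], P[ii - 1]} : Set V) := by
    intro m hm h1 h2
    simp only [Set.mem_insert_iff, Set.mem_singleton_iff, nP.getElem_inj_iff]
    omega
  have alongP : ∀ i j (hj : j < P.length) (hij : i ≤ j), (∀ m, i ≤ m → m < j → m ≠ iz - 1 ∧ m ≠ ii - 1) →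
      ReflTransGen (fun a b => D.Adj a b ∧ a ∉ ({P[iz - 1], P[ii - 1]} : Set V) ∧ a ∈ P) P[i] P[j] :=
    fun i j hj hij hm => rtg_along_list cP hij hj fun m hm' h1 h2 => hM m hm' (hm m h1 h2).1 (hm m h1 h2).2
  have goz : ReflTransGen (fun a b => D.Adj a b ∧ a ∉ ({P[iz - 1], P[ii - 1]} : Set V) ∧ a ∈ P) pin pl := by
    rw [← H.pin_P (by omega), ← H.pl_P (by omega)]
    exact alongP _ _ _ (by omega) (by omega)
  refine ⟨P[iz - 1], P[ii - 1], List.getElem_mem _, List.getElem_mem _, hne' _ _ _ _ (by omega), ?_, ?_, ?_,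
    ?_, ?_, goz, ?_⟩
  · rw [← H.pl_P (by omega)]; exact hne' _ _ _ _ (by omega)
  · rw [← H.pl_P (by omega)]; exact hne' _ _ _ _ (by omega)
  · rw [← H.pout_P (by omega)]; exact hne' _ _ _ _ (by omega)
  · rw [← H.pout_P (by omega)]; exact hne' _ _ _ _ (by omega)
  · rw [← H.p₁_P (by omega), ← H.pout_P (by omega)]
    exact alongP _ _ _ (by omega) (by omega)
  · intro b hb
    obtain ⟨j, hj, rfl⟩ := List.mem_iff_getElem.1 hb
    by_cases j1 : j ≤ iz - 1
    · left
      rw [← H.p₁_P (by omega)]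
      exact alongP _ _ _ (by omega) (by omega)
    · right
      by_cases j2 : j < ii
      · refine (goz.tail (c := P[iz]) ⟨?_, ?_, ?_⟩).trans (alongP _ _ _ (by omega) (by omega))
        · rw [hzP, ← H.pl_Q (by omega)]; exact arcQ t _
        · rw [← H.pl_P (by omega)]; exact hM _ _ (by omega) (by omega)
        · rw [← H.pl_P (by omega)]; exact List.getElem_mem _
      · rw [← H.pin_P (by omega)]
        exact alongP _ _ _ (by omega) (by omega)

/-- A passage through two inner vertices `u` and `v`. -/
theorem exists_twoWay_of_short {W : Type} {B : W → W → Prop} {a b c d u v : W}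
    (hab : a ≠ b → B a b) (hcd : c ≠ d → B c d) 
    (h1 : a ≠ c) (h2 : a ≠ d) (h3 : b ≠ c) (h4 : b ≠ d) (hu : a ≠ u ∧ b ≠ u ∧ c ≠ u ∧ d ≠ u)
    (hv : a ≠ v ∧ b ≠ v ∧ c ≠ v ∧ d ≠ v) (huv : u ≠ v)
    (Bu : ∀ x, B u x ↔ x = v ∨ x = a) (Bv : ∀ x, B v x ↔ x = u ∨ x = c)
    (uB : ∀ x, B x u ↔ x = v ∨ x = b) (vB : ∀ x, B x v ↔ x = u ∨ x = d)
    (fwd : ¬ B a c ∧ ¬ B a d ∧ ¬ B b c ∧ ¬ B b d) (bwd : ¬ B c a ∧ ¬ B c b ∧ ¬ B d a ∧ ¬ B d b)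
    (entry : ∀ x, x ≠ a → x ≠ b → x ≠ c → x ≠ d → x ≠ u → x ≠ v →
      (B x b → b = a) ∧ (B x d → d = c))
    (exit : ∀ x, x ≠ a → x ≠ b → x ≠ c → x ≠ d → x ≠ u → x ≠ v →
      (B a x → a = b) ∧ (B c x → c = d)) :
    ∃ P' Q' : List W, TwoWay B P' Q' a c b d ∧
      ∀ x, x ∈ P' ↔ x = a ∨ x = b ∨ x = c ∨ x = d ∨ x = u ∨ x = v := by
  obtain ⟨hu1, hu2, hu3, hu4⟩ := hu
  obtain ⟨hv1, hv2, hv3, hv4⟩ := hv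
  obtain ⟨f1, f2, f3, f4⟩ := fwd
  obtain ⟨g1, g2, g3, g4⟩ := bwd
  have step : ∀ {M : Set W} {l : List W} {x y : W}, (x ≠ y → B x y) → x ∉ M → x ∈ l →
      ReflTransGen (fun a b => B a b ∧ a ∉ M ∧ a ∈ l) x y := by
    intro M l x y h hM hl
    by_cases hxy : x = y
    · subst hxy; exact .refl
    · exact .single ⟨h hxy, hM, hl⟩
  -- Either end of the passage may consist of one vertex or of two, hence the four combinations
  -- below.
  obtain ⟨L₁, c1⟩ : ∃ L : List W, (L = [a] ∧ a = b) ∨ (L = [a, b] ∧ a ≠ b ∧ B a b) := by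
    by_cases e : a = b
    · exact ⟨_, .inl ⟨rfl, e⟩⟩
    · exact ⟨_, .inr ⟨rfl, e, hab e⟩⟩
  obtain ⟨L₂, c2⟩ : ∃ L : List W, (L = [c] ∧ c = d) ∨ (L = [c, d] ∧ c ≠ d ∧ B c d) := by
    by_cases e : c = d
    · exact ⟨_, .inl ⟨rfl, e⟩⟩
    · exact ⟨_, .inr ⟨rfl, e, hcd e⟩⟩
  have mL₁ : ∀ x, x ∈ L₁ ↔ x = a ∨ x = b := by
    intro x
    rcases c1 with ⟨rfl, rfl⟩ | ⟨rfl, -⟩ <;> simp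
  have mL₂ : ∀ x, x ∈ L₂ ↔ x = c ∨ x = d := by
    intro x
    rcases c2 with ⟨rfl, rfl⟩ | ⟨rfl, -⟩ <;> simp
  have mem : ∀ x, x ∈ L₁ ++ u :: v :: L₂ ↔ x = a ∨ x = b ∨ x = c ∨ x = d ∨ x = u ∨ x = v := by
    intro x
    rw [List.mem_append, List.mem_cons, List.mem_cons, mL₁, mL₂]
    clear * -
    tauto
  have mem' : ∀ x, x ∈ L₂ ++ v :: u :: L₁ ↔ x = a ∨ x = b ∨ x = c ∨ x = d ∨ x = u ∨ x = v := by
    intro x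
    rw [List.mem_append, List.mem_cons, List.mem_cons, mL₁, mL₂]
    clear * -
    tauto
  refine ⟨L₁ ++ u :: v :: L₂, L₂ ++ v :: u :: L₁, ⟨?_, ?_, ?_, ?_, ?_, ?_, ?_, ?_, ?_, ?_, ?_, h4, ?_, ?_, ?_⟩,
    mem⟩
  · rcases c1 with ⟨e1, rfl⟩ | ⟨e1, e2, e3⟩ <;> rcases c2 with ⟨e4, rfl⟩ | ⟨e4, e5, e6⟩ <;> rw [e1, e4]
    · simp [Bu, Bv, uB, vB]
    · simp [e5, e6, Bu, Bv, uB, vB, Ne.symm e5]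
    · simp [e2, e3, Bu, Bv, uB, vB, Ne.symm e2]
    · simp [e2, e3, e5, e6, Bu, Bv, uB, vB, Ne.symm e2, Ne.symm e5]
  · rcases c1 with ⟨e1, rfl⟩ | ⟨e1, e2, e3⟩ <;> rcases c2 with ⟨e4, rfl⟩ | ⟨e4, e5, e6⟩ <;> rw [e1, e4]
    · simp [huv, huv.symm, hu1, hu2, hu3, hu4, hv1, hv2, hv3, hv4, hu1.symm, hu2.symm, hu3.symm, hu4.symm, hv1.symm, hv2.symm, hv3.symm, hv4.symm, h1, h2, h3, h4, h1.symm, h2.symm, h3.symm, h4.symm]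
    · simp [e5, e6, huv, huv.symm, hu1, hu2, hu3, hu4, hv1, hv2, hv3, hv4, hu1.symm, hu2.symm, hu3.symm, hu4.symm, hv1.symm, hv2.symm, hv3.symm, hv4.symm, h1, h2, h3, h4, h1.symm, h2.symm, h3.symm, h4.symm, Ne.symm e5]
    · simp [e2, e3, huv, huv.symm, hu1, hu2, hu3, hu4, hv1, hv2, hv3, hv4, hu1.symm, hu2.symm, hu3.symm, hu4.symm, hv1.symm, hv2.symm, hv3.symm, hv4.symm, h1, h2, h3, h4, h1.symm, h2.symm, h3.symm, h4.symm, Ne.symm e2]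
    · simp [e2, e3, e5, e6, huv, huv.symm, hu1, hu2, hu3, hu4, hv1, hv2, hv3, hv4, hu1.symm, hu2.symm, hu3.symm, hu4.symm, hv1.symm, hv2.symm, hv3.symm, hv4.symm, h1, h2, h3, h4, h1.symm, h2.symm, h3.symm, h4.symm, Ne.symm e2, Ne.symm e5]
  · rcases c1 with ⟨e1, rfl⟩ | ⟨e1, e2, e3⟩ <;> rcases c2 with ⟨e4, rfl⟩ | ⟨e4, e5, e6⟩ <;> rw [e1, e4] <;>
      simp []
  · rcases c1 with ⟨e1, rfl⟩ | ⟨e1, e2, e3⟩ <;> rcases c2 with ⟨e4, rfl⟩ | ⟨e4, e5, e6⟩ <;> rw [e1, e4] <;>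
      simp []
  · rcases c1 with ⟨e1, rfl⟩ | ⟨e1, e2, e3⟩ <;> rcases c2 with ⟨e4, rfl⟩ | ⟨e4, e5, e6⟩ <;> rw [e1, e4]
    · simp [NoSkip, huv, huv.symm, hu1, hu2, hu3, hu4, hv1, hv2, hv3, hv4, hu1.symm, hu2.symm, hu3.symm, hu4.symm, hv1.symm, hv2.symm, hv3.symm, hv4.symm, h1, h2, h3, h4, h1.symm, h2.symm, h3.symm, h4.symm, Bu, Bv, uB, vB, f1, f2, f3, f4, g1, g2, g3, g4]
    · simp [e5, e6, NoSkip, huv, huv.symm, hu1, hu2, hu3, hu4, hv1, hv2, hv3, hv4, hu1.symm, hu2.symm, hu3.symm, hu4.symm, hv1.symm, hv2.symm, hv3.symm, hv4.symm, h1, h2, h3, h4, h1.symm, h2.symm, h3.symm, h4.symm, Bu, Bv, uB, vB, f1, f2, f3, f4, g1, g2, g3, g4, Ne.symm e5]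
    · simp [e2, e3, NoSkip, huv, huv.symm, hu1, hu2, hu3, hu4, hv1, hv2, hv3, hv4, hu1.symm, hu2.symm, hu3.symm, hu4.symm, hv1.symm, hv2.symm, hv3.symm, hv4.symm, h1, h2, h3, h4, h1.symm, h2.symm, h3.symm, h4.symm, Bu, Bv, uB, vB, f1, f2, f3, f4, g1, g2, g3, g4, Ne.symm e2]
    · simp [e2, e3, e5, e6, NoSkip, huv, huv.symm, hu1, hu2, hu3, hu4, hv1, hv2, hv3, hv4, hu1.symm, hu2.symm, hu3.symm, hu4.symm, hv1.symm, hv2.symm, hv3.symm, hv4.symm, h1, h2, h3, h4, h1.symm, h2.symm, h3.symm, h4.symm, Bu, Bv, uB, vB, f1, f2, f3, f4, g1, g2, g3, g4, Ne.symm e2, Ne.symm e5]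
  · rcases c1 with ⟨e1, rfl⟩ | ⟨e1, e2, e3⟩ <;> rcases c2 with ⟨e4, rfl⟩ | ⟨e4, e5, e6⟩ <;> rw [e1, e4]
    · simp [Bu, Bv, uB, vB]
    · simp [e5, e6, Bu, Bv, uB, vB, Ne.symm e5]
    · simp [e2, e3, Bu, Bv, uB, vB, Ne.symm e2]
    · simp [e2, e3, e5, e6, Bu, Bv, uB, vB, Ne.symm e2, Ne.symm e5]
  · rcases c1 with ⟨e1, rfl⟩ | ⟨e1, e2, e3⟩ <;> rcases c2 with ⟨e4, rfl⟩ | ⟨e4, e5, e6⟩ <;> rw [e1, e4]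
    · simp [huv, huv.symm, hu1, hu2, hu3, hu4, hv1, hv2, hv3, hv4, hu1.symm, hu2.symm, hu3.symm, hu4.symm, hv1.symm, hv2.symm, hv3.symm, hv4.symm, h1, h2, h3, h4, h1.symm, h2.symm, h3.symm, h4.symm]
    · simp [e5, e6, huv, huv.symm, hu1, hu2, hu3, hu4, hv1, hv2, hv3, hv4, hu1.symm, hu2.symm, hu3.symm, hu4.symm, hv1.symm, hv2.symm, hv3.symm, hv4.symm, h1, h2, h3, h4, h1.symm, h2.symm, h3.symm, h4.symm, Ne.symm e5]
    · simp [e2, e3, huv, huv.symm, hu1, hu2, hu3, hu4, hv1, hv2, hv3, hv4, hu1.symm, hu2.symm, hu3.symm, hu4.symm, hv1.symm, hv2.symm, hv3.symm, hv4.symm, h1, h2, h3, h4, h1.symm, h2.symm, h3.symm, h4.symm, Ne.symm e2]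
    · simp [e2, e3, e5, e6, huv, huv.symm, hu1, hu2, hu3, hu4, hv1, hv2, hv3, hv4, hu1.symm, hu2.symm, hu3.symm, hu4.symm, hv1.symm, hv2.symm, hv3.symm, hv4.symm, h1, h2, h3, h4, h1.symm, h2.symm, h3.symm, h4.symm, Ne.symm e2, Ne.symm e5]
  · rcases c1 with ⟨e1, rfl⟩ | ⟨e1, e2, e3⟩ <;> rcases c2 with ⟨e4, rfl⟩ | ⟨e4, e5, e6⟩ <;> rw [e1, e4] <;>
      simp []
  · rcases c1 with ⟨e1, rfl⟩ | ⟨e1, e2, e3⟩ <;> rcases c2 with ⟨e4, rfl⟩ | ⟨e4, e5, e6⟩ <;> rw [e1, e4] <;>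
      simp []
  · rcases c1 with ⟨e1, rfl⟩ | ⟨e1, e2, e3⟩ <;> rcases c2 with ⟨e4, rfl⟩ | ⟨e4, e5, e6⟩ <;> rw [e1, e4]
    · simp [NoSkip, huv, huv.symm, hu1, hu2, hu3, hu4, hv1, hv2, hv3, hv4, hu1.symm, hu2.symm, hu3.symm, hu4.symm, hv1.symm, hv2.symm, hv3.symm, hv4.symm, h1, h2, h3, h4, h1.symm, h2.symm, h3.symm, h4.symm, Bu, Bv, uB, vB, f1, f2, f3, f4, g1, g2, g3, g4]
    · simp [e5, e6, NoSkip, huv, huv.symm, hu1, hu2, hu3, hu4, hv1, hv2, hv3, hv4, hu1.symm, hu2.symm, hu3.symm, hu4.symm, hv1.symm, hv2.symm, hv3.symm, hv4.symm, h1, h2, h3, h4, h1.symm, h2.symm, h3.symm, h4.symm, Bu, Bv, uB, vB, f1, f2, f3, f4, g1, g2, g3, g4, Ne.symm e5]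
    · simp [e2, e3, NoSkip, huv, huv.symm, hu1, hu2, hu3, hu4, hv1, hv2, hv3, hv4, hu1.symm, hu2.symm, hu3.symm, hu4.symm, hv1.symm, hv2.symm, hv3.symm, hv4.symm, h1, h2, h3, h4, h1.symm, h2.symm, h3.symm, h4.symm, Bu, Bv, uB, vB, f1, f2, f3, f4, g1, g2, g3, g4, Ne.symm e2]
    · simp [e2, e3, e5, e6, NoSkip, huv, huv.symm, hu1, hu2, hu3, hu4, hv1, hv2, hv3, hv4, hu1.symm, hu2.symm, hu3.symm, hu4.symm, hv1.symm, hv2.symm, hv3.symm, hv4.symm, h1, h2, h3, h4, h1.symm, h2.symm, h3.symm, h4.symm, Bu, Bv, uB, vB, f1, f2, f3, f4, g1, g2, g3, g4, Ne.symm e2, Ne.symm e5]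
  · intro x; rw [mem, mem']
  · intro x y hx hy hxy
    rw [mem] at hx hy
    push Not at hx
    obtain ⟨x1, x2, x3, x4, x5, x6⟩ := hx
    obtain ⟨k1, k2⟩ := entry x x1 x2 x3 x4 x5 x6
    rcases hy with rfl | rfl | rfl | rfl | rfl | rfl
    · exact .inl rfl
    · exact .inl (k1 hxy)
    · exact .inr rfl
    · exact .inr (k2 hxy)
    · exact absurd ((uB _).1 hxy) (by simp [x6, x2])
    · exact absurd ((vB _).1 hxy) (by simp [x5, x4])
  · intro x y hx hy hxy
    rw [mem] at hx hy
    push Not at hy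
    obtain ⟨x1, x2, x3, x4, x5, x6⟩ := hy
    obtain ⟨k1, k2⟩ := exit y x1 x2 x3 x4 x5 x6
    rcases hx with rfl | rfl | rfl | rfl | rfl | rfl
    · exact .inr (k1 hxy)
    · exact .inr rfl
    · exact .inl (k2 hxy)
    · exact .inl rfl
    · exact absurd ((Bu _).1 hxy) (by simp [x6, x1])
    · exact absurd ((Bv _).1 hxy) (by simp [x5, x3])
  · have pa : ∀ {x}, x = a ∨ x = b ∨ x = c ∨ x = d ∨ x = u ∨ x = v → x ∈ L₁ ++ u :: v :: L₂ :=
      (mem _).2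
    have sab := step (M := {u, v}) (l := L₁ ++ u :: v :: L₂) hab (by simp [hu1, hv1]) (pa (by simp))
    have scd := step (M := {u, v}) (l := L₁ ++ u :: v :: L₂) hcd (by simp [hu3, hv3]) (pa (by simp))
    -- Here the two new vertices themselves are the simultaneous leaves.
    refine ⟨u, v, pa (by simp), pa (by simp), huv, hu4, hv4, hu2, hv2, sab, scd, fun x hx => ?_⟩
    rw [mem] at hx
    rcases hx with rfl | rfl | rfl | rfl | rfl | rfl
    · exact .inl .refl
    · exact .inl sab
    · exact .inr .refl
    · exact .inr scd
    · exact .inl (sab.tail ⟨(uB _).2 (.inr rfl), by simp [hu2, hv2], pa (by simp)⟩)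
    · exact .inr (scd.tail ⟨(vB _).2 (.inr rfl), by simp [hu4, hv4], pa (by simp)⟩)

end ReplacePath

end LeafKernel

namespace LeafKernel

open Relation

section ReplacePath

variable {V : Type} {D : Digraph V} {r : V} {P Q : List V} {p₁ pin pout pl : V}

/-- Both the old path and its replacement are two-way passages with the same connections to the
outside, so the exchange lemma applies in either direction. -/
theorem brYes_replacePath_iff [Finite V] (h : TwoPath D r P Q p₁ pin pout pl) (k : ℕ) :
    BrYes (D.replacePath P p₁ pin pout pl).Adj (.inl ⟨r, fun hP => absurd hP h.root_notMem⟩) k ↔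
      BrYes D.Adj r k := by
  classical
  obtain ⟨ii, io, t, s, H⟩ := h.exists_pos
  have nP := h.path.2.1
  have nQ := h.path_Q.2.1
  have hl := H.len
  have hlQ := H.lenQ
  have b1 := H.ii_mem
  have b2 := H.io_mem
  have b3 := H.t_le
  have b4 := H.s_ge
  have b5 := H.s_lt
  have b6 := H.t_eq
  have arcP := List.isChain_iff_getElem.1 h.path.1
  have skP : ∀ i j (hi : i < P.length) (hj : j < P.length), i + 1 < j → ¬ D.Adj P[i] P[j] :=
    fun i j hi hj hij hA => by have := noSkip_iff.1 h.noSkip_P i j hi hj hA; omega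
  have skQ : ∀ i j (hi : i < Q.length) (hj : j < Q.length), i + 1 < j → ¬ D.Adj Q[i] Q[j] :=
    fun i j hi hj hij hA => by have := noSkip_iff.1 h.noSkip_Q i j hi hj hA; omega
  have ne : ∀ i j (hi : i < P.length) (hj : j < P.length), i ≠ j → P[i] ≠ P[j] :=
    fun i j hi hj hij he => hij (nP.getElem_inj_iff.1 he)
  have m1 : p₁ ∈ P := H.p₁_P (by omega) ▸ List.getElem_mem _
  have m2 : pl ∈ P := H.pl_P (by omega) ▸ List.getElem_mem _
  have m3 : pin ∈ P := H.pin_P (by omega) ▸ List.getElem_mem _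
  have m4 : pout ∈ P := H.pout_P (by omega) ▸ List.getElem_mem _
  have kp : ∀ x, x = p₁ ∨ x = pin ∨ x = pout ∨ x = pl → Digraph.Kept P p₁ pin pout pl x := fun x hx _ => hx
  have e1 := H.p₁_P (by omega)
  have e2 := H.pl_P (by omega)
  have e3 := H.pin_P (by omega)
  have e4 := H.pout_P (by omega)
  have q1 := H.p₁_Q (by omega)
  have q2 := H.pl_Q (by omega)
  have q3 := H.pin_Q (by omega)
  have q4 := H.pout_Q (by omega)
  have d1 : p₁ ≠ pin := by rw [← e1, ← e3]; exact ne _ _ _ _ (by omega)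
  have d2 : p₁ ≠ pl := by rw [← e1, ← e2]; exact ne _ _ _ _ (by omega)
  have d3 : pout ≠ pin := by rw [← e4, ← e3]; exact ne _ _ _ _ (by omega)
  have d4 := h.pout_ne_pl
  have h' := exists_twoWay_of_short (B := (D.replacePath P p₁ pin pout pl).Adj)
    (a := .inl ⟨p₁, kp _ (by simp)⟩) (b := .inl ⟨pout, kp _ (by simp)⟩)
    (c := .inl ⟨pin, kp _ (by simp)⟩) (d := .inl ⟨pl, kp _ (by simp)⟩)
    (u := .inr false) (v := .inr true) ?_ ?_ (by simpa using d1) (by simpa using d2) (by simpa using d3)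
    (by simpa using d4) (by simp) (by simp) (by simp) ?_ ?_ ?_ ?_ ?_ ?_ ?_ ?_
  rotate_left
  · intro hne
    show D.Adj p₁ pout
    have hio : io = 1 := by
      refine b2.resolve_left ?_
      rintro rfl
      exact hne (by simp [← e1, ← e4])
    subst hio
    rw [← e1, ← e4]
    exact arcP 0 (by omega)
  · intro hne
    show D.Adj pin pl
    have hii : ii + 1 = P.length - 1 := by
      by_contra hc
      refine hne ?_
      have : pin = pl := by rw [← e2, ← e3]; congr 1; omega
      simp [this]
    rw [← e3, ← e2]
    simpa only [hii] using arcP ii (by omega)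
  · rintro (x | _ | _) <;> simp [Digraph.replacePath, Subtype.ext_iff]
  · rintro (x | _ | _) <;> simp [Digraph.replacePath, Subtype.ext_iff]
  · rintro (x | _ | _) <;> simp [Digraph.replacePath, Subtype.ext_iff]
  · rintro (x | _ | _) <;> simp [Digraph.replacePath, Subtype.ext_iff]
  · show ¬ D.Adj p₁ pin ∧ ¬ D.Adj p₁ pl ∧ ¬ D.Adj pout pin ∧ ¬ D.Adj pout pl
    rw [← e1, ← e2, ← e3, ← e4]
    exact ⟨skP _ _ _ _ (by omega), skP _ _ _ _ (by omega), skP _ _ _ _ (by omega), skP _ _ _ _ (by omega)⟩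
  · show ¬ D.Adj pin p₁ ∧ ¬ D.Adj pin pout ∧ ¬ D.Adj pl p₁ ∧ ¬ D.Adj pl pout
    rw [← q1, ← q2, ← q3, ← q4]
    exact ⟨skQ _ _ _ _ (by omega), skQ _ _ _ _ (by omega), skQ _ _ _ _ (by omega), skQ _ _ _ _ (by omega)⟩
  · rintro (⟨x, hx⟩ | _ | _) <;> simp only [ne_eq, Sum.inl.injEq, Subtype.mk.injEq, not_true, false_implies,
      implies_true, reduceCtorEq, not_false_eq_true, true_implies]
    intro x1 x2 x3 x4
    have hxP : x ∉ P := fun hh => by rcases hx hh with h | h | h | h <;> contradiction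
    refine ⟨fun hA => ?_, fun hA => ?_⟩
    · exact ((h.in_arcs _ m4).1 ⟨x, hxP, hA⟩).resolve_right d3
    · exact ((h.in_arcs _ m2).1 ⟨x, hxP, hA⟩).resolve_left d2.symm
  · rintro (⟨x, hx⟩ | _ | _) <;> simp only [ne_eq, Sum.inl.injEq, Subtype.mk.injEq, not_true, false_implies,
      implies_true, reduceCtorEq, not_false_eq_true, true_implies]
    intro x1 x2 x3 x4
    have hxP : x ∉ P := fun hh => by rcases hx hh with h | h | h | h <;> contradiction
    refine ⟨fun hA => ?_, fun hA => ?_⟩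
    · exact ((h.out_arcs _ m1).1 ⟨x, hxP, hA⟩).resolve_left d2
    · exact ((h.out_arcs _ m3).1 ⟨x, hxP, hA⟩).resolve_right d3.symm
  obtain ⟨P', Q', h', hmem⟩ := h'
  have hinl : ∀ x (hx : x ∉ P), (.inl ⟨x, fun hP => absurd hP hx⟩ : {x : V // Digraph.Kept P p₁ pin pout pl x} ⊕ Bool) ∉ P' := by
    intro x hx
    simp only [hmem, Sum.inl.injEq, reduceCtorEq, or_false]
    rintro (h | h | h | h)
    · exact hx (by rw [show x = _ from congrArg Subtype.val h]; exact m1)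
    · exact hx (by rw [show x = _ from congrArg Subtype.val h]; exact m4)
    · exact hx (by rw [show x = _ from congrArg Subtype.val h]; exact m3)
    · exact hx (by rw [show x = _ from congrArg Subtype.val h]; exact m2)
  let e : {x // x ∉ P} ≃ {x : {x : V // Digraph.Kept P p₁ pin pout pl x} ⊕ Bool // x ∉ P'} := Equiv.ofBijective
    (fun x => ⟨.inl ⟨x, fun hP => absurd hP x.2⟩, hinl x x.2⟩) (by
      constructor
      · rintro ⟨x, hx⟩ ⟨y, hy⟩ hxy
        exact Subtype.ext (congrArg Subtype.val (Sum.inl.inj (Subtype.ext_iff.1 hxy)) : x = y)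
      · rintro ⟨(⟨x, hx⟩ | _ | _), hy⟩
        · have hxP : x ∉ P := by
            intro hh
            apply hy
            rw [hmem]
            rcases hx hh with h | h | h | h <;> simp [h]
          exact ⟨⟨x, hxP⟩, rfl⟩
        · exact absurd ((hmem _).2 (by simp)) hy
        · exact absurd ((hmem _).2 (by simp)) hy)
  have he : Agree D.Adj P p₁ pin pout pl (D.replacePath P p₁ pin pout pl).Adj P'
      (.inl ⟨p₁, kp _ (by simp)⟩) (.inl ⟨pin, kp _ (by simp)⟩) (.inl ⟨pout, kp _ (by simp)⟩)
      (.inl ⟨pl, kp _ (by simp)⟩) e :=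
    ⟨fun _ _ => Iff.rfl, fun _ => Iff.rfl, fun _ => Iff.rfl, fun _ => Iff.rfl, fun _ => Iff.rfl⟩
  constructor
  · rintro ⟨L, hk, hL⟩
    obtain ⟨L', hc, hL'⟩ := exists_spans_of_agree h' h.twoWay he.symm (hinl r h.root_notMem) hL
    have : e.symm ⟨_, hinl r h.root_notMem⟩ = ⟨r, h.root_notMem⟩ := by
      rw [Equiv.symm_apply_eq]; rfl
    rw [this] at hL'
    exact ⟨L', hk.trans hc, hL'⟩
  · rintro ⟨L, hk, hL⟩
    obtain ⟨L', hc, hL'⟩ := exists_spans_of_agree h.twoWay h' he h.root_notMem hL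
    exact ⟨L', hk.trans hc, hL'⟩

end ReplacePath

end LeafKernel

namespace LeafKernel

open Relation

/-! ### Branchings with many leaves -/

section LeafyTrees

variable {V : Type} [Finite V]

/-- A hitting set for edges with at least two vertices each. -/
theorem exists_hitting_set [DecidableEq V] {ι : Type} [DecidableEq ι] (e : ι → Finset V) :
    ∀ (m : ℕ) (I : Finset ι) (X : Finset V), I.card = m → (∀ i ∈ I, 2 ≤ (e i ∩ X).card) →
      ∃ H ⊆ X, (∀ i ∈ I, (e i ∩ H).Nonempty) ∧ 3 * H.card ≤ X.card + I.card := by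
  intro m
  induction m using Nat.strong_induction_on with
  | _ m ih =>
    intro I X hm hI
    rcases I.eq_empty_or_nonempty with rfl | ⟨i, hi⟩
    · exact ⟨∅, by simp, by simp, by simp⟩
    by_cases hx : ∃ x ∈ X, 2 ≤ (I.filter fun j => x ∈ e j).card
    · obtain ⟨x, hxX, hx⟩ := hx
      have hsplit := Finset.card_filter_add_card_filter_not (s := I) (fun j => x ∈ e j)
      have hlt : (I.filter fun j => x ∉ e j).card < m := by omega
      -- A vertex in at least two edges is chosen: the ground set loses one vertex and at least two
      -- edges are hit, which pays for the factor three.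
      obtain ⟨H, hH, hH1, hH2⟩ := ih _ hlt (I.filter fun j => x ∉ e j) (X.erase x) rfl (by
        intro j hj
        rw [Finset.mem_filter] at hj
        rw [Finset.inter_erase, Finset.erase_eq_of_notMem]
        · exact hI j hj.1
        · simp [hj.2])
      refine ⟨insert x H, Finset.insert_subset hxX (hH.trans (Finset.erase_subset _ _)), ?_, ?_⟩
      · intro j hj
        by_cases hjx : x ∈ e j
        · exact ⟨x, by simp [hjx]⟩
        · obtain ⟨y, hy⟩ := hH1 j (by simp [hj, hjx])
          rw [Finset.mem_inter] at hy
          exact ⟨y, by simp [hy]⟩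
      · have h1 := Finset.card_insert_le x H
        have h2 := Finset.card_erase_of_mem hxX
        have h3 : 0 < X.card := Finset.card_pos.2 ⟨x, hxX⟩
        omega
    · push Not at hx
      have huniq : ∀ x ∈ X, ∀ j ∈ I, ∀ j' ∈ I, x ∈ e j → x ∈ e j' → j = j' := by
        intro x hxX j hj j' hj' h h'
        have := hx x hxX
        exact Finset.card_le_one.1 (Nat.le_of_lt_succ this) j (by simp [hj, h]) j' (by simp [hj', h'])
      -- Now the edges are disjoint inside `X`. Choosing `a` and discarding `a`, `b` and the edge
      -- `i` again lowers the sum by three.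
      obtain ⟨a, ha, b, hb, hab⟩ := Finset.one_lt_card.1 (hI i hi)
      rw [Finset.mem_inter] at ha hb
      obtain ⟨H, hH, hH1, hH2⟩ := ih _ (by
          rw [Finset.card_erase_of_mem hi]
          have : 0 < I.card := Finset.card_pos.2 ⟨i, hi⟩
          omega) (I.erase i) ((X.erase a).erase b) rfl (by
        intro j hj
        rw [Finset.mem_erase] at hj
        rw [Finset.inter_erase, Finset.inter_erase, Finset.erase_eq_of_notMem, Finset.erase_eq_of_notMem]
        · exact hI j hj.2
        · intro h
          rw [Finset.mem_inter] at h
          exact hj.1 (huniq a ha.2 _ hj.2 _ hi h.1 ha.1)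
        · intro h
          rw [Finset.mem_erase, Finset.mem_inter] at h
          exact hj.1 (huniq b hb.2 _ hj.2 _ hi h.2.1 hb.1))
      have hHX : H ⊆ X := hH.trans ((Finset.erase_subset _ _).trans (Finset.erase_subset _ _))
      refine ⟨insert a H, Finset.insert_subset ha.2 hHX, ?_, ?_⟩
      · intro j hj
        by_cases hji : j = i
        · subst hji; exact ⟨a, by simp [ha.1]⟩
        · obtain ⟨y, hy⟩ := hH1 j (by simp [hj, hji])
          rw [Finset.mem_inter] at hy
          exact ⟨y, by simp [hy]⟩
      · have h1 := Finset.card_insert_le a H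
        have h2 := Finset.card_erase_of_mem (s := X.erase a) (a := b) (by simp [hb.2, hab.symm])
        have h3 := Finset.card_erase_of_mem ha.2
        have h4 := Finset.card_erase_of_mem hi
        have h5 : 1 < X.card := Finset.one_lt_card.2 ⟨a, ha.2, b, hb.2, hab⟩
        have h6 : 0 < I.card := Finset.card_pos.2 ⟨i, hi⟩
        omega

/-- If arcs that respect a strict order reach everything, then a third of the vertices with two such
in-arcs can be made leaves. -/
theorem exists_spans_of_order {A R : V → V → Prop} {r : V} (hR : WellFounded R)
    (hp : ∀ w, w ≠ r → ∃ x, A x w ∧ R x w) :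
    ∃ L, Spans A r L ∧
      {w | w ≠ r ∧ ∃ x y, x ≠ y ∧ A x w ∧ R x w ∧ A y w ∧ R y w}.ncard + 2 ≤ 3 * L.ncard := by
  classical
  have := Fintype.ofFinite V
  let N : V → Finset V := fun w => Finset.univ.filter fun x => A x w ∧ R x w
  have hN : ∀ x w, x ∈ N w ↔ A x w ∧ R x w := by simp [N]
  let W : Finset V := Finset.univ.filter fun w => w ≠ r ∧ 2 ≤ (N w).card
  let C : Finset V := Finset.univ.filter fun w => w ≠ r ∧ (N w).card = 1
  choose! g hg using hp
  -- Vertices of `C` have a single admissible in-arc, so the tails in `U` cannot be leaves. The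
  -- vertices of `W` with no in-neighbour in `U`, collected in `I`, are served by a hitting set `H`;
  -- all remaining vertices become leaves.
  let U : Finset V := C.image g
  let I : Finset V := W.filter fun w => Disjoint (N w) U
  have hI : ∀ w ∈ I, 2 ≤ (N w ∩ Uᶜ).card := by
    intro w hw
    simp only [I, W, Finset.mem_filter, Finset.mem_univ, true_and] at hw
    have : N w ∩ Uᶜ = N w := by
      rw [Finset.inter_eq_left]
      intro x hx
      rw [Finset.mem_compl]
      exact Finset.disjoint_left.1 hw.2 hx
    rw [this]; exact hw.1.2
  obtain ⟨H, hH, hH1, hH2⟩ := exists_hitting_set N _ I Uᶜ rfl hI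
  refine ⟨((Uᶜ \ H : Finset V) : Set V), ?_, ?_⟩
  · intro w
    induction w using hR.induction with
    | _ w ih =>
      by_cases hwr : w = r
      · subst hwr; exact .refl
      · have key : ∃ x ∈ N w, x ∈ U ∨ x ∈ H := by
          by_cases h2 : 2 ≤ (N w).card
          · by_cases hd : Disjoint (N w) U
            · obtain ⟨x, hx⟩ := hH1 w (by simp [I, W, hwr, h2, hd])
              rw [Finset.mem_inter] at hx
              exact ⟨x, hx.1, .inr hx.2⟩
            · rw [Finset.not_disjoint_iff] at hd
              obtain ⟨x, h1, h2⟩ := hd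
              exact ⟨x, h1, .inl h2⟩
          · have h0 : 0 < (N w).card := Finset.card_pos.2 ⟨g w, (hN _ _).2 (hg w hwr)⟩
            exact ⟨g w, (hN _ _).2 (hg w hwr), .inl (Finset.mem_image_of_mem g (by simp [C, hwr]; omega))⟩
        obtain ⟨x, hx, hxL⟩ := key
        obtain ⟨h1, h2⟩ := (hN _ _).1 hx
        exact (ih x h2).tail ⟨h1, by simp; tauto⟩
  -- With `u` vertices outside `U`, the number of leaves is `u - |H|`, at least `(2 * u - |I|) / 3`.
  -- Since `|I| ≤ |W|` and `|U| ≤ |C|`, also `u ≥ |W| + 1`, the root lying in neither `C` nor `W`.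
  · rw [Set.ncard_coe_finset, Finset.card_sdiff_of_subset hH, Finset.card_compl]
    have hW : {w | w ≠ r ∧ ∃ x y, x ≠ y ∧ A x w ∧ R x w ∧ A y w ∧ R y w}.ncard = W.card := by
      rw [← Set.ncard_coe_finset]
      congr 1
      ext w
      simp only [Set.mem_ofPred_eq, W, Finset.coe_filter, Finset.mem_univ, true_and, and_congr_right_iff]
      intro _
      constructor
      · rintro ⟨x, y, hxy, h1, h2, h3, h4⟩
        exact Finset.one_lt_card.2 ⟨x, (hN _ _).2 ⟨h1, h2⟩, y, (hN _ _).2 ⟨h3, h4⟩, hxy⟩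
      · intro h
        obtain ⟨x, hx, y, hy, hxy⟩ := Finset.one_lt_card.1 h
        rw [hN] at hx hy
        exact ⟨x, y, hxy, hx.1, hx.2, hy.1, hy.2⟩
    have h1 : U.card ≤ C.card := Finset.card_image_le
    have h2 : C.card + W.card + 1 ≤ Fintype.card V := by
      have hd : Disjoint C W := by
        rw [Finset.disjoint_left]
        intro w hw hw'
        simp only [C, W, Finset.mem_filter] at hw hw'
        omega
      rw [← Finset.card_union_of_disjoint hd, ← Finset.card_insert_of_notMem (a := r)]
      · exact Finset.card_le_univ _
      · simp [C, W]
    have h3 : I.card ≤ W.card := Finset.card_filter_le _ _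
    have h4 : H.card ≤ Uᶜ.card := Finset.card_le_card hH
    rw [Finset.card_compl] at hH2 h4
    omega

end LeafyTrees

/-! ### Parent functions, ancestors and lexicographic orders -/

section Trees

variable {V : Type} {g : V → V} {r : V}

/-- The arcs of the tree in which the parent of a vertex `b` other than the root is `g b`. -/
def Step (g : V → V) (r : V) (a b : V) : Prop := b ≠ r ∧ g b = a

/-- `z` is an ancestor of `w`, possibly `w` itself. -/
def Anc (g : V → V) (r : V) (z w : V) : Prop := ReflTransGen (Step g r) z w

/-- The parent function `g` describes a tree with root `r`. -/
def IsParentFn (g : V → V) (r : V) : Prop := ∀ w, Anc g r r w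

theorem IsParentFn.wellFounded (h : IsParentFn g r) : WellFounded (Step g r) := by
  refine ⟨fun w => ?_⟩
  have hw := h w
  unfold Anc at hw
  induction hw with
  | refl => exact ⟨_, fun y hy => absurd rfl hy.1⟩
  | tail _ h ih =>
    refine ⟨_, fun y hy => ?_⟩
    obtain rfl : y = _ := hy.2.symm.trans h.2
    exact ih

theorem Anc.eq_or {z w : V} (h : Anc g r z w) : z = w ∨ (w ≠ r ∧ Anc g r z (g w)) := by
  rcases ReflTransGen.cases_tail h with h | ⟨x, h1, h2⟩
  · exact .inl h.symm
  · exact .inr ⟨h2.1, h2.2.symm ▸ h1⟩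

theorem anc_parent {w : V} (h : w ≠ r) : Anc g r (g w) w := .single ⟨h, rfl⟩

theorem Anc.trans {a b c : V} (h : Anc g r a b) (h' : Anc g r b c) : Anc g r a c :=
  ReflTransGen.trans h h'

theorem IsParentFn.antisymm (h : IsParentFn g r) {a b : V} (hab : Anc g r a b) (hba : Anc g r b a) : a = b := by
  by_contra hne
  have h1 : TransGen (Step g r) a b := (reflTransGen_iff_eq_or_transGen.1 hab).resolve_left fun e => hne e.symm
  have h2 : TransGen (Step g r) b a := (reflTransGen_iff_eq_or_transGen.1 hba).resolve_left hne
  exact h.wellFounded.transGen.irrefl.irrefl a (h1.trans h2)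

/-- The ancestors of a vertex are comparable. -/
theorem Anc.total {a b w : V} (ha : Anc g r a w) (hb : Anc g r b w) : Anc g r a b ∨ Anc g r b a := by
  unfold Anc at ha
  induction ha with
  | refl => exact .inr hb
  | tail h1 h2 ih =>
    rcases hb.eq_or with rfl | ⟨_, hb'⟩
    · exact .inl (h1.tail h2)
    · rw [h2.2] at hb'; exact ih hb'

end Trees

section TreeOrders

variable {V : Type} {g : V → V} {r : V}

/-- The list of the ancestors. -/
theorem IsParentFn.exists_list (h : IsParentFn g r) :
    ∃ p : V → List V, (∀ w, w ∈ p w ∧ ∀ x ∈ p w, Anc g r x w) ∧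
      ∀ z w, Anc g r z w → z ≠ w → ∃ l, l ≠ [] ∧ p w = p z ++ l := by
  classical
  let F : ∀ w, (∀ y, Step g r y w → List V) → List V := fun w f =>
    if hw : w = r then [w] else f (g w) ⟨hw, rfl⟩ ++ [w]
  let p : V → List V := h.wellFounded.fix F
  have hp : ∀ w, p w = if w = r then [w] else p (g w) ++ [w] := by
    intro w
    have := h.wellFounded.fix_eq F w
    rw [show p w = _ from this]
    simp only [F, p]
    split_ifs <;> rfl
  refine ⟨p, fun w => ?_, fun z w hzw hne => ?_⟩
  · induction w using h.wellFounded.induction with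
    | _ w ih =>
      rw [hp w]
      split_ifs with hw
      · simp only [List.mem_singleton, true_and, forall_eq]; exact .refl
      · refine ⟨by simp, fun x hx => ?_⟩
        rw [List.mem_append, List.mem_singleton] at hx
        rcases hx with hx | rfl
        · exact ((ih _ ⟨hw, rfl⟩).2 x hx).trans (anc_parent hw)
        · exact .refl
  · unfold Anc at hzw
    induction hzw with
    | refl => exact absurd rfl hne
    | @tail x y h1 h2 ih =>
      obtain ⟨hy, rfl⟩ := h2
      rw [hp y, if_neg hy]
      by_cases hzx : z = g y
      · exact ⟨[y], by simp, by rw [hzx]⟩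
      · obtain ⟨l, -, hl⟩ := ih hzx
        exact ⟨l ++ [y], by simp, by rw [hl, List.append_assoc]⟩

theorem lex_append {T : V → V → Prop} {l m : List V} (hm : m ≠ []) : List.Lex T l (l ++ m) := by
  induction l with
  | nil => obtain ⟨a, m, rfl⟩ := List.exists_cons_of_ne_nil hm; exact .nil
  | cons a l ih => exact .cons ih

theorem prefix_or_lex {T : V → V → Prop} (hT : ∀ a b, a ≠ b → T a b ∨ T b a) : ∀ l m : List V,
    l <+: m ∨ m <+: l ∨ List.Lex T l m ∨ List.Lex (fun a b => T b a) l m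
  | [], m => .inl (List.nil_prefix)
  | l, [] => .inr (.inl List.nil_prefix)
  | a :: l, b :: m => by
    by_cases hab : a = b
    · subst hab
      rcases prefix_or_lex hT l m with h | h | h | h
      · exact .inl (by simpa using h)
      · exact .inr (.inl (by simpa using h))
      · exact .inr (.inr (.inl (.cons h)))
      · exact .inr (.inr (.inr (.cons h)))
    · rcases hT a b hab with h | h
      · exact .inr (.inr (.inl (.rel h)))
      · exact .inr (.inr (.inr (.rel h)))

theorem lex_wellFounded [Finite V] {T : V → V → Prop} [IsStrictTotalOrder V T] {p : V → List V} :
    WellFounded (fun a b => List.Lex T (p a) (p b)) := by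
  have : IsTrans V (fun a b => List.Lex T (p a) (p b)) := ⟨fun a b c h h' => List.lex_trans (fun h h' => _root_.trans h h') h h'⟩
  have : Std.Irrefl (fun a b => List.Lex T (p a) (p b)) := ⟨fun a h => irrefl _ h⟩
  exact Finite.wellFounded_of_trans_of_irrefl _

/-- In a digraph all of whose leafy branchings have few leaves, few vertices have an in-neighbour
other than the parent that is not a descendant. -/
theorem IsParentFn.ncard_le [Finite V] (h : IsParentFn g r) {A : V → V → Prop}
    (hA : ∀ w, w ≠ r → A (g w) w) {k : ℕ} (hk : ∀ L, Spans A r L → L.ncard ≤ k) :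
    {w | w ≠ r ∧ ∃ x, A x w ∧ x ≠ g w ∧ ¬ Anc g r w x}.ncard + 4 ≤ 6 * k := by
  classical
  obtain ⟨p, hp1, hp2⟩ := h.exists_list
  obtain ⟨T, hT⟩ : ∃ T : V → V → Prop, IsStrictTotalOrder V T := ⟨WellOrderingRel, inferInstance⟩
  have hT' : IsStrictTotalOrder V (fun a b => T b a) := IsStrictTotalOrder.swap T
  have par : ∀ w, w ≠ r → ∃ l, l ≠ [] ∧ p w = p (g w) ++ l := fun w hw =>
    hp2 _ _ (anc_parent hw) (fun e => h.wellFounded.irrefl.irrefl w ⟨hw, e⟩)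
  obtain ⟨L₁, s1, c1⟩ := exists_spans_of_order (A := A) (r := r) (lex_wellFounded (T := T) (p := p))
    fun w hw => ⟨g w, hA w hw, by
      obtain ⟨l, hl, e⟩ := par w hw
      simp only [e]; exact lex_append hl⟩
  obtain ⟨L₂, s2, c2⟩ := exists_spans_of_order (A := A) (r := r) (lex_wellFounded (T := fun a b => T b a) (p := p))
    fun w hw => ⟨g w, hA w hw, by
      obtain ⟨l, hl, e⟩ := par w hw
      simp only [e]; exact lex_append hl⟩
  have k1 := hk _ s1
  have k2 := hk _ s2
  -- The vertices are ordered by their ancestor lists, lexicographically with respect to `T` or to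
  -- its reverse. The parent of `w` precedes `w` in both orders. An in-neighbour that is not a
  -- descendant precedes `w` in at least one of them, which gives `w` two admissible in-arcs there.
  have hsub : {w | w ≠ r ∧ ∃ x, A x w ∧ x ≠ g w ∧ ¬ Anc g r w x} ⊆
      {w | w ≠ r ∧ ∃ x y, x ≠ y ∧ A x w ∧ List.Lex T (p x) (p w) ∧ A y w ∧ List.Lex T (p y) (p w)} ∪
      {w | w ≠ r ∧ ∃ x y, x ≠ y ∧ A x w ∧ List.Lex (fun a b => T b a) (p x) (p w) ∧ A y w ∧
        List.Lex (fun a b => T b a) (p y) (p w)} := by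
    intro w hw
    obtain ⟨hwr, x, hx, hxg, hxw⟩ := hw
    have hl : List.Lex T (p x) (p w) ∨ List.Lex (fun a b => T b a) (p x) (p w) := by
      have pre : ∀ a b, p a <+: p b → Anc g r a b := fun a b hab => (hp1 b).2 a (hab.subset (hp1 a).1)
      rcases prefix_or_lex (T := T) (fun a b hab => by
        rcases trichotomous_of T a b with h | h | h <;> tauto) (p x) (p w) with h1 | h1 | h1 | h1
      · have hne : x ≠ w := by rintro rfl; exact hxw .refl
        obtain ⟨l, hl, e⟩ := hp2 _ _ (pre _ _ h1) hne
        rw [e]; exact .inl (lex_append hl)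
      · exact absurd (pre _ _ h1) hxw
      · exact .inl h1
      · exact .inr h1
    obtain ⟨l, hl', e⟩ := par w hwr
    rcases hl with hl | hl
    · exact .inl ⟨hwr, x, g w, hxg, hx, hl, hA w hwr, by rw [e]; exact lex_append hl'⟩
    · exact .inr ⟨hwr, x, g w, hxg, hx, hl, hA w hwr, by rw [e]; exact lex_append hl'⟩
  have := (Set.ncard_le_ncard hsub).trans (Set.ncard_union_le _ _)
  omega

end TreeOrders

end LeafKernel

namespace LeafKernel

open Relation

/-! ### Numberings of digraphs with two roots -/

section Numbering

variable {W : Type} [Finite W] {A : W → W → Prop} {S : Set W} {s t : W}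

/-- The in-neighbourhood of a set. -/
def inN (A : W → W → Prop) (K : Set W) : Set W := {x | x ∉ K ∧ ∃ y ∈ K, A x y}

/-- A digraph on `S` with two roots, in which no single vertex separates anything from the roots. -/
structure TwoRooted (A : W → W → Prop) (S : Set W) (s t : W) : Prop where
  s_mem : s ∈ S
  t_mem : t ∈ S
  ne : s ≠ t
  tail : ∀ a b, A a b → a ∈ S
  head : ∀ a b, A a b → b ∈ S ∧ b ≠ s ∧ b ≠ t ∧ a ≠ b
  cut : ∀ K ⊆ S, s ∉ K → t ∉ K → K.Nonempty → 2 ≤ (inN A K).ncard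

theorem inN_submodular (A : W → W → Prop) (K L : Set W) :
    (inN A (K ∩ L)).ncard + (inN A (K ∪ L)).ncard ≤ (inN A K).ncard + (inN A L).ncard := by
  rw [← Set.ncard_union_add_ncard_inter, ← Set.ncard_union_add_ncard_inter (inN A K)]
  refine add_le_add (Set.ncard_le_ncard ?_) (Set.ncard_le_ncard ?_)
  · rintro x (⟨h1, y, hy, hA⟩ | ⟨h1, y, hy | hy, hA⟩)
    · by_cases hK : x ∈ K
      · exact .inr ⟨fun hL => h1 ⟨hK, hL⟩, y, hy.2, hA⟩
      · exact .inl ⟨hK, y, hy.1, hA⟩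
    · exact .inl ⟨fun hK => h1 (.inl hK), y, hy, hA⟩
    · exact .inr ⟨fun hK => h1 (.inr hK), y, hy, hA⟩
  · rintro x ⟨⟨-, y, hy, hA⟩, h1, -⟩
    exact ⟨⟨fun hK => h1 (.inl hK), y, hy.1, hA⟩, fun hK => h1 (.inr hK), y, hy.2, hA⟩

theorem TwoRooted.exists_minimal (h : TwoRooted A S s t) : ∃ B : W → W → Prop, (∀ a b, B a b → A a b) ∧
    TwoRooted B S s t ∧ ∀ x w, B x w → ¬ TwoRooted (fun a b => B a b ∧ ¬ (a = x ∧ b = w)) S s t := by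
  induction hm : {p : W × W | A p.1 p.2}.ncard using Nat.strong_induction_on generalizing A with
  | _ m ih =>
    by_cases hx : ∃ x w, A x w ∧ TwoRooted (fun a b => A a b ∧ ¬ (a = x ∧ b = w)) S s t
    · obtain ⟨x, w, hxw, h'⟩ := hx
      obtain ⟨B, h1, h2, h3⟩ := ih _ (by
        rw [← hm]
        refine Set.ncard_lt_ncard ⟨fun p hp => hp.1, fun hsub => ?_⟩
        exact (hsub (a := (x, w)) hxw).2 ⟨rfl, rfl⟩) h' rfl
      exact ⟨B, fun a b hab => (h1 a b hab).1, h2, h3⟩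
    · exact ⟨A, fun _ _ h => h, h, fun x w hxw h' => hx ⟨x, w, hxw, h'⟩⟩

/-- Deleting the arc `xw` removes at most the vertex `x` from an in-neighbourhood, and only for sets
that contain `w` but not `x`. So an arc that cannot be deleted has a tight set of this kind. -/
theorem TwoRooted.exists_tight (h : TwoRooted A S s t) {x w : W}
    (hx : ¬ TwoRooted (fun a b => A a b ∧ ¬ (a = x ∧ b = w)) S s t) :
    ∃ K ⊆ S, s ∉ K ∧ t ∉ K ∧ w ∈ K ∧ x ∉ K ∧ (inN A K).ncard ≤ 2 := by
  by_contra hcon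
  push Not at hcon
  refine hx ⟨h.s_mem, h.t_mem, h.ne, fun a b hab => h.tail a b hab.1, fun a b hab => h.head a b hab.1, ?_⟩
  intro K hK hs ht hne
  have hsub : inN A K ⊆ insert x (inN (fun a b => A a b ∧ ¬ (a = x ∧ b = w)) K) := by
    rintro z ⟨hz, y, hy, hA⟩
    by_cases hzx : z = x ∧ y = w
    · exact .inl hzx.1
    · exact .inr ⟨hz, y, hy, hA, hzx⟩
  by_cases hc : w ∈ K ∧ x ∉ K
  · have h1 := hcon K hK hs ht hc.1 hc.2
    have h2 := Set.ncard_le_ncard hsub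
    have h3 := Set.ncard_insert_le x (inN (fun a b => A a b ∧ ¬ (a = x ∧ b = w)) K)
    omega
  · refine (h.cut K hK hs ht hne).trans (Set.ncard_le_ncard ?_)
    rintro z ⟨hz, y, hy, hA⟩
    refine ⟨hz, y, hy, hA, ?_⟩
    rintro ⟨rfl, rfl⟩
    exact hc ⟨hy, hz⟩

/-- In a minimal such digraph the in-degrees are two. -/
theorem TwoRooted.inDegree_eq_two (h : TwoRooted A S s t)
    (hmin : ∀ x w, A x w → ¬ TwoRooted (fun a b => A a b ∧ ¬ (a = x ∧ b = w)) S s t) {w : W} (hw : w ∈ S)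
    (hs : w ≠ s) (ht : w ≠ t) : ∃ x y, x ≠ y ∧ ∀ z, A z w ↔ z = x ∨ z = y := by
  obtain ⟨x, hx, y, hy, hxy⟩ := (Set.one_lt_ncard (Set.toFinite _)).1
    (h.cut {w} (by simpa using hw) (by simpa using hs.symm) (by simpa using ht.symm) ⟨w, rfl⟩)
  obtain ⟨-, _, rfl, hx⟩ := hx
  obtain ⟨-, _, rfl, hy⟩ := hy
  refine ⟨x, y, hxy, fun z => ⟨fun hz => ?_, by rintro (rfl | rfl) <;> assumption⟩⟩
  by_contra hcon
  push Not at hcon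
  obtain ⟨K₁, a1, a2, a3, a4, a5, a6⟩ := h.exists_tight (hmin _ _ hx)
  obtain ⟨K₂, b1, b2, b3, b4, b5, b6⟩ := h.exists_tight (hmin _ _ hy)
  obtain ⟨K₃, c1, c2, c3, c4, c5, c6⟩ := h.exists_tight (hmin _ _ hz)
  -- Uncrossing: the unions have at least two in-neighbours, so by submodularity the intersections
  -- have at most two. But the three tails `x`, `y`, `z` are all in-neighbours of the triple
  -- intersection.
  have e1 := inN_submodular A K₁ K₂
  have e2 := inN_submodular A (K₁ ∩ K₂) K₃
  have e3 := h.cut (K₁ ∪ K₂) (Set.union_subset a1 b1) (by simp [a2, b2]) (by simp [a3, b3]) ⟨_, .inl a4⟩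
  have e4 := h.cut (K₁ ∩ K₂ ∪ K₃) (Set.union_subset (fun x hx => a1 hx.1) c1) (by simp [a2, c2])
    (by simp [a3, c3]) ⟨_, .inr c4⟩
  have e5 : ({x, y, z} : Set W) ⊆ inN A (K₁ ∩ K₂ ∩ K₃) := by
    rintro _ (rfl | rfl | rfl)
    · exact ⟨fun h => a5 h.1.1, _, ⟨⟨a4, b4⟩, c4⟩, hx⟩
    · exact ⟨fun h => b5 h.1.2, _, ⟨⟨a4, b4⟩, c4⟩, hy⟩
    · exact ⟨fun h => c5 h.2, _, ⟨⟨a4, b4⟩, c4⟩, hz⟩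
  have e6 := Set.ncard_le_ncard e5
  rw [Set.ncard_eq_three.2 ⟨x, y, z, hxy, hcon.1.symm, hcon.2.symm, rfl⟩] at e6
  omega

/-- Double counting: there are exactly two arcs per inner vertex. If all inner out-degrees were at
least two, the arcs out of `s` and `t` would be surplus, and both roots do have out-arcs since the
set of all inner vertices has two in-neighbours. -/
theorem TwoRooted.exists_outDegree_le_one (h : TwoRooted A S s t)
    (hin : ∀ w ∈ S, w ≠ s → w ≠ t → ∃ x y, x ≠ y ∧ ∀ z, A z w ↔ z = x ∨ z = y)
    (hne : ∃ w ∈ S, w ≠ s ∧ w ≠ t) :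
    ∃ v ∈ S, v ≠ s ∧ v ≠ t ∧ ∀ b b', A v b → A v b' → b = b' := by
  classical
  have := Fintype.ofFinite W
  by_contra hcon
  push Not at hcon
  let I : Finset W := Finset.univ.filter fun w => w ∈ S ∧ w ≠ s ∧ w ≠ t
  let E : Finset (W × W) := Finset.univ.filter fun p => A p.1 p.2
  have hI : ∀ w, w ∈ I ↔ w ∈ S ∧ w ≠ s ∧ w ≠ t := by simp [I]
  have hE : ∀ p, p ∈ E ↔ A p.1 p.2 := by simp [E]
  have c1 : E.card = ∑ w ∈ I, (E.filter fun p => p.2 = w).card := by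
    apply Finset.card_eq_sum_card_fiberwise
    intro p hp
    have := h.head _ _ ((hE p).1 hp)
    exact (hI _).2 ⟨this.1, this.2.1, this.2.2.1⟩
  have c2 : ∀ w ∈ I, (E.filter fun p => p.2 = w).card = 2 := by
    intro w hw
    rw [hI] at hw
    obtain ⟨x, y, hxy, hz⟩ := hin w hw.1 hw.2.1 hw.2.2
    rw [Finset.card_eq_two]
    refine ⟨(x, w), (y, w), by simp [hxy], ?_⟩
    ext ⟨a, b⟩
    simp only [Finset.mem_filter, hE, Finset.mem_insert, Finset.mem_singleton, Prod.mk.injEq]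
    constructor
    · rintro ⟨hA, rfl⟩
      rw [hz] at hA; tauto
    · rintro (⟨rfl, rfl⟩ | ⟨rfl, rfl⟩) <;> simp [hz]
  have c3 : E.card = ∑ a ∈ insert s (insert t I), (E.filter fun p => p.1 = a).card := by
    apply Finset.card_eq_sum_card_fiberwise
    intro p hp
    have := h.tail _ _ ((hE p).1 hp)
    simp only [Finset.coe_insert, Set.mem_insert_iff, Finset.mem_coe, hI]
    tauto
  have c4 : ∀ w ∈ I, 2 ≤ (E.filter fun p => p.1 = w).card := by
    intro w hw
    rw [hI] at hw
    obtain ⟨b, b', h1, h2, h3⟩ := hcon w hw.1 hw.2.1 hw.2.2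
    exact Finset.one_lt_card.2 ⟨(w, b), by simp [hE, h1], (w, b'), by simp [hE, h2], by simp [h3]⟩
  have hst : ∀ x ∈ inN A (I : Set W), x = s ∨ x = t := by
    rintro x ⟨hx, y, -, hA⟩
    have := h.tail _ _ hA
    simp only [Finset.mem_coe, hI] at hx
    tauto
  obtain ⟨x, hx, y, hy, hxy⟩ := (Set.one_lt_ncard (Set.toFinite _)).1
    (h.cut (I : Set W) (fun w hw => ((hI _).1 hw).1) (by simp [hI]) (by simp [hI])
      (by obtain ⟨w, hw⟩ := hne; exact ⟨w, (hI _).2 hw⟩))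
  have hs : s ∈ inN A (I : Set W) ∧ t ∈ inN A (I : Set W) := by
    rcases hst x hx with rfl | rfl <;> rcases hst y hy with rfl | rfl <;> tauto
  have pos : ∀ x ∈ inN A (I : Set W), 1 ≤ (E.filter fun p => p.1 = x).card := by
    rintro x ⟨-, y, -, hA⟩
    exact Finset.card_pos.2 ⟨(x, y), by simp [hE, hA]⟩
  rw [Finset.sum_insert (by simp [hI, h.ne]), Finset.sum_insert (by simp [hI])] at c3
  have c5 := Finset.sum_le_sum c4
  rw [Finset.sum_congr rfl c2] at c1
  have p1 := pos s hs.1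
  have p2 := pos t hs.2
  omega

/-- The digraph obtained by removing `v` and joining its in-neighbours to its out-neighbours. -/
def bypass (A : W → W → Prop) (v x y : W) : Prop := x ≠ v ∧ y ≠ v ∧ x ≠ y ∧ (A x y ∨ A v y ∧ A x v)

/-- If `v` has an arc into `K`, the in-neighbours of `K ∪ {v}` become in-neighbours of `K`.
Otherwise the in-neighbours of `K` are unchanged. -/
theorem TwoRooted.bypass_out (h : TwoRooted A S s t) {v : W} (hs : v ≠ s) (ht : v ≠ t) :
    TwoRooted (bypass A v) (S \ {v}) s t where
  s_mem := ⟨h.s_mem, hs.symm⟩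
  t_mem := ⟨h.t_mem, ht.symm⟩
  ne := h.ne
  tail := by
    rintro a b ⟨h1, -, -, h2 | h2⟩
    · exact ⟨h.tail _ _ h2, h1⟩
    · exact ⟨h.tail _ _ h2.2, h1⟩
  head := by
    rintro a b ⟨-, h1, h0, h2 | h2⟩
    · have := h.head _ _ h2
      exact ⟨⟨this.1, h1⟩, this.2.1, this.2.2.1, h0⟩
    · have := h.head _ _ h2.1
      exact ⟨⟨this.1, h1⟩, this.2.1, this.2.2.1, h0⟩
  cut := by
    intro K hK h1 h2 hne
    have hv : v ∉ K := fun hv => (hK hv).2 rfl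
    by_cases hc : ∃ y ∈ K, A v y
    · obtain ⟨y₀, hy₀, hA₀⟩ := hc
      refine (h.cut (insert v K) ?_ ?_ ?_ ⟨v, .inl rfl⟩).trans (Set.ncard_le_ncard ?_)
      · exact Set.insert_subset (h.tail _ _ hA₀) fun x hx => (hK hx).1
      · rintro (h | h)
        exacts [hs h.symm, h1 h]
      · rintro (h | h)
        exacts [ht h.symm, h2 h]
      · rintro x ⟨hx, y, hy, hA⟩
        have hxv : x ≠ v := fun h => hx (.inl h)
        have hxK : x ∉ K := fun h => hx (.inr h)
        rcases hy with rfl | hy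
        · exact ⟨hxK, y₀, hy₀, hxv, fun h => hv (h ▸ hy₀), fun h => hxK (h ▸ hy₀), .inr ⟨hA₀, hA⟩⟩
        · exact ⟨hxK, y, hy, hxv, fun h => hv (h ▸ hy), fun h => hxK (h ▸ hy), .inl hA⟩
    · push Not at hc
      refine (h.cut K (fun x hx => (hK hx).1) h1 h2 hne).trans (Set.ncard_le_ncard ?_)
      rintro x ⟨hx, y, hy, hA⟩
      exact ⟨hx, y, hy, fun h => hc y hy (h ▸ hA), fun h => hv (h ▸ hy), fun h => hx (h ▸ hy), .inl hA⟩

theorem exists_between_notMem {α β : ℚ} (h : α < β) {T : Set ℚ} (hT : T.Finite) :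
    ∃ q, α < q ∧ q < β ∧ q ∉ T := by
  obtain ⟨q, hq, hqT⟩ := (Set.Ioo_infinite h).exists_notMem_finite hT
  exact ⟨q, hq.1, hq.2, hqT⟩

/-- A numbering in which every vertex other than the roots has a smaller and a larger in-neighbour. -/
theorem TwoRooted.exists_numbering (h : TwoRooted A S s t) : ∃ f : W → ℚ, Set.InjOn f S ∧
    (∀ w ∈ S, f s ≤ f w ∧ f w ≤ f t) ∧
    ∀ w ∈ S, w ≠ s → w ≠ t → ∃ x y, A x w ∧ A y w ∧ f x < f w ∧ f w < f y := by
  classical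
  induction hm : S.ncard using Nat.strong_induction_on generalizing A S with
  | _ m ih =>
    obtain ⟨B, hBA, hB, hmin⟩ := h.exists_minimal
    suffices hf : ∃ f : W → ℚ, Set.InjOn f S ∧ (∀ w ∈ S, f s ≤ f w ∧ f w ≤ f t) ∧
        ∀ w ∈ S, w ≠ s → w ≠ t → ∃ x y, B x w ∧ B y w ∧ f x < f w ∧ f w < f y by
      obtain ⟨f, h1, h2, h3⟩ := hf
      refine ⟨f, h1, h2, fun w hw hws hwt => ?_⟩
      obtain ⟨x, y, h4, h5, h6⟩ := h3 w hw hws hwt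
      exact ⟨x, y, hBA _ _ h4, hBA _ _ h5, h6⟩
    by_cases hne : ∃ w ∈ S, w ≠ s ∧ w ≠ t
    swap
    · push Not at hne
      have hst : ∀ w ∈ S, w = s ∨ w = t := fun w hw => by
        by_cases hws : w = s
        · exact .inl hws
        · exact .inr (hne w hw hws)
      have hne' := h.ne.symm
      refine ⟨fun w => if w = s then 0 else 1, ?_, ?_, fun w hw h1 h2 => absurd (hne w hw h1) h2⟩
      · intro a ha b hb hab
        rcases hst a ha with rfl | rfl <;> rcases hst b hb with rfl | rfl <;> simp_all
      · intro w hw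
        rcases hst w hw with rfl | rfl <;> simp [hne']
    have hin := fun w hw h1 h2 => hB.inDegree_eq_two hmin (w := w) hw h1 h2
    obtain ⟨v, hvS, hvs, hvt, hv⟩ := hB.exists_outDegree_le_one hin hne
    -- A vertex `v` with at most one out-neighbour is bypassed, the rest is numbered by induction,
    -- and `v` is then inserted strictly between its two in-neighbours.
    obtain ⟨f, f1, f2, f3⟩ := ih (S \ {v}).ncard (by
      rw [← hm]; exact Set.ncard_diff_singleton_lt_of_mem hvS) (hB.bypass_out hvs hvt) rfl
    obtain ⟨a, b, hab, hz⟩ := hin v hvS hvs hvt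
    have mem : ∀ x, B x v → x ∈ S \ {v} := fun x hx => ⟨hB.tail _ _ hx, (hB.head _ _ hx).2.2.2⟩
    have hmem : ∀ x, x ∈ S → x ≠ v → x ∈ S \ {v} := fun x hx hxv => ⟨hx, hxv⟩
    have ha : B a v := (hz a).2 (.inl rfl)
    have hb : B b v := (hz b).2 (.inr rfl)
    have hfab : f a ≠ f b := fun e => hab (f1 (mem a ha) (mem b hb) e)
    have hT : (f '' S).Finite := Set.toFinite _
    -- a value for `v` on the right side of its out-neighbour
    have hq : ∃ q, q ∉ f '' S ∧ (∃ x y, B x v ∧ B y v ∧ f x < q ∧ q < f y) ∧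
        ∀ w, B v w → ∃ y, y ≠ v ∧ B y w ∧ (f y < f w ∧ f w < q ∨ q < f w ∧ f w < f y) := by
      obtain ⟨lo, hi, hlo, hhi, hlt, hext⟩ : ∃ lo hi, B lo v ∧ B hi v ∧ f lo < f hi ∧
          ∀ x, B x v → f lo ≤ f x ∧ f x ≤ f hi := by
        rcases lt_or_gt_of_ne hfab with hlt | hlt
        · refine ⟨a, b, ha, hb, hlt, fun x hx => ?_⟩
          rcases (hz x).1 hx with rfl | rfl
          exacts [⟨le_rfl, hlt.le⟩, ⟨hlt.le, le_rfl⟩]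
        · refine ⟨b, a, hb, ha, hlt, fun x hx => ?_⟩
          rcases (hz x).1 hx with rfl | rfl
          exacts [⟨hlt.le, le_rfl⟩, ⟨le_rfl, hlt.le⟩]
      by_cases hw : ∃ w, B v w
      · obtain ⟨w, hw⟩ := hw
        have hwh := hB.head _ _ hw
        have hwS : w ∈ S \ {v} := ⟨hwh.1, hwh.2.2.2.symm⟩
        obtain ⟨x, x', hx, hx', hlt1, hlt2⟩ := f3 w hwS hwh.2.1 hwh.2.2.1
        obtain ⟨y, hyv, hyw, hyu⟩ : ∃ y, y ≠ v ∧ B y w ∧ ∀ z, B z w → z = v ∨ z = y := by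
          obtain ⟨c, d, hcd, hz'⟩ := hin w hwh.1 hwh.2.1 hwh.2.2.1
          rcases (hz' v).1 hw with rfl | rfl
          · exact ⟨d, hcd.symm, (hz' d).2 (.inr rfl), fun z hz => (hz' z).1 hz⟩
          · exact ⟨c, hcd, (hz' c).2 (.inl rfl), fun z hz => ((hz' z).1 hz).symm⟩
        have hfy : f y ≠ f w := fun e => (hB.head _ _ hyw).2.2.2
          (f1 ⟨hB.tail _ _ hyw, hyv⟩ hwS e)
        -- Since `v` and `y` are the only in-neighbours of `w`, any other in-neighbour of `w` after
        -- bypassing was an in-neighbour of `v`. If `y` is below `w`, the larger witness for `w` is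
        -- therefore an in-neighbour of `v`, which leaves room to place `v` above `w`; the other
        -- case is symmetric.
        have through : ∀ z, bypass B v z w → z ≠ y → B z v := by
          rintro z ⟨h1, -, -, h2 | h2⟩ h3
          · rcases hyu z h2 with h | h <;> contradiction
          · exact h2.2
        rcases lt_or_gt_of_ne hfy with hlt3 | hlt3
        · have hx'v := through x' hx' (by rintro rfl; exact absurd hlt2 (not_lt.2 hlt3.le))
          obtain ⟨q, q1, q2, q3⟩ := exists_between_notMem
            (max_lt hlt (hlt2.trans_le (hext x' hx'v).2)) hT
          refine ⟨q, q3, ⟨lo, hi, hlo, hhi, (le_max_left _ _).trans_lt q1, q2⟩, fun w' hw' => ?_⟩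
          obtain rfl := hv _ _ hw hw'
          exact ⟨y, hyv, hyw, .inl ⟨hlt3, (le_max_right _ _).trans_lt q1⟩⟩
        · have hxv := through x hx (by rintro rfl; exact absurd hlt1 (not_lt.2 hlt3.le))
          obtain ⟨q, q1, q2, q3⟩ := exists_between_notMem
            (lt_min hlt ((hext x hxv).1.trans_lt hlt1)) hT
          refine ⟨q, q3, ⟨lo, hi, hlo, hhi, q1, q2.trans_le (min_le_left _ _)⟩, fun w' hw' => ?_⟩
          obtain rfl := hv _ _ hw hw'
          exact ⟨y, hyv, hyw, .inr ⟨q2.trans_le (min_le_right _ _), hlt3⟩⟩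
      · obtain ⟨q, q1, q2, q3⟩ := exists_between_notMem hlt hT
        exact ⟨q, q3, ⟨lo, hi, hlo, hhi, q1, q2⟩, fun w hw' => absurd ⟨w, hw'⟩ hw⟩
    obtain ⟨q, q1, ⟨x, y, hx, hy, hxq, hyq⟩, q2⟩ := hq
    have upd : ∀ x, x ≠ v → Function.update f v q x = f x := fun x hx => Function.update_of_ne hx _ _
    have updv : Function.update f v q v = q := Function.update_self _ _ _
    refine ⟨Function.update f v q, ?_, ?_, ?_⟩
    · intro c hc d hd hcd
      by_cases hcv : c = v <;> by_cases hdv : d = v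
      · rw [hcv, hdv]
      · rw [hcv, updv, upd d hdv] at hcd
        exact absurd ⟨d, hd, hcd.symm⟩ q1
      · rw [hdv, updv, upd c hcv] at hcd
        exact absurd ⟨c, hc, hcd⟩ q1
      · rw [upd c hcv, upd d hdv] at hcd
        exact f1 ⟨hc, hcv⟩ ⟨hd, hdv⟩ hcd
    · intro w hw
      rw [upd s hvs.symm, upd t hvt.symm]
      by_cases hwv : w = v
      · rw [hwv, updv]
        exact ⟨(f2 x (mem x hx)).1.trans hxq.le, hyq.le.trans (f2 y (mem y hy)).2⟩
      · rw [upd w hwv]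
        exact f2 w ⟨hw, hwv⟩
    · intro w hw hws hwt
      by_cases hwv : w = v
      · subst hwv
        exact ⟨x, y, hx, hy, by rwa [upd x (mem x hx).2, updv], by rwa [upd y (mem y hy).2, updv]⟩
      · by_cases hvw : B v w
        · obtain ⟨z, hzv, hzw, hlt | hlt⟩ := q2 w hvw
          · exact ⟨z, v, hzw, hvw, by rw [upd z hzv, upd w hwv]; exact hlt.1,
              by rw [updv, upd w hwv]; exact hlt.2⟩
          · exact ⟨v, z, hvw, hzw, by rw [updv, upd w hwv]; exact hlt.1,
              by rw [upd z hzv, upd w hwv]; exact hlt.2⟩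
        · obtain ⟨x, y, ⟨x1, -, -, x2⟩, ⟨y1, -, -, y2⟩, h1, h2⟩ := f3 w ⟨hw, hwv⟩ hws hwt
          exact ⟨x, y, x2.resolve_right fun h => hvw h.1, y2.resolve_right fun h => hvw h.1,
            by rwa [upd x x1, upd w hwv], by rwa [upd y y1, upd w hwv]⟩

end Numbering

end LeafKernel

namespace LeafKernel

open Relation

/-! ### Dominators and independent spanning trees -/

section Dominators

variable {V : Type} {A : V → V → Prop} {r : V}

theorem Dom.refl (z : V) : Dom A r z z := by
  by_contra h
  unfold Dom at h
  push Not at h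
  rcases ReflTransGen.cases_tail h.2 with e | ⟨x, -, hx⟩
  · exact h.1 e
  · exact hx.2.2 rfl

theorem dom_root_iff {z : V} : Dom A r z r ↔ z = r :=
  ⟨fun h => h.elim id fun h => absurd .refl h, .inl⟩

theorem Dom.exists_between {z w : V} (h : Dom A r z w) {B : V → V → Prop} (hB : ∀ a b, B a b → A a b)
    (hw : ReflTransGen B r w) : ReflTransGen B r z ∧ ReflTransGen B z w := by
  obtain ⟨x, hx, h1⟩ := exists_mem_of_separates (S := {z}) hB (h.imp (fun e => e ▸ rfl) id) hw
  obtain rfl : x = z := hx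
  exact h1

theorem Dom.trans {x z w : V} (h : Dom A r x z) (h' : Dom A r z w) : Dom A r x w := by
  by_contra hx
  unfold Dom at hx
  push Not at hx
  rcases h with h | h
  · exact hx.1 h
  · exact h (h'.exists_between (fun _ _ h => h.1) hx.2).1

/-- A dominator of a vertex dominates its in-neighbours. -/
theorem Dom.of_adj {z x w : V} (h : Dom A r z w) (hA : A x w) (hne : z ≠ w) : Dom A r z x := by
  by_contra hx
  have hzx : z ≠ x := by rintro rfl; exact hx (.refl z)
  unfold Dom at hx
  push Not at hx
  exact h.elim hx.1 fun h => h (hx.2.tail ⟨hA, hzx.symm, hne.symm⟩)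

theorem exists_isParentFn (hr : ∀ w, ReflTransGen A r w) :
    ∃ g, IsParentFn g r ∧ ∀ w, w ≠ r → A (g w) w := by
  obtain ⟨g, d, hg⟩ := exists_bfs_parent A r
  refine ⟨g, fun w => ?_, fun w hw => (hg w (hr w) hw).1⟩
  induction hm : d w using Nat.strong_induction_on generalizing w with
  | _ m ih =>
    by_cases hw : w = r
    · subst hw; exact .refl
    · exact (ih _ (hm ▸ (hg w (hr w) hw).2.2) _ rfl).trans (anc_parent hw)

theorem Dom.anc {g : V → V} (hg : IsParentFn g r) (hA : ∀ w, w ≠ r → A (g w) w) {z w : V} (h : Dom A r z w) :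
    Anc g r z w :=
  (h.exists_between (B := Step g r) (fun a b hab => hab.2 ▸ hA b hab.1) (hg w)).2

theorem Dom.antisymm (hr : ∀ w, ReflTransGen A r w) {z w : V} (h : Dom A r z w) (h' : Dom A r w z) : z = w := by
  obtain ⟨g, hg, hA⟩ := exists_isParentFn hr
  exact hg.antisymm (h.anc hg hA) (h'.anc hg hA)

/-- The dominators of a vertex are comparable. -/
theorem Dom.total (hr : ∀ w, ReflTransGen A r w) {z z' w : V} (h : Dom A r z w) (h' : Dom A r z' w) :
    Dom A r z z' ∨ Dom A r z' z := by
  obtain ⟨g, hg, hA⟩ := exists_isParentFn hr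
  -- Otherwise a walk to the lower vertex `z'` that avoids `z`, continued down the tree, would reach
  -- `w` without meeting `z`.
  have key : ∀ z z', Dom A r z w → Anc g r z' w → Anc g r z z' → Dom A r z z' := by
    intro z z' hz hz' hzz'
    by_cases hne : z = z'
    · subst hne; exact .refl z
    · by_contra hcon
      unfold Dom at hcon
      push Not at hcon
      refine (hz.resolve_left hcon.1) ?_
      have : ∀ y, Anc g r z' y → ReflTransGen (Avoid A {z}) r y := by
        intro y hy
        unfold Anc at hy
        induction hy with
        | refl => exact hcon.2
        | tail h1 h2 ih =>
          have nz : ∀ y, Anc g r z' y → y ∉ ({z} : Set V) := by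
            rintro y hy rfl
            exact hne (hg.antisymm hzz' hy)
          exact ih.tail ⟨h2.2 ▸ hA _ h2.1, nz _ h1, nz _ (h1.tail h2)⟩
      exact this w hz'
  rcases (h.anc hg hA).total (h'.anc hg hA) with h1 | h1
  · exact .inl (key _ _ h (h'.anc hg hA) h1)
  · exact .inr (key _ _ h' (h.anc hg hA) h1)

theorem dom_wellFounded [Finite V] (hr : ∀ w, ReflTransGen A r w) :
    WellFounded (fun a b => Dom A r a b ∧ a ≠ b) ∧ WellFounded (fun a b => Dom A r b a ∧ b ≠ a) := by
  constructor
  · have : IsTrans V (fun a b => Dom A r a b ∧ a ≠ b) := ⟨fun a b c h h' => ⟨h.1.trans h'.1, by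
      rintro rfl; exact h.2 (h.1.antisymm hr h'.1)⟩⟩
    have : Std.Irrefl (fun a b => Dom A r a b ∧ a ≠ b) := ⟨fun a h => h.2 rfl⟩
    exact Finite.wellFounded_of_trans_of_irrefl _
  · have : IsTrans V (fun a b => Dom A r b a ∧ b ≠ a) := ⟨fun a b c h h' => ⟨h'.1.trans h.1, by
      rintro rfl; exact h.2 (h.1.antisymm hr h'.1)⟩⟩
    have : Std.Irrefl (fun a b => Dom A r b a ∧ b ≠ a) := ⟨fun a h => h.2 rfl⟩
    exact Finite.wellFounded_of_trans_of_irrefl _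

/-- `d` maps every vertex other than the root to its immediate dominator. -/
def IsIDom (A : V → V → Prop) (r : V) (d : V → V) : Prop :=
  ∀ w, w ≠ r → d w ≠ w ∧ Dom A r (d w) w ∧ ∀ z, Dom A r z w → z ≠ w → Dom A r z (d w)

theorem exists_isIDom [Finite V] (hr : ∀ w, ReflTransGen A r w) : ∃ d, IsIDom A r d := by
  have : ∀ w, w ≠ r → ∃ x, x ≠ w ∧ Dom A r x w ∧ ∀ z, Dom A r z w → z ≠ w → Dom A r z x := by
    intro w hw
    obtain ⟨m, ⟨hm1, hm2⟩, hm⟩ := (dom_wellFounded hr).2.has_min {z | Dom A r z w ∧ z ≠ w}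
      ⟨r, .inl rfl, hw.symm⟩
    refine ⟨m, hm2, hm1, fun z hz hzw => ?_⟩
    rcases hz.total hr hm1 with h | h
    · exact h
    · by_cases e : m = z
      · subst e; exact .refl _
      · exact absurd ⟨h, e⟩ (hm z ⟨hz, hzw⟩)
  choose! d hd using this
  exact ⟨d, hd⟩

section IDom

variable {d : V → V}

/-- A vertex dominated by `c` is dominated by one of the vertices with immediate dominator `c`. -/
theorem IsIDom.exists_child [Finite V] (hd : IsIDom A r d) (hr : ∀ w, ReflTransGen A r w)
    {c x : V} (h : Dom A r c x) (hne : x ≠ c) :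
    ∃ u, u ≠ r ∧ d u = c ∧ Dom A r u x := by
  obtain ⟨u, ⟨h1, h2, h3⟩, hu⟩ := (dom_wellFounded hr).1.has_min {u | Dom A r u x ∧ u ≠ c ∧ Dom A r c u}
    ⟨x, .refl x, hne, h⟩
  have hur : u ≠ r := by
    rintro rfl
    exact h2 (dom_root_iff.1 h3).symm
  obtain ⟨d1, d2, d3⟩ := hd u hur
  refine ⟨u, hur, ?_, h1⟩
  by_contra hc
  exact hu (d u) ⟨d2.trans h1, hc, d3 c h3 h2.symm⟩ ⟨d2, d1⟩

theorem IsIDom.dom_of_dom_child (hd : IsIDom A r d) (hr : ∀ w, ReflTransGen A r w)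
    {u v : V} (hu : u ≠ r) (hv : v ≠ r) (he : d u = d v) (h : Dom A r u v) :
    u = v := by
  by_contra hne
  have h1 := (hd v hv).2.2 u h hne
  rw [← he] at h1
  exact (hd u hu).1 ((hd u hu).2.1.antisymm hr h1)

theorem IsIDom.child_unique (hd : IsIDom A r d) (hr : ∀ w, ReflTransGen A r w)
    {u v x : V} (hu : u ≠ r) (hv : v ≠ r) (he : d u = d v) (h : Dom A r u x)
    (h' : Dom A r v x) : u = v := by
  rcases h.total hr h' with h1 | h1
  · exact hd.dom_of_dom_child hr hu hv he h1
  · exact (hd.dom_of_dom_child hr hv hu he.symm h1).symm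

/-- The digraph of the subtrees below `c` in the dominator tree, the vertex `c` itself being doubled. -/
theorem IsIDom.twoRooted [Finite V] (hd : IsIDom A r d) (hr : ∀ w, ReflTransGen A r w)
    (c : V) :
    TwoRooted (fun p q : Option V => ∃ w, q = some w ∧ w ≠ r ∧ d w = c ∧
        ((p = none ∨ p = some c) ∧ A c w ∨ ∃ u, p = some u ∧ u ≠ r ∧ d u = c ∧ u ≠ w ∧
          ∃ x, Dom A r u x ∧ A x w))
      {p | p = none ∨ p = some c ∨ ∃ w, p = some w ∧ w ≠ r ∧ d w = c} (some c) none where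
  s_mem := .inr (.inl rfl)
  t_mem := .inl rfl
  ne := by simp
  tail := by
    rintro p q ⟨w, -, -, -, ⟨rfl | rfl, -⟩ | ⟨u, rfl, h1, h2, -⟩⟩
    · exact .inl rfl
    · exact .inr (.inl rfl)
    · exact .inr (.inr ⟨u, rfl, h1, h2⟩)
  head := by
    rintro p q ⟨w, rfl, h1, h2, h3⟩
    have hwc : w ≠ c := fun e => (hd w h1).1 (h2.trans e.symm)
    refine ⟨.inr (.inr ⟨w, rfl, h1, h2⟩), by simpa using hwc, by simp, ?_⟩
    rcases h3 with ⟨rfl | rfl, -⟩ | ⟨u, rfl, -, -, h4, -⟩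
    · simp
    · simpa using hwc.symm
    · simpa using h4
  cut := by
    intro K hK hs ht hne
    by_contra hcon
    set N := inN (fun p q : Option V => ∃ w, q = some w ∧ w ≠ r ∧ d w = c ∧
        ((p = none ∨ p = some c) ∧ A c w ∨ ∃ u, p = some u ∧ u ≠ r ∧ d u = c ∧ u ≠ w ∧
          ∃ x, Dom A r u x ∧ A x w)) K with hN
    have hKc : ∀ p ∈ K, ∃ w, p = some w ∧ w ≠ r ∧ d w = c := by
      intro p hp
      rcases hK hp with rfl | rfl | h
      · exact absurd hp ht
      · exact absurd hp hs
      · exact h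
    have hle : ∀ p ∈ N, ∀ q ∈ N, p = q := by
      intro p hp q hq
      exact (Set.ncard_le_one (Set.toFinite _)).1 (by omega) p hp q hq
    -- An arc from `c` into `K` would make both copies of `c` in-neighbours of `K`, already two.
    have hcN : ∀ w, some w ∈ K → ¬ A c w := by
      intro w hw hA
      obtain ⟨w', e, h1, h2⟩ := hKc _ hw
      obtain rfl : w = w' := by simpa using e
      have := hle none ⟨ht, _, hw, w, rfl, h1, h2, .inl ⟨.inl rfl, hA⟩⟩ (some c)
        ⟨hs, _, hw, w, rfl, h1, h2, .inl ⟨.inr rfl, hA⟩⟩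
      simp at this
    -- every arc that enters the part dominated by `K` starts in the same subtree
    have enter : ∀ a b, A a b → (∃ w, some w ∈ K ∧ Dom A r w b) → (¬ ∃ w, some w ∈ K ∧ Dom A r w a) →
        ∃ u, some u ∈ N ∧ Dom A r u a := by
      rintro a b hA ⟨w, hw, hwb⟩ ha
      obtain ⟨w', e, h1, h2⟩ := hKc _ hw
      obtain rfl : w = w' := by simpa using e
      have hbw : w = b := by
        by_contra hne
        exact ha ⟨w, hw, hwb.of_adj hA hne⟩
      subst hbw
      have hca : Dom A r c a := (h2 ▸ (hd w h1).2.1).of_adj hA (h2 ▸ (hd w h1).1)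
      have hac : a ≠ c := by rintro rfl; exact hcN w hw hA
      obtain ⟨u, u1, u2, u3⟩ := hd.exists_child hr hca hac
      have huK : some u ∉ K := fun h => ha ⟨u, h, u3⟩
      refine ⟨u, ⟨huK, some w, hw, w, rfl, h1, h2, .inr ⟨u, rfl, u1, u2, ?_, a, u3, hA⟩⟩, u3⟩
      rintro rfl
      exact huK hw
    have hrX : ¬ ∃ w, some w ∈ K ∧ Dom A r w r := by
      rintro ⟨w, hw, h⟩
      obtain ⟨w', e, h1, -⟩ := hKc _ hw
      obtain rfl : w = w' := by simpa using e
      exact h1 (dom_root_iff.1 h)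
    obtain ⟨p, hp⟩ := hne
    obtain ⟨w, rfl, h1, h2⟩ := hKc p hp
    have reach : ∀ (B : V → V → Prop) y, (∀ a b, B a b → A a b) → ReflTransGen B r y →
        (∃ w, some w ∈ K ∧ Dom A r w y) → ∃ u a, some u ∈ N ∧ Dom A r u a ∧ ReflTransGen B r a := by
      intro B y hB hy
      induction hy with
      | refl => exact fun h => absurd h hrX
      | @tail a b h1 h2 ih =>
        intro hb
        by_cases ha : ∃ w, some w ∈ K ∧ Dom A r w a
        · exact ih ha
        · obtain ⟨u, u1, u2⟩ := enter a b (hB _ _ h2) hb ha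
          exact ⟨u, a, u1, u2, h1⟩
    obtain ⟨u, -, huN, -, -⟩ := reach A w (fun _ _ h => h) (hr w) ⟨w, hp, .refl w⟩
    obtain ⟨huK, q, hq, w', rfl, w1, w2, hu⟩ := huN
    obtain ⟨u', e, u1, u2, u3, -⟩ := hu.resolve_left (by
      rintro ⟨-, hA⟩; exact hcN w' hq hA)
    obtain rfl : u = u' := by simpa using e
    have huN : some u ∈ N := ⟨huK, some w', hq, w', rfl, w1, w2, hu⟩
    -- All walks into the part below `K` pass through the subtree of the only in-neighbour `u`. Then
    -- `u` dominates its sibling `w`, which is impossible.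
    have hdom : Dom A r u w := by
      by_contra hcon
      unfold Dom at hcon
      push Not at hcon
      obtain ⟨u'', a, hN'', hd'', ha⟩ := reach (Avoid A {u}) w (fun _ _ h => h.1) hcon.2 ⟨w, hp, .refl w⟩
      obtain rfl : u = u'' := by simpa using hle _ huN _ hN''
      exact (hd''.resolve_left u1) ha
    have huw : u ≠ w := by rintro rfl; exact huK hp
    exact huw (hd.dom_of_dom_child hr u1 h1 (u2.trans h2.symm) hdom)

end IDom

/-- `x` is an in-neighbour of `w` that comes before `w` in the order of the siblings given by `F`. -/
def Lower (A : V → V → Prop) (r : V) (d : V → V) (F : V → ℚ) (w x : V) : Prop :=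
  A x w ∧ (x = d w ∨ ∃ u, u ≠ r ∧ d u = d w ∧ Dom A r u x ∧ F u < F w)

/-- Each family of siblings is numbered separately. An arc from the common immediate dominator
counts as low as well as high, which is why that vertex was doubled. -/
theorem IsIDom.exists_lowHigh [Finite V] {d : V → V} (hd : IsIDom A r d) (hr : ∀ w, ReflTransGen A r w) :
    ∃ F : V → ℚ, ∀ w, w ≠ r → (∃ x, Lower A r d F w x) ∧ ∃ y, Lower A r d (fun v => - F v) w y := by
  choose f hf1 hf2 hf3 using fun c => (hd.twoRooted hr c).exists_numbering
  refine ⟨fun w => f (d w) (some w), fun w hw => ?_⟩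
  have hwd : some w ≠ some (d w) := by simpa using (hd w hw).1.symm
  obtain ⟨p, q, ⟨w₁, e₁, -, -, hp⟩, ⟨w₂, e₂, -, -, hq⟩, hlt₁, hlt₂⟩ :=
    hf3 (d w) (some w) (.inr (.inr ⟨w, rfl, hw, rfl⟩)) hwd (by simp)
  obtain rfl : w = w₁ := by simpa using e₁
  obtain rfl : w = w₂ := by simpa using e₂
  constructor
  · rcases hp with ⟨-, hA⟩ | ⟨u, rfl, u1, u2, u3, x, hx, hA⟩
    · exact ⟨d w, hA, .inl rfl⟩
    · exact ⟨x, hA, .inr ⟨u, u1, u2, hx, by simpa only [u2] using hlt₁⟩⟩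
  · rcases hq with ⟨-, hA⟩ | ⟨u, rfl, u1, u2, u3, x, hx, hA⟩
    · exact ⟨d w, hA, .inl rfl⟩
    · exact ⟨x, hA, .inr ⟨u, u1, u2, hx, by simpa only [u2, neg_lt_neg_iff] using hlt₂⟩⟩

/-- The order of the dominator tree in which siblings are ordered by `F`. -/
def Before (A : V → V → Prop) (r : V) (d : V → V) (F : V → ℚ) (x w : V) : Prop :=
  (Dom A r x w ∧ x ≠ w) ∨ ∃ u v, u ≠ r ∧ v ≠ r ∧ d u = d v ∧ Dom A r u x ∧ Dom A r v w ∧ F u < F v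

section Before

variable {d : V → V} {F : V → ℚ}

theorem Lower.before (hd : IsIDom A r d) {w x : V} (hw : w ≠ r) (h : Lower A r d F w x) : Before A r d F x w := by
  rcases h.2 with rfl | ⟨u, u1, u2, u3, u4⟩
  · exact .inl ⟨(hd w hw).2.1, (hd w hw).1⟩
  · exact .inr ⟨u, w, u1, hw, u2, u3, .refl w, u4⟩

theorem Before.irrefl (hd : IsIDom A r d) (hr : ∀ w, ReflTransGen A r w) (x : V) : ¬ Before A r d F x x := by
  rintro (⟨-, h⟩ | ⟨u, v, hu, hv, he, h1, h2, h3⟩)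
  · exact h rfl
  · have := hd.child_unique hr hu hv he h1 h2
    subst this
    exact lt_irrefl _ h3

theorem Before.trans (hd : IsIDom A r d) (hr : ∀ w, ReflTransGen A r w) {x y z : V}
    (h : Before A r d F x y) (h' : Before A r d F y z) : Before A r d F x z := by
  rcases h with ⟨h1, h2⟩ | ⟨u, v, hu, hv, he, h1, h2, h3⟩ <;>
    rcases h' with ⟨k1, k2⟩ | ⟨u', v', hu', hv', he', k1, k2, k3⟩
  · exact .inl ⟨h1.trans k1, by rintro rfl; exact h2 (h1.antisymm hr k1)⟩
  · rcases h1.total hr k1 with hx | hx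
    · by_cases hxu : x = u'
      · subst hxu; exact .inr ⟨x, v', hu', hv', he', .refl x, k2, k3⟩
      have h4 : Dom A r x (d v') := he' ▸ (hd u' hu').2.2 x hx hxu
      refine .inl ⟨h4.trans ((hd v' hv').2.1.trans k2), ?_⟩
      rintro rfl
      exact (hd v' hv').1 ((hd v' hv').2.1.antisymm hr (k2.trans h4))
    · exact .inr ⟨u', v', hu', hv', he', hx, k2, k3⟩
  · exact .inr ⟨u, v, hu, hv, he, h1, h2.trans k1, h3⟩
  · rcases h2.total hr k1 with hx | hx
    · by_cases hvu : v = u'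
      · subst hvu; exact .inr ⟨u, v', hu, hv', he.trans he', h1, k2, h3.trans k3⟩
      · have h4 : Dom A r v (d v') := he' ▸ (hd u' hu').2.2 v hx hvu
        exact .inr ⟨u, v, hu, hv, he, h1, h4.trans ((hd v' hv').2.1.trans k2), h3⟩
    · by_cases hvu : u' = v
      · subst hvu; exact .inr ⟨u, v', hu, hv', he.trans he', h1, k2, h3.trans k3⟩
      · have h4 : Dom A r u' (d u) := he ▸ (hd v hv).2.2 u' hx hvu
        exact .inr ⟨u', v', hu', hv', he', h4.trans ((hd u hu).2.1.trans h1), k2, k3⟩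

/-- Parents come earlier in a strict order on a finite set, so climbing ends at the root. -/
theorem isParentFn_of_lower [Finite V] (hd : IsIDom A r d) (hr : ∀ w, ReflTransGen A r w) {g : V → V}
    (hg : ∀ w, w ≠ r → Lower A r d F w (g w)) :
    IsParentFn g r ∧ ∀ z w, Anc g r z w → z ≠ w → Before A r d F z w := by
  have : IsTrans V (Before A r d F) := ⟨fun a b c h h' => h.trans hd hr h'⟩
  have : Std.Irrefl (Before A r d F) := ⟨Before.irrefl hd hr⟩
  have wf := Finite.wellFounded_of_trans_of_irrefl (Before A r d F)
  refine ⟨fun w => ?_, fun z w h hne => ?_⟩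
  · induction w using wf.induction with
    | _ w ih =>
      by_cases hw : w = r
      · subst hw; exact .refl
      · exact (ih _ ((hg w hw).before hd hw)).trans (anc_parent hw)
  · unfold Anc at h
    induction h with
    | refl => exact absurd rfl hne
    | @tail x y h1 h2 ih =>
      obtain ⟨h2, rfl⟩ := h2
      have hy := (hg y h2).before hd h2
      by_cases hz : z = g y
      · exact hz ▸ hy
      · exact (ih hz).trans hd hr hy

end Before

/-- There are two spanning trees such that a common ancestor of a vertex in both dominates it. -/
theorem exists_independent_trees [Finite V] (hr : ∀ w, ReflTransGen A r w) :
    ∃ g₁ g₂ : V → V, IsParentFn g₁ r ∧ IsParentFn g₂ r ∧ (∀ w, w ≠ r → A (g₁ w) w) ∧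
      (∀ w, w ≠ r → A (g₂ w) w) ∧ ∀ z w, Anc g₁ r z w → Anc g₂ r z w → Dom A r z w := by
  obtain ⟨d, hd⟩ := exists_isIDom hr
  obtain ⟨F, hF⟩ := hd.exists_lowHigh hr
  choose! g₁ h₁ using fun w hw => (hF w hw).1
  choose! g₂ h₂ using fun w hw => (hF w hw).2
  obtain ⟨p₁, b₁⟩ := isParentFn_of_lower hd hr h₁
  obtain ⟨p₂, b₂⟩ := isParentFn_of_lower hd hr h₂
  refine ⟨g₁, g₂, p₁, p₂, fun w hw => (h₁ w hw).1, fun w hw => (h₂ w hw).1, fun z w hz₁ hz₂ => ?_⟩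
  by_cases hne : z = w
  · subst hne; exact .refl z
  by_contra hcon
  rcases b₁ z w hz₁ hne with ⟨h, -⟩ | ⟨u, v, hu, hv, he, c1, c2, c3⟩
  · exact hcon h
  rcases b₂ z w hz₂ hne with ⟨h, -⟩ | ⟨u', v', hu', hv', he', c1', c2', c3'⟩
  · exact hcon h
  have aux : ∀ u v u' v', u ≠ r → v ≠ r → u' ≠ r → v' ≠ r → d u = d v → d u' = d v' → Dom A r v w →
      Dom A r v' w → Dom A r u u' → u ≠ u' → u = v := by
    intro u v u' v' hu hv hu' hv' he he' hvw hv'w huu' hne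
    have h1 : Dom A r u (d v') := he' ▸ (hd u' hu').2.2 u huu' hne
    exact hd.child_unique hr hu hv he (h1.trans ((hd v' hv').2.1.trans hv'w)) hvw
  -- If `z` does not dominate `w`, it lies below a sibling that is smaller and below a sibling that
  -- is larger than the one above `w`. For the same pair of siblings this is contradictory. For
  -- different pairs, the upper of the two siblings above `z` dominates `w` too and so coincides
  -- with its partner.
  by_cases huu : u = u'
  · subst huu
    obtain rfl := hd.child_unique hr hv hv' (he.symm.trans he') c2 c2'
    exact lt_asymm c3 (neg_lt_neg_iff.1 c3')
  · rcases c1.total hr c1' with h | h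
    · obtain rfl := aux u v u' v' hu hv hu' hv' he he' c2 c2' h huu
      exact lt_irrefl _ c3
    · obtain rfl := aux u' v' u v hu' hv' hu hv he' he c2' c2 h (Ne.symm huu)
      exact lt_irrefl _ c3'

end Dominators

end LeafKernel

namespace LeafKernel

open Relation

/-! ### Reduced digraphs and their special vertices -/

section Reduced

variable {V : Type}

/-- The vertices with an in-neighbour that is neither the parent nor a descendant. -/
def crossHeads (A : V → V → Prop) (g : V → V) (r : V) : Set V :=
  {w | w ≠ r ∧ ∃ x, A x w ∧ x ≠ g w ∧ ¬ Anc g r w x}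

/-- A digraph with two independent spanning trees to which neither the useless arc rule nor the bridge
rule nor the avoidable arc rule applies. -/
structure Rigid (A : V → V → Prop) (r : V) (g₁ g₂ : V → V) : Prop where
  loopless : ∀ a, ¬ A a a
  reach : ∀ w, ReflTransGen A r w
  tree₁ : IsParentFn g₁ r
  tree₂ : IsParentFn g₂ r
  adj₁ : ∀ w, w ≠ r → A (g₁ w) w
  adj₂ : ∀ w, w ≠ r → A (g₂ w) w
  independent : ∀ z w, Anc g₁ r z w → Anc g₂ r z w → Dom A r z w
  useless : ∀ u v, Dom A r u v → ¬ A v u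
  bridge : ∀ u v w, r ≠ v → A u v → w ≠ v → ¬ ReflTransGen (fun a b => A a b ∧ ¬ (a = u ∧ b = v)) r v →
    ReflTransGen (fun a b => A a b ∧ ¬ (a = u ∧ b = v)) r w
  avoidable : ∀ (S : Finset V) v w, S.card ≤ 2 → v ∉ S → ¬ ReflTransGen (Avoid A S) r v → A v w →
    ∃ x ∈ S, ¬ A x w

/-- Not the root and not the head of a cross arc of one of the trees. -/
def Clean (A : V → V → Prop) (r : V) (g₁ g₂ : V → V) (w : V) : Prop :=
  w ≠ r ∧ w ∉ crossHeads A g₁ r ∧ w ∉ crossHeads A g₂ r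

/-- The vertices with two children. -/
def branching (g : V → V) (r : V) : Set V := {x | ∃ a b, a ≠ b ∧ a ≠ r ∧ b ≠ r ∧ g a = x ∧ g b = x}

/-- The vertices that dominate something else than a child with no other in-neighbour. -/
def domBad (A : V → V → Prop) (r : V) (g₁ g₂ : V → V) : Set V :=
  {z | ∃ x, x ≠ z ∧ Dom A r z x ∧ ¬ (Clean A r g₁ g₂ x ∧ g₁ x = z ∧ g₂ x = z)}

variable {A : V → V → Prop} {r : V} {g₁ g₂ : V → V}

theorem Rigid.symm (h : Rigid A r g₁ g₂) : Rigid A r g₂ g₁ :=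
  ⟨h.loopless, h.reach, h.tree₂, h.tree₁, h.adj₂, h.adj₁, fun z w a b => h.independent z w b a, h.useless,
    h.bridge, h.avoidable⟩

theorem Clean.symm {w : V} (h : Clean A r g₁ g₂ w) : Clean A r g₂ g₁ w := ⟨h.1, h.2.2, h.2.1⟩

theorem Rigid.not_adj_root (h : Rigid A r g₁ g₂) (x : V) : ¬ A x r := h.useless r x (.inl rfl)

/-- A third in-neighbour would be a descendant of `w` in both trees, hence dominated by `w`, and its
arc to `w` would be useless. -/
theorem Rigid.inNbr (h : Rigid A r g₁ g₂) {w x : V} (hw : Clean A r g₁ g₂ w) (hx : A x w) : x = g₁ w ∨ x = g₂ w := by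
  by_contra hcon
  push Not at hcon
  refine h.useless w x (h.independent w x ?_ ?_) hx
  · by_contra hA
    exact hw.2.1 ⟨hw.1, x, hx, hcon.1, hA⟩
  · by_contra hA
    exact hw.2.2 ⟨hw.1, x, hx, hcon.2, hA⟩

/-- The first parent is an in-neighbour other than the second parent, so, as `w` is no cross head of
the second tree, it is a descendant there. The two trees thus run in opposite directions. -/
theorem Rigid.anc₂ (h : Rigid A r g₁ g₂) {w : V} (hw : Clean A r g₁ g₂ w) (hne : g₁ w ≠ g₂ w) :
    Anc g₂ r w (g₁ w) := by
  by_contra hA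
  exact hw.2.2 ⟨hw.1, g₁ w, h.adj₁ w hw.1, hne, hA⟩

theorem Rigid.anc₁ (h : Rigid A r g₁ g₂) {w : V} (hw : Clean A r g₁ g₂ w) (hne : g₁ w ≠ g₂ w) :
    Anc g₁ r w (g₂ w) :=
  h.symm.anc₂ hw.symm hne.symm

theorem Rigid.parent_ne₁ (h : Rigid A r g₁ g₂) {w : V} (hw : w ≠ r) : g₁ w ≠ w := fun e =>
  h.loopless w (by simpa only [e] using h.adj₁ w hw)

/-- The only in-neighbour of a vertex dominates it. -/
theorem Rigid.dom_of_eq (h : Rigid A r g₁ g₂) {w : V} (hw : Clean A r g₁ g₂ w) (he : g₁ w = g₂ w) :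
    Dom A r (g₁ w) w := by
  by_contra hcon
  unfold Dom at hcon
  push Not at hcon
  rcases ReflTransGen.cases_tail hcon.2 with e | ⟨x, -, hx⟩
  · exact hw.1 e
  · rcases h.inNbr hw hx.1 with e | e
    · exact hx.2.1 e
    · exact hx.2.1 (e.trans he.symm)

/-- Two consecutive vertices with one in-neighbour each would give a bridge. -/
theorem Rigid.parent_not_single (h : Rigid A r g₁ g₂) {w : V} (hw : Clean A r g₁ g₂ w) (he : g₁ w = g₂ w)
    (hp : Clean A r g₁ g₂ (g₁ w)) : g₁ (g₁ w) ≠ g₂ (g₁ w) := by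
  intro he'
  have aux : ∀ w, Clean A r g₁ g₂ w → g₁ w = g₂ w →
      ¬ ReflTransGen (fun a b => A a b ∧ ¬ (a = g₁ w ∧ b = w)) r w := by
    intro w hw he hR
    rcases ReflTransGen.cases_tail hR with e | ⟨x, -, hx⟩
    · exact hw.1 e
    · rcases h.inNbr hw hx.1 with e | e
      · exact hx.2 ⟨e, rfl⟩
      · exact hx.2 ⟨e.trans he.symm, rfl⟩
  have h1 := h.bridge (g₁ (g₁ w)) (g₁ w) w hp.1.symm (h.adj₁ _ hp.1) (h.parent_ne₁ hw.1).symm (aux _ hp he')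
  rcases ReflTransGen.cases_tail h1 with e | ⟨x, hx, hxw⟩
  · exact hw.1 e
  · have : x = g₁ w := by
      rcases h.inNbr hw hxw.1 with e | e
      · exact e
      · exact e.trans he.symm
    subst this
    exact aux _ hp he' hx

/-- A bad dominator other than the root and the branching vertices has an arc to a cross head that it
dominates. -/
theorem Rigid.exists_of_domBad (h : Rigid A r g₁ g₂) {z : V} (hz : z ∈ domBad A r g₁ g₂) (hzr : z ≠ r)
    (hb₁ : z ∉ branching g₁ r) (hb₂ : z ∉ branching g₂ r) :
    ∃ c, (c ∈ crossHeads A g₁ r ∨ c ∈ crossHeads A g₂ r) ∧ A z c ∧ Dom A r z c := by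
  obtain ⟨x, hxz, hzx, hx⟩ := hz
  by_contra hcon
  push Not at hcon
  have domr : ∀ w, Dom A r z w → w ≠ z → w ≠ r := by
    rintro w hw - rfl
    exact hzr (dom_root_iff.1 hw)
  have clean : ∀ c, A z c → Dom A r z c → c ≠ z → Clean A r g₁ g₂ c := fun c hc hd hne =>
    ⟨domr c hd hne, fun hm => hcon c (.inl hm) hc hd, fun hm => hcon c (.inr hm) hc hd⟩
  -- the parents of a dominated out-neighbour
  have single : ∀ c, A z c → Dom A r z c → c ≠ z → g₁ c = z ∧ g₂ c = z := by
    intro c hc hd hne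
    have hcl := clean c hc hd hne
    by_cases he : g₁ c = g₂ c
    · rcases h.inNbr hcl hc with e | e
      · exact ⟨e.symm, by rw [← he, ← e]⟩
      · exact ⟨by rw [he, ← e], e.symm⟩
    · exfalso
      rcases h.inNbr hcl hc with e | e
      · have h1 := h.anc₂ hcl he
        rw [← e] at h1
        exact hne (h.tree₂.antisymm h1 (hd.anc h.tree₂ h.adj₂))
      · have h1 := h.anc₁ hcl he
        rw [← e] at h1
        exact hne (h.tree₁.antisymm h1 (hd.anc h.tree₁ h.adj₁))
  -- there is a dominated child
  obtain ⟨c, hc₁, hc₂, hc₃⟩ : ∃ c, A z c ∧ Dom A r z c ∧ c ≠ z := by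
    by_contra hno
    push Not at hno
    have up : ∀ w, ReflTransGen A r w → Dom A r z w → w ≠ z → False := by
      intro w hw
      induction hw with
      | refl => exact fun hd hne => domr _ hd hne rfl
      | @tail a b h1 h2 ih =>
        intro hd hne
        have hda := hd.of_adj h2 hne.symm
        by_cases hay : a = z
        · subst hay; exact hne (hno b h2 hd)
        · exact ih hda hay
    exact up x (h.reach x) hzx hxz
  obtain ⟨e₁, e₂⟩ := single c hc₁ hc₂ hc₃
  have huniq : ∀ c', A z c' → Dom A r z c' → c' ≠ z → c' = c := by
    intro c' h1 h2 h3
    by_contra hne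
    exact hb₁ ⟨c', c, hne, domr c' h2 h3, domr c hc₂ hc₃, (single c' h1 h2 h3).1, e₁⟩
  -- With a unique dominated out-neighbour `c`, everything that `z` properly dominates lies behind
  -- the arc `zc`. A dominated vertex other than `c` would make this arc a bridge.
  have hsep : ∀ w, Dom A r z w → w ≠ z → ¬ ReflTransGen (fun a b => A a b ∧ ¬ (a = z ∧ b = c)) r w := by
    intro w hd hne hR
    induction hR with
    | refl => exact domr _ hd hne rfl
    | @tail a b h1 h2 ih =>
      have hda := hd.of_adj h2.1 hne.symm
      by_cases hay : a = z
      · subst hay; exact h2.2 ⟨rfl, huniq b h2.1 hd hne⟩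
      · exact ih hda hay
  have hxc : x ≠ c := by
    rintro rfl
    exact hx ⟨clean x hc₁ hc₂ hc₃, e₁, e₂⟩
  exact hsep x hzx hxz (h.bridge z c x (domr c hc₂ hc₃).symm hc₁ hxc (hsep c hc₂ hc₃))

/-- Each such `z` is sent to a cross head that it dominates and has an arc to. If two had the same
image, one would dominate the other, since dominators are comparable, and the arc of the lower one
would be avoidable. -/
theorem Rigid.ncard_domBad_le [Finite V] (h : Rigid A r g₁ g₂) :
    (domBad A r g₁ g₂ \ ({r} ∪ branching g₁ r ∪ branching g₂ r)).ncard ≤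
      (crossHeads A g₁ r ∪ crossHeads A g₂ r).ncard := by
  have : ∀ z ∈ domBad A r g₁ g₂ \ ({r} ∪ branching g₁ r ∪ branching g₂ r),
      ∃ c, c ∈ crossHeads A g₁ r ∪ crossHeads A g₂ r ∧ A z c ∧ Dom A r z c := by
    rintro z ⟨hz, hn⟩
    simp only [Set.mem_union, Set.mem_singleton_iff, not_or] at hn
    obtain ⟨c, h1, h2, h3⟩ := h.exists_of_domBad hz hn.1.1 hn.1.2 hn.2
    exact ⟨c, h1, h2, h3⟩
  choose! c hc using this
  have aux : ∀ z z', z ≠ r → A z (c z) → A z' (c z) → Dom A r z z' → z ≠ z' → False := by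
    intro z z' hr h1 h2 h3 hne
    obtain ⟨x, hx, hxA⟩ := h.avoidable {z} z' (c z) (by simp) (by simpa using hne.symm)
      (by simpa using h3.resolve_left hr) h2
    rw [Finset.mem_singleton] at hx
    subst hx
    exact hxA h1
  refine Set.ncard_le_ncard_of_injOn c (fun z hz => (hc z hz).1) ?_
  intro z hz z' hz' he
  by_contra hne
  have nr : ∀ z ∈ domBad A r g₁ g₂ \ ({r} ∪ branching g₁ r ∪ branching g₂ r), z ≠ r := by
    rintro z ⟨-, hn⟩ rfl
    exact hn (.inl (.inl rfl))
  rcases (hc z hz).2.2.total h.reach (he ▸ (hc z' hz').2.2) with h1 | h1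
  · exact aux z z' (nr z hz) (hc z hz).2.1 (he ▸ (hc z' hz').2.1) h1 hne
  · exact aux z' z (nr z' hz') (hc z' hz').2.1 (he ▸ (hc z hz).2.1) h1 (Ne.symm hne)

section TreeCounting

variable [Finite V] {g : V → V}

theorem IsParentFn.spans_leaves (hg : IsParentFn g r) (hA : ∀ w, w ≠ r → A (g w) w) :
    Spans A r {x | ∀ w, w ≠ r → g w ≠ x} := by
  intro w
  refine rtg_mono (fun a b hab => ?_) (hg w)
  exact ⟨hab.2 ▸ hA b hab.1, fun hl => hl b hab.1 hab.2⟩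

/-- Every vertex that is neither in `B` nor a leaf has a child of its own, which is not a child of
`B`. As only `n - 1` vertices are children, at most `|B| + k - 1` remain for `B`. -/
theorem IsParentFn.ncard_children_le (hg : IsParentFn g r) (hA : ∀ w, w ≠ r → A (g w) w) {k : ℕ}
    (hk : ∀ L, Spans A r L → L.ncard ≤ k) (B : Set V) : {w | w ≠ r ∧ g w ∈ B}.ncard + 1 ≤ B.ncard + k := by
  have h1 := hk _ (hg.spans_leaves hA)
  set L : Set V := {x | ∀ w, w ≠ r → g w ≠ x} with hL
  have : ∀ x ∈ (B ∪ L)ᶜ, ∃ w, w ≠ r ∧ g w = x := by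
    intro x hx
    by_contra hcon
    push Not at hcon
    exact hx (.inr hcon)
  choose! c hc using this
  have h2 : (B ∪ L)ᶜ.ncard = (c '' (B ∪ L)ᶜ).ncard := by
    rw [Set.ncard_image_of_injOn]
    intro x hx y hy hxy
    rw [← (hc x hx).2, ← (hc y hy).2, hxy]
  have h3 : {w | w ≠ r ∧ g w ∈ B}.ncard + (c '' (B ∪ L)ᶜ).ncard ≤ ({r}ᶜ : Set V).ncard := by
    rw [← Set.ncard_union_eq]
    · refine Set.ncard_le_ncard ?_
      rintro w (hw | ⟨x, hx, rfl⟩)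
      · exact hw.1
      · exact (hc x hx).1
    · rw [Set.disjoint_left]
      rintro _ hw ⟨x, hx, rfl⟩
      have := hw.2
      rw [(hc x hx).2] at this
      exact hx (.inl this)
  have h4 := Set.ncard_add_ncard_compl (B ∪ L)
  have h5 := Set.ncard_union_le B L
  have h6 := Set.ncard_add_ncard_compl ({r} : Set V)
  rw [Set.ncard_singleton] at h6
  omega

/-- Choose a child of every inner vertex and a second child of every branching one. These are
distinct vertices other than the root, so there are at most `n - 1` of them. -/
theorem IsParentFn.ncard_branching_le (hg : IsParentFn g r) (hA : ∀ w, w ≠ r → A (g w) w) {k : ℕ}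
    (hk : ∀ L, Spans A r L → L.ncard ≤ k) : (branching g r).ncard + 1 ≤ k := by
  have h1 := hk _ (hg.spans_leaves hA)
  set L : Set V := {x | ∀ w, w ≠ r → g w ≠ x} with hL
  have hc : ∀ x, ∃ a b, (x ∉ L → a ≠ r ∧ g a = x) ∧ (x ∈ branching g r → b ≠ r ∧ g b = x ∧ a ≠ b) := by
    intro x
    by_cases hx : x ∈ branching g r
    · obtain ⟨a, b, h1, h2, h3, h4, h5⟩ := hx
      exact ⟨a, b, fun _ => ⟨h2, h4⟩, fun _ => ⟨h3, h5, h1⟩⟩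
    · by_cases hxL : x ∈ L
      · exact ⟨r, r, fun h => absurd hxL h, fun h => absurd h hx⟩
      · have : ∃ w, w ≠ r ∧ g w = x := by
          by_contra hcon
          push Not at hcon
          exact hxL hcon
        obtain ⟨a, ha⟩ := this
        exact ⟨a, r, fun _ => ha, fun h => absurd h hx⟩
  choose a b ha hb using hc
  have h2 : Lᶜ.ncard = (a '' Lᶜ).ncard := by
    rw [Set.ncard_image_of_injOn]
    intro x hx y hy hxy
    rw [← (ha x hx).2, ← (ha y hy).2, hxy]
  have h3 : (branching g r).ncard = (b '' branching g r).ncard := by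
    rw [Set.ncard_image_of_injOn]
    intro x hx y hy hxy
    rw [← (hb x hx).2.1, ← (hb y hy).2.1, hxy]
  have h4 : (a '' Lᶜ).ncard + (b '' branching g r).ncard ≤ ({r}ᶜ : Set V).ncard := by
    rw [← Set.ncard_union_eq]
    · refine Set.ncard_le_ncard ?_
      rintro w (⟨x, hx, rfl⟩ | ⟨x, hx, rfl⟩)
      · exact (ha x hx).1
      · exact (hb x hx).1
    · rw [Set.disjoint_left]
      rintro _ ⟨x, hx, rfl⟩ ⟨y, hy, hxy⟩
      have e : y = x := by rw [← (hb y hy).2.1, ← (ha x hx).2, hxy]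
      subst e
      exact (hb y hy).2.2 hxy.symm
  have h5 := Set.ncard_add_ncard_compl L
  have h6 := Set.ncard_add_ncard_compl ({r} : Set V)
  rw [Set.ncard_singleton] at h6
  omega

end TreeCounting

/-- The vertices at which the structure of the digraph is not controlled by the two trees. -/
def special (A : V → V → Prop) (r : V) (g₁ g₂ : V → V) : Set V :=
  {r} ∪ (crossHeads A g₁ r ∪ crossHeads A g₂ r) ∪ branching g₁ r ∪ branching g₂ r ∪ domBad A r g₁ g₂

theorem Rigid.ncard_cross_le [Finite V] (h : Rigid A r g₁ g₂) {k : ℕ} (hk : ∀ L, Spans A r L → L.ncard ≤ k) :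
    (crossHeads A g₁ r ∪ crossHeads A g₂ r).ncard + 8 ≤ 12 * k := by
  have h1 := h.tree₁.ncard_le h.adj₁ hk
  have h2 := h.tree₂.ncard_le h.adj₂ hk
  have h3 := Set.ncard_union_le (crossHeads A g₁ r) (crossHeads A g₂ r)
  unfold crossHeads at *
  omega

/-- The sum is `1` for the root, `12 * k - 8` for the cross heads, `k - 1` for the branching
vertices of each tree and `12 * k - 8` for the remaining bad dominators. -/
theorem Rigid.ncard_special_le [Finite V] (h : Rigid A r g₁ g₂) {k : ℕ} (hk : ∀ L, Spans A r L → L.ncard ≤ k) :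
    (special A r g₁ g₂).ncard + 17 ≤ 26 * k := by
  have h1 := h.ncard_cross_le hk
  have h2 := h.tree₁.ncard_branching_le h.adj₁ hk
  have h3 := h.tree₂.ncard_branching_le h.adj₂ hk
  have h4 := h.ncard_domBad_le
  have hsub : special A r g₁ g₂ ⊆ {r} ∪ (crossHeads A g₁ r ∪ crossHeads A g₂ r) ∪ branching g₁ r ∪
      branching g₂ r ∪ (domBad A r g₁ g₂ \ ({r} ∪ branching g₁ r ∪ branching g₂ r)) := by
    rintro x (hx | hx)
    · exact .inl hx
    · by_cases hx' : x ∈ {r} ∪ branching g₁ r ∪ branching g₂ r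
      · left
        rcases hx' with (hx' | hx') | hx'
        · exact .inl (.inl (.inl hx'))
        · exact .inl (.inr hx')
        · exact .inr hx'
      · exact .inr ⟨hx, hx'⟩
  have h5 := Set.ncard_le_ncard hsub
  have h6 := Set.ncard_union_le ({r} ∪ (crossHeads A g₁ r ∪ crossHeads A g₂ r) ∪ branching g₁ r ∪
      branching g₂ r) (domBad A r g₁ g₂ \ ({r} ∪ branching g₁ r ∪ branching g₂ r))
  have h7 := Set.ncard_union_le ({r} ∪ (crossHeads A g₁ r ∪ crossHeads A g₂ r) ∪ branching g₁ r)
    (branching g₂ r)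
  have h8 := Set.ncard_union_le ({r} ∪ (crossHeads A g₁ r ∪ crossHeads A g₂ r)) (branching g₁ r)
  have h9 := Set.ncard_union_le {r} (crossHeads A g₁ r ∪ crossHeads A g₂ r)
  rw [Set.ncard_singleton] at h9
  omega

end Reduced

end LeafKernel

namespace LeafKernel

open Relation

/-! ### Paths of the second tree without special vertices -/

section Runs

variable {V : Type} {A : V → V → Prop} {r : V} {g₁ g₂ : V → V}

theorem clean_of_notMem {z : V} (hz : z ∉ special A r g₁ g₂) : Clean A r g₁ g₂ z := by
  simp only [special, Set.mem_union, Set.mem_singleton_iff, not_or] at hz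
  exact ⟨hz.1.1.1.1, hz.1.1.1.2.1, hz.1.1.1.2.2⟩

theorem child_unique₁ {z a b : V} (hz : z ∉ special A r g₁ g₂) (ha : a ≠ r) (hb : b ≠ r) (h : g₁ a = z)
    (h' : g₁ b = z) : a = b := by
  by_contra hne
  exact hz (.inl (.inl (.inr ⟨a, b, hne, ha, hb, h, h'⟩)))

theorem child_unique₂ {z a b : V} (hz : z ∉ special A r g₁ g₂) (ha : a ≠ r) (hb : b ≠ r) (h : g₂ a = z)
    (h' : g₂ b = z) : a = b := by
  by_contra hne
  exact hz (.inl (.inr ⟨a, b, hne, ha, hb, h, h'⟩))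

theorem eq_or_single_of_dom {z x : V} (hz : z ∉ special A r g₁ g₂) (h : Dom A r z x) :
    x = z ∨ (Clean A r g₁ g₂ x ∧ g₁ x = z ∧ g₂ x = z) := by
  by_contra hcon
  push Not at hcon
  exact hz (.inr ⟨x, hcon.1, h, fun hx => hcon.2 hx.1 hx.2.1 hx.2.2⟩)

/-- Proper descendants of an unbranched vertex are descendants of its child. -/
theorem anc_child₂ {z c y : V} (hz : z ∉ special A r g₁ g₂) (hc : c ≠ r) (hcz : g₂ c = z) (h : Anc g₂ r z y)
    (hne : z ≠ y) : Anc g₂ r c y := by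
  rcases ReflTransGen.cases_head h with e | ⟨c', h1, h2⟩
  · exact absurd e hne
  · rwa [child_unique₂ hz h1.1 hc h1.2 hcz] at h2

/-- In the second tree `g₁ w` lies properly below `w`, hence below its only child `c`. In the first
tree `w` lies properly below `c`, hence so or equally does its parent `g₁ w`. So `c` is a common
ancestor. -/
theorem Rigid.link (h : Rigid A r g₁ g₂) {w c : V} (hw : w ∉ special A r g₁ g₂) (hc : c ∉ special A r g₁ g₂)
    (hcw : g₂ c = w) (wB : g₁ w ≠ g₂ w) (cB : g₁ c ≠ g₂ c) : Dom A r c (g₁ w) := by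
  have cw := clean_of_notMem hw
  have cc := clean_of_notMem hc
  have h1 : Anc g₂ r c (g₁ w) := anc_child₂ hw cc.1 hcw (h.anc₂ cw wB) (h.parent_ne₁ cw.1).symm
  refine h.independent _ _ ?_ h1
  rcases (hcw ▸ h.anc₁ cc cB : Anc g₁ r c w).eq_or with e | ⟨-, h2⟩
  · exact absurd (e ▸ hcw) (h.symm.parent_ne₁ cc.1)
  · exact h2

/-- The same argument across a vertex `c` whose two parents are both `w`. -/
theorem Rigid.link_skip (h : Rigid A r g₁ g₂) {w c c' : V} (hw : w ∉ special A r g₁ g₂)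
    (hc : c ∉ special A r g₁ g₂) (hc' : c' ∉ special A r g₁ g₂) (hcw : g₂ c = w) (hcc : g₂ c' = c)
    (wB : g₁ w ≠ g₂ w) (cA : g₁ c = g₂ c) (cB' : g₁ c' ≠ g₂ c') : Dom A r c' (g₁ w) := by
  have cw := clean_of_notMem hw
  have cc := clean_of_notMem hc
  have cc' := clean_of_notMem hc'
  have g1c : g₁ c = w := cA.trans hcw
  have hwc : c ≠ w := by rintro rfl; exact h.parent_ne₁ cc.1 g1c
  have h1 : Anc g₂ r c (g₁ w) := anc_child₂ hw cc.1 hcw (h.anc₂ cw wB) (h.parent_ne₁ cw.1).symm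
  have hne : c ≠ g₁ w := by
    intro e
    have h2 : Anc g₁ r w c := g1c ▸ anc_parent cc.1
    have h3 : Anc g₁ r c w := e ▸ anc_parent cw.1
    exact hwc (h.tree₁.antisymm h3 h2)
  have h2 : Anc g₂ r c' (g₁ w) := anc_child₂ hc cc'.1 hcc h1 hne
  refine h.independent _ _ ?_ h2
  rcases (hcc ▸ h.anc₁ cc' cB' : Anc g₁ r c' c).eq_or with e | ⟨-, h3⟩
  · exact absurd (e ▸ hcc) (h.symm.parent_ne₁ cc'.1)
  · rw [g1c] at h3
    rcases h3.eq_or with e | ⟨-, h4⟩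
    · subst e
      have k1 : Anc g₂ r c' c := hcw ▸ anc_parent cc.1
      have k2 : Anc g₂ r c c' := hcc ▸ anc_parent cc'.1
      exact absurd (h.tree₂.antisymm k2 k1) hwc
    · exact h4

/-- A path of the second tree that avoids the special vertices. -/
structure Run (A : V → V → Prop) (r : V) (g₁ g₂ : V → V) (v : ℕ → V) (n : ℕ) : Prop where
  notMem : ∀ i ≤ n, v i ∉ special A r g₁ g₂
  step : ∀ i < n, g₂ (v (i + 1)) = v i

section Run

variable {v : ℕ → V} {n : ℕ}

theorem Run.clean (hv : Run A r g₁ g₂ v n) {i : ℕ} (hi : i ≤ n) : Clean A r g₁ g₂ (v i) :=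
  clean_of_notMem (hv.notMem i hi)

theorem Run.anc (hv : Run A r g₁ g₂ v n) {i j : ℕ} (hij : i ≤ j) (hj : j ≤ n) : Anc g₂ r (v i) (v j) := by
  induction j with
  | zero => obtain rfl : i = 0 := by omega
            exact .refl
  | succ j ih =>
    by_cases h : i = j + 1
    · subst h; exact .refl
    · exact (ih (by omega) (by omega)).tail ⟨(hv.clean hj).1, hv.step j (by omega)⟩

theorem Run.injective (h : Rigid A r g₁ g₂) (hv : Run A r g₁ g₂ v n) {i j : ℕ} (hi : i ≤ n) (hj : j ≤ n)
    (he : v i = v j) : i = j := by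
  have aux : ∀ i j, i < j → j ≤ n → v i ≠ v j := by
    intro i j hij hj he
    obtain ⟨m, rfl⟩ : ∃ m, j = m + 1 := ⟨j - 1, by omega⟩
    have h1 := hv.anc (i := i) (j := m) (by omega) (by omega)
    rw [he] at h1
    have h2 := hv.anc (i := m) (j := m + 1) (by omega) hj
    have := h.tree₂.antisymm h1 h2
    exact h.symm.parent_ne₁ (hv.clean hj).1 ((hv.step m (by omega)).trans this.symm)
  rcases lt_trichotomy i j with h1 | h1 | h1
  · exact absurd he (aux i j h1 hj)
  · exact h1
  · exact absurd he.symm (aux j i h1 hi)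

/-- By the bridge rule, vertices with a single in-neighbour are never consecutive on a run. -/
theorem Run.not_single_pred (h : Rigid A r g₁ g₂) (hv : Run A r g₁ g₂ v n) {i : ℕ} (hi : i < n)
    (hA : g₁ (v (i + 1)) = g₂ (v (i + 1))) : g₁ (v i) ≠ g₂ (v i) := by
  have e : g₁ (v (i + 1)) = v i := hA.trans (hv.step i hi)
  have := h.parent_not_single (hv.clean (by omega)) hA (by rw [e]; exact hv.clean (by omega))
  rwa [e] at this

/-- The first parent of a vertex with two in-neighbours belongs to the next such vertex. -/
theorem Run.exists_next (h : Rigid A r g₁ g₂) (hv : Run A r g₁ g₂ v n) {i : ℕ} (hi : i < n)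
    (hB : g₁ (v i) ≠ g₂ (v i)) (hn : g₁ (v (i + 1)) = g₂ (v (i + 1)) → i + 2 ≤ n) :
    ∃ j ≤ n, i < j ∧ j ≤ i + 2 ∧ g₁ (v j) ≠ g₂ (v j) ∧ (j = i + 2 → g₁ (v (i + 1)) = g₂ (v (i + 1))) ∧
      Dom A r (v j) (g₁ (v i)) ∧
      (j < n → g₁ (v i) = v j ∨ (g₁ (v i) = v (j + 1) ∧ g₁ (v (j + 1)) = g₂ (v (j + 1)))) := by
  have val : ∀ j, Dom A r (v j) (g₁ (v i)) → j < n →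
      g₁ (v i) = v j ∨ (g₁ (v i) = v (j + 1) ∧ g₁ (v (j + 1)) = g₂ (v (j + 1))) := by
    intro j hd hj
    rcases eq_or_single_of_dom (hv.notMem j hj.le) hd with e | ⟨c1, c2, c3⟩
    · exact .inl e
    · have := child_unique₂ (hv.notMem j hj.le) c1.1 (hv.clean hj).1 c3 (hv.step j hj)
      exact .inr ⟨this, by rw [← this, c2, c3]⟩
  by_cases hA : g₁ (v (i + 1)) = g₂ (v (i + 1))
  · have hi2 := hn hA
    have hB2 : g₁ (v (i + 2)) ≠ g₂ (v (i + 2)) := fun e =>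
      hv.not_single_pred h (i := i + 1) (by omega) e hA
    have hd := h.link_skip (hv.notMem i (by omega)) (hv.notMem (i + 1) (by omega)) (hv.notMem (i + 2) hi2)
      (hv.step i hi) (hv.step (i + 1) (by omega)) hB hA hB2
    exact ⟨i + 2, hi2, by omega, le_rfl, hB2, fun _ => hA, hd, val _ hd⟩
  · have hd := h.link (hv.notMem i (by omega)) (hv.notMem (i + 1) (by omega)) (hv.step i hi) hB hA
    exact ⟨i + 1, hi, by omega, by omega, hA, by omega, hd, val _ hd⟩

/-- At most two vertices of a run have arcs to the same vertex. -/
theorem Run.not_three (h : Rigid A r g₁ g₂) (hv : Run A r g₁ g₂ v n) {j : ℕ} (hj0 : 0 < j) (hjn : j < n) {w : V}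
    (h0 : A (v 0) w) (hj : A (v j) w) (hn : A (v n) w) : False := by
  classical
  -- In this case `v j` is the only in-neighbour of `v n`, so `v j` alone makes the arc from `v n`
  -- to `w` avoidable.
  by_cases hc : j + 1 = n ∧ g₁ (v n) = g₂ (v n)
  · obtain ⟨rfl, hA⟩ := hc
    have hd := h.dom_of_eq (hv.clean le_rfl) hA
    rw [hA, hv.step j (by omega)] at hd
    obtain ⟨x, hx, hxw⟩ := h.avoidable {v j} (v (j + 1)) w (by simp)
      (by simpa using fun e => by have := hv.injective h le_rfl hjn.le e; omega)
      (by simpa using hd.resolve_left (hv.clean hjn.le).1) hn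
    rw [Finset.mem_singleton] at hx
    subst hx
    exact hxw hj
  -- `K` is the last index with two distinct parents.
  obtain ⟨K, hKn, hjK, hKB, hK⟩ : ∃ K ≤ n, j < K ∧ g₁ (v K) ≠ g₂ (v K) ∧
      (K = n ∨ (K + 1 = n ∧ g₁ (v n) = g₂ (v n))) := by
    by_cases hA : g₁ (v n) = g₂ (v n)
    · obtain ⟨m, rfl⟩ : ∃ m, n = m + 1 := ⟨n - 1, by omega⟩
      refine ⟨m, by omega, ?_, hv.not_single_pred h (by omega) hA, .inr ⟨rfl, hA⟩⟩
      by_contra hjm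
      exact hc ⟨by omega, hA⟩
    · exact ⟨n, le_rfl, hjn, hA, .inl rfl⟩
  -- The vertices `v 0` and `v n` separate `v j` from the root: the inner vertices before `v K`,
  -- together with what `v n` dominates if `K = n`, can be entered only from these two. Hence the
  -- arc from `v j` to `w` is avoidable.
  have key : ∀ y, ReflTransGen (Avoid A ({v 0, v n} : Finset V)) r y →
      ¬ ((∃ m, 0 < m ∧ m < K ∧ y = v m) ∨ (K = n ∧ Dom A r (v n) y)) := by
    intro y hy
    induction hy with
    | refl =>
      rintro (⟨m, m1, m2, e⟩ | ⟨-, hd⟩)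
      · exact (hv.clean (i := m) (by omega)).1 e.symm
      · exact (hv.clean le_rfl).1 (dom_root_iff.1 hd)
    | @tail x y h1 h2 ih =>
      obtain ⟨hA, hxS, hyS⟩ := h2
      simp only [Finset.coe_insert, Finset.coe_singleton, Set.mem_insert_iff, Set.mem_singleton_iff,
        not_or] at hxS hyS
      rintro (⟨m, m1, m2, rfl⟩ | ⟨hKn, hd⟩)
      · have pred : x = g₂ (v m) → False := by
          intro e
          obtain ⟨m', rfl⟩ : ∃ m', m = m' + 1 := ⟨m - 1, by omega⟩
          rw [hv.step m' (by omega)] at e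
          by_cases hm0 : m' = 0
          · subst hm0; exact hxS.1 e
          · exact ih (.inl ⟨m', by omega, by omega, e⟩)
        rcases h.inNbr (hv.clean (by omega)) hA with e | e
        swap
        · exact pred e
        by_cases hB : g₁ (v m) = g₂ (v m)
        · exact pred (e.trans hB)
        obtain ⟨jn, j1, j2, j3, j4, j5, j6, j7⟩ := hv.exists_next h (i := m) (by omega) hB (by
          intro hA'
          by_contra hcon
          have : m + 1 = n := by omega
          rw [this] at hA'
          rcases hK with rfl | ⟨hK, -⟩
          · exact hKB hA'
          · omega)
        rw [← e] at j6 j7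
        have hjK : jn ≤ K := by
          by_contra hcon
          rcases hK with rfl | ⟨hK, hA'⟩
          · omega
          · have : jn = n := by omega
            subst this
            exact j4 hA'
        by_cases hjn' : jn = n
        · subst hjn'
          exact ih (.inr ⟨by omega, j6⟩)
        · rcases j7 (by omega) with e' | ⟨e', hA'⟩
          · by_cases hjK' : jn = K
            · subst hjK'
              rcases hK with hK | ⟨hK, hAn⟩
              · exact hjn' hK
              -- In the first tree the only child of `v K` is already `v n`, so it cannot be `v m`.
              · have e1 : g₁ (v n) = v jn := by
                  rw [hAn, ← hK]; exact hv.step jn (by omega)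
                have e2 : g₁ (v m) = v jn := e.symm.trans e'
                have := hv.injective h (by omega) le_rfl (child_unique₁ (hv.notMem jn j1)
                  (hv.clean (i := m) (by omega)).1 (hv.clean le_rfl).1 e2 e1)
                omega
            · exact ih (.inl ⟨jn, by omega, by omega, e'⟩)
          · by_cases hlt : jn + 1 < K
            · exact ih (.inl ⟨jn + 1, by omega, hlt, e'⟩)
            · by_cases heq : jn + 1 = K
              · rw [heq] at hA'; exact hKB hA'
              · have : jn + 1 = n := by omega
                rw [this] at e'
                exact hxS.2 e'
      · exact ih (.inr ⟨hKn, hd.of_adj hA (fun e => hyS.2 e.symm)⟩)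
  have ne : ∀ i, i ≤ n → i ≠ j → v j ≠ v i := fun i hi hij e => hij (hv.injective h hjn.le hi e).symm
  obtain ⟨x, hx, hxw⟩ := h.avoidable {v 0, v n} (v j) w Finset.card_le_two
    (by simpa using ⟨ne 0 (by omega) (by omega), ne n le_rfl (by omega)⟩)
    (fun hR => key _ hR (.inl ⟨j, hj0, hjK, rfl⟩)) hj
  rw [Finset.mem_insert, Finset.mem_singleton] at hx
  rcases hx with rfl | rfl
  · exact hxw h0
  · exact hxw hn

end Run

end Runs

end LeafKernel

namespace LeafKernel

open Relation

/-! ### From a long run to a two directional path -/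

section FromRun

variable {V : Type}

/-- The path of a tree between an ancestor and a descendant. -/
theorem IsParentFn.exists_path {g : V → V} {r : V} (hg : IsParentFn g r) {a b : V} (h : Anc g r a b) :
    ∃ Q : List V, Q.IsChain (Step g r) ∧ Q.Nodup ∧ Q.head? = some a ∧ Q.getLast? = some b ∧
      ∀ y, y ∈ Q ↔ Anc g r a y ∧ Anc g r y b := by
  unfold Anc at h
  induction h with
  | refl =>
    refine ⟨[a], by simp, by simp, by simp, by simp, fun y => ?_⟩
    rw [List.mem_singleton]
    exact ⟨by rintro rfl; exact ⟨.refl, .refl⟩, fun h => hg.antisymm h.2 h.1⟩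
  | @tail b c h1 h2 ih =>
    obtain ⟨Q, q1, q2, q3, q4, q5⟩ := ih
    have hbc : Anc g r b c := .single h2
    have hcb : ¬ Anc g r c b := fun h => by
      have e := hg.antisymm hbc h
      subst e
      exact hg.wellFounded.irrefl.irrefl b h2
    refine ⟨Q ++ [c], ?_, ?_, ?_, by simp, fun y => ?_⟩
    · rw [List.isChain_append]
      refine ⟨q1, by simp, fun x hx y hy => ?_⟩
      rw [q4] at hx
      simp only [Option.mem_def, Option.some_inj, List.head?_cons] at hx hy
      subst hx hy
      exact h2
    · rw [List.nodup_append]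
      refine ⟨q2, by simp, fun x hx y hy => ?_⟩
      rw [List.mem_singleton] at hy
      rintro rfl
      subst hy
      exact hcb ((q5 _).1 hx).2
    · cases Q with
      | nil => simp at q3
      | cons x l => simpa using q3
    · rw [List.mem_append, List.mem_singleton, q5]
      constructor
      · rintro (⟨h3, h4⟩ | rfl)
        · exact ⟨h3, h4.trans hbc⟩
        · exact ⟨ReflTransGen.tail h1 h2, .refl⟩
      · rintro ⟨h3, h4⟩
        rcases h4.eq_or with e | ⟨-, h5⟩
        · exact .inr e
        · rw [h2.2] at h5; exact .inl ⟨h3, h5⟩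

theorem anc_of_chain {g : V → V} {r : V} {Q : List V} (hQ : Q.IsChain (Step g r)) {i j : ℕ} (hij : i ≤ j)
    (hj : j < Q.length) : Anc g r Q[i] Q[j] :=
  rtg_mono (fun _ _ h => h.1) (rtg_along_list (M := ∅) hQ hij hj (by simp))

variable {D : Digraph V} {r : V} {g₁ g₂ : V → V}

/-- A run of seven or eight vertices that starts and continues with a vertex with two in-neighbours and
that has no arcs to cross heads gives the situation of the two directional path rule. -/
theorem Run.twoPath [Finite V] (h : Rigid D.Adj r g₁ g₂) {u : ℕ → V} {l : ℕ} (hu : Run D.Adj r g₁ g₂ u l)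
    (hl : l = 7 ∨ l = 8) (h0 : g₁ (u 0) ≠ g₂ (u 0)) (hlB : g₁ (u l) ≠ g₂ (u l))
    (hex : ∀ i < l, ∀ w, D.Adj (u i) w → w ∉ crossHeads D.Adj g₁ r ∪ crossHeads D.Adj g₂ r) :
    ∃ P Q p₁ pin pout pl, TwoPath D r P Q p₁ pin pout pl := by
  classical
  -- The path `P` will consist of `u 0, …, u (l - 1)`, and `pin` is its last vertex `u b` with two
  -- parents. The vertex `u l` lies outside `P`.
  obtain ⟨b, hbl, hb2, hbB, hbA⟩ : ∃ b < l, l ≤ b + 2 ∧ g₁ (u b) ≠ g₂ (u b) ∧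
      ∀ i, b < i → i < l → i + 1 = l ∧ b + 1 = i ∧ g₁ (u i) = g₂ (u i) := by
    by_cases hA : g₁ (u (l - 1)) = g₂ (u (l - 1))
    · refine ⟨l - 2, by omega, by omega, ?_, fun i h1 h2 => ?_⟩
      · refine hu.not_single_pred h (i := l - 2) (by omega) ?_
        rwa [show l - 2 + 1 = l - 1 by omega]
      · obtain rfl : i = l - 1 := by omega
        exact ⟨by omega, by omega, hA⟩
    · exact ⟨l - 1, by omega, by omega, hA, fun i h1 h2 => by omega⟩
  -- The vertex `pout` is `u 1` if that vertex has the single parent `u 0`, and `u 0` otherwise.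
  obtain ⟨io, hio, hioA, hioB⟩ : ∃ io, io ≤ 1 ∧ (io = 1 → g₁ (u 1) = g₂ (u 1)) ∧
      (io = 0 → g₁ (u 1) ≠ g₂ (u 1)) := by
    by_cases hA : g₁ (u 1) = g₂ (u 1)
    · exact ⟨1, le_rfl, fun _ => hA, by omega⟩
    · exact ⟨0, by omega, by omega, fun _ => hA⟩
  have cl : ∀ {i}, i ≤ l → Clean D.Adj r g₁ g₂ (u i) := fun hi => hu.clean hi
  have inj : ∀ {i j}, i ≤ l → j ≤ l → u i = u j → i = j := fun hi hj e => hu.injective h hi hj e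
  have single : ∀ i, i ≤ l → g₁ (u i) = g₂ (u i) → ∃ m, i = m + 1 ∧ g₁ (u i) = u m := by
    intro i hi hA
    rcases i with _ | m
    · exact absurd hA h0
    · exact ⟨m, rfl, hA.trans (hu.step m (by omega))⟩
  have next : ∀ i, i < l → g₁ (u i) ≠ g₂ (u i) → ∃ j ≤ l, i < j ∧ j ≤ i + 2 ∧ g₁ (u j) ≠ g₂ (u j) ∧
      (j = i + 2 → g₁ (u (i + 1)) = g₂ (u (i + 1))) ∧
      Dom D.Adj r (u j) (g₁ (u i)) ∧
      (j < l → g₁ (u i) = u j ∨ (g₁ (u i) = u (j + 1) ∧ g₁ (u (j + 1)) = g₂ (u (j + 1)))) := by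
    intro i hi hB
    refine hu.exists_next h hi hB fun hA => ?_
    by_contra hcon
    obtain rfl : l = i + 1 := by omega
    exact hlB hA
  -- the first parents stay inside, except for that of `pin`
  have up : ∀ i, i < l → i ≠ b → ∃ m, m < l ∧ m ≤ i + 3 ∧ g₁ (u i) = u m := by
    intro i hi hib
    by_cases hA : g₁ (u i) = g₂ (u i)
    · obtain ⟨m, rfl, hm⟩ := single i hi.le hA
      exact ⟨m, by omega, by omega, hm⟩
    · have hlt : i < b := by
        by_contra hcon
        exact hA (hbA i (by omega) hi).2.2
      obtain ⟨j, j1, j2, j3, j4, j5, j6, j7⟩ := next i hi hA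
      have hjb : j ≤ b := by
        by_contra hcon
        have e : j = i + 2 := by omega
        have e' : i + 1 = b := by omega
        exact hbB (e' ▸ j5 e)
      rcases j7 (by omega) with e | ⟨e, hA'⟩
      · exact ⟨j, by omega, by omega, e⟩
      · refine ⟨j + 1, ?_, by omega, e⟩
        have : j + 1 ≠ l := by rintro e'; rw [e'] at hA'; exact hlB hA'
        omega
  -- The next vertex with two parents after `u b` is `u l`, which dominates the first parent of `u
  -- b`. A vertex of `P`, being above `u l` in the second tree, cannot be that parent.
  have pin_out : ∀ m < l, g₁ (u b) ≠ u m := by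
    intro m hm e
    obtain ⟨j, j1, j2, j3, j4, j5, j6, j7⟩ := next b hbl hbB
    have hjl : j = l := by
      by_contra hcon
      exact j4 (hbA j j2 (by omega)).2.2
    subst hjl
    rw [e] at j6
    have := h.tree₂.antisymm (j6.anc h.tree₂ h.adj₂) (hu.anc hm.le le_rfl)
    have := inj le_rfl hm.le this
    omega
  have pout_free : ∀ i, i < l → i ≠ b → g₁ (u i) ≠ u io := by
    intro i hi hib e
    by_cases hA : g₁ (u i) = g₂ (u i)
    · obtain ⟨m, rfl, hm⟩ := single i hi.le hA
      have hmio := inj (by omega) (by omega) (hm.symm.trans e)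
      subst hmio
      rcases Nat.eq_zero_or_pos m with rfl | hpos
      · exact hioB rfl hA
      · obtain rfl : m = 1 := by omega
        exact hu.not_single_pred h (i := 1) (by omega) hA (hioA rfl)
    · have h1 := h.anc₂ (cl hi.le) hA
      rw [e] at h1
      have hle : i ≤ io := by
        by_contra hcon
        have := inj (by omega) (by omega) (h.tree₂.antisymm (hu.anc (i := io) (j := i) (by omega) hi.le) h1)
        omega
      rcases Nat.lt_or_ge i io with hlt | hge
      · obtain rfl : io = 1 := by omega
        obtain rfl : i = 0 := by omega
        obtain ⟨m, hm0, hm⟩ := single 1 (by omega) (hioA rfl)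
        obtain rfl : m = 0 := by omega
        have k1 : Anc g₁ r (u 1) (u 0) := e ▸ anc_parent (cl (i := 0) (by omega)).1
        have k2 : Anc g₁ r (u 0) (u 1) := hm ▸ anc_parent (cl (i := 1) (by omega)).1
        have := inj (by omega) (by omega) (h.tree₁.antisymm k1 k2)
        omega
      · obtain rfl : i = io := by omega
        exact h.parent_ne₁ (cl hi.le).1 e
  -- The first parent maps the `l - 1` vertices other than `pin` injectively into the `l - 1`
  -- vertices other than `pout`, hence onto them. So the first tree traverses `P` as a single path
  -- from `pin` to `pout`.
  have down : ∀ m, m < l → m ≠ io → ∃ i, i < l ∧ i ≠ b ∧ g₁ (u i) = u m := by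
    have hinj : Set.InjOn (fun i => g₁ (u i)) ((Finset.range l).erase b) := by
      intro i hi j hj hij
      simp only [Finset.coe_erase, Finset.coe_range, Set.mem_sdiff, Set.mem_Iio, Set.mem_singleton_iff] at hi hj
      obtain ⟨m, hm, -, e⟩ := up i hi.1 hi.2
      exact inj hi.1.le hj.1.le (child_unique₁ (hu.notMem m hm.le) (cl hi.1.le).1 (cl hj.1.le).1 e ((show g₁ (u i) = g₁ (u j) from hij).symm.trans e))
    have hinj' : Set.InjOn u ((Finset.range l).erase io) := by
      intro i hi j hj hij
      simp only [Finset.coe_erase, Finset.coe_range, Set.mem_sdiff, Set.mem_Iio, Set.mem_singleton_iff] at hi hj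
      exact inj hi.1.le hj.1.le hij
    have hsub : ((Finset.range l).erase b).image (fun i => g₁ (u i)) ⊆ ((Finset.range l).erase io).image u := by
      intro y hy
      obtain ⟨i, hi, rfl⟩ := Finset.mem_image.1 hy
      rw [Finset.mem_erase, Finset.mem_range] at hi
      obtain ⟨m, hm, -, e⟩ := up i hi.2 hi.1
      refine Finset.mem_image.2 ⟨m, ?_, e.symm⟩
      rw [Finset.mem_erase, Finset.mem_range]
      exact ⟨by rintro rfl; exact pout_free i hi.2 hi.1 e, hm⟩
    have heq := Finset.eq_of_subset_of_card_le hsub (by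
      rw [Finset.card_image_of_injOn hinj, Finset.card_image_of_injOn hinj',
        Finset.card_erase_of_mem (by simp; omega), Finset.card_erase_of_mem (by simp; omega)])
    intro m hm hne
    have hmem : u m ∈ ((Finset.range l).erase io).image u :=
      Finset.mem_image.2 ⟨m, by simp [hm, hne], rfl⟩
    rw [← heq] at hmem
    obtain ⟨i, hi, e⟩ := Finset.mem_image.1 hmem
    rw [Finset.mem_erase, Finset.mem_range] at hi
    exact ⟨i, hi.2, hi.1, e⟩
  let P := (List.range l).map u
  have hPl : P.length = l := by simp [P]
  have hPg : ∀ i (hi : i < P.length), P[i] = u i := by simp [P]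
  have hmem : ∀ y, y ∈ P ↔ ∃ i < l, u i = y := by simp [P]
  have memP : ∀ i, i < l → u i ∈ P := fun i hi => (hmem _).2 ⟨i, hi, rfl⟩
  have nP : P.Nodup := by
    rw [List.nodup_iff_injective_get]
    intro i j hij
    simp only [List.get_eq_getElem, hPg] at hij
    exact Fin.ext (inj (by omega) (by omega) hij)
  have ancIn : ∀ i, i < l → Anc g₁ r (u b) (u i) := by
    have : ∀ y, (∃ i < l, u i = y) → Anc g₁ r (u b) y := by
      intro y
      induction y using h.tree₁.wellFounded.induction with
      | _ y ih =>
        rintro ⟨i, hi, rfl⟩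
        by_cases hib : i = b
        · subst hib; exact .refl
        · obtain ⟨m, hm, -, e⟩ := up i hi hib
          exact (ih _ ⟨(cl hi.le).1, rfl⟩ ⟨m, hm, e.symm⟩).trans (anc_parent (cl hi.le).1)
    exact fun i hi => this _ ⟨i, hi, rfl⟩
  have wf' : WellFounded (fun a b => Anc g₁ r b a ∧ a ≠ b) := by
    have : IsTrans V (fun a b => Anc g₁ r b a ∧ a ≠ b) := ⟨fun a b c h1 h2 => ⟨h2.1.trans h1.1, by
      rintro rfl; exact h1.2 (h.tree₁.antisymm h2.1 h1.1)⟩⟩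
    have : Std.Irrefl (fun a b => Anc g₁ r b a ∧ a ≠ b) := ⟨fun a h => h.2 rfl⟩
    exact Finite.wellFounded_of_trans_of_irrefl _
  have ancOut : ∀ i, i < l → Anc g₁ r (u i) (u io) := by
    have : ∀ y, (∃ i < l, u i = y) → Anc g₁ r y (u io) := by
      intro y
      induction y using wf'.induction with
      | _ y ih =>
        rintro ⟨m, hm, rfl⟩
        by_cases hib : m = io
        · subst hib; exact .refl
        · obtain ⟨i, hi, -, e⟩ := down m hm hib
          have hs : Anc g₁ r (u m) (u i) := e ▸ anc_parent (cl hi.le).1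
          exact hs.trans (ih _ ⟨hs, by rintro e'; rw [e'] at e; exact h.parent_ne₁ (cl hm.le).1 e⟩ ⟨i, hi, rfl⟩)
    exact fun i hi => this _ ⟨i, hi, rfl⟩
  have inside : ∀ y, Anc g₁ r y (u io) → Anc g₁ r (u b) y → y ∈ P := by
    intro y hy
    unfold Anc at hy
    induction hy using ReflTransGen.head_induction_on with
    | refl => exact fun _ => memP _ (by omega)
    | @head a c h1 h2 ih =>
      intro hba
      obtain ⟨i, hi, rfl⟩ := (hmem c).1 (ih (hba.trans (.single h1)))
      by_cases hib : i = b
      · subst hib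
        have := h.tree₁.antisymm hba (.single h1)
        exact absurd (h1.2.trans this.symm) (h.parent_ne₁ h1.1)
      · obtain ⟨m, hm, -, e⟩ := up i hi hib
        rw [← h1.2, e]
        exact memP m hm
  obtain ⟨Q, q1, q2, q3, q4, q5⟩ := h.tree₁.exists_path (ancIn io (by omega))
  have hPQ : ∀ x, x ∈ P ↔ x ∈ Q := by
    intro x
    rw [q5]
    constructor
    · rw [hmem]
      rintro ⟨i, hi, rfl⟩
      exact ⟨ancIn i hi, ancOut i hi⟩
    · exact fun hx => inside x hx.2 hx.1
  have g2_out : ∀ m < l, g₂ (u 0) ≠ u m := by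
    intro m hm e
    have h1 : Anc g₂ r (u m) (u 0) := e ▸ anc_parent (cl (i := 0) (by omega)).1
    have := inj (by omega) (by omega) (h.tree₂.antisymm h1 (hu.anc (Nat.zero_le _) hm.le))
    subst this
    exact h.symm.parent_ne₁ (cl (i := 0) (by omega)).1 e
  refine ⟨P, Q, u 0, u b, u io, u (l - 1), ⟨?_, nP, ?_, ?_⟩, by rwa [hPl], ?_, ?_, ?_, ?_, ?_, ?_,
    ⟨?_, q2, q3, q4⟩, hPQ, ?_, ?_⟩
  · rw [List.isChain_iff_getElem]
    intro i hi
    rw [hPg, hPg]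
    rw [hPl] at hi
    have := h.adj₂ (u (i + 1)) (cl (by omega)).1
    rwa [hu.step i (by omega)] at this
  · rw [List.head?_eq_getElem?, List.getElem?_eq_getElem (by omega), hPg]
  · rw [List.getLast?_eq_getElem?, List.getElem?_eq_getElem (by omega), hPg, hPl]
  · have hb' : b = l - 1 ∨ b = l - 2 := by omega
    rcases hl with rfl | rfl <;> rcases hb' with rfl | rfl
    · exact .inl rfl
    · exact .inr ⟨[u 0, u 1, u 2, u 3, u 4], rfl⟩
    · exact .inl rfl
    · exact .inr ⟨[u 0, u 1, u 2, u 3, u 4, u 5], rfl⟩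
  · have hio' : io = 0 ∨ io = 1 := by omega
    rcases hio' with rfl | rfl
    · exact .inl rfl
    · rcases hl with rfl | rfl
      · exact .inr ⟨[u 2, u 3, u 4, u 5, u 6], rfl⟩
      · exact .inr ⟨[u 2, u 3, u 4, u 5, u 6, u 7], rfl⟩
  · rw [hmem]
    rintro ⟨i, hi, e⟩
    exact (cl hi.le).1 e
  · intro y hy
    obtain ⟨i, hi, rfl⟩ := (hmem y).1 hy
    constructor
    · rintro ⟨a, ha, hA⟩
      rcases h.inNbr (cl hi.le) hA with rfl | rfl
      · right
        by_contra hne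
        obtain ⟨m, hm, -, e⟩ := up i hi (fun e => hne (e ▸ rfl))
        exact ha (e ▸ memP m hm)
      · left
        rcases i with _ | i
        · rfl
        · rw [hu.step i (by omega)] at ha
          exact absurd (memP i (by omega)) ha
    · rintro (e | e)
      · refine ⟨g₂ (u 0), ?_, by rw [e]; exact h.adj₂ (u 0) (cl (i := 0) (by omega)).1⟩
        rw [hmem]
        rintro ⟨m, hm, e⟩
        exact g2_out m hm e.symm
      · refine ⟨g₁ (u b), ?_, by rw [e]; exact h.adj₁ (u b) (cl hbl.le).1⟩
        rw [hmem]
        rintro ⟨m, hm, e⟩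
        exact pin_out m hm e.symm
  · intro y hy
    obtain ⟨i, hi, rfl⟩ := (hmem y).1 hy
    have child_out : ∀ m, m < l → ∀ c, c ≠ r → g₁ c = u m → c ∉ P → m = io := by
      intro m hm c hc e hcP
      by_contra hne
      obtain ⟨i, hi, -, e'⟩ := down m hm hne
      exact hcP (child_unique₁ (hu.notMem m hm.le) hc (cl hi.le).1 e e' ▸ memP i hi)
    constructor
    · rintro ⟨c, hcP, hA⟩
      have hcr : c ≠ r := by rintro rfl; exact h.not_adj_root _ hA
      have hcx := hex i hi c hA
      have hcc : Clean D.Adj r g₁ g₂ c := ⟨hcr, fun hm => hcx (.inl hm), fun hm => hcx (.inr hm)⟩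
      rcases h.inNbr hcc hA with e | e
      · right
        rw [child_out i hi c hcr e.symm hcP]
      · left
        by_cases hil : i + 1 = l
        · rw [← hil]; rfl
        · exfalso
          have := child_unique₂ (hu.notMem i hi.le) hcr (cl (i := i + 1) (by omega)).1 e.symm
            (hu.step i (by omega))
          exact hcP (this ▸ memP (i + 1) (by omega))
    · rintro (e | e)
      · refine ⟨u l, ?_, ?_⟩
        · rw [hmem]
          rintro ⟨m, hm, e⟩
          have := inj hm.le le_rfl e
          omega
        · have h1 := h.adj₂ (u l) (cl le_rfl).1
          have h2 := hu.step (l - 1) (by omega)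
          rw [show l - 1 + 1 = l by omega] at h2
          rw [h2] at h1
          rwa [e]
      -- In the first tree a path leads from `u 0` down to its second parent, which is outside `P`.
      -- It must leave `P` somewhere, and `pout` is the only vertex where it can.
      · have hA : Anc g₁ r (u 0) (g₂ (u 0)) := h.anc₁ (cl (i := 0) (by omega)) h0
        have key : ∀ z, Anc g₁ r (u 0) z → z ∉ P → ∃ c, c ∉ P ∧ D.Adj (u io) c := by
          intro z hz
          unfold Anc at hz
          induction hz with
          | refl => exact fun hh => absurd (memP 0 (by omega)) hh
          | @tail x z h1 h2 ih =>
            intro hzP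
            by_cases hx : x ∈ P
            · obtain ⟨m, hm, rfl⟩ := (hmem x).1 hx
              have := child_out m hm z h2.1 h2.2 hzP
              subst this
              exact ⟨z, hzP, h2.2 ▸ h.adj₁ z h2.1⟩
            · exact ih hx
        rw [e]
        refine key _ hA ?_
        rw [hmem]
        rintro ⟨m, hm, e⟩
        exact g2_out m hm e.symm
  · rw [noSkip_iff]
    intro i j hi hj hA
    rw [hPg, hPg] at hA
    rw [hPl] at hi hj
    by_contra hcon
    obtain ⟨j', rfl⟩ : ∃ j', j = j' + 1 := ⟨j - 1, by omega⟩
    have two : u i ≠ g₂ (u (j' + 1)) := by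
      intro e
      rw [hu.step j' (by omega)] at e
      have := inj hi.le (by omega) e
      omega
    rcases h.inNbr (cl hj.le) hA with e | e
    · by_cases hA' : g₁ (u (j' + 1)) = g₂ (u (j' + 1))
      · exact two (e.trans hA')
      · have h1 := h.anc₂ (cl hj.le) hA'
        rw [← e] at h1
        have := inj hi.le hj.le (h.tree₂.antisymm (hu.anc (by omega) hj.le) h1)
        omega
    · exact two e
  · exact q1.imp fun (a b : V) (hab : Step g₁ r a b) => hab.2 ▸ h.adj₁ b hab.1
  · rw [noSkip_iff]
    intro i j hi hj hA
    by_contra hcon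
    obtain ⟨m, hm, e⟩ := (hmem _).1 ((hPQ _).2 (List.getElem_mem hj))
    have hcl : Clean D.Adj r g₁ g₂ Q[j] := e ▸ cl hm.le
    obtain ⟨j', rfl⟩ : ∃ j', j = j' + 1 := ⟨j - 1, by omega⟩
    have one : Q[i] ≠ g₁ Q[j' + 1] := by
      rw [(List.isChain_iff_getElem.1 q1 j' hj).2]
      intro e
      rw [q2.getElem_inj_iff] at e
      omega
    rcases h.inNbr hcl hA with e | e
    · exact one e
    · by_cases hA' : g₁ Q[j' + 1] = g₂ Q[j' + 1]
      · exact one (e.trans hA'.symm)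
      · have h1 := h.anc₁ hcl hA'
        rw [← e] at h1
        have := h.tree₁.antisymm (anc_of_chain q1 (i := i) (j := j' + 1) (by omega) hj) h1
        rw [q2.getElem_inj_iff] at this
        omega
  · intro x hx hx'
    obtain ⟨i, hi, e1, e2⟩ := infix_pair_iff.1 hx
    obtain ⟨j, hj, e3, e4⟩ := infix_pair_iff.1 hx'
    rw [hPg] at e1 e2
    rw [hPl] at hi
    have := inj (by omega) (by omega) e1
    subst this
    -- First parents lie at most three positions ahead, so that of the vertex after `pout` has index
    -- at most `5`. As `l ≥ 7`, it is not the last vertex of `P`.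
    obtain ⟨m, hm, hm', e5⟩ := up (i + 1) hi (by omega)
    have e6 := (List.isChain_iff_getElem.1 q1 j hj).2
    rw [e4, e3, ← e2, e5] at e6
    have := inj hm.le (by omega) e6
    omega

/-- Single-parent vertices are not consecutive, so the start can be chosen among the first two
positions and the length among seven and eight such that both boundary vertices have two parents.
This stays within index `9`. -/
theorem Run.exists_twoPath [Finite V] (h : Rigid D.Adj r g₁ g₂) {v : ℕ → V} (hv : Run D.Adj r g₁ g₂ v 9)
    (hex : ∀ i ≤ 9, ∀ w, D.Adj (v i) w → w ∉ crossHeads D.Adj g₁ r ∪ crossHeads D.Adj g₂ r) :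
    ∃ P Q p₁ pin pout pl, TwoPath D r P Q p₁ pin pout pl := by
  obtain ⟨s, hs, hsB⟩ : ∃ s, s ≤ 1 ∧ g₁ (v s) ≠ g₂ (v s) := by
    by_cases hA : g₁ (v 1) = g₂ (v 1)
    · exact ⟨0, by omega, hv.not_single_pred h (i := 0) (by omega) hA⟩
    · exact ⟨1, le_rfl, hA⟩
  obtain ⟨l, hl, hlB⟩ : ∃ l, (l = 7 ∨ l = 8) ∧ g₁ (v (s + l)) ≠ g₂ (v (s + l)) := by
    by_cases hA : g₁ (v (s + 8)) = g₂ (v (s + 8))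
    · exact ⟨7, .inl rfl, hv.not_single_pred h (i := s + 7) (by omega) hA⟩
    · exact ⟨8, .inr rfl, hA⟩
  exact Run.twoPath h (u := fun i => v (s + i)) (l := l)
    ⟨fun i hi => hv.notMem _ (by omega), fun i hi => hv.step (s + i) (by omega)⟩ hl hsB hlB
    fun i hi => hex _ (by omega)

end FromRun

end LeafKernel

namespace LeafKernel

open Relation

/-! ### Counting vertices near exceptional ones -/

section Counting

variable {V : Type} {A : V → V → Prop} {r : V} {g₁ g₂ : V → V}

theorem root_mem_special : r ∈ special A r g₁ g₂ := .inl (.inl (.inl (.inl rfl)))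

theorem IsParentFn.exists_iterate {g : V → V} (hg : IsParentFn g r) (w : V) : ∃ n, g^[n] w = r := by
  induction hg w with
  | refl => exact ⟨0, rfl⟩
  | tail _ hbc ih =>
    obtain ⟨n, hn⟩ := ih
    exact ⟨n + 1, by rw [Function.iterate_succ_apply, hbc.2, hn]⟩

/-- A vertex that is not special has at most one child in the second tree. -/
theorem iterate_injective {i : ℕ} {a b : V} (ha : ∀ j ≤ i, g₂^[j] a ∉ special A r g₁ g₂)
    (hb : ∀ j < i, g₂^[j] b ∉ special A r g₁ g₂) (e : g₂^[i] a = g₂^[i] b) : a = b := by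
  induction i with
  | zero => exact e
  | succ i ih =>
    refine ih (fun j hj => ha j (by omega)) (fun j hj => hb j (by omega)) ?_
    have hne : ∀ x, x ∉ special A r g₁ g₂ → x ≠ r := fun x hx e => hx (e ▸ root_mem_special)
    rw [Function.iterate_succ_apply', Function.iterate_succ_apply'] at e
    refine child_unique₂ (A := A) (g₁ := g₁) (z := g₂ (g₂^[i] a)) ?_ (hne _ (ha i (by omega))) (hne _ (hb i (by omega))) rfl e.symm
    rw [← Function.iterate_succ_apply' g₂]
    exact ha (i + 1) le_rfl

/-- An exit `y` is sent to a pair: an out-neighbour in `C`, and the top of the run containing `y`.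
The tops are children of special vertices, and fibres have at most two elements because three exits
of one run to the same vertex are impossible. -/
theorem Rigid.ncard_exits_le [Finite V] (h : Rigid A r g₁ g₂) {k : ℕ} (hk : ∀ L, Spans A r L → L.ncard ≤ k)
    (C : Set V) : {y | y ∉ special A r g₁ g₂ ∧ ∃ w ∈ C, A y w}.ncard ≤
      2 * (C.ncard * ((special A r g₁ g₂).ncard + k)) := by
  classical
  have := Fintype.ofFinite V
  set S := special A r g₁ g₂ with hS
  have hex : ∀ y, ∃ n, g₂^[n] y ∈ S := fun y => by
    obtain ⟨n, hn⟩ := h.tree₂.exists_iterate y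
    exact ⟨n, hn ▸ root_mem_special⟩
  -- `t` is the number of steps from `y` to the top of its run; the value on special vertices is
  -- irrelevant.
  have hdist : ∀ y, ∃ t, y ∉ S → g₂^[t + 1] y ∈ S ∧ ∀ i ≤ t, g₂^[i] y ∉ S := by
    intro y
    by_cases hy : y ∈ S
    · exact ⟨0, fun h => absurd hy h⟩
    · have h0 : Nat.find (hex y) ≠ 0 := fun e => hy (by simpa [e] using Nat.find_spec (hex y))
      refine ⟨Nat.find (hex y) - 1, fun _ => ⟨?_, fun i hi => Nat.find_min (hex y) (by omega)⟩⟩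
      rw [Nat.sub_add_cancel (by omega)]
      exact Nat.find_spec (hex y)
  choose d hd using hdist
  set E : Set V := {y | y ∉ S ∧ ∃ w ∈ C, A y w} with hE
  have hw : ∀ y, ∃ w, y ∈ E → w ∈ C ∧ A y w := fun y => by
    by_cases hy : y ∈ E
    · obtain ⟨w, h1, h2⟩ := hy.2
      exact ⟨w, fun _ => ⟨h1, h2⟩⟩
    · exact ⟨y, fun h => absurd h hy⟩
  choose w hw using hw
  have key : ∀ a b, a ∉ S → b ∉ S → g₂^[d a] a = g₂^[d b] b → d a ≤ d b → a = g₂^[d b - d a] b := by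
    intro a b ha hb e hab
    refine iterate_injective (i := d a) (fun j hj => (hd a ha).2 j hj) (fun j hj => ?_) ?_
    · rw [← Function.iterate_add_apply]
      exact (hd b hb).2 _ (by omega)
    · rw [← Function.iterate_add_apply, e]
      congr 2
      omega
  have three : ∀ a b c, a ∈ E → b ∈ E → c ∈ E → w a = w b → w a = w c → g₂^[d a] a = g₂^[d b] b →
      g₂^[d a] a = g₂^[d c] c → d a < d b → d b < d c → False := by
    intro a b c ha hb hc e1 e2 e3 e4 l1 l2
    have hrun : Run A r g₁ g₂ (fun i => g₂^[d c - d a - i] c) (d c - d a) := by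
      refine ⟨fun i _ => (hd c hc.1).2 _ (by omega), fun i hi => ?_⟩
      rw [← Function.iterate_succ_apply' g₂]
      congr 2
      omega
    have h0 : g₂^[d c - d a - 0] c = a := (key a c ha.1 hc.1 e4 (by omega)).symm
    have h1 : g₂^[d c - d a - (d b - d a)] c = b := by
      exact (congrArg (fun i => g₂^[i] c) (by omega)).trans (key b c hb.1 hc.1 (e3.symm.trans e4) (by omega)).symm
    refine hrun.not_three h (j := d b - d a) (w := w a) (by omega) (by omega) ?_ ?_ ?_
    · simp only [h0]
      exact (hw a ha).2
    · simp only [h1]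
      exact e1 ▸ (hw b hb).2
    · simpa [e2] using (hw c hc).2
  have hinj : ∀ a b, a ∈ E → b ∈ E → g₂^[d a] a = g₂^[d b] b → d a = d b → a = b := by
    intro a b ha hb e hab
    simpa [hab] using key a b ha.1 hb.1 e hab.le
  set T : Set V := {y | y ≠ r ∧ g₂ y ∈ S} with hT
  have hTc : T.ncard + 1 ≤ S.ncard + k := h.tree₂.ncard_children_le h.adj₂ hk S
  have hfib := Finset.card_le_mul_card_image_of_maps_to (s := E.toFinset) (t := C.toFinset ×ˢ T.toFinset)
    (f := fun y => (w y, g₂^[d y] y)) (by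
      intro y hy
      rw [Set.mem_toFinset] at hy
      rw [Finset.mem_product, Set.mem_toFinset, Set.mem_toFinset]
      refine ⟨(hw y hy).1, fun e => (hd y hy.1).2 (d y) le_rfl ((show g₂^[d y] y = r from e) ▸ root_mem_special), ?_⟩
      rw [← Function.iterate_succ_apply' g₂]
      exact (hd y hy.1).1) 2 (by
      intro p _
      by_contra hcon
      push Not at hcon
      obtain ⟨a, ha, b, hb, c, hc, hab, hac, hbc⟩ := Finset.two_lt_card.1 hcon
      simp only [Finset.mem_filter, Set.mem_toFinset] at ha hb hc
      obtain ⟨ha, rfl⟩ := ha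
      obtain ⟨hb, eb⟩ := hb
      obtain ⟨hc, ec⟩ := hc
      rw [Prod.mk.injEq] at eb ec
      obtain ⟨b1, b2⟩ := eb
      obtain ⟨c1, c2⟩ := ec
      have nab := fun e => hab (hinj a b ha hb b2.symm e)
      have nac := fun e => hac (hinj a c ha hc c2.symm e)
      have nbc := fun e => hbc (hinj b c hb hc (b2.trans c2.symm) e)
      have b1' := b1.symm
      have b2' := b2.symm
      have c1' := c1.symm
      have c2' := c2.symm
      have bc1 := b1.trans c1'
      have bc2 := b2.trans c2'
      rcases lt_or_gt_of_ne nab with l1 | l1 <;> rcases lt_or_gt_of_ne nac with l2 | l2 <;>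
        rcases lt_or_gt_of_ne nbc with l3 | l3
      · exact three a b c ha hb hc b1' c1' b2' c2' l1 l3
      · exact three a c b ha hc hb c1' b1' c2' b2' l2 l3
      · omega
      · exact three c a b hc ha hb c1 bc1.symm c2 bc2.symm l2 l1
      · exact three b a c hb ha hc b1 bc1 b2 bc2 l1 l2
      · omega
      · exact three b c a hb hc ha bc1 b1 bc2 b2 l3 l2
      · exact three c b a hc hb ha bc1.symm c1 bc2.symm c2 l3 l1)
  rw [Finset.card_product, ← Set.ncard_eq_toFinset_card', ← Set.ncard_eq_toFinset_card',
    ← Set.ncard_eq_toFinset_card'] at hfib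
  refine hfib.trans (Nat.mul_le_mul le_rfl (Nat.mul_le_mul le_rfl ?_))
  omega

/-- The vertices one step below `B` number at most `|B| + k`. Further layers do not grow, as
vertices outside `B` are not branching. -/
theorem Rigid.card_le_of_near [Finite V] (h : Rigid A r g₁ g₂) {k : ℕ} (hk : ∀ L, Spans A r L → L.ncard ≤ k)
    {B : Set V} (hB : special A r g₁ g₂ ⊆ B) (m : ℕ) :
    {y | ∃ i ≤ m, g₂^[i] y ∈ B}.ncard ≤ B.ncard + m * (B.ncard + k) := by
  have hne : ∀ x, x ∉ B → x ≠ r := fun x hx e => hx (hB (e ▸ root_mem_special))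
  have hlayer : ∀ i, {y | g₂^[i + 1] y ∈ B ∧ ∀ j ≤ i, g₂^[j] y ∉ B}.ncard ≤ B.ncard + k := by
    intro i
    induction i with
    | zero =>
      have h1 := h.tree₂.ncard_children_le h.adj₂ hk B
      refine (Set.ncard_le_ncard (t := {w | w ≠ r ∧ g₂ w ∈ B}) ?_).trans (by omega)
      rintro y ⟨hy1, hy2⟩
      exact ⟨hne _ (hy2 0 le_rfl), hy1⟩
    | succ i ih =>
      refine (Set.ncard_le_ncard_of_injOn g₂ ?_ ?_).trans ih
      · rintro y ⟨hy1, hy2⟩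
        exact ⟨hy1, fun j hj => hy2 (j + 1) (by omega)⟩
      · rintro a ⟨-, ha⟩ b ⟨-, hb⟩ e
        exact child_unique₂ (fun hs => ha 1 (by omega) (hB hs)) (hne _ (ha 0 (by omega)))
          (hne _ (hb 0 (by omega))) rfl e.symm
  induction m with
  | zero =>
    refine (Set.ncard_le_ncard ?_).trans (Nat.le_add_right _ _)
    rintro y ⟨i, hi, hy⟩
    obtain rfl : i = 0 := by omega
    exact hy
  | succ m ih =>
    have hsub : {y | ∃ i ≤ m + 1, g₂^[i] y ∈ B} ⊆ {y | ∃ i ≤ m, g₂^[i] y ∈ B} ∪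
        {y | g₂^[m + 1] y ∈ B ∧ ∀ j ≤ m, g₂^[j] y ∉ B} := by
      rintro y ⟨i, hi, hy⟩
      by_cases hcon : ∃ i ≤ m, g₂^[i] y ∈ B
      · exact .inl hcon
      · push Not at hcon
        obtain rfl : i = m + 1 := by
          by_contra hne
          exact hcon i (by omega) hy
        exact .inr ⟨hy, hcon⟩
    have h1 := (Set.ncard_le_ncard hsub).trans (Set.ncard_union_le _ _)
    have h2 := hlayer m
    rw [Nat.succ_mul]
    omega

theorem Rigid.exists_twoPath_of_card [Finite V] {D : Digraph V} (h : Rigid D.Adj r g₁ g₂) {k : ℕ}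
    (hk : ∀ L, Spans D.Adj r L → L.ncard ≤ k) (hn : 1540 * (k + 1) ^ 3 < Nat.card V) :
    ∃ P Q p₁ pin pout pl, TwoPath D r P Q p₁ pin pout pl := by
  set C := crossHeads D.Adj g₁ r ∪ crossHeads D.Adj g₂ r with hC
  set E : Set V := {y | y ∉ special D.Adj r g₁ g₂ ∧ ∃ w ∈ C, D.Adj y w} with hE
  have hCc : C.ncard + 8 ≤ 12 * k := h.ncard_cross_le hk
  have hSc := h.ncard_special_le hk
  have hEc : E.ncard ≤ _ := h.ncard_exits_le hk C
  by_cases hfar : ∃ y, ∀ i ≤ 9, g₂^[i] y ∉ special D.Adj r g₁ g₂ ∪ E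
  · obtain ⟨y, hy⟩ := hfar
    have hrun : Run D.Adj r g₁ g₂ (fun i => g₂^[9 - i] y) 9 := by
      refine ⟨fun i _ hs => hy (9 - i) (by omega) (.inl hs), fun i hi => ?_⟩
      rw [← Function.iterate_succ_apply' g₂]
      congr 2
      omega
    refine hrun.exists_twoPath h fun i _ w hA hw => ?_
    exact hy (9 - i) (by omega) (.inr ⟨fun hs => hy (9 - i) (by omega) (.inl hs), w, hw, hA⟩)
  · push Not at hfar
    exfalso
    have h1 := h.card_le_of_near hk (B := special D.Adj r g₁ g₂ ∪ E) Set.subset_union_left 9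
    have h2 := Set.ncard_union_le (special D.Adj r g₁ g₂) E
    have h3 : {y | ∃ i ≤ 9, g₂^[i] y ∈ special D.Adj r g₁ g₂ ∪ E} = Set.univ :=
      Set.eq_univ_of_forall hfar
    rw [h3, Set.ncard_univ] at h1
    -- There are at most `12 * k` cross heads, and `27 * k` bounds the special vertices plus `k`. If
    -- no run of ten vertices is free of exceptions, the total is at most ten times the number of
    -- exceptions plus `9 * k`.
    have h4 : E.ncard ≤ 2 * ((12 * k) * (27 * k)) :=
      hEc.trans (Nat.mul_le_mul le_rfl (Nat.mul_le_mul (by omega) (by omega)))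
    have h5 : 10 * (26 * k + 2 * ((12 * k) * (27 * k))) + 9 * k ≤ 1540 * (k + 1) ^ 3 := by
      zify
      nlinarith [mul_nonneg (Int.natCast_nonneg k) (sq_nonneg ((k : ℤ) - 1)), sq_nonneg (k : ℤ)]
    omega

end Counting

end LeafKernel

namespace LeafKernel

open Relation

/-! ### Soundness of the whole procedure -/

section Kernel

variable {I J : Instance}

theorem RuleStep.k_eq (h : RuleStep I J) : J.k = I.k := by
  rcases h with ⟨_, _, _, _, h⟩ | ⟨_, _, _, _, _, _, _, _, _, h⟩ | ⟨_, _, _, _, _, _, _, _, h⟩ |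
    ⟨_, _, _, _, _, _, _, h⟩ <;> exact h.1

theorem RuleStep.brYes_iff (h : RuleStep I J) (hI : ∀ w, ReflTransGen I.D.Adj I.root w) (k : ℕ) :
    BrYes J.D.Adj J.root k ↔ BrYes I.D.Adj I.root k := by
  rcases h with ⟨u, v, h1, h2, h⟩ | ⟨u, v, w₁, w₂, hr, h1, h2, h3, h4, h⟩ |
    ⟨S, v, w, _, h2, h3, _, h5, h⟩ | ⟨P, Q, p₁, pin, pout, pl, hP, h⟩
  · refine (h.brYes_iff k).trans (brYes_deleteArc_iff (S := {u}) (setDisconnects_iff.1 h1) ?_ fun x hx => .inl hx)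
    rintro rfl
    exact I.loopless _ h2
  · exact (h.brYes_iff k).trans (brYes_contract_iff hr h1 I.loopless hI h2 h3 h4)
  · exact (h.brYes_iff k).trans (brYes_deleteArc_iff (S := S) (setDisconnects_iff.1 h3) h2 fun x hx => .inr (h5 x hx))
  · exact (h.brYes_iff k).trans (brYes_replacePath_iff (twoDirectionalPath_iff.1 hP) k)

theorem RuleStep.allReachable (h : RuleStep I J) (hI : AllReachable I) : AllReachable J := by
  rw [allReachable_iff] at *
  rw [← brYes_zero_iff] at *
  exact (h.brYes_iff (brYes_zero_iff.1 hI) 0).2 hI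

theorem UnreachableVertexRule.trYes_iff (h : UnreachableVertexRule I J) (k : ℕ) :
    TrYes J.D.Adj J.root k ↔ TrYes I.D.Adj I.root k := by
  obtain ⟨u, hr, hu, h⟩ := h
  exact (h.trYes_iff k).trans (trYes_inducedOn_iff hr (by rwa [← reaches_iff]))

theorem trYes_iff_brYes (hI : AllReachable I) (k : ℕ) :
    TrYes I.D.Adj I.root k ↔ BrYes I.D.Adj I.root k :=
  ⟨fun h => h.brYes (allReachable_iff.1 hI), BrYes.trYes⟩

theorem BranchingStep.steps_iff (h : ReflTransGen BranchingStep I J) :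
    J.k = I.k ∧ (RootedLeafOutBranching I ↔ RootedLeafOutBranching J) := by
  induction h with
  | refl => exact ⟨rfl, Iff.rfl⟩
  | tail _ hs ih =>
    refine ⟨hs.2.k_eq.trans ih.1, ih.2.trans ?_⟩
    rw [rootedLeafOutBranching_iff, rootedLeafOutBranching_iff, hs.2.brYes_iff (allReachable_iff.1 hs.1),
      hs.2.k_eq]

theorem TreeStep.steps_iff (h : ReflTransGen TreeStep I J) :
    J.k = I.k ∧ (RootedLeafOutTree I ↔ RootedLeafOutTree J) := by
  induction h with
  | refl => exact ⟨rfl, Iff.rfl⟩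
  | @tail J J' _ hs ih =>
    have hk : J'.k = J.k := by
      rcases hs with ⟨_, _, _, hs⟩ | hs
      · exact hs.1
      · exact hs.2.k_eq
    refine ⟨hk.trans ih.1, ih.2.trans ?_⟩
    rw [rootedLeafOutTree_iff, rootedLeafOutTree_iff, hk]
    rcases hs with hs | hs
    · exact (hs.trYes_iff _).symm
    · rw [trYes_iff_brYes hs.1, trYes_iff_brYes (hs.2.allReachable hs.1),
        hs.2.brYes_iff (allReachable_iff.1 hs.1)]

theorem IsReduced.exists_rigid (h : IsReduced I) : ∃ g₁ g₂, Rigid I.D.Adj I.root g₁ g₂ := by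
  have hr := allReachable_iff.1 h.1
  obtain ⟨g₁, g₂, h1, h2, h3, h4, h5⟩ := exists_independent_trees hr
  refine ⟨g₁, g₂, I.loopless, hr, h1, h2, h3, h4, h5, fun u v hd hA => ?_, fun u v w hrv hA hwv hv => ?_,
    fun S v w hS hv hd hA => ?_⟩
  · obtain ⟨J, hJ⟩ := exists_isCopyOf (I.D.deleteArc v u) (fun a ha => I.loopless a ha.1) I.root I.k
    exact h.2 J (.inl ⟨u, v, setDisconnects_iff.2 (hd.imp_left fun e => e.symm), hA, hJ⟩)
  · by_contra hw
    obtain ⟨J, hJ⟩ := exists_isCopyOf (I.D.contract u v) (fun a ha => ha.1 rfl) ⟨I.root, hrv⟩ I.k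
    exact h.2 J (.inr (.inl ⟨u, v, w, v, hrv, hA, hwv, arcDisconnects_iff.2 hw, arcDisconnects_iff.2 hv, hJ⟩))
  · by_contra hcon
    push Not at hcon
    obtain ⟨J, hJ⟩ := exists_isCopyOf (I.D.deleteArc v w) (fun a ha => I.loopless a ha.1) I.root I.k
    exact h.2 J (.inr (.inr (.inl ⟨S, v, w, hS, hv, setDisconnects_iff.2 (.inr hd), hA, hcon, hJ⟩)))

theorem replacePath_loopless {V : Type} {D : Digraph V} (hD : ∀ a, ¬ D.Adj a a) (P : List V) (p₁ pin pout pl : V)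
    (a : {x : V // Digraph.Kept P p₁ pin pout pl x} ⊕ Bool) : ¬ (D.replacePath P p₁ pin pout pl).Adj a a := by
  rcases a with a | b
  · exact hD a
  · cases b <;> exact fun h => absurd rfl h

/-- For a positive parameter, a no-instance has at most `I.k - 1` leaves in any branching, so the
counting bound for `I.k - 1` yields an applicable two directional path rule. -/
theorem IsReduced.brYes_of_lt (h : IsReduced I) (hn : 1540 * I.k ^ 3 < I.n) : BrYes I.D.Adj I.root I.k := by
  rcases Nat.eq_zero_or_pos I.k with h0 | h0
  · rw [h0]
    exact brYes_zero_iff.2 (allReachable_iff.1 h.1)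
  · by_contra hcon
    obtain ⟨g₁, g₂, hg⟩ := h.exists_rigid
    obtain ⟨P, Q, p₁, pin, pout, pl, hP⟩ := hg.exists_twoPath_of_card (k := I.k - 1)
      (fun L hL => by
        by_contra hlt
        exact hcon ⟨L, by omega, hL⟩)
      (by rwa [Nat.sub_add_cancel h0, Nat.card_fin])
    obtain ⟨J, hJ⟩ := exists_isCopyOf (I.D.replacePath P p₁ pin pout pl) (replacePath_loopless I.loopless _ _ _ _ _)
      (.inl ⟨I.root, fun hP' => absurd hP' hP.root_notMem⟩) I.k
    exact h.2 J (.inr (.inr (.inr ⟨P, Q, p₁, pin, pout, pl, twoDirectionalPath_iff.2 hP, hJ⟩)))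

theorem rootedLeafOutBranching_yesInstance : RootedLeafOutBranching yesInstance := by
  rw [rootedLeafOutBranching_iff]
  refine brYes_zero_iff.2 fun w => ?_
  obtain rfl : w = yesInstance.root := Subsingleton.elim (α := Fin 1) _ _
  exact .refl

theorem not_rootedLeafOutBranching_noInstance : ¬ RootedLeafOutBranching noInstance := by
  rw [rootedLeafOutBranching_iff]
  intro h
  have h1 := brYes_zero_iff.1 h (1 : Fin 2)
  rcases ReflTransGen.cases_tail h1 with h2 | ⟨_, _, h2⟩
  · exact absurd h2 (show ¬ (1 : Fin 2) = 0 by decide)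
  · exact h2

theorem BranchingRun.sound (h : BranchingRun I J) : (RootedLeafOutBranching I ↔ RootedLeafOutBranching J) ∧
    J.n ≤ max 2 (1540 * I.k ^ 3) ∧ J.k ≤ I.k := by
  cases h with
  | unreachable J hs hJ =>
    refine ⟨(BranchingStep.steps_iff hs).2.trans (iff_of_false (fun hb => hJ ?_)
      not_rootedLeafOutBranching_noInstance), le_max_left _ _, Nat.zero_le _⟩
    obtain ⟨L, -, hL⟩ := rootedLeafOutBranching_iff.1 hb
    exact allReachable_iff.2 (brYes_zero_iff.1 ⟨L, Nat.zero_le _, hL⟩)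
  | large J hs hJ hn =>
    refine ⟨(BranchingStep.steps_iff hs).2.trans (iff_of_true ?_ rootedLeafOutBranching_yesInstance),
      le_max_of_le_left (by decide), Nat.zero_le _⟩
    exact rootedLeafOutBranching_iff.2 (hJ.brYes_of_lt (by rwa [(BranchingStep.steps_iff hs).1]))
  | small J hs hJ hn =>
    exact ⟨(BranchingStep.steps_iff hs).2, le_max_of_le_right hn, (BranchingStep.steps_iff hs).1.le⟩

theorem TreeRun.sound (h : TreeRun I J) : (RootedLeafOutTree I ↔ RootedLeafOutTree J) ∧
    J.n ≤ max 2 (1540 * I.k ^ 3) ∧ J.k ≤ I.k := by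
  cases h with
  | large J hs hJ hn =>
    refine ⟨(TreeStep.steps_iff hs).2.trans (iff_of_true ?_ ?_), le_max_of_le_left (by decide), Nat.zero_le _⟩
    · exact rootedLeafOutTree_iff.2 (hJ.brYes_of_lt (by rwa [(TreeStep.steps_iff hs).1])).trYes
    · exact rootedLeafOutTree_iff.2 (rootedLeafOutBranching_iff.1 rootedLeafOutBranching_yesInstance).trYes
  | small J hs hJ hn =>
    exact ⟨(TreeStep.steps_iff hs).2, le_max_of_le_right hn, (TreeStep.steps_iff hs).1.le⟩

/-- A program that carries out the procedure on every input in polynomial time gives a kernelization. -/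
theorem exists_isKernelization {L : Instance → Prop} {R : Instance → Instance → Prop}
    (hR : ∀ I J, R I J → (L I ↔ L J) ∧ J.n ≤ max 2 (1540 * I.k ^ 3) ∧ J.k ≤ I.k) (c : Prog) (p : Polynomial ℕ)
    (hc : ∀ I, ∃ J s t, Exec c (initial I.encode) s t ∧ t ≤ p.eval (bitSize I.encode) ∧
      s.Outputs J.encode ∧ R I J) :
    ∃ f : Instance → Instance, IsKernelization L (fun k => max 2 (1540 * k ^ 3)) f ∧ ∀ I, R I (f I) := by
  choose f s t h1 h2 h3 h4 using hc
  exact ⟨f, ⟨⟨c, p, fun I => ⟨s I, t I, h1 I, h2 I, h3 I⟩⟩, fun I => (hR I _ (h4 I)).1,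
    fun I => (hR I _ (h4 I)).2.1, fun I => (hR I _ (h4 I)).2.2⟩, h4⟩

end Kernel

end LeafKernel

namespace LeafKernel

/-! ### A program logic with running times -/

section Machine

def State.setReg (s : State) (i v : ℕ) : State := ⟨Function.update s.reg i v, s.mem⟩

def State.setMem (s : State) (a v : ℕ) : State := ⟨s.reg, Function.update s.mem a v⟩

variable {s s' : State} {i j v K : ℕ}

@[simp] theorem State.reg_setReg : (s.setReg i v).reg i = v := Function.update_self ..

@[simp] theorem State.mem_setReg : (s.setReg i v).mem = s.mem := rfl

@[simp] theorem State.reg_setMem : (s.setMem i v).reg = s.reg := rfl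

@[simp] theorem State.mem_setMem : (s.setMem i v).mem i = v := Function.update_self ..

theorem State.reg_setReg_of_ne (h : j ≠ i) : (s.setReg i v).reg j = s.reg j := Function.update_of_ne h ..

theorem State.mem_setMem_of_ne (h : j ≠ i) : (s.setMem i v).mem j = s.mem j := Function.update_of_ne h ..

/-- An upper bound for the running time if no loop is executed more than `K` times in a row. -/
def Prog.cost (K : ℕ) : Prog → ℕ
  | .assign _ _ => 1
  | .store _ _ => 1
  | .seq c d => c.cost K + d.cost K
  | .ite _ c d => c.cost K + d.cost K + 1
  | .loop _ c => K * (c.cost K + 1) + 1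

theorem Prog.exists_polynomial_cost (c : Prog) : ∃ p : Polynomial ℕ, ∀ K, c.cost K = p.eval K := by
  induction c with
  | assign | store => exact ⟨1, fun K => by simp [Prog.cost]⟩
  | seq c d hc hd =>
    obtain ⟨p, hp⟩ := hc
    obtain ⟨q, hq⟩ := hd
    exact ⟨p + q, fun K => by simp [Prog.cost, hp, hq]⟩
  | ite e c d hc hd =>
    obtain ⟨p, hp⟩ := hc
    obtain ⟨q, hq⟩ := hd
    exact ⟨p + q + 1, fun K => by simp [Prog.cost, hp, hq]⟩
  | loop e c hc =>
    obtain ⟨p, hp⟩ := hc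
    exact ⟨.X * (p + 1) + 1, fun K => by simp [Prog.cost, hp]⟩

/-- Started in `s`, the program halts within its cost in a state that satisfies `Q`. -/
def Runs (K : ℕ) (c : Prog) (s : State) (Q : State → Prop) : Prop :=
  ∃ s' t, Exec c s s' t ∧ t ≤ c.cost K ∧ Q s'

variable {Q Q' : State → Prop} {c d : Prog} {e a : Expr}

theorem Runs.mono (h : Runs K c s Q) (hQ : ∀ s', Q s' → Q' s') : Runs K c s Q' := by
  obtain ⟨s', t, h1, h2, h3⟩ := h
  exact ⟨s', t, h1, h2, hQ _ h3⟩

theorem Runs.assign (h : Q (s.setReg i (e.val s))) : Runs K (.assign i e) s Q := ⟨_, _, .assign i e s, le_rfl, h⟩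

theorem Runs.store (h : Q (s.setMem (a.val s) (e.val s))) : Runs K (.store a e) s Q :=
  ⟨_, _, .store a e s, le_rfl, h⟩

theorem Runs.seq (h : Runs K c s fun s' => Runs K d s' Q) : Runs K (.seq c d) s Q := by
  obtain ⟨s', t, h1, h2, s'', t', h3, h4, h5⟩ := h
  exact ⟨s'', t + t', .seq _ _ _ _ _ _ _ h1 h3, add_le_add h2 h4, h5⟩

theorem Runs.ite (h : e.val s ≠ 0 → Runs K c s Q) (h' : e.val s = 0 → Runs K d s Q) : Runs K (.ite e c d) s Q := by
  by_cases he : e.val s = 0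
  · obtain ⟨s', t, h1, h2, h3⟩ := h' he
    exact ⟨s', t + 1, .ite_false _ _ _ _ _ _ he h1, by simp only [Prog.cost]; omega, h3⟩
  · obtain ⟨s', t, h1, h2, h3⟩ := h he
    exact ⟨s', t + 1, .ite_true _ _ _ _ _ _ he h1, by simp only [Prog.cost]; omega, h3⟩

/-- The index of the invariant is a variant: it decreases with each round, so it bounds the number
of rounds, and `m ≤ K` fits this bound into the cost. -/
theorem Runs.loop {Inv : ℕ → State → Prop}
    (h : ∀ m s, Inv m s → e.val s ≠ 0 → Runs K c s fun s' => ∃ m' < m, Inv m' s') {m : ℕ} (hm : m ≤ K)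
    (hs : Inv m s) (hQ : ∀ m' s', Inv m' s' → e.val s' = 0 → Q s') : Runs K (.loop e c) s Q := by
  have key : ∀ m s, Inv m s → ∃ s' t, Exec (.loop e c) s s' t ∧ t ≤ m * (c.cost K + 1) + 1 ∧ Q s' := by
    intro m
    induction m using Nat.strong_induction_on with
    | _ m ih =>
      intro s hs
      by_cases he : e.val s = 0
      · exact ⟨s, 1, .loop_false _ _ _ he, by omega, hQ m s hs he⟩
      · obtain ⟨s', t, h1, h2, m', hm', h3⟩ := h m s hs he
        obtain ⟨s'', t', h4, h5, h6⟩ := ih m' hm' s' h3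
        refine ⟨s'', t + t' + 1, .loop_true _ _ _ _ _ _ _ he h1 h4, ?_, h6⟩
        have := Nat.mul_le_mul_right (c.cost K + 1) (show m' + 1 ≤ m from hm')
        rw [Nat.succ_mul] at this
        omega
  obtain ⟨s', t, h1, h2, h3⟩ := key m s hs
  refine ⟨s', t, h1, h2.trans ?_, h3⟩
  simp only [Prog.cost]
  gcongr

/-- The program that does nothing. -/
def Prog.skip : Prog := .assign 9 (.reg 9)

theorem Runs.skip (h : Q s) : Runs K .skip s Q := by
  refine Runs.assign ?_
  have : s.setReg 9 ((Expr.reg 9).val s) = s := by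
    cases s
    simp [State.setReg, Expr.val]
  rwa [this]

/-- Run `c` once for every vertex as the value of the variable `d`. A variable has three registers: its
value, the offset of its row of the matrix, and a result. -/
def Prog.forLoop (d : ℕ) (c : Prog) : Prog :=
  .seq (.assign (3 * d + 10) (.lit 0)) <| .seq (.assign (3 * d + 11) (.lit 0)) <|
    .loop (.minus (.load (.lit 0)) (.reg (3 * d + 10))) <| .seq c <|
      .seq (.assign (3 * d + 10) (.plus (.reg (3 * d + 10)) (.lit 1)))
        (.assign (3 * d + 11) (.plus (.reg (3 * d + 11)) (.reg 1)))

/-- The machine cannot multiply, so the row offset `i * M` is maintained by addition alongside the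
counter `i`. -/
theorem Runs.forLoop {Inv : ℕ → State → Prop} {d n M : ℕ} (hn : n ≤ K)
    (stable : ∀ i s v w, Inv i s → Inv i ((s.setReg (3 * d + 10) v).setReg (3 * d + 11) w))
    (size : ∀ i s, Inv i s → s.mem 0 = n ∧ s.reg 1 = M)
    (body : ∀ i s, i < n → Inv i s → s.reg (3 * d + 10) = i → s.reg (3 * d + 11) = i * M →
      Runs K c s fun s' => Inv (i + 1) s' ∧ s'.reg (3 * d + 10) = i ∧ s'.reg (3 * d + 11) = i * M)
    (hs : Inv 0 s) (hQ : ∀ s', Inv n s' → Q s') : Runs K (.forLoop d c) s Q := by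
  refine .seq (.assign (.seq (.assign (.loop (Inv := fun m s => ∃ i, i + m = n ∧ Inv i s ∧
    s.reg (3 * d + 10) = i ∧ s.reg (3 * d + 11) = i * M) (m := n) ?_ hn ?_ ?_))))
  · rintro m s ⟨i, him, hi, h1, h2⟩ he
    have h3 := size i s hi
    simp only [Expr.val, h1, h3.1] at he
    refine .seq ((body i s (by omega) hi h1 h2).mono fun s' hs' => .seq (.assign (.assign ?_)))
    obtain ⟨h4, h5, h6⟩ := hs'
    have h7 := (size _ _ h4).2
    refine ⟨m - 1, by omega, i + 1, by omega, stable _ _ _ _ h4, ?_, ?_⟩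
    · rw [State.reg_setReg_of_ne (by omega), State.reg_setReg]
      simp [Expr.val, h5]
    · rw [State.reg_setReg]
      simp only [Expr.val]
      rw [State.reg_setReg_of_ne (by omega), State.reg_setReg_of_ne (by omega), h6, h7, Nat.succ_mul]
  · refine ⟨0, by omega, stable _ _ _ _ hs, ?_, ?_⟩
    · rw [State.reg_setReg_of_ne (by omega), State.reg_setReg]
      rfl
    · rw [State.reg_setReg, Nat.zero_mul]
      rfl
  · rintro m s ⟨i, him, hi, h1, h2⟩ he
    simp only [Expr.val, h1, (size i s hi).1] at he
    obtain rfl : i = n := by omega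
    exact hQ s hi

end Machine

/-! ### Memory layout and bounded search -/

section Layout

/-- The state holds the instance, with rows of length `M`, and the values of the first `d` variables. -/
structure Holds (I : Instance) (M d : ℕ) (env : ℕ → Fin I.n) (s : State) : Prop where
  size : s.reg 1 = M
  scratch : s.reg 2 = 3 + M * M
  marks : s.reg 3 = 3 + 2 * (M * M)
  le : I.n ≤ M
  num : s.mem 0 = I.n
  root : s.mem 1 = I.root
  param : s.mem 2 = I.k
  adj : ∀ i j : Fin I.n, I.D.Adj i j ↔ s.mem (3 + i * M + j) ≠ 0
  val : ∀ i < d, s.reg (3 * i + 10) = env i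
  row : ∀ i < d, s.reg (3 * i + 11) = env i * M

/-- The registers of the variables from the `d`-th on and the memory from address `a` on may change. -/
structure Frame (d a : ℕ) (s s' : State) : Prop where
  reg : ∀ i < 3 * d + 10, s'.reg i = s.reg i
  mem : ∀ i < a, s'.mem i = s.mem i

variable {s s' s'' : State} {d d' a a' : ℕ}

theorem Frame.refl : Frame d a s s := ⟨fun _ _ => rfl, fun _ _ => rfl⟩

theorem Frame.trans (h : Frame d a s s') (h' : Frame d a s' s'') : Frame d a s s'' :=
  ⟨fun i hi => (h'.reg i hi).trans (h.reg i hi), fun i hi => (h'.mem i hi).trans (h.mem i hi)⟩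

theorem Frame.mono (h : Frame d' a' s s') (hd : d ≤ d') (ha : a ≤ a') : Frame d a s s' :=
  ⟨fun i hi => h.reg i (by omega), fun i hi => h.mem i (by omega)⟩

theorem Frame.setReg {i v : ℕ} (h : Frame d a s s') (hi : 3 * d + 10 ≤ i) : Frame d a s (s'.setReg i v) :=
  ⟨fun j hj => (State.reg_setReg_of_ne (by omega)).trans (h.reg j hj), h.mem⟩

theorem Frame.setMem {i v : ℕ} (h : Frame d a s s') (hi : a ≤ i) : Frame d a s (s'.setMem i v) :=
  ⟨h.reg, fun j hj => (State.mem_setMem_of_ne (by omega)).trans (h.mem j hj)⟩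

theorem index_lt {n M i j : ℕ} (hn : n ≤ M) (hi : i < n) (hj : j < n) : i * M + j < M * M := by
  have := Nat.mul_le_mul_right M (show i + 1 ≤ M by omega)
  rw [Nat.succ_mul] at this
  omega

theorem index_inj {M i j i' j' : ℕ} (hj : j < M) (hj' : j' < M) (h : i * M + j = i' * M + j') : i = i' ∧ j = j' := by
  have h1 : (i * M + j) / M = i := by
    rw [mul_comm, Nat.mul_add_div (by omega), Nat.div_eq_of_lt hj, add_zero]
  have h2 : (i' * M + j') / M = i' := by
    rw [mul_comm, Nat.mul_add_div (by omega), Nat.div_eq_of_lt hj', add_zero]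
  have h3 : i = i' := by rw [← h1, h, h2]
  subst h3
  exact ⟨rfl, by omega⟩

/-- The first address of the memory that a program of depth `d` uses for marks. -/
def limit (M d : ℕ) : ℕ := 3 + 2 * (M * M) + d * M

theorem limit_succ (M d : ℕ) : limit M (d + 1) = limit M d + M := by
  simp only [limit, Nat.succ_mul]
  omega

theorem limit_mono {M d d' : ℕ} (h : d ≤ d') : limit M d ≤ limit M d' := by
  have := Nat.mul_le_mul_right M h
  simp only [limit]
  omega

variable {I : Instance} {M : ℕ} {env : ℕ → Fin I.n}

theorem Holds.frame (h : Holds I M d env s) (hf : Frame d a s s') (ha : 3 + M * M ≤ a) : Holds I M d env s' := by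
  obtain ⟨h1, h2, h3, h4, h5, h6, h7, h8, h9, h10⟩ := h
  refine ⟨?_, ?_, ?_, h4, ?_, ?_, ?_, fun i j => ?_, fun i hi => ?_, fun i hi => ?_⟩
  · rw [hf.reg _ (by omega), h1]
  · rw [hf.reg _ (by omega), h2]
  · rw [hf.reg _ (by omega), h3]
  · rw [hf.mem _ (by omega), h5]
  · rw [hf.mem _ (by omega), h6]
  · rw [hf.mem _ (by omega), h7]
  · have := index_lt h4 i.2 j.2
    rw [hf.mem _ (by omega), h8]
  · rw [hf.reg _ (by omega), h9 i hi]
  · rw [hf.reg _ (by omega), h10 i hi]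

theorem Holds.succ (h : Holds I M d env s) {x : Fin I.n} (hv : s.reg (3 * d + 10) = x)
    (hw : s.reg (3 * d + 11) = x * M) : Holds I M (d + 1) (Function.update env d x) s := by
  refine ⟨h.size, h.scratch, h.marks, h.le, h.num, h.root, h.param, h.adj, fun i hi => ?_, fun i hi => ?_⟩ <;>
    rcases Nat.lt_succ_iff_lt_or_eq.1 hi with hi | rfl
  · rw [Function.update_of_ne (by omega), h.val i hi]
  · rw [Function.update_self, hv]
  · rw [Function.update_of_ne (by omega), h.row i hi]
  · rw [Function.update_self, hw]

/-- Look for the first value of the `d`-th variable for which the program `c` gives a nonzero result. -/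
def Prog.find (d : ℕ) (c : Prog) : Prog :=
  .seq (.assign (3 * d + 10) (.lit 0)) <| .seq (.assign (3 * d + 11) (.lit 0)) <|
    .seq (.assign (3 * d + 12) (.lit 0)) <|
      .loop (.minus (.load (.lit 0)) (.plus (.reg (3 * d + 10)) (.reg (3 * d + 12)))) <| .seq c <|
        .ite (.reg (3 * (d + 1) + 12)) (.assign (3 * d + 12) (.load (.lit 0))) <|
          .seq (.assign (3 * d + 10) (.plus (.reg (3 * d + 10)) (.lit 1)))
            (.assign (3 * d + 11) (.plus (.reg (3 * d + 11)) (.reg 1)))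

/-- On success the result register receives `n`, which ends the loop, as `n - (i + n) = 0`, and
leaves the found value in its register. It is nonzero because the root exists. -/
theorem Runs.find {K : ℕ} {c : Prog} (h : Holds I M d env s) (hK : M ≤ K) {p : Fin I.n → Prop}
    {G : Fin I.n → State → Prop} (hG : ∀ x s v, G x s → G x (s.setReg (3 * d + 12) v))
    (body : ∀ x s', Holds I M (d + 1) (Function.update env d x) s' →
      Runs K c s' fun s'' => Frame (d + 1) (limit M (d + 1)) s' s'' ∧
        ((s''.reg (3 * (d + 1) + 12) = 0 ∧ ¬ p x) ∨ (s''.reg (3 * (d + 1) + 12) ≠ 0 ∧ G x s''))) :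
    Runs K (.find d c) s fun s' => Frame d (limit M d) s s' ∧
      ((s'.reg (3 * d + 12) = 0 ∧ ∀ x, ¬ p x) ∨ (s'.reg (3 * d + 12) ≠ 0 ∧ ∃ x, G x s')) := by
  refine .seq (.assign (.seq (.assign (.seq (.assign (.loop (m := I.n) (Inv := fun m s' =>
    Frame d (limit M d) s s' ∧ ((s'.reg (3 * d + 12) = 0 ∧ s'.reg (3 * d + 10) + m = I.n ∧
      s'.reg (3 * d + 11) = s'.reg (3 * d + 10) * M ∧ ∀ x : Fin I.n, x < s'.reg (3 * d + 10) → ¬ p x) ∨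
      (s'.reg (3 * d + 12) = I.n ∧ ∃ x, G x s'))) ?_ (h.le.trans hK) ?_ ?_))))))
  · rintro m s₁ ⟨hf, hm⟩ he
    have h₁ : Holds I M d env s₁ := h.frame hf (by simp only [limit]; omega)
    simp only [Expr.val, h₁.num] at he
    rcases hm with ⟨h0, hm, hrow, hp⟩ | ⟨h0, -⟩
    swap
    · omega
    have hlt : s₁.reg (3 * d + 10) < I.n := by omega
    refine .seq ((body ⟨_, hlt⟩ s₁ (h₁.succ rfl hrow)).mono fun s₂ ⟨hf₂, hs₂⟩ => ?_)
    have hf' := hf.trans (hf₂.mono (Nat.le_succ d) (limit_mono (Nat.le_succ d)))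
    have h₂ : Holds I M d env s₂ := h.frame hf' (by simp only [limit]; omega)
    refine .ite (fun hr => .assign ?_) (fun hr => .seq (.assign (.assign ?_)))
    · rcases hs₂ with ⟨h3, -⟩ | ⟨-, h3⟩
      · exact absurd h3 hr
      · exact ⟨0, by omega, hf'.setReg (by omega), .inr ⟨by simp [Expr.val, h₂.num], _, hG _ _ _ h3⟩⟩
    · rcases hs₂ with ⟨-, h3⟩ | ⟨h3, -⟩
      · refine ⟨m - 1, by omega, (hf'.setReg (by omega)).setReg (by omega), .inl ⟨?_, ?_, ?_, ?_⟩⟩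
        · rw [State.reg_setReg_of_ne (by omega), State.reg_setReg_of_ne (by omega), hf₂.reg _ (by omega), h0]
        · rw [State.reg_setReg_of_ne (by omega), State.reg_setReg]
          simp only [Expr.val]
          rw [hf₂.reg _ (by omega)]
          omega
        · rw [State.reg_setReg, State.reg_setReg_of_ne (by omega), State.reg_setReg]
          simp only [Expr.val]
          rw [State.reg_setReg_of_ne (by omega), State.reg_setReg_of_ne (by omega), hf₂.reg (3 * d + 11) (by omega),
            hf₂.reg (3 * d + 10) (by omega), h₂.size, hrow]
          ring
        · intro x hx
          rw [State.reg_setReg_of_ne (by omega), State.reg_setReg] at hx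
          simp only [Expr.val] at hx
          rw [hf₂.reg _ (by omega)] at hx
          rcases Nat.lt_succ_iff_lt_or_eq.1 hx with hx | hx
          · exact hp x hx
          · obtain rfl : x = ⟨_, hlt⟩ := Fin.ext hx
            exact h3
      · exact absurd hr h3
  · refine ⟨((Frame.refl.setReg (by omega)).setReg (by omega)).setReg (by omega), .inl ⟨by simp [Expr.val], ?_, ?_, ?_⟩⟩
    · rw [State.reg_setReg_of_ne (by omega), State.reg_setReg_of_ne (by omega)]
      simp [Expr.val]
    · rw [State.reg_setReg_of_ne (by omega), State.reg_setReg, State.reg_setReg_of_ne (by omega),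
        State.reg_setReg_of_ne (by omega)]
      simp [Expr.val]
    · intro x hx
      rw [State.reg_setReg_of_ne (by omega), State.reg_setReg_of_ne (by omega)] at hx
      simp [Expr.val] at hx
  · rintro m s₁ ⟨hf, hm⟩ he
    have h₁ : Holds I M d env s₁ := h.frame hf (by simp only [limit]; omega)
    simp only [Expr.val, h₁.num] at he
    refine ⟨hf, ?_⟩
    rcases hm with ⟨h0, hm, hrow, hp⟩ | ⟨h0, hx⟩
    · exact .inl ⟨h0, fun x => hp x (by have := x.2; omega)⟩
    · exact .inr ⟨by have := I.root.2; omega, hx⟩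

end Layout

end LeafKernel

namespace LeafKernel

open Relation

/-! ### Reachability by repeated marking -/

section Reach

variable {I : Instance} {M d K : ℕ} {env : ℕ → Fin I.n} {s s' : State} {c : Prog} {q : Fin I.n → Fin I.n → Prop}

theorem Holds.setReg (h : Holds I M d env s) (i v : ℕ) : Holds I M d env (s.setReg (3 * i + 12) v) := by
  obtain ⟨h1, h2, h3, h4, h5, h6, h7, h8, h9, h10⟩ := h
  refine ⟨?_, ?_, ?_, h4, h5, h6, h7, h8, fun j hj => ?_, fun j hj => ?_⟩ <;> rw [State.reg_setReg_of_ne (by omega)]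
  · exact h1
  · exact h2
  · exact h3
  · exact h9 j hj
  · exact h10 j hj

/-- The address of the marks of the programs of depth `d`. -/
def markBase : ℕ → Expr
  | 0 => .reg 3
  | d + 1 => .plus (markBase d) (.reg 1)

theorem markBase_val (h1 : s.reg 1 = M) (h3 : s.reg 3 = 3 + 2 * (M * M)) : ∀ d, (markBase d).val s = limit M d
  | 0 => by simp [markBase, Expr.val, h3, limit]
  | d + 1 => by simp [markBase, Expr.val, markBase_val h1 h3 d, h1, limit_succ]

def markExpr (d i : ℕ) : Expr := .plus (markBase d) (.reg (3 * i + 10))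

theorem markExpr_val (h : Holds I M d env s) (k i : ℕ) : (markExpr k i).val s = limit M k + s.reg (3 * i + 10) := by
  simp [markExpr, Expr.val, markBase_val h.size h.marks]

theorem le_limit (M d : ℕ) : 3 + M * M ≤ limit M d := by
  simp only [limit]
  omega

/-- Mark the vertices to which there is an arc from the vertex `d`, where `c` decides what an arc is. -/
def Prog.markOut (d : ℕ) (c : Prog) : Prog :=
  .forLoop (d + 1) (.seq c (.ite (.reg (3 * (d + 2) + 12)) (.store (markExpr d (d + 1)) (.lit 1)) .skip))

/-- The program `c` decides the relation `q` between the variables `d` and `d + 1`. -/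
def Decides (I : Instance) (M K d : ℕ) (env : ℕ → Fin I.n) (c : Prog) (q : Fin I.n → Fin I.n → Prop) : Prop :=
  ∀ a b s, Holds I M (d + 2) (Function.update (Function.update env d a) (d + 1) b) s →
    Runs K c s fun s' => Frame (d + 2) (limit M (d + 2)) s s' ∧ (s'.reg (3 * (d + 2) + 12) ≠ 0 ↔ q a b)

theorem Runs.markOut (h : Holds I M d env s) (hK : M ≤ K) (hc : Decides I M K d env c q) {a : Fin I.n}
    (hv : s.reg (3 * d + 10) = a) (hw : s.reg (3 * d + 11) = a * M) :
    Runs K (.markOut d c) s fun s' => Frame (d + 1) (limit M d) s s' ∧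
      ∀ x : Fin I.n, s'.mem (limit M d + x) ≠ 0 ↔ s.mem (limit M d + x) ≠ 0 ∨ q a x := by
  have hl := le_limit M d
  refine Runs.forLoop (n := I.n) (M := M) (Inv := fun j s' => Frame (d + 1) (limit M d) s s' ∧
    ∀ x : Fin I.n, s'.mem (limit M d + x) ≠ 0 ↔ s.mem (limit M d + x) ≠ 0 ∨ (x < j ∧ q a x))
    (h.le.trans hK) ?_ ?_ ?_ ⟨.refl, by simp⟩ ?_
  · rintro i s' v w ⟨h1, h2⟩
    exact ⟨(h1.setReg (by omega)).setReg (by omega), h2⟩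
  · rintro i s' ⟨h1, h2⟩
    exact ⟨by rw [h1.mem _ (by omega), h.num], by rw [h1.reg _ (by omega), h.size]⟩
  · rintro j s₁ hj ⟨h1, h2⟩ h3 h4
    have H₁ : Holds I M d env s₁ := h.frame (h1.mono (Nat.le_succ d) le_rfl) hl
    have H₁' := (H₁.succ (x := a) (by rw [h1.reg _ (by omega), hv]) (by rw [h1.reg _ (by omega), hw])).succ
      (x := ⟨j, hj⟩) h3 h4
    refine .seq ((hc _ _ _ H₁').mono fun s₂ ⟨f₂, hq⟩ => ?_)
    have hm : ∀ x : Fin I.n, s₂.mem (limit M d + x) = s₁.mem (limit M d + x) := fun x => f₂.mem _ (by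
      have := x.2
      have := h.le
      rw [limit_succ, limit_succ]
      omega)
    have f : Frame (d + 1) (limit M d) s s₂ := h1.trans (f₂.mono (by omega) (limit_mono (by omega)))
    have H₂ : Holds I M d env s₂ := h.frame (f.mono (Nat.le_succ d) le_rfl) hl
    have hv₂ : s₂.reg (3 * (d + 1) + 10) = j := by rw [f₂.reg _ (by omega), h3]
    have hw₂ : s₂.reg (3 * (d + 1) + 11) = j * M := by rw [f₂.reg _ (by omega), h4]
    refine .ite (fun he => .store ?_) (fun he => .skip ?_)
    · rw [markExpr_val H₂, hv₂]
      refine ⟨⟨f.setMem (by omega), fun x => ?_⟩, hv₂, hw₂⟩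
      by_cases hx : (x : ℕ) = j
      · have : x = ⟨j, hj⟩ := Fin.ext hx
        subst this
        simp [Expr.val, hq.1 he]
      · rw [State.mem_setMem_of_ne (by omega), hm, h2]
        exact or_congr Iff.rfl (and_congr (by omega) Iff.rfl)
    · refine ⟨⟨f, fun x => ?_⟩, hv₂, hw₂⟩
      rw [hm, h2]
      by_cases hx : (x : ℕ) = j
      · have : x = ⟨j, hj⟩ := Fin.ext hx
        subst this
        have : ¬ q a ⟨j, hj⟩ := fun hq' => hq.2 hq' he
        simp [this]
      · exact or_congr Iff.rfl (and_congr (by omega) Iff.rfl)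
  · rintro s' ⟨h1, h2⟩
    exact ⟨h1, fun x => by simp [h2]⟩

def Prog.markRound (d : ℕ) (c : Prog) : Prog :=
  .forLoop d (.ite (.load (markExpr d d)) (.markOut d c) .skip)

/-- Marks set during the round may be used in the same round, so only a sandwich is claimed: all old
marks are propagated, and every mark satisfies the closed property `P`. -/
theorem Runs.markRound (h : Holds I M d env s) (hK : M ≤ K) (hc : Decides I M K d env c q)
    {P : Fin I.n → Prop} (hP : ∀ a b, P a → q a b → P b) (hs : ∀ x : Fin I.n, s.mem (limit M d + x) ≠ 0 → P x) :
    Runs K (.markRound d c) s fun s' => Frame d (limit M d) s s' ∧ s'.reg (3 * d + 12) = s.reg (3 * d + 12) ∧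
      (∀ x : Fin I.n, s'.mem (limit M d + x) ≠ 0 → P x) ∧ ∀ x : Fin I.n, s.mem (limit M d + x) ≠ 0 →
        s'.mem (limit M d + x) ≠ 0 ∧ ∀ y : Fin I.n, q x y → s'.mem (limit M d + y) ≠ 0 := by
  have hl := le_limit M d
  refine Runs.forLoop (n := I.n) (M := M) (Inv := fun j s' => Frame d (limit M d) s s' ∧
    s'.reg (3 * d + 12) = s.reg (3 * d + 12) ∧ (∀ x : Fin I.n, s'.mem (limit M d + x) ≠ 0 → P x) ∧
    ∀ x : Fin I.n, s.mem (limit M d + x) ≠ 0 →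
        s'.mem (limit M d + x) ≠ 0 ∧ (x < j → ∀ y : Fin I.n, q x y → s'.mem (limit M d + y) ≠ 0))
    (h.le.trans hK) ?_ ?_ ?_ ⟨.refl, rfl, hs, by simp⟩ ?_
  · rintro i s' v w ⟨h1, h2, h3⟩
    refine ⟨(h1.setReg (by omega)).setReg (by omega), ?_, h3⟩
    rw [State.reg_setReg_of_ne (by omega), State.reg_setReg_of_ne (by omega), h2]
  · rintro i s' ⟨h1, h2⟩
    exact ⟨by rw [h1.mem _ (by omega), h.num], by rw [h1.reg _ (by omega), h.size]⟩
  · rintro j s₁ hj ⟨f₁, h2, h3, h4⟩ hv hw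
    have H₁ : Holds I M d env s₁ := h.frame f₁ hl
    have he : (Expr.load (markExpr d d)).val s₁ = s₁.mem (limit M d + j) := by
      simp only [Expr.val]
      rw [markExpr_val H₁, hv]
    refine .ite (fun he' => ?_) (fun he' => .skip ?_)
    · rw [he] at he'
      refine (Runs.markOut H₁ hK hc (a := ⟨j, hj⟩) hv hw).mono fun s₂ ⟨f₂, hm⟩ => ?_
      refine ⟨⟨f₁.trans (f₂.mono (Nat.le_succ d) le_rfl), by rw [f₂.reg _ (by omega), h2], fun x hx => ?_,
        fun x hx => ⟨(hm x).2 (.inl (h4 x hx).1), fun hlt y hy => ?_⟩⟩, ?_, ?_⟩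
      · rcases (hm x).1 hx with hx | hx
        · exact h3 x hx
        · exact hP ⟨j, hj⟩ x (h3 ⟨j, hj⟩ he') hx
      · rcases Nat.lt_succ_iff_lt_or_eq.1 hlt with hlt | hlt
        · exact (hm y).2 (.inl ((h4 x hx).2 hlt y hy))
        · obtain rfl : x = ⟨j, hj⟩ := Fin.ext hlt
          exact (hm y).2 (.inr hy)
      · rw [f₂.reg _ (by omega), hv]
      · rw [f₂.reg _ (by omega), hw]
    · rw [he] at he'
      refine ⟨⟨f₁, h2, h3, fun x hx => ⟨(h4 x hx).1, fun hlt => ?_⟩⟩, hv, hw⟩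
      rcases Nat.lt_succ_iff_lt_or_eq.1 hlt with hlt | hlt
      · exact (h4 x hx).2 hlt
      · obtain rfl : x = ⟨j, hj⟩ := Fin.ext hlt
        exact absurd he' (h4 _ hx).1
  · rintro s' ⟨h1, h2, h3, h4⟩
    exact ⟨h1, h2, h3, fun x hx => ⟨(h4 x hx).1, (h4 x hx).2 x.2⟩⟩

/-- Decide whether the vertex `t` can be reached from the root. -/
def Prog.reach (d : ℕ) (c : Prog) (t : ℕ) : Prog :=
  .seq (.forLoop d (.store (markExpr d d) (.lit 0))) <|
    .seq (.store (.plus (markBase d) (.load (.lit 1))) (.lit 1)) <|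
      .seq (.assign (3 * d + 12) (.load (.lit 0))) <|
        .seq (.loop (.reg (3 * d + 12))
          (.seq (.markRound d c) (.assign (3 * d + 12) (.minus (.reg (3 * d + 12)) (.lit 1))))) <|
            .assign (3 * d + 12) (.load (markExpr d t))

/-- As long as some reachable vertex is unmarked, a round adds a mark. Starting with one mark, `n`
rounds suffice: an incomplete marking would need more than `n` marks at the end. -/
theorem Runs.reach (h : Holds I M d env s) (hK : M ≤ K) (hc : Decides I M K d env c q) {t : ℕ} (ht : t < d) :
    Runs K (.reach d c t) s fun s' => Frame d (limit M d) s s' ∧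
      (s'.reg (3 * d + 12) ≠ 0 ↔ ReflTransGen q I.root (env t)) := by
  have hl := le_limit M d
  refine .seq (Runs.forLoop (n := I.n) (M := M) (Inv := fun j s' => Frame d (limit M d) s s' ∧
    ∀ x : Fin I.n, x < j → s'.mem (limit M d + x) = 0) (h.le.trans hK) ?_ ?_ ?_ ⟨.refl, by simp⟩ ?_)
  · rintro i s' v w ⟨h1, h2⟩
    exact ⟨(h1.setReg (by omega)).setReg (by omega), h2⟩
  · rintro i s' ⟨h1, h2⟩
    exact ⟨by rw [h1.mem _ (by omega), h.num], by rw [h1.reg _ (by omega), h.size]⟩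
  · rintro j s₁ hj ⟨f₁, h2⟩ hv hw
    refine .store ?_
    rw [markExpr_val (h.frame f₁ hl), hv]
    refine ⟨⟨f₁.setMem (by omega), fun x hx => ?_⟩, hv, hw⟩
    by_cases hxj : (x : ℕ) = j
    · simp [hxj, Expr.val]
    · rw [State.mem_setMem_of_ne (by omega), h2 x (by omega)]
  rintro s₁ ⟨f₁, hm₁⟩
  have H₁ := h.frame f₁ hl
  have hb : (Expr.plus (markBase d) (.load (.lit 1))).val s₁ = limit M d + I.root := by
    simp [Expr.val, markBase_val H₁.size H₁.marks, H₁.root]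
  refine .seq (.store ?_)
  rw [hb]
  refine .seq (.assign (.seq (.loop (m := I.n) (Inv := fun m s' => Frame d (limit M d) s s' ∧
    s'.reg (3 * d + 12) = m ∧ s'.mem (limit M d + I.root) ≠ 0 ∧
    (∀ x : Fin I.n, s'.mem (limit M d + x) ≠ 0 → ReflTransGen q I.root x) ∧
    ((∀ x : Fin I.n, ReflTransGen q I.root x → s'.mem (limit M d + x) ≠ 0) ∨
      I.n + 1 ≤ {x : Fin I.n | s'.mem (limit M d + x) ≠ 0}.ncard + m)) ?_ (h.le.trans hK) ?_ ?_)))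
  · rintro m s₂ ⟨f₂, h2, h3, h4, h5⟩ he
    simp only [Expr.val, h2] at he
    refine .seq ((Runs.markRound (h.frame f₂ hl) hK hc (P := ReflTransGen q I.root)
      (fun a b ha hab => ha.tail hab) h4).mono fun s₃ ⟨f₃, g2, g3, g4⟩ => .assign ?_)
    refine ⟨m - 1, by omega, (f₂.trans f₃).setReg (by omega), by simp [Expr.val, g2, h2], (g4 _ h3).1, g3, ?_⟩
    simp only [State.mem_setReg]
    by_cases hall : ∀ x : Fin I.n, ReflTransGen q I.root x → s₂.mem (limit M d + x) ≠ 0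
    · exact .inl fun x hx => (g4 x (hall x hx)).1
    · right
      have h5' := h5.resolve_left hall
      push Not at hall
      obtain ⟨x, hx, hx0⟩ := hall
      have hnew : ∃ y : Fin I.n, s₃.mem (limit M d + y) ≠ 0 ∧ s₂.mem (limit M d + y) = 0 := by
        by_contra hcon
        push Not at hcon
        have : ∀ y, ReflTransGen q I.root y → s₂.mem (limit M d + y) ≠ 0 := by
          intro y hy
          induction hy with
          | refl => exact h3
          | tail _ hq ih => exact hcon _ ((g4 _ ih).2 _ hq)
        exact this x hx hx0
      obtain ⟨y, hy, hy0⟩ := hnew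
      have := Set.ncard_lt_ncard (s := {x : Fin I.n | s₂.mem (limit M d + x) ≠ 0})
        (t := {x : Fin I.n | s₃.mem (limit M d + x) ≠ 0}) ⟨fun x hx => (g4 x hx).1, fun hsub => hsub hy hy0⟩
      omega
  · have hlt := I.root.2
    have hle := H₁.le
    have key : ∀ x : Fin I.n, (s₁.setMem (limit M d + I.root) 1).mem (limit M d + x) ≠ 0 ↔ x = I.root := by
      intro x
      by_cases hx : x = I.root
      · simp [hx]
      · have : (x : ℕ) ≠ I.root := fun e => hx (Fin.ext e)
        rw [State.mem_setMem_of_ne (by omega), hm₁ x x.2]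
        simp [hx]
    refine ⟨(f₁.setMem (by omega)).setReg (by omega), ?_, ?_, ?_, .inr ?_⟩
    · rw [State.reg_setReg]
      simp only [Expr.val]
      rw [State.mem_setMem_of_ne (by omega), H₁.num]
    · exact (key _).2 rfl
    · intro x hx
      rw [(key x).1 hx]
    · have : {x : Fin I.n | (s₁.setMem (limit M d + I.root) 1).mem (limit M d + x) ≠ 0} = {I.root} :=
        Set.ext fun x => key x
      simp only [State.mem_setReg]
      erw [this]
      rw [Set.ncard_singleton, Nat.add_comm]
  · rintro m s₂ ⟨f₂, h2, h3, h4, h5⟩ he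
    simp only [Expr.val, h2] at he
    subst he
    have hall : ∀ x : Fin I.n, ReflTransGen q I.root x → s₂.mem (limit M d + x) ≠ 0 := by
      refine h5.resolve_right fun hcard => ?_
      have := Set.ncard_le_card {x : Fin I.n | s₂.mem (limit M d + x) ≠ 0}
      rw [Nat.card_fin] at this
      omega
    refine .assign ⟨f₂.setReg (by omega), ?_⟩
    rw [State.reg_setReg]
    simp only [Expr.val]
    rw [markExpr_val (h.frame f₂ hl), (h.frame f₂ hl).val t ht]
    exact ⟨h4 _, hall _⟩

end Reach

/-- Formulas about a digraph with a root. A formula of depth `d` speaks about the variables below `d`. -/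
inductive Fm
  | eq (i j : ℕ)
  | root (i : ℕ)
  | adj (i j : ℕ)
  | neg (φ : Fm)
  | conj (φ ψ : Fm)
  | exi (φ : Fm)
  | rch (φ : Fm) (t : ℕ)

/-! ### Compilation of formulas -/

namespace Fm

/-- The meaning of a formula; `exi` binds the variable `d`, and `rch` asks whether `t` can be reached from the
root along the arcs from the variable `d` to the variable `d + 1`. -/
def Sat {V : Type} (A : V → V → Prop) (r : V) : ℕ → (ℕ → V) → Fm → Prop
  | _, env, eq i j => env i = env j
  | _, env, root i => env i = r
  | _, env, adj i j => A (env i) (env j)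
  | d, env, neg φ => ¬ φ.Sat A r d env
  | d, env, conj φ ψ => φ.Sat A r d env ∧ ψ.Sat A r d env
  | d, env, exi φ => ∃ x, φ.Sat A r (d + 1) (Function.update env d x)
  | d, env, rch φ t =>
    ReflTransGen (fun a b => φ.Sat A r (d + 2) (Function.update (Function.update env d a) (d + 1) b)) r (env t)

def Ok : ℕ → Fm → Prop
  | d, eq i j => i < d ∧ j < d
  | d, root i => i < d
  | d, adj i j => i < d ∧ j < d
  | d, neg φ => φ.Ok d
  | d, conj φ ψ => φ.Ok d ∧ ψ.Ok d
  | d, exi φ => φ.Ok (d + 1)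
  | d, rch φ t => φ.Ok (d + 2) ∧ t < d

def eqExpr (a b : Expr) : Expr := .minus (.lit 1) (.plus (.minus a b) (.minus b a))

theorem eqExpr_val {s : State} {a b : Expr} : (eqExpr a b).val s ≠ 0 ↔ a.val s = b.val s := by
  simp only [eqExpr, Expr.val]
  omega

def comp : ℕ → Fm → Prog
  | d, eq i j => .assign (3 * d + 12) (eqExpr (.reg (3 * i + 10)) (.reg (3 * j + 10)))
  | d, root i => .assign (3 * d + 12) (eqExpr (.reg (3 * i + 10)) (.load (.lit 1)))
  | d, adj i j =>
    .assign (3 * d + 12) (.load (.plus (.plus (.lit 3) (.reg (3 * i + 11))) (.reg (3 * j + 10))))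
  | d, neg φ => .seq (φ.comp d) (.assign (3 * d + 12) (.minus (.lit 1) (.reg (3 * d + 12))))
  | d, conj φ ψ => .seq (φ.comp d) (.ite (.reg (3 * d + 12)) (ψ.comp d) .skip)
  | d, exi φ => .find d (φ.comp (d + 1))
  | d, rch φ t => .reach d (φ.comp (d + 2)) t

/-- The formula is true, and the state holds witnesses for its leading existential quantifiers. -/
def Witness (I : Instance) (M : ℕ) : ℕ → (ℕ → Fin I.n) → State → Fm → Prop
  | d, env, s, exi φ => ∃ x, φ.Witness I M (d + 1) (Function.update env d x) s
  | d, env, s, φ => Holds I M d env s ∧ φ.Sat I.D.Adj I.root d env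

variable {I : Instance} {M K : ℕ}

theorem Witness.sat {φ : Fm} {d : ℕ} {env : ℕ → Fin I.n} {s : State} (h : φ.Witness I M d env s) :
    φ.Sat I.D.Adj I.root d env := by
  induction φ generalizing d env with
  | exi φ ih =>
    obtain ⟨x, hx⟩ := h
    exact ⟨x, ih hx⟩
  | _ => exact h.2

theorem Witness.setReg {φ : Fm} {d : ℕ} {env : ℕ → Fin I.n} {s : State} (h : φ.Witness I M d env s) (i v : ℕ) :
    φ.Witness I M d env (s.setReg (3 * i + 12) v) := by
  induction φ generalizing d env with
  | exi φ ih =>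
    obtain ⟨x, hx⟩ := h
    exact ⟨x, ih hx⟩
  | _ => exact ⟨h.1.setReg i v, h.2⟩

/-- Success yields `Witness` and not just truth, so that after a search the registers still hold the
values to which a rule is then applied. -/
theorem runs_comp (hK : M ≤ K) (φ : Fm) : ∀ {d : ℕ} {env : ℕ → Fin I.n} {s : State}, φ.Ok d → Holds I M d env s →
    Runs K (φ.comp d) s fun s' => Frame d (limit M d) s s' ∧
      ((s'.reg (3 * d + 12) = 0 ∧ ¬ φ.Sat I.D.Adj I.root d env) ∨
        (s'.reg (3 * d + 12) ≠ 0 ∧ φ.Witness I M d env s')) := by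
  have atom : ∀ {d : ℕ} {env : ℕ → Fin I.n} {s : State} {e : Expr} {p : Prop}, Holds I M d env s →
      (e.val s ≠ 0 ↔ p) → Runs K (.assign (3 * d + 12) e) s fun s' => Frame d (limit M d) s s' ∧
      ((s'.reg (3 * d + 12) = 0 ∧ ¬ p) ∨ (s'.reg (3 * d + 12) ≠ 0 ∧ Holds I M d env s' ∧ p)) := by
    intro d env s e p h he
    refine .assign ⟨Frame.refl.setReg (by omega), ?_⟩
    rw [State.reg_setReg]
    by_cases hp : p
    · exact .inr ⟨he.2 hp, h.setReg d _, hp⟩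
    · exact .inl ⟨by_contra fun h0 => hp (he.1 h0), hp⟩
  induction φ with
  | eq i j =>
    intro d env s hok h
    refine atom h ?_
    rw [eqExpr_val]
    simp only [Expr.val]
    rw [h.val i hok.1, h.val j hok.2, Fin.val_inj]
    exact Iff.rfl
  | root i =>
    intro d env s hok h
    refine atom h ?_
    rw [eqExpr_val]
    simp only [Expr.val]
    rw [h.val i hok, h.root, Fin.val_inj]
    exact Iff.rfl
  | adj i j =>
    intro d env s hok h
    refine atom h ?_
    simp only [Expr.val]
    rw [h.row i hok.1, h.val j hok.2, ← h.adj]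
    exact Iff.rfl
  | neg φ ih =>
    intro d env s hok h
    refine .seq ((ih hok h).mono fun s' ⟨f, hs'⟩ => ?_)
    refine (atom (e := .minus (.lit 1) (.reg (3 * d + 12))) (p := ¬ φ.Sat I.D.Adj I.root d env)
      (h.frame f (le_limit M d)) ?_).mono fun s'' ⟨f', hs''⟩ => ⟨f.trans f', hs''⟩
    simp only [Expr.val]
    rcases hs' with ⟨h1, h2⟩ | ⟨h1, h2⟩
    · simp [h1, h2]
    · simp only [h2.sat, not_true, iff_false]
      omega
  | conj φ ψ ih₁ ih₂ =>
    intro d env s hok h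
    refine .seq ((ih₁ hok.1 h).mono fun s' ⟨f, hs'⟩ => .ite (fun he => ?_) (fun he => .skip ?_))
    · have h1 := (hs'.resolve_left fun h0 => he h0.1).2.sat
      refine (ih₂ hok.2 (h.frame f (le_limit M d))).mono fun s'' ⟨f', hs''⟩ => ⟨f.trans f', ?_⟩
      rcases hs'' with ⟨h2, h3⟩ | ⟨h2, h3⟩
      · exact .inl ⟨h2, fun h4 => h3 h4.2⟩
      · exact .inr ⟨h2, h.frame (f.trans f') (le_limit M d), h1, h3.sat⟩
    · exact ⟨f, .inl ⟨he, fun h1 => (hs'.resolve_right fun h0 => h0.1 he).2 h1.1⟩⟩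
  | exi φ ih =>
    intro d env s hok h
    refine (Runs.find (c := φ.comp (d + 1)) h hK
      (p := fun x => φ.Sat I.D.Adj I.root (d + 1) (Function.update env d x))
      (G := fun x s => φ.Witness I M (d + 1) (Function.update env d x) s)
      (fun x s v hx => hx.setReg d v) fun x s' hs' => ih hok hs').mono fun s' ⟨f, hs'⟩ => ⟨f, ?_⟩
    rcases hs' with ⟨h1, h2⟩ | h2
    · exact .inl ⟨h1, fun ⟨x, hx⟩ => h2 x hx⟩
    · exact .inr h2
  | rch φ t ih =>
    intro d env s hok h
    refine (Runs.reach (c := φ.comp (d + 2)) (q := fun a b => φ.Sat I.D.Adj I.root (d + 2)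
      (Function.update (Function.update env d a) (d + 1) b)) h hK (fun a b s' hs' =>
        (ih hok.1 hs').mono fun s'' ⟨f, hs''⟩ => ⟨f, ?_⟩) hok.2).mono fun s' ⟨f, hs'⟩ => ⟨f, ?_⟩
    · rcases hs'' with ⟨h1, h2⟩ | ⟨h1, h2⟩
      · simp [h1, h2]
      · simp [h1, h2.sat]
    · by_cases h0 : s'.reg (3 * d + 12) = 0
      · exact .inl ⟨h0, fun h1 => hs'.2 h1 h0⟩
      · exact .inr ⟨h0, h.frame f (le_limit M d), hs'.1 h0⟩

end Fm

end LeafKernel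

namespace LeafKernel

open Relation

/-! ### Renumbering and rewriting the digraph in memory -/

section Count

variable {p : ℕ → Prop} [DecidablePred p]

theorem count_lt {x y : ℕ} (hx : p x) (h : x < y) : Nat.count p x < Nat.count p y :=
  lt_of_lt_of_le (by rw [Nat.count_succ, if_pos hx]; omega) (Nat.count_monotone p (show x + 1 ≤ y from h))

theorem exists_count_eq {n k : ℕ} (h : k < Nat.count p n) : ∃ x < n, p x ∧ Nat.count p x = k := by
  induction n with
  | zero => simp at h
  | succ n ih =>
    by_cases hk : k < Nat.count p n
    · obtain ⟨x, h1, h2⟩ := ih hk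
      exact ⟨x, by omega, h2⟩
    · rw [Nat.count_succ] at h
      by_cases hp : p n
      · rw [if_pos hp] at h
        exact ⟨n, by omega, hp, by omega⟩
      · rw [if_neg hp] at h
        omega

end Count

section Rewrite

variable {I : Instance} {M m K : ℕ} {env : ℕ → Fin I.n} {s : State}

/-- Write the matrix of the relation `ψ` between the variables `m` and `m + 1` to the scratch memory. -/
def Prog.fill (m : ℕ) (ψ : Fm) : Prog :=
  .forLoop m <| .forLoop (m + 1) <| .seq (ψ.comp (m + 2)) <|
    .ite (.reg (3 * (m + 2) + 12))
      (.store (.plus (.reg 2) (.plus (.reg (3 * m + 11)) (.reg (3 * (m + 1) + 10)))) (.lit 1))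
      (.store (.plus (.reg 2) (.plus (.reg (3 * m + 11)) (.reg (3 * (m + 1) + 10)))) (.lit 0))

/-- The value of a truth value in the matrix. -/
def IsBit (v : ℕ) (p : Prop) : Prop := (v = 1 ∧ p) ∨ (v = 0 ∧ ¬ p)

def Fm.rel (I : Instance) (m : ℕ) (env : ℕ → Fin I.n) (ψ : Fm) (x y : Fin I.n) : Prop :=
  ψ.Sat I.D.Adj I.root (m + 2) (Function.update (Function.update env m x) (m + 1) y)

def Fm.set (I : Instance) (m : ℕ) (env : ℕ → Fin I.n) (δ : Fm) (x : Fin I.n) : Prop :=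
  δ.Sat I.D.Adj I.root (m + 1) (Function.update env m x)

/-- The new matrix goes to scratch memory, so that `ψ` is always evaluated in the unchanged old
digraph. -/
theorem Runs.fill (h : Holds I M m env s) (hK : M ≤ K) {ψ : Fm} (hψ : ψ.Ok (m + 2)) :
    Runs K (.fill m ψ) s fun s' => Frame m (3 + M * M) s s' ∧
      ∀ x y : Fin I.n, IsBit (s'.mem (3 + M * M + (x * M + y))) (ψ.rel I m env x y) := by
  have size : ∀ {s'}, Frame m (3 + M * M) s s' → s'.mem 0 = I.n ∧ s'.reg 1 = M := fun h1 =>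
    ⟨by rw [h1.mem _ (by omega), h.num], by rw [h1.reg _ (by omega), h.size]⟩
  refine Runs.forLoop (n := I.n) (M := M) (Inv := fun i s' => Frame m (3 + M * M) s s' ∧
    ∀ x y : Fin I.n, x < i → IsBit (s'.mem (3 + M * M + (x * M + y))) (ψ.rel I m env x y))
    (h.le.trans hK) ?_ (fun i s' h1 => size h1.1) ?_ ⟨.refl, by simp⟩ ?_
  · rintro i s' v w ⟨h1, h2⟩
    exact ⟨(h1.setReg (by omega)).setReg (by omega), h2⟩
  · rintro i s₁ hi ⟨f₁, h1⟩ hv₁ hw₁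
    refine Runs.forLoop (n := I.n) (M := M) (Inv := fun j s' => Frame m (3 + M * M) s s' ∧
      s'.reg (3 * m + 10) = i ∧ s'.reg (3 * m + 11) = i * M ∧
      ∀ x y : Fin I.n, x < i ∨ (x = i ∧ y < j) → IsBit (s'.mem (3 + M * M + (x * M + y))) (ψ.rel I m env x y))
      (h.le.trans hK) ?_ (fun i s' h1 => size h1.1) ?_ ⟨f₁, hv₁, hw₁, ?_⟩ ?_
    · rintro j s' v w ⟨h1, h2, h3, h4⟩
      refine ⟨(h1.setReg (by omega)).setReg (by omega), ?_, ?_, h4⟩ <;>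
        rwa [State.reg_setReg_of_ne (by omega), State.reg_setReg_of_ne (by omega)]
    · rintro j s₂ hj ⟨f₂, hv, hw, h2⟩ hv₂ hw₂
      have H₂ := h.frame f₂ le_rfl
      have H₂' := (H₂.succ (x := ⟨i, hi⟩) hv hw).succ (x := ⟨j, hj⟩) hv₂ hw₂
      refine .seq ((Fm.runs_comp hK ψ hψ H₂').mono fun s₃ ⟨f₃, h3⟩ => ?_)
      have f₃' : Frame m (3 + M * M) s s₃ := f₂.trans (f₃.mono (by omega) (le_limit M _))
      have e : (Expr.plus (.reg 2) (.plus (.reg (3 * m + 11)) (.reg (3 * (m + 1) + 10)))).val s₃ =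
          3 + M * M + (i * M + j) := by
        simp only [Expr.val]
        rw [(h.frame f₃' le_rfl).scratch, f₃.reg _ (by omega), f₃.reg _ (by omega), hw, hv₂]
      have hold : ∀ x y : Fin I.n, s₃.mem (3 + M * M + (x * M + y)) = s₂.mem (3 + M * M + (x * M + y)) := by
        intro x y
        have := index_lt h.le x.2 y.2
        refine f₃.mem _ ?_
        have := limit_mono (M := M) (Nat.zero_le (m + 2))
        simp only [limit] at this ⊢
        omega
      have hnew : ∀ v, IsBit v (ψ.rel I m env ⟨i, hi⟩ ⟨j, hj⟩) →
          (Frame m (3 + M * M) s (s₃.setMem (3 + M * M + (i * M + j)) v) ∧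
            s₃.reg (3 * m + 10) = i ∧ s₃.reg (3 * m + 11) = i * M ∧
            ∀ x y : Fin I.n, x < i ∨ (x = i ∧ y < j + 1) →
              IsBit ((s₃.setMem (3 + M * M + (i * M + j)) v).mem (3 + M * M + (x * M + y))) (ψ.rel I m env x y)) ∧
          s₃.reg (3 * (m + 1) + 10) = j ∧ s₃.reg (3 * (m + 1) + 11) = j * M := by
        intro v hbit
        refine ⟨⟨f₃'.setMem (by omega), ?_, ?_, ?_⟩, ?_, ?_⟩
        · rw [f₃.reg _ (by omega), hv]
        · rw [f₃.reg _ (by omega), hw]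
        · intro x y hxy
          by_cases hx : (x : ℕ) = i ∧ (y : ℕ) = j
          · obtain ⟨rfl, rfl⟩ := hx
            simpa using hbit
          · have hne : 3 + M * M + (x * M + y) ≠ 3 + M * M + (i * M + j) := fun e =>
              hx (index_inj (x.2.trans_le h.le |> fun _ => y.2.trans_le h.le) (hj.trans_le h.le) (by omega))
            rw [State.mem_setMem_of_ne hne, hold]
            exact h2 x y (by omega)
        · rw [f₃.reg _ (by omega), hv₂]
        · rw [f₃.reg _ (by omega), hw₂]
      refine .ite (fun he => .store ?_) (fun he => .store ?_) <;> rw [e]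
      · exact hnew 1 (.inl ⟨rfl, (h3.resolve_left fun h0 => he h0.1).2.sat⟩)
      · exact hnew 0 (.inr ⟨rfl, (h3.resolve_right fun h0 => h0.1 he).2⟩)
    · rintro x y (hx | ⟨-, hy⟩)
      · exact h1 x y hx
      · exact absurd hy (by omega)
    · rintro s' ⟨g1, g2, g3, g4⟩
      exact ⟨⟨g1, fun x y hx => g4 x y (by have := y.2; omega)⟩, g2, g3⟩
  · rintro s' ⟨h1, h2⟩
    exact ⟨h1, fun x y => h2 x y x.2⟩

/-- Mark the vertices that satisfy `δ`. -/
def Prog.markSet (m : ℕ) (δ : Fm) : Prog :=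
  .forLoop m (.seq (δ.comp (m + 1)) (.store (markExpr m m) (.reg (3 * (m + 1) + 12))))

theorem Runs.markSet (h : Holds I M m env s) (hK : M ≤ K) {δ : Fm} (hδ : δ.Ok (m + 1)) :
    Runs K (.markSet m δ) s fun s' => Frame m (limit M m) s s' ∧
      ∀ x : Fin I.n, s'.mem (limit M m + x) ≠ 0 ↔ δ.set I m env x := by
  have hl := le_limit M m
  refine Runs.forLoop (n := I.n) (M := M) (Inv := fun i s' => Frame m (limit M m) s s' ∧
    ∀ x : Fin I.n, x < i → (s'.mem (limit M m + x) ≠ 0 ↔ δ.set I m env x))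
    (h.le.trans hK) ?_ ?_ ?_ ⟨.refl, by simp⟩ ?_
  · rintro i s' v w ⟨h1, h2⟩
    exact ⟨(h1.setReg (by omega)).setReg (by omega), h2⟩
  · rintro i s' ⟨h1, h2⟩
    exact ⟨by rw [h1.mem _ (by omega), h.num], by rw [h1.reg _ (by omega), h.size]⟩
  · rintro j s₁ hj ⟨f₁, h2⟩ hv hw
    have H₁ := (h.frame f₁ hl).succ (x := ⟨j, hj⟩) hv hw
    refine .seq ((Fm.runs_comp hK δ hδ H₁).mono fun s₂ ⟨f₂, h3⟩ => .store ?_)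
    have f : Frame m (limit M m) s s₂ := f₁.trans (f₂.mono (Nat.le_succ m) (limit_mono (Nat.le_succ m)))
    have hv₂ : s₂.reg (3 * m + 10) = j := by rw [f₂.reg _ (by omega), hv]
    rw [markExpr_val (h.frame f hl), hv₂]
    refine ⟨⟨f.setMem (by omega), fun x hx => ?_⟩, hv₂, by rw [State.reg_setMem, f₂.reg _ (by omega), hw]⟩
    by_cases hxj : (x : ℕ) = j
    · obtain rfl : x = ⟨j, hj⟩ := Fin.ext hxj
      simp only [State.mem_setMem, Expr.val]
      rcases h3 with ⟨h3, h4⟩ | ⟨h3, h4⟩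
      · exact iff_of_false (fun h => h h3) h4
      · exact iff_of_true h3 h4.sat
    · rw [State.mem_setMem_of_ne (by omega), f₂.mem _ (by rw [limit_succ]; have := h.le; omega)]
      exact h2 x (by omega)
  · rintro s' ⟨h1, h2⟩
    exact ⟨h1, fun x => h2 x x.2⟩

/-- The entries of the marked rows up to `i`, and the marked entries up to `j` of row `i`, have been copied. -/
structure Copied (M σ : ℕ) (p : ℕ → Prop) (cnt : ℕ → ℕ) (r : ℕ) (s₀ : State) (i j : ℕ) (s : State) : Prop where
  reg : ∀ k, 1 ≤ k → k ≤ 3 → s.reg k = s₀.reg k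
  mem : ∀ a, a < 3 ∨ 3 + M * M ≤ a → s.mem a = s₀.mem a
  num : s.reg 4 = cnt i
  row : s.reg 5 = cnt i * σ
  root : r < i → s.reg 7 = cnt r
  entry : ∀ x y, p x → p y → x < i ∨ (x = i ∧ y < j) →
    s.mem (3 + (cnt x * σ + cnt y)) = s₀.mem (3 + M * M + (x * M + y))

theorem Copied.setReg {σ : ℕ} {p : ℕ → Prop} {cnt : ℕ → ℕ} {r : ℕ} {s₀ : State} {i j : ℕ}
    (h : Copied M σ p cnt r s₀ i j s) {k v : ℕ} (hk : k = 6 ∨ 8 ≤ k) : Copied M σ p cnt r s₀ i j (s.setReg k v) := by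
  obtain ⟨h1, h2, h3, h4, h5, h6⟩ := h
  refine ⟨fun k' _ _ => ?_, h2, ?_, ?_, fun hr => ?_, h6⟩ <;> rw [State.reg_setReg_of_ne (by omega)]
  · exact h1 k' (by omega) (by omega)
  · exact h3
  · exact h4
  · exact h5 hr

/-- Copy the marked rows and columns of the scratch memory to the matrix, with rows of length `e`. -/
def Prog.compact (m : ℕ) (e : Expr) : Prog :=
  .seq (.assign 4 (.lit 0)) <| .seq (.assign 5 (.lit 0)) <|
    .seq (.forLoop m <| .ite (.load (markExpr m m))
      (.seq (.assign 6 (.lit 0)) <|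
        .seq (.forLoop (m + 1) <| .ite (.load (markExpr m (m + 1)))
          (.seq (.store (.plus (.lit 3) (.plus (.reg 5) (.reg 6)))
              (.load (.plus (.reg 2) (.plus (.reg (3 * m + 11)) (.reg (3 * (m + 1) + 10))))))
            (.assign 6 (.plus (.reg 6) (.lit 1)))) .skip) <|
        .seq (.ite (Fm.eqExpr (.reg (3 * m + 10)) (.load (.lit 1))) (.assign 7 (.reg 4)) .skip) <|
          .seq (.assign 4 (.plus (.reg 4) (.lit 1))) (.assign 5 (.plus (.reg 5) e))) .skip) <|
      .seq (.store (.lit 0) (.reg 4)) (.store (.lit 1) (.reg 7))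

/-- A kept vertex gets as new name its rank `Nat.count p` among the kept ones. Register `4` holds
the current row rank, `5` its row offset, `6` the column rank and `7` the new name of the root. -/
theorem Runs.compact (h : Holds I M m env s) (hK : M ≤ K) {p : ℕ → Prop} [DecidablePred p]
    (hp : ∀ x, x < I.n → (s.mem (limit M m + x) ≠ 0 ↔ p x)) (hpn : ∀ x, p x → x < I.n) (hr : p I.root) {e : Expr}
    {σ : ℕ} (he : ∀ s' : State, s'.reg 1 = s.reg 1 → s'.mem 0 = s.mem 0 → e.val s' = σ)
    (hσ : Nat.count p I.n ≤ σ) (hσM : σ ≤ M) :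
    Runs K (.compact m e) s fun s' => (∀ k, 1 ≤ k → k ≤ 3 → s'.reg k = s.reg k) ∧ s'.mem 0 = Nat.count p I.n ∧
      s'.mem 1 = Nat.count p I.root ∧ s'.mem 2 = I.k ∧ ∀ x y, p x → p y →
        s'.mem (3 + (Nat.count p x * σ + Nat.count p y)) = s.mem (3 + M * M + (x * M + y)) := by
  have hl := le_limit M m
  have hmark : ∀ {i j : ℕ} {s' : State}, Copied M σ p (Nat.count p) I.root s i j s' → ∀ {k x : ℕ}, x < I.n →
      s'.reg (3 * k + 10) = x → ((Expr.load (markExpr m k)).val s' ≠ 0 ↔ p x) := by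
    intro i j s' h' k x hx hk
    simp only [Expr.val, markExpr]
    rw [markBase_val ((h'.reg 1 le_rfl (by omega)).trans h.size) ((h'.reg 3 (by omega) le_rfl).trans h.marks), hk,
      h'.mem _ (.inr (by omega)), hp x hx]
  have size : ∀ {i j : ℕ} {s' : State}, Copied M σ p (Nat.count p) I.root s i j s' →
      s'.mem 0 = I.n ∧ s'.reg 1 = M := fun h' =>
    ⟨(h'.mem 0 (.inl (by omega))).trans h.num, (h'.reg 1 le_rfl (by omega)).trans h.size⟩
  have hcnt : ∀ x, p x → Nat.count p x < σ := fun x hx => (count_lt hx (hpn x hx)).trans_le hσ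
  refine .seq (.assign (.seq (.assign (.seq (Runs.forLoop (n := I.n) (M := M)
    (Inv := fun i => Copied M σ p (Nat.count p) I.root s i 0) (h.le.trans hK) ?_ (fun _ _ => size) ?_ ?_ ?_)))))
  · exact fun i s' v w h' => (h'.setReg (.inr (by omega))).setReg (.inr (by omega))
  · intro i s₁ hi h₁ hv hw
    refine .ite (fun hd => ?_) (fun hd => .skip ⟨?_, hv, hw⟩)
    · have hpi : p i := (hmark h₁ hi hv).1 hd
      refine .seq (.assign (.seq (Runs.forLoop (n := I.n) (M := M) (Inv := fun j s' =>
        Copied M σ p (Nat.count p) I.root s i j s' ∧ s'.reg 6 = Nat.count p j ∧ s'.reg (3 * m + 10) = i ∧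
        s'.reg (3 * m + 11) = i * M) (h.le.trans hK) ?_ (fun _ _ h' => size h'.1) ?_ ?_ ?_)))
      · rintro j s' v w ⟨h1, h2, h3, h4⟩
        refine ⟨(h1.setReg (.inr (by omega))).setReg (.inr (by omega)), ?_, ?_, ?_⟩ <;>
          rwa [State.reg_setReg_of_ne (by omega), State.reg_setReg_of_ne (by omega)]
      · rintro j s₂ hj ⟨h₂, h6, hv₂, hw₂⟩ hv₂' hw₂'
        refine .ite (fun hd => ?_) (fun hd => .skip ⟨⟨?_, ?_, hv₂, hw₂⟩, hv₂', hw₂'⟩)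
        · have hpj : p j := (hmark h₂ hj hv₂').1 hd
          have ea : (Expr.plus (.lit 3) (.plus (.reg 5) (.reg 6))).val s₂ =
              3 + (Nat.count p i * σ + Nat.count p j) := by
            simp only [Expr.val]
            rw [h₂.row, h6]
          have ev : (Expr.load (.plus (.reg 2) (.plus (.reg (3 * m + 11)) (.reg (3 * (m + 1) + 10))))).val s₂ =
              s.mem (3 + M * M + (i * M + j)) := by
            simp only [Expr.val]
            rw [h₂.reg 2 (by omega) (by omega), h.scratch, hw₂, hv₂', h₂.mem _ (.inr (by omega))]
          refine .seq (.store (.assign ?_))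
          rw [ea, ev]
          have hlt := index_lt le_rfl (hcnt i hpi) (hcnt j hpj)
          have hMM := Nat.mul_le_mul hσM hσM
          have key : Copied M σ p (Nat.count p) I.root s i (j + 1)
              (s₂.setMem (3 + (Nat.count p i * σ + Nat.count p j)) (s.mem (3 + M * M + (i * M + j)))) := by
            refine ⟨h₂.reg, fun a ha => ?_, h₂.num, h₂.row, h₂.root, fun x y hx hy hxy => ?_⟩
            · rw [State.mem_setMem_of_ne (by omega)]
              exact h₂.mem a ha
            · by_cases hxy' : x = i ∧ y = j
              · obtain ⟨rfl, rfl⟩ := hxy'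
                rw [State.mem_setMem]
              · rw [State.mem_setMem_of_ne]
                · exact h₂.entry x y hx hy (by omega)
                · intro e
                  obtain ⟨e1, e2⟩ := index_inj (hcnt y hy) (hcnt j hpj) (Nat.add_left_cancel e)
                  exact hxy' ⟨Nat.count_injective hx hpi e1, Nat.count_injective hy hpj e2⟩
          refine ⟨⟨key.setReg (.inl rfl), ?_, ?_, ?_⟩, ?_, ?_⟩
          · rw [State.reg_setReg, Nat.count_succ, if_pos hpj]
            simp [Expr.val, h6]
          · rwa [State.reg_setReg_of_ne (by omega)]
          · rwa [State.reg_setReg_of_ne (by omega)]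
          · rwa [State.reg_setReg_of_ne (by omega)]
          · rwa [State.reg_setReg_of_ne (by omega)]
        · have hpj : ¬ p j := fun h0 => (hmark h₂ hj hv₂').2 h0 hd
          refine ⟨h₂.reg, h₂.mem, h₂.num, h₂.row, h₂.root, fun x y hx hy hxy => h₂.entry x y hx hy ?_⟩
          have : y ≠ j := fun e => hpj (e ▸ hy)
          omega
        · have hpj : ¬ p j := fun h0 => (hmark h₂ hj hv₂').2 h0 hd
          rw [h6, Nat.count_succ, if_neg hpj, add_zero]
      · refine ⟨h₁.setReg (.inl rfl), ?_, ?_, ?_⟩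
        · rw [State.reg_setReg, Nat.count_zero]
          rfl
        · rwa [State.reg_setReg_of_ne (by omega)]
        · rwa [State.reg_setReg_of_ne (by omega)]
      · rintro s₃ ⟨h₃, -, hv₃, hw₃⟩
        have hroot : (Fm.eqExpr (.reg (3 * m + 10)) (.load (.lit 1))).val s₃ ≠ 0 ↔ i = I.root := by
          rw [Fm.eqExpr_val]
          simp only [Expr.val]
          rw [hv₃, h₃.mem 1 (.inl (by omega)), h.root]
        have fin : ∀ s₄ : State, s₄.mem = s₃.mem → (∀ k, k ≠ 7 → s₄.reg k = s₃.reg k) →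
            (I.root < i + 1 → s₄.reg 7 = Nat.count p I.root) →
            Runs K (.seq (.assign 4 (.plus (.reg 4) (.lit 1))) (.assign 5 (.plus (.reg 5) e))) s₄ fun s' =>
              Copied M σ p (Nat.count p) I.root s (i + 1) 0 s' ∧ s'.reg (3 * m + 10) = i ∧
                s'.reg (3 * m + 11) = i * M := by
          intro s₄ hmem hreg hroot'
          refine .seq (.assign (.assign ⟨⟨fun k hk hk' => ?_, fun a ha => ?_, ?_, ?_, fun hr => ?_,
            fun x y hx hy hxy => ?_⟩, ?_, ?_⟩))
          · rw [State.reg_setReg_of_ne (by omega), State.reg_setReg_of_ne (by omega), hreg _ (by omega),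
              h₃.reg k hk hk']
          · simp only [State.mem_setReg]
            rw [hmem, h₃.mem a ha]
          · rw [State.reg_setReg_of_ne (by omega), State.reg_setReg, Nat.count_succ, if_pos hpi]
            simp only [Expr.val]
            rw [hreg _ (by omega), h₃.num]
          · rw [State.reg_setReg, Nat.count_succ, if_pos hpi, Nat.succ_mul]
            simp only [Expr.val]
            rw [State.reg_setReg_of_ne (by omega), hreg _ (by omega), h₃.row, he]
            · rw [State.reg_setReg_of_ne (by omega), hreg _ (by omega), h₃.reg 1 (by omega) (by omega)]
            · simp only [State.mem_setReg]
              rw [hmem, h₃.mem 0 (.inl (by omega))]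
          · rw [State.reg_setReg_of_ne (by omega), State.reg_setReg_of_ne (by omega), hroot' hr]
          · simp only [State.mem_setReg]
            rw [hmem]
            refine h₃.entry x y hx hy ?_
            have := hpn y hy
            omega
          · rw [State.reg_setReg_of_ne (by omega), State.reg_setReg_of_ne (by omega), hreg _ (by omega), hv₃]
          · rw [State.reg_setReg_of_ne (by omega), State.reg_setReg_of_ne (by omega), hreg _ (by omega), hw₃]
        refine .seq (.ite (fun h0 => .assign (fin _ rfl (fun k hk => State.reg_setReg_of_ne hk) fun _ => ?_))
          fun h0 => .skip (fin _ rfl (fun _ _ => rfl) fun hr' => h₃.root ?_))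
        · rw [State.reg_setReg]
          simp only [Expr.val]
          rw [h₃.num, hroot.1 h0]
        · have : i ≠ I.root := fun e => hroot.2 e h0
          omega
    · have hpi : ¬ p i := fun h0 => (hmark h₁ hi hv).2 h0 hd
      refine ⟨h₁.reg, h₁.mem, ?_, ?_, fun hr' => h₁.root ?_, fun x y hx hy hxy => h₁.entry x y hx hy ?_⟩
      · rw [h₁.num, Nat.count_succ, if_neg hpi, add_zero]
      · rw [h₁.row, Nat.count_succ, if_neg hpi, add_zero]
      · have : (I.root : ℕ) ≠ i := fun e => hpi (e ▸ hr)
        omega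
      · have : x ≠ i := fun e => hpi (e ▸ hx)
        omega
  · refine ⟨fun k hk hk' => ?_, fun _ _ => rfl, ?_, ?_, fun hr => absurd hr (by omega), fun x y _ _ hxy => ?_⟩
    · rw [State.reg_setReg_of_ne (by omega), State.reg_setReg_of_ne (by omega)]
    · rw [State.reg_setReg_of_ne (by omega), State.reg_setReg, Nat.count_zero]
      rfl
    · rw [State.reg_setReg, Nat.count_zero, Nat.zero_mul]
      rfl
    · exact absurd hxy (by omega)
  · intro s' h'
    refine .seq (.store (.store ?_))
    simp only [Expr.val]
    refine ⟨h'.reg, ?_, ?_, ?_, fun x y hx hy => ?_⟩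
    · rw [State.mem_setMem_of_ne (by omega), State.mem_setMem, h'.num]
    · rw [State.mem_setMem, State.reg_setMem, h'.root I.root.2]
    · rw [State.mem_setMem_of_ne (by omega), State.mem_setMem_of_ne (by omega), h'.mem 2 (.inl (by omega)), h.param]
    · rw [State.mem_setMem_of_ne (by omega), State.mem_setMem_of_ne (by omega)]
      exact h'.entry x y hx hy (.inl (hpn x hx))

/-- Replace the digraph by the digraph on the vertices with `δ` whose arcs are given by `ψ`. -/
def Prog.rewrite (m : ℕ) (δ ψ : Fm) (e : Expr) : Prog :=
  .seq (.fill m ψ) (.seq (.markSet m δ) (.compact m e))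

/-- The row length `σ` is independent of the number of vertices, so that the layout can stay fixed
while the digraph shrinks. -/
theorem Runs.rewrite (h : Holds I M m env s) (hK : M ≤ K) {δ ψ : Fm} (hδ : δ.Ok (m + 1)) (hψ : ψ.Ok (m + 2))
    (hr : δ.set I m env I.root) (hloop : ∀ x, δ.set I m env x → ¬ ψ.rel I m env x x) {e : Expr} {σ : ℕ}
    (he : ∀ s' : State, s'.reg 1 = M → s'.mem 0 = I.n → e.val s' = σ)
    (hσ : I.n ≤ σ) (hσM : σ ≤ M) :
    ∃ J : Instance, J.IsCopyOf (V := {x // δ.set I m env x}) ⟨fun a b => ψ.rel I m env a b⟩ ⟨I.root, hr⟩ I.k ∧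
      Runs K (.rewrite m δ ψ e) s fun s' => (∀ k, 1 ≤ k → k ≤ 3 → s'.reg k = s.reg k) ∧ s'.mem 0 = J.n ∧
        s'.mem 1 = J.root ∧ s'.mem 2 = J.k ∧
        ∀ x y : Fin J.n, IsBit (s'.mem (3 + (x * σ + y))) (J.D.Adj x y) := by
  classical
  set p : ℕ → Prop := fun j => ∃ hj : j < I.n, δ.set I m env ⟨j, hj⟩ with hp
  let f : {x // δ.set I m env x} → Fin (Nat.count p I.n) := fun x =>
    ⟨Nat.count p x.1, count_lt ⟨x.1.2, x.2⟩ x.1.2⟩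
  have hf : Function.Bijective f := by
    constructor
    · intro x y hxy
      exact Subtype.ext (Fin.ext (Nat.count_injective (p := p) ⟨x.1.2, x.2⟩ ⟨y.1.2, y.2⟩ (congrArg Fin.val hxy)))
    · intro k
      obtain ⟨x, -, ⟨hx, hδx⟩, hk⟩ := exists_count_eq k.2
      exact ⟨⟨⟨x, hx⟩, hδx⟩, Fin.ext hk⟩
  let E := Equiv.ofBijective f hf
  let J : Instance := ⟨Nat.count p I.n, ⟨fun a b => ψ.rel I m env (E.symm a).1 (E.symm b).1⟩,
    fun a => hloop _ (E.symm a).2, E ⟨I.root, hr⟩, I.k⟩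
  refine ⟨J, ⟨rfl, E, fun a b => ?_, rfl⟩, ?_⟩
  · change _ ↔ ψ.rel I m env (E.symm (E a)).1 (E.symm (E b)).1
    rw [E.symm_apply_apply, E.symm_apply_apply]
  · refine .seq ((Runs.fill h hK hψ).mono fun s₁ ⟨f₁, h1⟩ => .seq ?_)
    have H₁ := h.frame f₁ le_rfl
    refine (Runs.markSet H₁ hK hδ).mono fun s₂ ⟨f₂, h2⟩ => ?_
    have H₂ := H₁.frame f₂ (le_limit M m)
    refine (Runs.compact (p := p) (σ := σ) H₂ hK (fun x hx => (h2 ⟨x, hx⟩).trans ⟨fun h => ⟨hx, h⟩, fun h => h.2⟩)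
      (fun x hx => hx.1) ⟨I.root.2, hr⟩ (fun s' g1 g2 => he s' (g1.trans H₂.size) (g2.trans H₂.num))
      ((Nat.count_le p).trans hσ) hσM).mono fun s' ⟨g1, g2, g3, g4, g5⟩ => ?_
    refine ⟨fun k hk hk' => ?_, g2, g3, g4, fun x y => ?_⟩
    · rw [g1 k hk hk', f₂.reg k (by omega), f₁.reg k (by omega)]
    · obtain ⟨x, rfl⟩ := E.surjective x
      obtain ⟨y, rfl⟩ := E.surjective y
      have h5 := g5 x.1 y.1 ⟨x.1.2, x.2⟩ ⟨y.1.2, y.2⟩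
      change IsBit (s'.mem (3 + (Nat.count p x.1 * σ + Nat.count p y.1)))
        (ψ.rel I m env (E.symm (E x)).1 (E.symm (E y)).1)
      rw [E.symm_apply_apply, E.symm_apply_apply, h5, f₂.mem]
      · exact h1 x.1 y.1
      · have := index_lt h.le x.1.2 y.1.2
        simp only [limit]
        omega

end Rewrite

end LeafKernel

namespace LeafKernel

open Relation

/-! ### Derived connectives and their semantics -/

namespace Fm

def or (φ ψ : Fm) : Fm := neg (conj (neg φ) (neg ψ))

def iff (φ ψ : Fm) : Fm := conj (or (neg φ) ψ) (or φ (neg ψ))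

def all (l : List ℕ) (f : ℕ → Fm) : Fm := l.foldr (fun i φ => conj (f i) φ) (eq 0 0)

def any (l : List ℕ) (f : ℕ → Fm) : Fm := neg (all l fun i => neg (f i))

def exiN : ℕ → Fm → Fm
  | 0, φ => φ
  | m + 1, φ => exi (exiN m φ)

section Semantics

variable {V : Type} {A : V → V → Prop} {r : V} {d : ℕ} {env : ℕ → V} {φ ψ : Fm} {l : List ℕ} {f : ℕ → Fm}

theorem sat_or : (or φ ψ).Sat A r d env ↔ φ.Sat A r d env ∨ ψ.Sat A r d env := by
  simp only [or, Sat]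
  tauto

theorem sat_iff : (iff φ ψ).Sat A r d env ↔ (φ.Sat A r d env ↔ ψ.Sat A r d env) := by
  simp only [iff, Sat, sat_or]
  tauto

theorem sat_all : (all l f).Sat A r d env ↔ ∀ i ∈ l, (f i).Sat A r d env := by
  induction l with
  | nil => simp [all, Sat]
  | cons a l ih =>
    rw [List.forall_mem_cons, ← ih]
    exact Iff.rfl

theorem sat_any : (any l f).Sat A r d env ↔ ∃ i ∈ l, (f i).Sat A r d env := by
  simp [any, Sat, sat_all]

theorem ok_or : (or φ ψ).Ok d ↔ φ.Ok d ∧ ψ.Ok d := Iff.rfl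

theorem ok_iff : (iff φ ψ).Ok d ↔ φ.Ok d ∧ ψ.Ok d := by
  simp only [iff, Ok, ok_or]
  tauto

theorem ok_all : (all l f).Ok d ↔ 0 < d ∧ ∀ i ∈ l, (f i).Ok d := by
  induction l with
  | nil => simp [all, Ok]
  | cons a l ih =>
    rw [List.forall_mem_cons]
    refine (and_congr Iff.rfl ih).trans ?_
    tauto

theorem ok_any : (any l f).Ok d ↔ 0 < d ∧ ∀ i ∈ l, (f i).Ok d := ok_all

theorem ok_exiN {m : ℕ} : ∀ {d}, (exiN m φ).Ok d ↔ φ.Ok (d + m) := by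
  induction m with
  | zero => exact Iff.rfl
  | succ m ih =>
    intro d
    refine (ih (d := d + 1)).trans ?_
    rw [show d + 1 + m = d + (m + 1) by omega]

theorem sat_congr {env' : ℕ → V} (hφ : φ.Ok d) (h : ∀ i < d, env i = env' i) :
    φ.Sat A r d env ↔ φ.Sat A r d env' := by
  have upd : ∀ {d : ℕ} {env env' : ℕ → V} (x : V), (∀ i < d, env i = env' i) →
      ∀ i < d + 1, Function.update env d x i = Function.update env' d x i := by
    intro d env env' x h i hi
    by_cases hid : i = d
    · subst hid
      simp
    · rw [Function.update_of_ne hid, Function.update_of_ne hid, h i (by omega)]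
  induction φ generalizing d env env' with
  | eq i j => simp only [Sat, h i hφ.1, h j hφ.2]
  | root i => simp only [Sat, h i hφ]
  | adj i j => simp only [Sat, h i hφ.1, h j hφ.2]
  | neg φ ih => exact not_congr (ih hφ h)
  | conj φ ψ ih₁ ih₂ => exact and_congr (ih₁ hφ.1 h) (ih₂ hφ.2 h)
  | exi φ ih => exact exists_congr fun x => ih hφ (upd x h)
  | rch φ t ih =>
    simp only [Sat]
    rw [h t hφ.2]
    have : (fun a b => φ.Sat A r (d + 2) (Function.update (Function.update env d a) (d + 1) b)) =
        fun a b => φ.Sat A r (d + 2) (Function.update (Function.update env' d a) (d + 1) b) := by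
      funext a b
      exact propext (ih hφ.1 (upd b (upd a h)))
    rw [this]

theorem sat_exiN_of {m : ℕ} (hφ : φ.Ok (d + m)) (h : φ.Sat A r (d + m) env) : ∀ {env' : ℕ → V},
    (∀ i < d, env' i = env i) → (exiN m φ).Sat A r d env' := by
  induction m generalizing d with
  | zero =>
    intro env' he
    exact (sat_congr hφ he).2 h
  | succ m ih =>
    intro env' he
    refine ⟨env d, ih (d := d + 1) (by rwa [show d + 1 + m = d + (m + 1) by omega])
      (by rwa [show d + 1 + m = d + (m + 1) by omega]) fun i hi => ?_⟩
    by_cases hid : i = d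
    · subst hid
      simp
    · rw [Function.update_of_ne hid, he i (by omega)]

end Semantics

theorem Witness.holds {I : Instance} {M : ℕ} {φ : Fm} {d : ℕ} {env : ℕ → Fin I.n} {s : State}
    (h : φ.Witness I M d env s) : Holds I M d env s := by
  induction φ generalizing d env with
  | exi φ ih =>
    obtain ⟨x, hx⟩ := h
    obtain ⟨h1, h2, h3, h4, h5, h6, h7, h8, h9, h10⟩ := ih hx
    refine ⟨h1, h2, h3, h4, h5, h6, h7, h8, fun i hi => ?_, fun i hi => ?_⟩
    · rw [h9 i (by omega), Function.update_of_ne (by omega)]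
    · rw [h10 i (by omega), Function.update_of_ne (by omega)]
  | _ => exact h.1

theorem Witness.exiN {I : Instance} {M m : ℕ} {φ : Fm} : ∀ {d : ℕ} {env : ℕ → Fin I.n} {s : State},
    (exiN m φ).Witness I M d env s →
      ∃ env', Holds I M (d + m) env' s ∧ φ.Sat I.D.Adj I.root (d + m) env' := by
  induction m with
  | zero => exact fun {d env s} h => ⟨env, h.holds, h.sat⟩
  | succ m ih =>
    rintro d env s ⟨x, hx⟩
    rw [show d + (m + 1) = d + 1 + m by omega]
    exact ih hx

end Fm

/-! ### Copies and the termination order -/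

section Copies

variable {V W : Type} {I J : Instance}

theorem Instance.IsCopyOf.of_equiv {D : Digraph V} {D' : Digraph W} {r : V} {r' : W} {k : ℕ} (h : J.IsCopyOf D r k)
    (φ : V ≃ W) (hφ : ∀ a b, D.Adj a b ↔ D'.Adj (φ a) (φ b)) (hr : φ r = r') : J.IsCopyOf D' r' k := by
  obtain ⟨hk, e, h1, h2⟩ := h
  refine ⟨hk, φ.symm.trans e, fun a b => ?_, ?_⟩
  · simp only [Equiv.trans_apply]
    rw [← h1, hφ, φ.apply_symm_apply, φ.apply_symm_apply]
  · rw [← hr]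
    simpa using h2

theorem Instance.IsCopyOf.of_equiv_symm {D : Digraph V} {D' : Digraph W} {r : V} {r' : W} {k : ℕ}
    (h : J.IsCopyOf D r k) (φ : W ≃ V) (hφ : ∀ a b, D'.Adj a b ↔ D.Adj (φ a) (φ b)) (hr : φ r' = r) :
    J.IsCopyOf D' r' k :=
  h.of_equiv φ.symm (fun a b => by rw [hφ, φ.apply_symm_apply, φ.apply_symm_apply]) (by rw [← hr, φ.symm_apply_apply])

theorem Instance.IsCopyOf.card_eq {D : Digraph V} {r : V} {k : ℕ} (h : J.IsCopyOf D r k) : J.n = Nat.card V := by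
  obtain ⟨-, e, -⟩ := h
  rw [Nat.card_congr e, Nat.card_fin]

noncomputable def arcCount (I : Instance) : ℕ := {p : Fin I.n × Fin I.n | I.D.Adj p.1 p.2}.ncard

theorem Instance.IsCopyOf.arcCount_eq {D : Digraph V} {r : V} {k : ℕ} (h : J.IsCopyOf D r k) :
    arcCount J = {p : V × V | D.Adj p.1 p.2}.ncard := by
  obtain ⟨-, e, h, -⟩ := h
  rw [arcCount, ← Set.ncard_image_of_injective _ (e.prodCongr e).injective]
  congr 1
  ext ⟨a, b⟩
  constructor
  · intro hab
    exact ⟨(e.symm a, e.symm b), (h _ _).2 (by simpa using hab), by simp⟩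
  · rintro ⟨⟨a', b'⟩, hab, he⟩
    simp only [Equiv.prodCongr_apply, Prod.map_apply, Prod.mk.injEq] at he
    obtain ⟨rfl, rfl⟩ := he
    exact (h _ _).1 hab

def Smaller (J I : Instance) : Prop := J.n < I.n ∨ (J.n = I.n ∧ arcCount J < arcCount I)

theorem smaller_of_notMem {p : Fin I.n → Prop} {D : Digraph {x // p x}} {r : {x // p x}} {k : ℕ}
    (h : J.IsCopyOf D r k) {x : Fin I.n} (hx : ¬ p x) : Smaller J I := by
  left
  rw [h.card_eq]
  have h1 := Set.ncard_lt_card (s := {x | p x}) (fun e => hx (e ▸ Set.mem_univ x : x ∈ {x | p x}))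
  rwa [Nat.card_fin] at h1

theorem copy_deleteArc {p : Fin I.n → Prop} (hp : ∀ x, p x) {q : Fin I.n → Fin I.n → Prop} {a b : Fin I.n}
    (hab : I.D.Adj a b) (hq : ∀ x y, q x y ↔ I.D.Adj x y ∧ ¬ (x = a ∧ y = b)) {hr : p I.root}
    (h : J.IsCopyOf (V := {x // p x}) ⟨fun x y => q x y⟩ ⟨I.root, hr⟩ I.k) :
    J.IsCopyOf (I.D.deleteArc a b) I.root I.k ∧ Smaller J I := by
  have h1 : J.IsCopyOf (I.D.deleteArc a b) I.root I.k :=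
    h.of_equiv (Equiv.subtypeUnivEquiv hp) (fun x y => hq x y) rfl
  refine ⟨h1, .inr ⟨by rw [h1.card_eq, Nat.card_fin], ?_⟩⟩
  rw [h1.arcCount_eq]
  exact Set.ncard_lt_ncard ⟨fun p hp => hp.1, fun hsub => (hsub (a := (a, b)) hab).2 ⟨rfl, rfl⟩⟩

end Copies

/-- A reduction rule: if the guard is true of some values of the variables, then the digraph is replaced by the
digraph on the vertices with `keep` whose arcs are given by `arcs`. -/
structure Rule where
  vars : ℕ
  guard : Fm
  keep : Fm
  arcs : Fm

def Rule.Ok (R : Rule) : Prop := R.guard.Ok R.vars ∧ R.keep.Ok (R.vars + 1) ∧ R.arcs.Ok (R.vars + 2)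

/-- The rule leads from `I` only to smaller instances with the property `T`. -/
def Rule.Sound (R : Rule) (I : Instance) (T : Instance → Prop) : Prop :=
  ∀ env : ℕ → Fin I.n, R.guard.Sat I.D.Adj I.root R.vars env → ∃ hr : R.keep.set I R.vars env I.root,
    (∀ x, ¬ R.arcs.rel I R.vars env x x) ∧ ∀ J : Instance,
      J.IsCopyOf (V := {x // R.keep.set I R.vars env x}) ⟨fun a b => R.arcs.rel I R.vars env a b⟩ ⟨I.root, hr⟩ I.k →
        T J ∧ Smaller J I

/-! ### The simple rules as formulas -/

section Rules

open Fm

/-- Variable `0` is the vertex to be deleted. The clause `neg (eq 1 2)` makes the arc relation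
irreflexive. -/
def unreachableRule : Rule :=
  ⟨1, neg (rch (adj 1 2) 0), neg (eq 1 0), conj (adj 1 2) (neg (eq 1 2))⟩

/-- Variables `0` and `1` are the separating vertex and the tail of the useless arc. The formula `eq
2 2` keeps all vertices. -/
def uselessRule : Rule :=
  ⟨2, conj (adj 1 0) (or (root 0) (neg (rch (conj (adj 2 3) (conj (neg (eq 2 0)) (neg (eq 3 0)))) 1))), eq 2 2,
    conj (adj 2 3) (neg (conj (eq 2 1) (eq 3 0)))⟩

/-- Variables `0`, `1` are the ends of the bridge and `2`, `3` two vertices separated by it. -/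
def bridgeRule : Rule :=
  ⟨4, conj (conj (adj 0 1) (conj (neg (root 1)) (neg (eq 2 3))))
      (conj (neg (rch (conj (adj 4 5) (neg (conj (eq 4 0) (eq 5 1)))) 2))
        (neg (rch (conj (adj 4 5) (neg (conj (eq 4 0) (eq 5 1)))) 3))), neg (eq 4 1),
    conj (neg (eq 4 5)) (or (adj 4 5) (or (conj (eq 4 0) (adj 1 5)) (conj (eq 5 0) (adj 4 1))))⟩

/-- Variables `0`, `1` are the ends of the avoidable arc. The separating set consists of `2` and
`3`, which may coincide. -/
def avoidableRule : Rule :=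
  ⟨4, conj (conj (adj 0 1) (conj (adj 2 1) (adj 3 1))) (conj (conj (neg (eq 0 2)) (neg (eq 0 3)))
      (or (or (root 2) (root 3)) (neg (rch (conj (adj 4 5) (conj (conj (neg (eq 4 2)) (neg (eq 4 3)))
        (conj (neg (eq 5 2)) (neg (eq 5 3))))) 0)))), eq 4 4, conj (adj 4 5) (neg (conj (eq 4 0) (eq 5 1)))⟩

variable {I J : Instance}

theorem unreachableRule_guard {V : Type} {D : Digraph V} {r : V} {env : ℕ → V} :
    unreachableRule.guard.Sat D.Adj r 1 env ↔ ¬ D.Reaches r (env 0) := by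
  simp [unreachableRule, Sat, reaches_iff]

theorem unreachableRule_sound : unreachableRule.Sound I (UnreachableVertexRule I) := by
  intro env h
  have h' := unreachableRule_guard.1 h
  have hne : I.root ≠ env 0 := fun e => h' (reaches_iff.2 (e ▸ .refl))
  have hset : ∀ x, unreachableRule.keep.set I 1 env x ↔ x ≠ env 0 := fun x => by
    simp [unreachableRule, Fm.set, Sat]
  have hrel : ∀ x y, unreachableRule.arcs.rel I 1 env x y ↔ I.D.Adj x y ∧ x ≠ y := fun x y => by
    simp [unreachableRule, Fm.rel, Sat]
  refine ⟨(hset _).2 hne, fun x hx => ((hrel x x).1 hx).2 rfl, fun J hJ => ⟨⟨env 0, hne, h', ?_⟩,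
    smaller_of_notMem hJ (x := env 0) fun hx => (hset _).1 hx rfl⟩⟩
  refine hJ.of_equiv (Equiv.subtypeEquivRight hset) (fun a b => (hrel _ _).trans ⟨fun h => h.1, fun h => ⟨h, ?_⟩⟩) rfl
  exact fun e => I.loopless b.1 (Eq.subst (motive := fun z => I.D.Adj z b.1) e h)

theorem uselessRule_guard {V : Type} {D : Digraph V} {r : V} {env : ℕ → V} :
    uselessRule.guard.Sat D.Adj r 2 env ↔ D.SetDisconnects r {env 0} (env 1) ∧ D.Adj (env 1) (env 0) := by
  rw [setDisconnects_iff, and_comm]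
  simp [uselessRule, Sat, sat_or, eq_comm (a := r)]
  exact fun _ => Iff.rfl

theorem uselessRule_sound : uselessRule.Sound I (RuleStep I) := by
  intro env h
  obtain ⟨h1, h2⟩ := uselessRule_guard.1 h
  have hrel : ∀ x y, uselessRule.arcs.rel I 2 env x y ↔ I.D.Adj x y ∧ ¬ (x = env 1 ∧ y = env 0) := fun x y => by
    simp [uselessRule, Fm.rel, Sat]
  refine ⟨rfl, fun x hx => I.loopless _ ((hrel _ _).1 hx).1, fun J hJ => ?_⟩
  obtain ⟨h3, h4⟩ := copy_deleteArc (fun _ => rfl) h2 hrel hJ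
  exact ⟨.inl ⟨_, _, h1, h2, h3⟩, h4⟩

theorem bridgeRule_guard {V : Type} {D : Digraph V} {r : V} {env : ℕ → V} :
    bridgeRule.guard.Sat D.Adj r 4 env ↔ (D.Adj (env 0) (env 1) ∧ r ≠ env 1 ∧ env 2 ≠ env 3) ∧
      D.ArcDisconnects r (env 0) (env 1) (env 2) ∧ D.ArcDisconnects r (env 0) (env 1) (env 3) := by
  rw [arcDisconnects_iff, arcDisconnects_iff, ne_comm (a := r)]
  simp [bridgeRule, Sat]

theorem bridgeRule_sound : bridgeRule.Sound I (RuleStep I) := by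
  intro env h
  obtain ⟨⟨h1, h2, h3⟩, h4, h5⟩ := bridgeRule_guard.1 h
  have hset : ∀ x, bridgeRule.keep.set I 4 env x ↔ x ≠ env 1 := fun x => by
    simp [bridgeRule, Fm.set, Sat]
  have hrel : ∀ x y, bridgeRule.arcs.rel I 4 env x y ↔ x ≠ y ∧ (I.D.Adj x y ∨ (x = env 0 ∧ I.D.Adj (env 1) y) ∨
      (y = env 0 ∧ I.D.Adj x (env 1))) := fun x y => by
    simp [bridgeRule, Fm.rel, Sat, sat_or]
  refine ⟨(hset _).2 h2, fun x hx => ((hrel x x).1 hx).1 rfl, fun J hJ => ⟨.inr (.inl ⟨env 0, env 1, env 2, env 3,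
    h2, h1, h3, h4, h5, ?_⟩), smaller_of_notMem hJ (x := env 1) fun hx => (hset _).1 hx rfl⟩⟩
  refine hJ.of_equiv (Equiv.subtypeEquivRight hset) (fun a b => (hrel _ _).trans (and_congr ?_ Iff.rfl)) rfl
  exact not_congr (Subtype.ext_iff.symm.trans ((Equiv.subtypeEquivRight hset).injective.eq_iff).symm)

theorem avoidableRule_guard {V : Type} {D : Digraph V} {r : V} {env : ℕ → V} :
    avoidableRule.guard.Sat D.Adj r 4 env ↔ (D.Adj (env 0) (env 1) ∧ D.Adj (env 2) (env 1) ∧ D.Adj (env 3) (env 1)) ∧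
      (env 0 ≠ env 2 ∧ env 0 ≠ env 3) ∧ D.SetDisconnects r {env 2, env 3} (env 0) := by
  rw [setDisconnects_iff]
  have : Avoid D.Adj {env 2, env 3} = fun a b => D.Adj a b ∧ (a ≠ env 2 ∧ a ≠ env 3) ∧ b ≠ env 2 ∧ b ≠ env 3 := by
    funext a b
    simp [Avoid]
  rw [this]
  simp [avoidableRule, Sat, sat_or, eq_comm (a := r)]

theorem avoidableRule_sound : avoidableRule.Sound I (RuleStep I) := by
  classical
  intro env h
  obtain ⟨⟨h1, h2, h3⟩, ⟨h4, h5⟩, h6⟩ := avoidableRule_guard.1 h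
  have hrel : ∀ x y, avoidableRule.arcs.rel I 4 env x y ↔ I.D.Adj x y ∧ ¬ (x = env 0 ∧ y = env 1) := fun x y => by
    simp [avoidableRule, Fm.rel, Sat]
  refine ⟨rfl, fun x hx => I.loopless _ ((hrel _ _).1 hx).1, fun J hJ => ?_⟩
  obtain ⟨h7, h8⟩ := copy_deleteArc (fun _ => rfl) h1 hrel hJ
  refine ⟨.inr (.inr (.inl ⟨{env 2, env 3}, _, _, Finset.card_le_two, by simp [h4, h5], by simpa using h6, h1, ?_, h7⟩)), h8⟩
  simp [h2, h3]

end Rules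

end LeafKernel

namespace LeafKernel

open Relation

/-! ### The two directional path rule as a formula -/

namespace Fm

/-- The variables `f 0, …, f (l - 1)` form a path without forward chords. -/
def path (l : ℕ) (f : ℕ → ℕ) : Fm :=
  conj (all (List.range (l - 1)) fun i => adj (f i) (f (i + 1))) <|
    conj (all (List.range l) fun i => all (List.range i) fun j => neg (eq (f j) (f i))) <|
      all (List.range l) fun i => all (List.range (l - (i + 2))) fun j => neg (adj (f i) (f (i + 2 + j)))

variable {V : Type} {D : Digraph V} {A : V → V → Prop} {r : V} {d l : ℕ} {env : ℕ → V} {f : ℕ → ℕ}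

theorem sat_path : (path l f).Sat A r d env ↔ ((List.range l).map fun i => env (f i)).IsChain A ∧
    ((List.range l).map fun i => env (f i)).Nodup ∧ NoSkip A ((List.range l).map fun i => env (f i)) := by
  simp only [path, Sat, sat_all, List.mem_range]
  refine and_congr ?_ (and_congr ?_ ?_)
  · rw [List.isChain_iff_getElem]
    simp only [List.length_map, List.length_range, List.getElem_map, List.getElem_range]
    exact ⟨fun h i hi => h i (by omega), fun h i hi => h i (by omega)⟩
  · rw [List.nodup_iff_pairwise_ne, List.pairwise_iff_getElem]
    simp only [List.length_map, List.length_range, List.getElem_map, List.getElem_range]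
    exact ⟨fun h i j _ hj hij => h j hj i hij, fun h i hi j hj => h j i (by omega) hi hj⟩
  · rw [noSkip_iff]
    simp only [List.length_map, List.length_range, List.getElem_map, List.getElem_range]
    constructor
    · intro h i j hi hj hA
      by_contra hcon
      refine h i hi (j - (i + 2)) (by omega) ?_
      rwa [show i + 2 + (j - (i + 2)) = j by omega]
    · intro h i hi j hj hA
      have := h i (i + 2 + j) hi (by omega) hA
      omega

/-- The variable `m` is not one of the first `l` variables. -/
def off (l m : ℕ) : Fm := all (List.range l) fun j => neg (eq m j)

theorem sat_off {m : ℕ} : (off l m).Sat A r d env ↔ env m ∉ (List.range l).map env := by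
  simp only [off, sat_all, Sat, List.mem_range, List.mem_map, not_exists, not_and]
  exact forall₂_congr fun i _ => not_congr eq_comm

end Fm

open Fm

/-- The guard of the two directional path rule; the variables are the vertices of `P`, followed by those of `Q`. -/
def twoPathGuard (l ii io : ℕ) : Fm :=
  conj (conj (path l fun i => i) (path l fun i => l + i)) <|
    conj (conj (eq l ii) (eq (l + (l - 1)) io)) <|
    conj (all (List.range l) fun i => neg (root i)) <|
    conj (all (List.range l) fun i =>
      iff (exi (conj (off l (2 * l)) (adj (2 * l) i))) (or (eq i 0) (eq i ii))) <|
    conj (all (List.range l) fun i =>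
      iff (exi (conj (off l (2 * l)) (adj i (2 * l)))) (or (eq i (l - 1)) (eq i io))) <|
    conj (conj (all (List.range l) fun i => any (List.range l) fun j => eq (l + j) i)
      (all (List.range l) fun i => any (List.range l) fun j => eq j (l + i))) <|
    all (List.range (l - 1)) fun i => all (List.range (l - 1)) fun j =>
      neg (conj (conj (eq i io) (eq (l + j) (l - 1))) (eq (i + 1) (l + j + 1)))

/-- The new vertices reuse the names of the inner vertices `2` and `3` of `P`, whose old arcs are
dropped, since a rewriting can only keep existing vertices. -/
def twoPathRule (l ii io : ℕ) : Rule where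
  vars := 2 * l
  guard := twoPathGuard l ii io
  keep := or (or (off l (2 * l)) (or (eq (2 * l) 0) (or (eq (2 * l) ii) (or (eq (2 * l) io) (eq (2 * l) (l - 1))))))
    (or (eq (2 * l) 2) (eq (2 * l) 3))
  arcs := or (conj (adj (2 * l) (2 * l + 1)) (conj (conj (neg (eq (2 * l) 2)) (neg (eq (2 * l) 3)))
      (conj (neg (eq (2 * l + 1) 2)) (neg (eq (2 * l + 1) 3))))) <|
    or (or (conj (eq (2 * l) io) (eq (2 * l + 1) 2)) (conj (eq (2 * l) (l - 1)) (eq (2 * l + 1) 3))) <|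
    or (or (conj (eq (2 * l) 2) (eq (2 * l + 1) 0)) (conj (eq (2 * l) 3) (eq (2 * l + 1) ii)))
      (or (conj (eq (2 * l) 2) (eq (2 * l + 1) 3)) (conj (eq (2 * l) 3) (eq (2 * l + 1) 2)))

/-- The lengths of the path and the positions of its two inner ends. -/
def IsShape (l ii io : ℕ) : Prop := (l = 7 ∨ l = 8) ∧ (ii = l - 1 ∨ ii = l - 2) ∧ (io = 0 ∨ io = 1)

section TwoPathRule

variable {V : Type} {D : Digraph V} {r : V} {l ii io : ℕ} {env : ℕ → V}

theorem twoPathGuard_iff (hs : IsShape l ii io) : (twoPathGuard l ii io).Sat D.Adj r (2 * l) env ↔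
    TwoPath D r ((List.range l).map env) ((List.range l).map fun i => env (l + i)) (env 0) (env ii) (env io)
      (env (l - 1)) := by
  obtain ⟨hl, hii, hio⟩ := hs
  set P := (List.range l).map env with hP
  set Q := (List.range l).map (fun i => env (l + i)) with hQ
  have lenP : P.length = l := by simp [hP]
  have lenQ : Q.length = l := by simp [hQ]
  have getP : ∀ i (h : i < P.length), P[i] = env i := fun i h => by simp [hP]
  have getQ : ∀ i (h : i < Q.length), Q[i] = env (l + i) := fun i h => by simp [hQ]
  have memP : ∀ x, x ∈ P ↔ ∃ i < l, env i = x := fun x => by simp [hP]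
  have memQ : ∀ x, x ∈ Q ↔ ∃ i < l, env (l + i) = x := fun x => by simp [hQ]
  have hpin : env ii = env (l - 1) ∨ [env ii, env (l - 1)] <:+ P := by
    rcases hii with rfl | rfl
    · exact .inl rfl
    · right
      rcases hl with rfl | rfl
      · exact ⟨(List.range 5).map env, rfl⟩
      · exact ⟨(List.range 6).map env, rfl⟩
  have hpout : env io = env 0 ∨ [env 0, env io] <+: P := by
    rcases hio with rfl | rfl
    · exact .inl rfl
    · right
      rcases hl with rfl | rfl <;> exact ⟨_, rfl⟩
  have hin : (∀ i < l, ((∃ a, a ∉ P ∧ D.Adj a (env i)) ↔ (env i = env 0 ∨ env i = env ii))) ↔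
      ∀ b ∈ P, (∃ a, a ∉ P ∧ D.Adj a b) ↔ (b = env 0 ∨ b = env ii) := by
    simp only [memP]
    exact ⟨fun h b ⟨i, hi, e⟩ => e ▸ h i hi, fun h i hi => h _ ⟨i, hi, rfl⟩⟩
  have hout : (∀ i < l, ((∃ a, a ∉ P ∧ D.Adj (env i) a) ↔ (env i = env (l - 1) ∨ env i = env io))) ↔
      ∀ b ∈ P, (∃ a, a ∉ P ∧ D.Adj b a) ↔ (b = env (l - 1) ∨ b = env io) := by
    simp only [memP]
    exact ⟨fun h b ⟨i, hi, e⟩ => e ▸ h i hi, fun h i hi => h _ ⟨i, hi, rfl⟩⟩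
  have hmem : ((∀ i < l, ∃ j < l, env (l + j) = env i) ∧ ∀ i < l, ∃ j < l, env j = env (l + i)) ↔
      ∀ x, x ∈ P ↔ x ∈ Q := by
    simp only [memP, memQ]
    constructor
    · rintro ⟨h1, h2⟩ x
      constructor
      · rintro ⟨i, hi, rfl⟩
        exact h1 i hi
      · rintro ⟨i, hi, rfl⟩
        exact h2 i hi
    · intro h
      exact ⟨fun i hi => (h _).1 ⟨i, hi, rfl⟩, fun i hi => (h _).2 ⟨i, hi, rfl⟩⟩
  have hnext : (∀ i < l - 1, ∀ j < l - 1,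
      ¬ ((env i = env io ∧ env (l + j) = env (l - 1)) ∧ env (i + 1) = env (l + j + 1))) ↔
      ∀ x, [env io, x] <:+: P → ¬ [env (l - 1), x] <:+: Q := by
    simp only [infix_pair_iff]
    constructor
    · rintro h x ⟨i, hi, e1, e2⟩ ⟨j, hj, e3, e4⟩
      rw [getP] at e1 e2
      rw [getQ] at e3 e4
      exact h i (by omega) j (by omega) ⟨⟨e1, e3⟩, e2.trans e4.symm⟩
    · rintro h i hi j hj ⟨⟨e1, e2⟩, e3⟩
      exact h (env (i + 1)) ⟨i, by omega, by rwa [getP], by rw [getP]⟩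
        ⟨j, by omega, by rwa [getQ], by rw [getQ, e3]; rfl⟩
  have head : ∀ L : List V, L.length = l → ∀ h : 0 < L.length, L.head? = some L[0] := fun L _ h => by
    rw [List.head?_eq_getElem?, List.getElem?_eq_getElem h]
  have last : ∀ L : List V, L.length = l → ∀ h : l - 1 < L.length, L.getLast? = some L[l - 1] := fun L hL h => by
    rw [List.getLast?_eq_getElem?, List.getElem?_eq_getElem (by omega)]
    simp only [hL]
  have hsat : (twoPathGuard l ii io).Sat D.Adj r (2 * l) env ↔
      ((P.IsChain D.Adj ∧ P.Nodup ∧ NoSkip D.Adj P) ∧ (Q.IsChain D.Adj ∧ Q.Nodup ∧ NoSkip D.Adj Q)) ∧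
      (env l = env ii ∧ env (l + (l - 1)) = env io) ∧ (∀ i < l, ¬ env i = r) ∧
      (∀ i < l, ((∃ a, a ∉ P ∧ D.Adj a (env i)) ↔ (env i = env 0 ∨ env i = env ii))) ∧
      (∀ i < l, ((∃ a, a ∉ P ∧ D.Adj (env i) a) ↔ (env i = env (l - 1) ∨ env i = env io))) ∧
      ((∀ i < l, ∃ j < l, env (l + j) = env i) ∧ ∀ i < l, ∃ j < l, env j = env (l + i)) ∧
      ∀ i < l - 1, ∀ j < l - 1,
        ¬ ((env i = env io ∧ env (l + j) = env (l - 1)) ∧ env (i + 1) = env (l + j + 1)) := by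
    have hP' : ∀ x, (List.range l).map (Function.update env (2 * l) x) = P := fun x =>
      List.map_congr_left fun i hi => Function.update_of_ne (by have := List.mem_range.1 hi; omega) _ _
    simp only [twoPathGuard, Sat, sat_path, sat_all, sat_any, sat_iff, sat_or, sat_off, List.mem_range, hP',
      Function.update_self]
    refine and_congr Iff.rfl (and_congr Iff.rfl (and_congr Iff.rfl (and_congr ?_ (and_congr ?_ Iff.rfl)))) <;>
    · refine forall₂_congr fun i hi => iff_congr (exists_congr fun x => ?_) Iff.rfl
      rw [Function.update_of_ne (by omega)]
  rw [hsat, hin, hout, hmem, hnext]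
  constructor
  · rintro ⟨⟨⟨a1, a2, a3⟩, b1, b2, b3⟩, ⟨c1, c2⟩, c3, c4, c5, c6, c7⟩
    refine ⟨⟨a1, a2, ?_, ?_⟩, by rwa [lenP], hpin, hpout, ?_, c4, c5, a3, ⟨b1, b2, ?_, ?_⟩, c6, b3, c7⟩
    · rw [head P lenP (by omega), getP]
    · rw [last P lenP (by omega), getP]
    · rw [memP]
      rintro ⟨i, hi, e⟩
      exact c3 i hi e
    · rw [head Q lenQ (by omega), getQ, ← c1]
      rfl
    · rw [last Q lenQ (by omega), getQ, c2]
  · rintro ⟨⟨a1, a2, -, -⟩, -, -, -, a4, a5, a6, a7, ⟨b1, b2, b3, b4⟩, b5, b6, b7⟩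
    rw [head Q lenQ (by omega), getQ, Option.some_inj] at b3
    rw [last Q lenQ (by omega), getQ, Option.some_inj] at b4
    exact ⟨⟨⟨a1, a2, a7⟩, b1, b2, b6⟩, ⟨b3, b4⟩, fun i hi e => a4 ((memP r).2 ⟨i, hi, e⟩), a5, a6, b5, b7⟩

theorem TwoPath.exists_guard {P Q : List V} {p₁ pin pout pl : V} (h : TwoPath D r P Q p₁ pin pout pl) :
    ∃ l ii io, IsShape l ii io ∧ ∃ env : ℕ → V, (twoPathGuard l ii io).Sat D.Adj r (2 * l) env := by
  obtain ⟨ii, io, t, s, H⟩ := h.exists_pos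
  have hlen := H.len
  have hlenQ := H.lenQ
  have hii := H.ii_mem
  have hio := H.io_mem
  have hs : IsShape P.length ii io := ⟨hlen, by omega, hio⟩
  refine ⟨P.length, ii, io, hs, fun i => (P ++ Q).getD i r, (twoPathGuard_iff hs).2 ?_⟩
  have getP : ∀ i (hi : i < P.length), (P ++ Q).getD i r = P[i] := fun i hi => by
    rw [List.getD_eq_getElem _ _ (by simp; omega), List.getElem_append_left hi]
  have getQ : ∀ i (hi : i < Q.length), (P ++ Q).getD (P.length + i) r = Q[i] := fun i hi => by
    rw [List.getD_eq_getElem _ _ (by simp; omega), List.getElem_append_right (by omega)]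
    simp
  have eP : (List.range P.length).map (fun i => (P ++ Q).getD i r) = P :=
    List.ext_getElem (by simp) fun i h1 h2 => by rw [List.getElem_map, List.getElem_range, getP i h2]
  have eQ : (List.range P.length).map (fun i => (P ++ Q).getD (P.length + i) r) = Q :=
    List.ext_getElem (by simp [hlenQ]) fun i h1 h2 => by rw [List.getElem_map, List.getElem_range, getQ i h2]
  rw [eP, eQ, getP 0 (by omega), getP ii (by omega), getP io (by omega), getP (P.length - 1) (by omega), H.p₁_P,
    H.pin_P, H.pout_P, H.pl_P]
  exact h

end TwoPathRule

theorem twoPathRule_sound {I : Instance} {l ii io : ℕ} (hs : IsShape l ii io) :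
    (twoPathRule l ii io).Sound I (RuleStep I) := by
  classical
  intro env h
  have hT := (twoPathGuard_iff hs).1 h
  obtain ⟨hl, hii, hio⟩ := hs
  set P := (List.range l).map env with hP
  have inj : ∀ {i j}, i < l → j < l → env i = env j → i = j := by
    intro i j hi hj e
    have := hT.path.2.1
    rw [hP, List.nodup_map_iff_inj_on List.nodup_range] at this
    exact this i (List.mem_range.2 hi) j (List.mem_range.2 hj) e
  have mem : ∀ {i}, i < l → env i ∈ P := fun hi => List.mem_map.2 ⟨_, List.mem_range.2 hi, rfl⟩
  set kept := Digraph.Kept P (env 0) (env ii) (env io) (env (l - 1)) with hkept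
  -- The ends occupy positions at most `1` or at least `l - 2 ≥ 5`. Position `4` is thus removed
  -- without replacement, which makes the result smaller.
  have notKept : ∀ {i}, 2 ≤ i → i ≤ 4 → ¬ kept (env i) := by
    intro i h2 h4 hk
    rcases hk (mem (by omega)) with e | e | e | e <;> have := inj (by omega) (by omega) e <;> omega
  have hP' : ∀ x, (List.range l).map (Function.update env (2 * l) x) = P := fun x =>
    List.map_congr_left fun i hi => Function.update_of_ne (by have := List.mem_range.1 hi; omega) _ _
  have upd : ∀ {i} (x : Fin I.n), i < l → Function.update env (2 * l) x i = env i := fun x hi =>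
    Function.update_of_ne (by omega) _ _
  have upd' : ∀ {i} (x y : Fin I.n), i < l →
      Function.update (Function.update env (2 * l) x) (2 * l + 1) y i = env i := fun x y hi => by
    rw [Function.update_of_ne (by omega), upd x hi]
  have updx : ∀ (x y : Fin I.n), Function.update (Function.update env (2 * l) x) (2 * l + 1) y (2 * l) = x :=
    fun x y => by rw [Function.update_of_ne (by omega), Function.update_self]
  have hset : ∀ x, (twoPathRule l ii io).keep.set I (2 * l) env x ↔ kept x ∨ x = env 2 ∨ x = env 3 := by
    intro x
    simp only [twoPathRule, Fm.set, sat_or, sat_off, Sat, hP', Function.update_self]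
    rw [upd x (by omega), upd x (by omega), upd x (by omega), upd x (by omega), upd x (by omega), upd x (by omega)]
    refine or_congr ?_ Iff.rfl
    rw [hkept, Digraph.Kept, imp_iff_not_or]
  have hrel : ∀ x y, (twoPathRule l ii io).arcs.rel I (2 * l) env x y ↔
      (I.D.Adj x y ∧ (x ≠ env 2 ∧ x ≠ env 3) ∧ y ≠ env 2 ∧ y ≠ env 3) ∨
      ((x = env io ∧ y = env 2) ∨ (x = env (l - 1) ∧ y = env 3)) ∨
      ((x = env 2 ∧ y = env 0) ∨ (x = env 3 ∧ y = env ii)) ∨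
      ((x = env 2 ∧ y = env 3) ∨ (x = env 3 ∧ y = env 2)) := by
    intro x y
    simp only [twoPathRule, Fm.rel, sat_or, Sat, Function.update_self, updx]
    rw [upd' x y (by omega), upd' x y (by omega), upd' x y (by omega), upd' x y (by omega), upd' x y (by omega),
      upd' x y (by omega)]
  have ne : ∀ {i j}, i < l → j < l → i ≠ j → env i ≠ env j := fun hi hj hij e => hij (inj hi hj e)
  have hroot : kept I.root := fun hr => absurd hr hT.root_notMem
  refine ⟨(hset _).2 (.inl hroot), fun x hx => ?_, fun J hJ => ⟨.inr (.inr (.inr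
    ⟨P, _, _, _, _, _, twoDirectionalPath_iff.2 hT, ?_⟩)),
    smaller_of_notMem hJ (x := env 4) fun hx => ?_⟩⟩
  · rcases (hrel x x).1 hx with h1 | (⟨h1, h2⟩ | ⟨h1, h2⟩) | (⟨h1, h2⟩ | ⟨h1, h2⟩) | ⟨h1, h2⟩ | ⟨h1, h2⟩
    · exact I.loopless _ h1.1
    all_goals exact ne (by omega) (by omega) (by omega) (h1.symm.trans h2)
  · let f : {x // kept x} ⊕ Bool → {x // (twoPathRule l ii io).keep.set I (2 * l) env x} := fun
      | .inl a => ⟨a.1, (hset _).2 (.inl a.2)⟩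
      | .inr false => ⟨env 2, (hset _).2 (.inr (.inl rfl))⟩
      | .inr true => ⟨env 3, (hset _).2 (.inr (.inr rfl))⟩
    have k2 : ∀ a : {x // kept x}, a.1 ≠ env 2 := fun a e => notKept (i := 2) le_rfl (by omega) (e ▸ a.2)
    have k3 : ∀ a : {x // kept x}, a.1 ≠ env 3 := fun a e => notKept (i := 3) (by omega) (by omega) (e ▸ a.2)
    have n23 : env 2 ≠ env 3 := ne (by omega) (by omega) (by omega)
    have n2 : env 2 ≠ env 0 ∧ env 2 ≠ env ii ∧ env 2 ≠ env io ∧ env 2 ≠ env (l - 1) :=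
      ⟨ne (by omega) (by omega) (by omega), ne (by omega) (by omega) (by omega), ne (by omega) (by omega) (by omega),
        ne (by omega) (by omega) (by omega)⟩
    have n3 : env 3 ≠ env 0 ∧ env 3 ≠ env ii ∧ env 3 ≠ env io ∧ env 3 ≠ env (l - 1) :=
      ⟨ne (by omega) (by omega) (by omega), ne (by omega) (by omega) (by omega), ne (by omega) (by omega) (by omega),
        ne (by omega) (by omega) (by omega)⟩
    have hf : Function.Bijective f := by
      constructor
      · rintro (a | _ | _) (b | _ | _) e <;> have e' := congrArg Subtype.val e <;> dsimp only [f] at e'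
        · exact congrArg _ (Subtype.ext e')
        · exact absurd e' (k2 a)
        · exact absurd e' (k3 a)
        · exact absurd e'.symm (k2 b)
        · rfl
        · exact absurd e' n23
        · exact absurd e'.symm (k3 b)
        · exact absurd e'.symm n23
        · rfl
      · rintro ⟨x, hx⟩
        rcases (hset x).1 hx with hk | rfl | rfl
        · exact ⟨.inl ⟨x, hk⟩, rfl⟩
        · exact ⟨.inr false, rfl⟩
        · exact ⟨.inr true, rfl⟩
    refine hJ.of_equiv_symm (Equiv.ofBijective f hf) (fun a b => .trans ?_ (hrel (f a).1 (f b).1).symm) rfl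
    rcases a with a | _ | _ <;> rcases b with b | _ | _ <;> dsimp only [f, Digraph.replacePath]
    · simp [k2 a, k3 a, k2 b, k3 b]
    · simp [k2 a, k3 a, n23]
    · simp [k2 a, k3 a, n23.symm]
    · simp [k2 b, k3 b, n23, n2]
    · simp [n2, n23]
    · simp [n23, n23.symm]
    · simp [k2 b, k3 b, n23.symm, n3]
    · simp [n23, n23.symm]
    · simp [n3, n23.symm]
  · rcases (hset _).1 hx with hk | e | e
    · exact notKept (by omega) le_rfl hk
    · exact ne (by omega) (by omega) (by omega) e
    · exact ne (by omega) (by omega) (by omega) e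

end LeafKernel

namespace LeafKernel

open Relation

/-! ### The list of rules -/

section RuleList

open Fm

def rules : List Rule :=
  [uselessRule, bridgeRule, avoidableRule] ++
    [7, 8].flatMap fun l => [l - 1, l - 2].flatMap fun ii => [0, 1].map (twoPathRule l ii)

theorem mem_rules {R : Rule} : R ∈ rules ↔ R = uselessRule ∨ R = bridgeRule ∨ R = avoidableRule ∨
    ∃ l ii io, IsShape l ii io ∧ R = twoPathRule l ii io := by
  simp only [rules, List.mem_append, List.mem_cons, List.not_mem_nil, or_false, List.mem_flatMap, List.mem_map,
    or_assoc]
  refine or_congr Iff.rfl (or_congr Iff.rfl (or_congr Iff.rfl ?_))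
  constructor
  · rintro ⟨l, hl, ii, hii, io, hio, rfl⟩
    exact ⟨l, ii, io, ⟨hl, hii, hio⟩, rfl⟩
  · rintro ⟨l, ii, io, ⟨hl, hii, hio⟩, rfl⟩
    exact ⟨l, hl, ii, hii, io, hio, rfl⟩

theorem Fm.ok_path {l d : ℕ} {f : ℕ → ℕ} (hd : 0 < d) (h : ∀ i < l, f i < d) : (path l f).Ok d := by
  simp only [path, Ok, ok_all, List.mem_range]
  exact ⟨⟨hd, fun i hi => ⟨h _ (by omega), h _ (by omega)⟩⟩, ⟨hd, fun i hi => ⟨hd, fun j hj =>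
    ⟨h _ (by omega), h _ hi⟩⟩⟩, hd, fun i hi => ⟨hd, fun j hj => ⟨h _ hi, h _ (by omega)⟩⟩⟩

theorem twoPathRule_ok {l ii io : ℕ} (hs : IsShape l ii io) : (twoPathRule l ii io).Ok := by
  obtain ⟨hl, hii, hio⟩ := hs
  have h1 : ii < 2 * l := by omega
  have h2 : io < 2 * l := by omega
  have h3 : l < 2 * l := by omega
  have h4 : 0 < l := by omega
  refine ⟨?_, ?_, ?_⟩
  · simp only [twoPathRule, twoPathGuard, Ok, ok_all, ok_any, ok_iff, ok_or, off, List.mem_range]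
    refine ⟨⟨ok_path (by omega) (by omega), ok_path (by omega) (by omega)⟩, ⟨by omega, by omega⟩, ?_⟩
    refine ⟨⟨by omega, fun i hi => by omega⟩, ⟨by omega, fun i hi => ?_⟩, ⟨by omega, fun i hi => ?_⟩,
      ⟨⟨by omega, fun i hi => ⟨by omega, fun j hj => by omega⟩⟩, by omega,
        fun i hi => ⟨by omega, fun j hj => by omega⟩⟩, by omega, fun i hi => ⟨by omega, fun j hj => by omega⟩⟩
    · exact ⟨⟨⟨by omega, fun j hj => by omega⟩, by omega⟩, by omega, by omega⟩
    · exact ⟨⟨⟨by omega, fun j hj => by omega⟩, by omega⟩, by omega, by omega⟩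
  · simp only [twoPathRule, Ok, ok_all, ok_or, off, List.mem_range]
    exact ⟨⟨⟨by omega, fun j hj => by omega⟩, by omega⟩, by omega⟩
  · simp only [twoPathRule, Ok, ok_or]
    omega

theorem rules_ok {R : Rule} (h : R ∈ rules) : R.Ok := by
  rcases mem_rules.1 h with rfl | rfl | rfl | ⟨l, ii, io, hs, rfl⟩
  · simp [Rule.Ok, uselessRule, Ok, ok_or]
  · simp [Rule.Ok, bridgeRule, Ok, ok_or]
  · simp [Rule.Ok, avoidableRule, Ok, ok_or]
  · exact twoPathRule_ok hs

theorem unreachableRule_ok : unreachableRule.Ok := by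
  simp [Rule.Ok, unreachableRule, Ok]

variable {I J : Instance}

theorem rules_sound {R : Rule} (h : R ∈ rules) : R.Sound I (RuleStep I) := by
  rcases mem_rules.1 h with rfl | rfl | rfl | ⟨l, ii, io, hs, rfl⟩
  · exact uselessRule_sound
  · exact bridgeRule_sound
  · exact avoidableRule_sound
  · exact twoPathRule_sound hs

theorem exists_rule (hI : AllReachable I) (h : RuleStep I J) :
    ∃ R ∈ rules, ∃ env, R.guard.Sat I.D.Adj I.root R.vars env := by
  classical
  rcases h with ⟨u, v, h1, h2, -⟩ | ⟨u, v, w₁, w₂, hr, h1, h2, h3, h4, -⟩ |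
    ⟨S, v, w, h1, h2, h3, h4, h5, -⟩ | ⟨P, Q, p₁, pin, pout, pl, hP, -⟩
  · exact ⟨_, mem_rules.2 (.inl rfl), fun i => if i = 0 then u else v, uselessRule_guard.2 ⟨h1, h2⟩⟩
  · exact ⟨_, mem_rules.2 (.inr (.inl rfl)), fun i => if i = 0 then u else if i = 1 then v else if i = 2 then w₁ else w₂,
      bridgeRule_guard.2 ⟨⟨h1, hr, h2⟩, h3, h4⟩⟩
  -- The empty set separates no reachable vertex, and a singleton is written with its element
  -- repeated.
  · obtain ⟨x₁, x₂, rfl⟩ : ∃ x₁ x₂, S = {x₁, x₂} := by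
      rcases Nat.le_succ_iff.1 h1 with h0 | h0
      · rcases Nat.le_succ_iff.1 h0 with h0 | h0
        · obtain rfl : S = ∅ := by simpa using h0
          obtain ⟨p, hp⟩ := hI v
          obtain ⟨x, hx, -⟩ := h3 p hp
          simp at hx
        · obtain ⟨x, rfl⟩ := Finset.card_eq_one.1 h0
          exact ⟨x, x, by simp⟩
      · obtain ⟨x₁, x₂, -, e⟩ := Finset.card_eq_two.1 h0
        exact ⟨x₁, x₂, e⟩
    simp only [Finset.mem_insert, Finset.mem_singleton, not_or] at h2
    refine ⟨_, mem_rules.2 (.inr (.inr (.inl rfl))),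
      fun i => if i = 0 then v else if i = 1 then w else if i = 2 then x₁ else x₂,
      avoidableRule_guard.2 ⟨⟨h4, h5 x₁ (by simp), h5 x₂ (by simp)⟩, h2, ?_⟩⟩
    simpa using h3
  · obtain ⟨l, ii, io, hs, env, he⟩ := (twoDirectionalPath_iff.1 hP).exists_guard
    exact ⟨_, mem_rules.2 (.inr (.inr (.inr ⟨l, ii, io, hs, rfl⟩))), env, he⟩

end RuleList

/-! ### The main loop and its termination -/

section Steps

variable {I J : Instance} {M K : ℕ} {s : State} {Q : State → Prop}

/-- The state holds the instance. -/
def Stores (M : ℕ) (I : Instance) (s : State) : Prop := Holds I M 0 (fun _ => I.root) s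

theorem Holds.stores {d : ℕ} {env : ℕ → Fin I.n} (h : Holds I M d env s) : Stores M I s :=
  ⟨h.size, h.scratch, h.marks, h.le, h.num, h.root, h.param, h.adj, fun _ hi => absurd hi (by omega),
    fun _ hi => absurd hi (by omega)⟩

theorem Stores.setReg (h : Stores M I s) {i v : ℕ} (hi : 4 ≤ i) : Stores M I (s.setReg i v) :=
  ⟨(State.reg_setReg_of_ne (by omega)).trans h.size, (State.reg_setReg_of_ne (by omega)).trans h.scratch,
    (State.reg_setReg_of_ne (by omega)).trans h.marks, h.le, h.num, h.root, h.param, h.adj,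
    fun _ hi => absurd hi (by omega), fun _ hi => absurd hi (by omega)⟩

/-- Look for values of the first `m` variables for which the formula is true. -/
def Prog.search (m : ℕ) (φ : Fm) : Prog := (φ.exiN m).comp 0

theorem Runs.search (h : Stores M I s) (hK : M ≤ K) {m : ℕ} {φ : Fm} (hφ : φ.Ok m) :
    Runs K (.search m φ) s fun s' =>
      (s'.reg 12 = 0 ∧ Stores M I s' ∧ ∀ env : ℕ → Fin I.n, ¬ φ.Sat I.D.Adj I.root m env) ∨
      (s'.reg 12 ≠ 0 ∧ ∃ env : ℕ → Fin I.n, Holds I M m env s' ∧ φ.Sat I.D.Adj I.root m env) := by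
  have hφ' : φ.Ok (0 + m) := by rwa [Nat.zero_add]
  refine (Fm.runs_comp hK (φ.exiN m) (Fm.ok_exiN.2 hφ') h).mono fun s' ⟨f, hs'⟩ => ?_
  rcases hs' with ⟨h1, h2⟩ | ⟨h1, h2⟩
  · refine .inl ⟨h1, (h.frame f (le_limit M 0)).stores, fun env he => h2 ?_⟩
    exact Fm.sat_exiN_of (env := env) hφ' (by rwa [Nat.zero_add]) fun i hi => absurd hi (by omega)
  · obtain ⟨env, h3, h4⟩ := Fm.Witness.exiN h2
    rw [Nat.zero_add] at h3 h4
    exact .inr ⟨h1, env, h3, h4⟩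

/-- Apply the rule once if possible, otherwise run the program `d`. -/
def Rule.prog (R : Rule) (d : Prog) : Prog :=
  .seq (.search R.vars R.guard) <|
    .ite (.reg 12) (.seq (.rewrite R.vars R.keep R.arcs (.reg 1)) (.assign 8 (.lit 1))) d

theorem Runs.rule {R : Rule} {d : Prog} (h : Stores M I s) (hK : M ≤ K) (hR : R.Ok) {T : Instance → Prop}
    (hT : R.Sound I T) (hQ : ∀ J s', T J → Smaller J I → Stores M J s' → s'.reg 8 = 1 → Q s')
    (hd : ∀ s', Stores M I s' → (∀ env : ℕ → Fin I.n, ¬ R.guard.Sat I.D.Adj I.root R.vars env) → Runs K d s' Q) :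
    Runs K (R.prog d) s Q := by
  refine .seq ((Runs.search h hK hR.1).mono fun s₁ hs₁ => .ite (fun he => ?_) (fun he => ?_))
  · obtain ⟨env, h1, h2⟩ := (hs₁.resolve_left fun h0 => he h0.1).2
    obtain ⟨hr, hloop, hJ⟩ := hT env h2
    obtain ⟨J, hc, hrun⟩ := Runs.rewrite h1 hK hR.2.1 hR.2.2 hr (fun x _ => hloop x) (e := .reg 1) (σ := M)
      (fun s' g _ => g) h1.le le_rfl
    obtain ⟨hTJ, hsm⟩ := hJ J hc
    refine .seq (hrun.mono fun s₂ ⟨g1, g2, g3, g4, g5⟩ => .assign (hQ J _ hTJ hsm ?_ State.reg_setReg))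
    refine ⟨?_, ?_, ?_, ?_, g2, g3, g4, fun i j => ?_, fun _ hi => absurd hi (by omega),
      fun _ hi => absurd hi (by omega)⟩
    · rw [State.reg_setReg_of_ne (by omega), g1 1 (by omega) (by omega), h1.size]
    · rw [State.reg_setReg_of_ne (by omega), g1 2 (by omega) (by omega), h1.scratch]
    · rw [State.reg_setReg_of_ne (by omega), g1 3 (by omega) (by omega), h1.marks]
    · have := h1.le
      rcases hsm with hsm | ⟨hsm, -⟩ <;> omega
    · rw [State.mem_setReg, Nat.add_assoc]
      rcases g5 i j with ⟨h3, h4⟩ | ⟨h3, h4⟩ <;> simp [h3, h4]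
  · obtain ⟨-, h1, h2⟩ := hs₁.resolve_right fun h0 => h0.1 he
    exact hd s₁ h1 h2

/-- Apply the first of the rules that can be applied. -/
def cascade (L : List Rule) : Prog := L.foldr Rule.prog (.assign 8 (.lit 0))

/-- The state after one round of the main loop: a step has been made, or the loop is to be left. -/
def After (M : ℕ) (I : Instance) (T : Instance → Prop) (F : Prop) (s : State) : Prop :=
  (∃ J, T J ∧ Smaller J I ∧ Stores M J s ∧ s.reg 8 = 1) ∨ (Stores M I s ∧ s.reg 8 = 0 ∧ F)

theorem Runs.cascade (hK : M ≤ K) {T : Instance → Prop} {L : List Rule} (hL : ∀ R ∈ L, R.Ok ∧ R.Sound I T) :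
    ∀ {s}, Stores M I s → Runs K (cascade L) s
      (After M I T (∀ R ∈ L, ∀ env : ℕ → Fin I.n, ¬ R.guard.Sat I.D.Adj I.root R.vars env)) := by
  induction L with
  | nil =>
    intro s h
    exact .assign (.inr ⟨h.setReg (by omega), State.reg_setReg, by simp⟩)
  | cons R L ih =>
    intro s h
    have hR := hL R (by simp)
    refine Runs.rule h hK hR.1 hR.2 (fun J s' h1 h2 h3 h4 => .inl ⟨J, h1, h2, h3, h4⟩) fun s' h1 h2 => ?_
    refine (ih (fun R' h' => hL R' (by simp [h'])) h1).mono fun s'' hs'' => ?_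
    rcases hs'' with hs'' | ⟨h3, h4, h5⟩
    · exact .inl hs''
    · refine .inr ⟨h3, h4, fun R' h' => ?_⟩
      rcases List.mem_cons.1 h' with rfl | h'
      · exact h2
      · exact h5 R' h'

theorem isReduced_of_guards (hI : AllReachable I)
    (h : ∀ R ∈ rules, ∀ env : ℕ → Fin I.n, ¬ R.guard.Sat I.D.Adj I.root R.vars env) : IsReduced I :=
  ⟨hI, fun J hJ => by
    obtain ⟨R, hR, env, he⟩ := exists_rule hI hJ
    exact h R hR env he⟩

theorem allReachable_of_guard
    (h : ∀ env : ℕ → Fin I.n, ¬ unreachableRule.guard.Sat I.D.Adj I.root unreachableRule.vars env) : AllReachable I :=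
  fun u => by_contra fun hu => h (fun _ => u) (unreachableRule_guard.2 hu)

theorem Runs.cascade_rules (h : Stores M I s) (hK : M ≤ K) (hI : AllReachable I) :
    Runs K (LeafKernel.cascade rules) s (After M I (fun J => AllReachable I ∧ RuleStep I J) (IsReduced I)) := by
  refine (Runs.cascade hK (fun R hR => ⟨rules_ok hR, rules_sound hR⟩) h).mono fun s' hs' => ?_
  rcases hs' with ⟨J, h1, h2⟩ | ⟨h1, h2, h3⟩
  · exact .inl ⟨J, ⟨hI, h1⟩, h2⟩
  · exact .inr ⟨h1, h2, isReduced_of_guards hI h3⟩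

/-- If some vertex is unreachable, `cascade []` merely clears the flag in register `8`, which ends
the main loop. -/
def branchingRound : Prog :=
  .seq (.search 1 unreachableRule.guard) (.ite (.reg 12) (cascade []) (cascade rules))

theorem Runs.branchingRound (h : Stores M I s) (hK : M ≤ K) :
    Runs K branchingRound s (After M I (BranchingStep I) (¬ AllReachable I ∨ IsReduced I)) := by
  refine .seq ((Runs.search h hK unreachableRule_ok.1).mono fun s₁ hs₁ => .ite (fun he => ?_) (fun he => ?_))
  · obtain ⟨env, h1, h2⟩ := (hs₁.resolve_left fun h0 => he h0.1).2
    refine (Runs.cascade (T := BranchingStep I) (L := []) hK (by simp) h1.stores).mono fun s' hs' => ?_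
    rcases hs' with hs' | ⟨h3, h4, -⟩
    · exact .inl hs'
    · exact .inr ⟨h3, h4, .inl fun hI => unreachableRule_guard.1 h2 (hI _)⟩
  · obtain ⟨-, h1, h2⟩ := hs₁.resolve_right fun h0 => h0.1 he
    refine (Runs.cascade_rules h1 hK (allReachable_of_guard h2)).mono fun s' hs' => ?_
    rcases hs' with hs' | ⟨h3, h4, h5⟩
    · exact .inl hs'
    · exact .inr ⟨h3, h4, .inr h5⟩

def treeRound : Prog := unreachableRule.prog (cascade rules)

theorem Runs.treeRound (h : Stores M I s) (hK : M ≤ K) :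
    Runs K treeRound s (After M I (TreeStep I) (IsReduced I)) := by
  refine Runs.rule h hK unreachableRule_ok unreachableRule_sound
    (fun J s' h1 h2 h3 h4 => .inl ⟨J, .inl h1, h2, h3, h4⟩) fun s' h1 h2 => ?_
  refine (Runs.cascade_rules h1 hK (allReachable_of_guard h2)).mono fun s' hs' => ?_
  rcases hs' with ⟨J, h3, h4⟩ | hs'
  · exact .inl ⟨J, .inr h3, h4⟩
  · exact .inr hs'

/-- A number that decreases with every step. -/
noncomputable def potential (M : ℕ) (I : Instance) : ℕ := I.n * (M * M + 1) + arcCount I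

theorem arcCount_le (I : Instance) : arcCount I ≤ I.n * I.n := by
  have := Set.ncard_le_card {p : Fin I.n × Fin I.n | I.D.Adj p.1 p.2}
  rwa [Nat.card_prod, Nat.card_fin] at this

/-- A vertex weighs `M * M + 1`, more than all possible arcs together. -/
theorem Smaller.potential_lt (h : Smaller J I) (hM : I.n ≤ M) : potential M J < potential M I := by
  rcases h with h | ⟨h1, h2⟩
  · have h1 := arcCount_le J
    have h2 := Nat.mul_le_mul (show J.n ≤ M by omega) (show J.n ≤ M by omega)
    have h3 := Nat.mul_le_mul_right (M * M + 1) (show J.n + 1 ≤ I.n from h)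
    rw [Nat.succ_mul] at h3
    simp only [potential]
    omega
  · simp only [potential, h1]
    omega

theorem potential_lt (hM : I.n ≤ M) : potential M I < (M + 1) ^ 3 := by
  have h1 := arcCount_le I
  have h2 := Nat.mul_le_mul hM hM
  have h3 := Nat.mul_le_mul_right (M * M + 1) hM
  have h4 : (M + 1) ^ 3 = M * (M * M + 1) + M * M + 1 + 2 * (M * M) + 2 * M := by ring
  simp only [potential]
  omega

/-- Make steps until the loop is left. -/
def Prog.main (c : Prog) : Prog := .seq (.assign 8 (.lit 1)) (.loop (.reg 8) c)

/-- The potential bounds the number of steps. The variant exceeds it by one to account for the last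
round, which makes no step but clears the flag. -/
theorem Runs.main {c : Prog} {T : Instance → Instance → Prop} {F : Instance → Prop} (hK : (M + 1) ^ 3 ≤ K)
    (hc : ∀ I s, Stores M I s → Runs K c s (After M I (T I) (F I))) (h : Stores M I s) :
    Runs K (.main c) s fun s' => ∃ J, ReflTransGen T I J ∧ Stores M J s' ∧ F J := by
  refine .seq (.assign (.loop (m := potential M I + 1) (Inv := fun m s' => ∃ J, ReflTransGen T I J ∧ Stores M J s' ∧
    ((s'.reg 8 = 1 ∧ m = potential M J + 1) ∨ (s'.reg 8 = 0 ∧ m = 0 ∧ F J))) ?_ ?_ ?_ ?_))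
  · rintro m s₁ ⟨J, h1, h2, h3⟩ he
    obtain ⟨-, rfl⟩ := h3.resolve_right fun h0 => he h0.1
    refine (hc J s₁ h2).mono fun s₂ hs₂ => ?_
    rcases hs₂ with ⟨J', h4, h5, h6, h7⟩ | ⟨h4, h5, h6⟩
    · have := h5.potential_lt h2.le
      exact ⟨_, by omega, J', h1.tail h4, h6, .inl ⟨h7, rfl⟩⟩
    · exact ⟨0, by omega, J, h1, h4, .inr ⟨h5, rfl, h6⟩⟩
  · have := potential_lt h.le
    omega
  · exact ⟨I, .refl, h.setReg (by omega), .inl ⟨State.reg_setReg, rfl⟩⟩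
  · rintro m s₁ ⟨J, h1, h2, h3⟩ he
    refine ⟨J, h1, h2, (h3.resolve_left fun h0 => ?_).2.2⟩
    exact absurd (h0.1.symm.trans he) (by omega)

end Steps

end LeafKernel

namespace LeafKernel

open Relation

/-! ### The encoding of instances -/

section Encoding

theorem length_flatMap_const {α : Type} {f : α → List ℕ} {n : ℕ} (h : ∀ x, (f x).length = n) (l : List α) :
    (l.flatMap f).length = l.length * n := by
  induction l with
  | nil => simp
  | cons a l ih => rw [List.flatMap_cons, List.length_append, h, ih, List.length_cons, Nat.succ_mul, Nat.add_comm]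

theorem getD_flatMap_const {α : Type} {f : α → List ℕ} {n j : ℕ} (h : ∀ x, (f x).length = n) (hj : j < n) :
    ∀ (l : List α) (i : ℕ) (hi : i < l.length), (l.flatMap f).getD (i * n + j) 0 = (f l[i]).getD j 0
  | a :: l, 0, _ => by
    rw [List.flatMap_cons, Nat.zero_mul, Nat.zero_add, List.getD_append _ _ _ _ (by rwa [h])]
    rfl
  | a :: l, i + 1, hi => by
    rw [List.flatMap_cons, List.getD_append_right _ _ _ _ (by rw [h, Nat.succ_mul]; omega), h,
      show (i + 1) * n + j - n = i * n + j by rw [Nat.succ_mul]; omega,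
      getD_flatMap_const h hj l i (Nat.lt_of_succ_lt_succ hi)]
    rfl

variable {I : Instance}

theorem Instance.length_encode : I.encode.length = 3 + I.n * I.n := by
  rw [Instance.encode, List.length_append, length_flatMap_const (n := I.n) (by simp), List.length_finRange]
  rfl

theorem Instance.getD_encode (x y : Fin I.n) : IsBit (I.encode.getD (3 + (x * I.n + y)) 0) (I.D.Adj x y) := by
  classical
  have h1 : I.encode.getD (3 + (x * I.n + y)) 0 = if I.D.Adj x y then 1 else 0 := by
    rw [Instance.encode, List.getD_append_right _ _ _ _ (by simp)]
    simp only [List.length_cons, List.length_nil, Nat.zero_add, Nat.reduceAdd, Nat.add_sub_cancel_left]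
    rw [getD_flatMap_const (n := I.n) (by simp) y.2 _ _ (by simp), List.getD_eq_getElem _ _ (by simp)]
    simp
  rw [h1]
  by_cases h : I.D.Adj x y
  · exact .inl ⟨if_pos h, h⟩
  · exact .inr ⟨if_neg h, h⟩

theorem IsBit.unique {v w : ℕ} {p : Prop} (h : IsBit v p) (h' : IsBit w p) : v = w := by
  rcases h with ⟨rfl, h⟩ | ⟨rfl, h⟩ <;> rcases h' with ⟨rfl, h'⟩ | ⟨rfl, h'⟩
  · rfl
  · exact absurd h h'
  · exact absurd h' h
  · rfl

theorem State.outputs_encode {s : State} (h0 : s.reg 0 = 3 + I.n * I.n) (h1 : s.mem 0 = I.n) (h2 : s.mem 1 = I.root)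
    (h3 : s.mem 2 = I.k) (h4 : ∀ x y : Fin I.n, IsBit (s.mem (3 + (x * I.n + y))) (I.D.Adj x y)) :
    s.Outputs I.encode := by
  refine ⟨h0.trans I.length_encode.symm, fun i hi => ?_⟩
  rw [Instance.length_encode] at hi
  match i, hi with
  | 0, _ => exact h1
  | 1, _ => exact h2
  | 2, _ => exact h3
  | i + 3, hi =>
    have hn : 0 < I.n := I.root.pos
    have hx : i / I.n < I.n := Nat.div_lt_of_lt_mul (by omega)
    have hy : i % I.n < I.n := Nat.mod_lt _ hn
    have e : i + 3 = 3 + (i / I.n * I.n + i % I.n) := by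
      rw [Nat.div_add_mod']
      omega
    rw [e]
    exact (h4 ⟨_, hx⟩ ⟨_, hy⟩).unique (Instance.getD_encode ⟨_, hx⟩ ⟨_, hy⟩)

theorem Instance.n_le_bitSize : I.n ≤ bitSize I.encode := by
  have h1 : ∀ l : List ℕ, l.length ≤ bitSize l := by
    intro l
    induction l with
    | nil => simp
    | cons a l ih =>
      simp only [bitSize, List.map_cons, List.sum_cons, List.length_cons] at *
      omega
  have h2 := h1 I.encode
  have h3 := Nat.le_mul_self I.n
  rw [Instance.length_encode] at h2
  omega

end Encoding

/-! ### Input, output and the whole program -/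

section Programs

variable {I : Instance} {M K : ℕ} {s : State}

/-- The input length is `3 + n * n`, so the addresses `3 + n * n` and `3 + 2 * (n * n)` are obtained
from it without multiplication. -/
def Prog.init : Prog :=
  .seq (.assign 1 (.load (.lit 0))) <| .seq (.assign 2 (.reg 0)) <|
    .assign 3 (.minus (.plus (.reg 0) (.reg 0)) (.lit 3))

theorem Runs.init (I : Instance) : Runs K .init (initial I.encode) (Stores I.n I) := by
  have h0 : (initial I.encode).reg 0 = 3 + I.n * I.n := by
    simp [initial, Instance.length_encode]
  refine .seq (.assign (.seq (.assign (.assign ⟨?_, ?_, ?_, le_rfl, rfl, rfl, rfl, fun x y => ?_,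
    fun _ hi => absurd hi (by omega), fun _ hi => absurd hi (by omega)⟩))))
  · rw [State.reg_setReg_of_ne (by omega), State.reg_setReg_of_ne (by omega), State.reg_setReg]
    rfl
  · rw [State.reg_setReg_of_ne (by omega), State.reg_setReg]
    exact h0
  · rw [State.reg_setReg]
    simp only [Expr.val]
    rw [State.reg_setReg_of_ne (by omega), State.reg_setReg_of_ne (by omega), h0]
    omega
  · simp only [State.mem_setReg, initial]
    rw [Nat.add_assoc]
    rcases I.getD_encode x y with ⟨h1, h2⟩ | ⟨h1, h2⟩ <;> simp only [h1, h2] <;> simp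

/-- Multiply register `4` by the parameter. -/
def Prog.mulParam : Prog :=
  .seq (.assign 5 (.lit 0)) <| .seq (.assign 6 (.load (.lit 2))) <|
    .seq (.loop (.reg 6) (.seq (.assign 5 (.plus (.reg 5) (.reg 4))) (.assign 6 (.minus (.reg 6) (.lit 1))))) <|
      .assign 4 (.reg 5)

theorem Runs.mulParam (h : Stores M I s) (hK : I.k ≤ K) :
    Runs K .mulParam s fun s' => Stores M I s' ∧ s'.reg 4 = s.reg 4 * I.k := by
  refine .seq (.assign (.seq (.assign (.seq (.loop (m := I.k) (Inv := fun m s' => Stores M I s' ∧ s'.reg 6 = m ∧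
    s'.reg 4 = s.reg 4 ∧ s'.reg 5 + s.reg 4 * m = s.reg 4 * I.k) ?_ hK ?_ ?_)))))
  · rintro m s₁ ⟨h1, h2, h3, h4⟩ he
    simp only [Expr.val, h2] at he
    obtain ⟨m, rfl⟩ := Nat.exists_eq_succ_of_ne_zero he
    refine .seq (.assign (.assign ⟨m, by omega, (h1.setReg (by omega)).setReg (by omega), ?_, ?_, ?_⟩))
    · rw [State.reg_setReg]
      simp only [Expr.val]
      rw [State.reg_setReg_of_ne (by omega), h2]
      rfl
    · rw [State.reg_setReg_of_ne (by omega), State.reg_setReg_of_ne (by omega), h3]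
    · rw [State.reg_setReg_of_ne (by omega), State.reg_setReg]
      simp only [Expr.val, h3]
      rw [Nat.mul_succ] at h4
      omega
  · refine ⟨(h.setReg (by omega)).setReg (by omega), ?_, ?_, ?_⟩
    · rw [State.reg_setReg]
      exact h.param
    · rw [State.reg_setReg_of_ne (by omega), State.reg_setReg_of_ne (by omega)]
    · rw [State.reg_setReg_of_ne (by omega), State.reg_setReg]
      simp [Expr.val]
  · rintro m s₁ ⟨h1, h2, h3, h4⟩ he
    simp only [Expr.val, h2] at he
    subst he
    refine .assign ⟨h1.setReg (by omega), ?_⟩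
    rw [State.reg_setReg]
    simpa [Expr.val] using h4

/-- Decide whether the number of vertices is too large. -/
def Prog.compare : Prog :=
  .ite (.minus (.load (.lit 0)) (.load (.lit 2)))
    (.seq (.assign 4 (.lit 1540)) <| .seq .mulParam <| .seq .mulParam <| .seq .mulParam <|
      .assign 12 (.minus (.load (.lit 0)) (.reg 4)))
    (.assign 12 (.lit 0))

/-- The parameter may be exponential in the input length, so it is cubed by repeated addition only
if it is less than `n`. Otherwise `n ≤ k ≤ 1540 * k ^ 3` anyway. -/
theorem Runs.compare (h : Stores M I s) (hK : M ≤ K) :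
    Runs K .compare s fun s' => Stores M I s' ∧ (s'.reg 12 ≠ 0 ↔ 1540 * I.k ^ 3 < I.n) := by
  have hM := h.le
  refine .ite (fun he => ?_) (fun he => ?_) <;> simp only [Expr.val, h.num, h.param] at he
  · have hk : I.k ≤ K := by omega
    refine .seq (.assign (.seq ((Runs.mulParam (h.setReg (by omega)) hk).mono fun s₁ ⟨h1, e1⟩ => .seq
      ((Runs.mulParam h1 hk).mono fun s₂ ⟨h2, e2⟩ => .seq ((Runs.mulParam h2 hk).mono fun s₃ ⟨h3, e3⟩ =>
        .assign ⟨h3.setReg (by omega), ?_⟩)))))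
    rw [State.reg_setReg] at e1 ⊢
    simp only [Expr.val, h3.num] at e1 ⊢
    have : s₃.reg 4 = 1540 * I.k ^ 3 := by
      rw [e3, e2, e1]
      ring
    omega
  · refine .assign ⟨h.setReg (by omega), ?_⟩
    rw [State.reg_setReg]
    have h1 : I.k ≤ 1540 * I.k ^ 3 := (Nat.le_self_pow (by omega) _).trans (Nat.le_mul_of_pos_left _ (by omega))
    simp only [Expr.val, ne_eq, not_true, false_iff]
    omega

def Prog.outYes : Prog :=
  .seq (.store (.lit 0) (.lit 1)) <| .seq (.store (.lit 1) (.lit 0)) <| .seq (.store (.lit 2) (.lit 0)) <|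
    .seq (.store (.lit 3) (.lit 0)) <| .assign 0 (.lit 4)

theorem Runs.outYes : Runs K .outYes s fun s' => s'.Outputs yesInstance.encode := by
  refine .seq (.store (.seq (.store (.seq (.store (.seq (.store (.assign ?_))))))))
  refine State.outputs_encode (I := yesInstance) rfl rfl rfl rfl fun x y => ?_
  obtain rfl : x = (0 : Fin 1) := Subsingleton.elim (α := Fin 1) _ _
  obtain rfl : y = (0 : Fin 1) := Subsingleton.elim (α := Fin 1) _ _
  exact .inr ⟨rfl, id⟩

def Prog.outNo : Prog :=
  .seq (.store (.lit 0) (.lit 2)) <| .seq (.store (.lit 1) (.lit 0)) <| .seq (.store (.lit 2) (.lit 0)) <|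
    .seq (.store (.lit 3) (.lit 0)) <| .seq (.store (.lit 4) (.lit 0)) <| .seq (.store (.lit 5) (.lit 0)) <|
      .seq (.store (.lit 6) (.lit 0)) <| .assign 0 (.lit 7)

theorem Runs.outNo : Runs K .outNo s fun s' => s'.Outputs noInstance.encode := by
  refine .seq (.store (.seq (.store (.seq (.store (.seq (.store (.seq (.store (.seq (.store (.seq (.store
    (.assign ?_))))))))))))))
  refine State.outputs_encode (I := noInstance) rfl rfl rfl rfl fun x y => .inr ⟨?_, id⟩
  change Fin 2 at x y
  fin_cases x <;> fin_cases y <;> rfl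

/-- Write the matrix with rows of the right length. -/
def Prog.outKernel : Prog :=
  .seq (.rewrite 0 (.eq 0 0) (.adj 0 1) (.load (.lit 0))) <| .seq (.assign 0 (.lit 3)) <|
    .seq (.assign 4 (.load (.lit 0))) <|
      .loop (.reg 4) (.seq (.assign 0 (.plus (.reg 0) (.load (.lit 0)))) (.assign 4 (.minus (.reg 4) (.lit 1))))

theorem count_lt_self {n x : ℕ} (h : x ≤ n) : Nat.count (· < n) x = x := by
  rw [Nat.count_iff_forall]
  exact fun y hy => by omega

/-- Up to here rows had the original length `M`. The same rewriting, with the identity formulas and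
row length `n`, packs the matrix, and the output length `3 + n * n` is summed up in a loop. -/
theorem Runs.outKernel (h : Stores M I s) (hK : M ≤ K) : Runs K .outKernel s fun s' => s'.Outputs I.encode := by
  have hset : ∀ x, (Fm.eq 0 0).set I 0 (fun _ => I.root) x := fun x => rfl
  refine .seq (.seq ((Runs.fill h hK (ψ := .adj 0 1) (by simp [Fm.Ok])).mono fun s₁ ⟨f₁, h1⟩ => .seq ?_))
  have H₁ := h.frame f₁ le_rfl
  refine (Runs.markSet H₁ hK (δ := .eq 0 0) (by simp [Fm.Ok])).mono fun s₂ ⟨f₂, h2⟩ => ?_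
  have H₂ := H₁.frame f₂ (le_limit M 0)
  refine (Runs.compact (p := (· < I.n)) (σ := I.n) (e := .load (.lit 0)) H₂ hK
    (fun x hx => (h2 ⟨x, hx⟩).trans (iff_of_true (hset _) hx)) (fun x hx => hx) I.root.2
    (fun s' _ g2 => g2.trans H₂.num) (Nat.count_le _) h.le).mono fun s₃ ⟨g1, g2, g3, g4, g5⟩ => ?_
  rw [count_lt_self le_rfl] at g2
  rw [count_lt_self I.root.2.le] at g3
  have g6 : ∀ x y : Fin I.n, IsBit (s₃.mem (3 + (x * I.n + y))) (I.D.Adj x y) := by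
    intro x y
    have h5 := g5 x y x.2 y.2
    rw [count_lt_self x.2.le, count_lt_self y.2.le] at h5
    rw [h5, f₂.mem]
    · simpa [Fm.rel, Fm.Sat] using h1 x y
    · have := index_lt h.le x.2 y.2
      simp only [limit]
      omega
  refine .seq (.assign (.seq (.assign (.loop (m := I.n) (Inv := fun m s' => s'.mem = s₃.mem ∧ s'.reg 4 = m ∧
    s'.reg 0 + I.n * m = 3 + I.n * I.n) ?_ (h.le.trans hK) ⟨rfl, ?_, ?_⟩ ?_))))
  · rintro m s₄ ⟨k1, k2, k3⟩ he
    simp only [Expr.val, k2] at he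
    obtain ⟨m, rfl⟩ := Nat.exists_eq_succ_of_ne_zero he
    refine .seq (.assign (.assign ⟨m, by omega, k1, ?_, ?_⟩))
    · rw [State.reg_setReg]
      simp only [Expr.val]
      rw [State.reg_setReg_of_ne (by omega), k2]
      rfl
    · rw [State.reg_setReg_of_ne (by omega), State.reg_setReg]
      simp only [Expr.val]
      rw [k1, g2]
      rw [Nat.mul_succ] at k3
      omega
  · rw [State.reg_setReg]
    exact g2
  · rw [State.reg_setReg_of_ne (by omega), State.reg_setReg]
    rfl
  · rintro m s₄ ⟨k1, k2, k3⟩ he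
    simp only [Expr.val, k2] at he
    subst he
    refine State.outputs_encode (by simpa using k3) ?_ ?_ ?_ fun x y => ?_ <;> rw [k1]
    · exact g2
    · exact g3
    · exact g4
    · exact g6 x y

def Prog.output : Prog :=
  .seq (.search 1 unreachableRule.guard) <|
    .ite (.reg 12) .outNo <| .seq .compare <| .ite (.reg 12) .outYes .outKernel

theorem Runs.output (h : Stores M I s) (hK : M ≤ K) : Runs K .output s fun s' =>
    (¬ AllReachable I ∧ s'.Outputs noInstance.encode) ∨
      (AllReachable I ∧ ((1540 * I.k ^ 3 < I.n ∧ s'.Outputs yesInstance.encode) ∨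
        (I.n ≤ 1540 * I.k ^ 3 ∧ s'.Outputs I.encode))) := by
  refine .seq ((Runs.search h hK unreachableRule_ok.1).mono fun s₁ hs₁ => .ite (fun he => ?_) (fun he => ?_))
  · obtain ⟨env, -, h2⟩ := (hs₁.resolve_left fun h0 => he h0.1).2
    exact Runs.outNo.mono fun s' hs' => .inl ⟨fun hI => unreachableRule_guard.1 h2 (hI _), hs'⟩
  · obtain ⟨-, h1, h2⟩ := hs₁.resolve_right fun h0 => h0.1 he
    have hI := allReachable_of_guard h2
    refine .seq ((Runs.compare h1 hK).mono fun s₂ ⟨h3, h4⟩ => .ite (fun he' => ?_) (fun he' => ?_))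
    · exact Runs.outYes.mono fun s' hs' => .inr ⟨hI, .inl ⟨h4.1 he', hs'⟩⟩
    · exact (Runs.outKernel h3 hK).mono fun s' hs' =>
        .inr ⟨hI, .inr ⟨not_lt.1 fun hlt => h4.2 hlt he', hs'⟩⟩

/-- The whole program, for a given program for one round of the main loop. -/
def Prog.kernelize (c : Prog) : Prog := .seq .init (.seq (.main c) .output)

theorem Prog.cost_mono (c : Prog) {K K' : ℕ} (h : K ≤ K') : c.cost K ≤ c.cost K' := by
  induction c with
  | assign | store => exact le_rfl
  | seq c d hc hd => exact add_le_add hc hd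
  | ite e c d hc hd => exact Nat.succ_le_succ (add_le_add hc hd)
  | loop e c hc => exact Nat.succ_le_succ (Nat.mul_le_mul h (Nat.succ_le_succ hc))

/-- All loops make at most `(n + 1) ^ 3` rounds in a row, and `n` is at most the bit size of the
input, so the cost polynomial composed with a cube bounds the time. -/
theorem exists_kernelization {L : Instance → Prop} {R T : Instance → Instance → Prop} {F : Instance → Prop}
    (hR : ∀ I J, R I J → (L I ↔ L J) ∧ J.n ≤ max 2 (1540 * I.k ^ 3) ∧ J.k ≤ I.k) {c : Prog}
    (hc : ∀ I M K s, Stores M I s → M ≤ K → Runs K c s (After M I (T I) (F I)))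
    (hno : ∀ I J, ReflTransGen T I J → F J → ¬ AllReachable J → R I noInstance)
    (hyes : ∀ I J, ReflTransGen T I J → F J → AllReachable J → 1540 * J.k ^ 3 < J.n → R I yesInstance)
    (hsmall : ∀ I J, ReflTransGen T I J → F J → AllReachable J → J.n ≤ 1540 * J.k ^ 3 → R I J) :
    ∃ f : Instance → Instance, IsKernelization L (fun k => max 2 (1540 * k ^ 3)) f ∧ ∀ I, R I (f I) := by
  obtain ⟨p, hp⟩ := (Prog.kernelize c).exists_polynomial_cost
  refine exists_isKernelization hR (.kernelize c) (p.comp ((.X + 1) ^ 3)) fun I => ?_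
  have hK : I.n ≤ (I.n + 1) ^ 3 := (Nat.le_succ _).trans (Nat.le_self_pow (by omega) _)
  have hrun : Runs ((I.n + 1) ^ 3) (.kernelize c) (initial I.encode) fun s' => ∃ J, s'.Outputs J.encode ∧ R I J := by
    refine .seq ((Runs.init I).mono fun s₁ h1 => .seq ((Runs.main le_rfl (fun J s hJ => hc J _ _ s hJ hK) h1).mono ?_))
    rintro s₂ ⟨J, h2, h3, h4⟩
    refine (Runs.output h3 hK).mono fun s' hs' => ?_
    rcases hs' with ⟨h5, h6⟩ | ⟨h5, ⟨h6, h7⟩ | ⟨h6, h7⟩⟩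
    · exact ⟨_, h6, hno I J h2 h4 h5⟩
    · exact ⟨_, h7, hyes I J h2 h4 h5 h6⟩
    · exact ⟨_, h7, hsmall I J h2 h4 h5 h6⟩
  obtain ⟨s', t, h1, h2, J, h3, h4⟩ := hrun
  refine ⟨J, s', t, h1, h2.trans ?_, h3, h4⟩
  refine ((Prog.kernelize c).cost_mono (Nat.pow_le_pow_left (Nat.succ_le_succ I.n_le_bitSize) 3)).trans ?_
  rw [hp]
  simp

end Programs

end LeafKernel

theorem mainTheorem1 :
    (∃ f : LeafKernel.Instance → LeafKernel.Instance,
      LeafKernel.IsKernelization LeafKernel.RootedLeafOutBranching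
        (fun k => max 2 (1540 * k ^ 3)) f ∧
      ∀ I, LeafKernel.BranchingRun I (f I)) ∧
    (∃ f : LeafKernel.Instance → LeafKernel.Instance,
      LeafKernel.IsKernelization LeafKernel.RootedLeafOutTree
        (fun k => max 2 (1540 * k ^ 3)) f ∧
      ∀ I, LeafKernel.TreeRun I (f I)) := by
  open LeafKernel in
  constructor
  · exact exists_kernelization (T := BranchingStep) (fun _ _ => BranchingRun.sound)
      (fun I M K s h hK => Runs.branchingRound h hK) (fun I J hs _ hJ => .unreachable J hs hJ)
      (fun I J hs hF hJ hn => .large J hs (hF.resolve_left fun h => h hJ) ((BranchingStep.steps_iff hs).1 ▸ hn))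
      (fun I J hs hF hJ hn => .small J hs (hF.resolve_left fun h => h hJ) ((BranchingStep.steps_iff hs).1 ▸ hn))
  · exact exists_kernelization (T := TreeStep) (fun _ _ => TreeRun.sound)
      (fun I M K s h hK => Runs.treeRound h hK) (fun I J _ hF hJ => absurd hF.1 hJ)
      (fun I J hs hF _ hn => .large J hs hF ((TreeStep.steps_iff hs).1 ▸ hn))
      (fun I J hs hF _ hn => .small J hs hF ((TreeStep.steps_iff hs).1 ▸ hn))
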